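/- Conventions. Let $(M,g)$ be a smooth Riemannian 4-manifold with Levi-Civita connection $\nabla_a$, oriented so that symmetric unprimed spinors correspond to anti-self-dual (ASD) 2-forms. Suppose that $(M,g)$ is quaternionic-Kähler: the ASD Weyl spinor vanishes, $\Psi_{ABCD}=0$, and $R_{ab}=\lambda g_{ab}$ with $\lambda\neq 0$. All statements are local (on an open set carrying an oriented orthonormal frame and its spin frame), fields are smooth and complex-valued, round brackets denote symmetrisation, and spinor indices are raised with $\epsilon^{AB},\epsilon^{A'B'}$. **1.** Let $\Pi_{A'ABC}=\Pi_{A'(ABC)}$ be a spinor field satisfying $\nabla^{A'}_{(A}\Pi_{BCD)A'}=0$, and let $\gamma_{CDA'B'}:=\nabla^{A}_{(A'}\Pi_{B')ACD}$. Then $\nabla^{A'}_{(A}\nabla^{B'}_{B}\gamma_{CD)A'B'}=0$. **2.** Let $J^a{}_b={\rm i}(o^A\iota_B+\iota^A o_B)\delta^{A'}_{B'}$, $o_A\iota^A=1$, be an integrable (ASD, compatible) almost-complex structure with principal spinors $o_A,\iota_A$. Set $f_a:=-\tfrac12 J^b{}_c\nabla_bJ^c{}_a$, $\omega_a:=\iota_B\nabla_a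 o^B$, $P_a:=\omega_a-\tfrac{\rm i}{2}J^b{}_af_b$, and on scalars $\psi$ and covectors $v_b$ of weights $(w,p)$ let $$\mathscr C_a\psi=\nabla_a\psi+(wf_a+pP_a)\psi,\qquad \mathscr C_av_b=\nabla_av_b+(wf_a+pP_a)v_b-(f_a\delta^c_b+f_b\delta^c_a-g_{ab}f^c)v_c,$$ $\Box^{\mathscr C}:=g^{ab}\mathscr C_a\mathscr C_b$. For $i\in\{0,\dots,4\}$ let $S_i^{ABCD}$ be the total symmetrisation of the product of $4-i$ factors $o$ and $i$ factors $\iota$, and $W_i^{abcd}:=S_i^{ABCD}\epsilon^{A'B'}\epsilon^{C'D'}$. Let $\Phi$ satisfy $\Box^{\mathscr C}\Phi=0$ with weights $w=1$, $p=2i-4$. Then the (in general complex) symmetric tensor $$h_{ab}:=-\nabla^d\big[(\nabla^c+4f^c)\,W^i_{c(ab)d}\,\Phi\big]$$ has identically vanishing linearised ASD Weyl spinor: $\frac{d}{dt}\big|_{t=0}\tfrac14 C_{AA'BB'CC'DD'}[g+th]\,\epsilon^{A'B'}\epsilon^{C'D'}=0$. Moreover $h_{ab}$ is a quaternionic deformation,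 i.e. the conditions $\Psi_{ABCD}=0$ and $R_{ab}=\lambda g_{ab}$ are preserved to first order along $g+th$; in particular also $\frac{d}{dt}\big|_{t=0}\big(R_{ab}[g+th]-\lambda(g_{ab}+t\,h_{ab})\big)=0$. -/

import Mathlib

open scoped Manifold ContDiff

noncomputable section

/-! Conventions. `M` is a smooth 4-manifold with a Riemannian metric `g`. Tensor and spinor fields
over an open set are given by their (complex) components in an orthonormal frame
`E 0, E 1, E 2, E 3` of that set and in the associated spin frame. The orientation is the one for
which the frame is positive; unprimed symmetric spinors are then anti-self-dual 2-forms. In an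
orthonormal frame the metric is `δ`, so frame indices `a, b, c, …` are all written as lower ones. -/

namespace QK

/-- The model space of a 4-manifold. -/
abbrev R4 : Type := EuclideanSpace ℝ (Fin 4)

/-- Smooth Riemannian metrics on the 4-manifold `M`. -/
abbrev Metric (M : Type*) [TopologicalSpace M] [ChartedSpace R4 M] [IsManifold (𝓡 4) ∞ M] :=
  Bundle.ContMDiffRiemannianMetric (𝓡 4) ∞ R4 (fun x : M => TangentSpace (𝓡 4) x)

/-- Four vector fields on `M`. -/
abbrev Frame (M : Type*) [TopologicalSpace M] [ChartedSpace R4 M] :=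
  Fin 4 → (x : M) → TangentSpace (𝓡 4) x

/-- Components `T_{a₀ a₁ …}` of a complex tensor field with `n` indices. -/
abbrev TensorField (M : Type*) (n : ℕ) := (Fin n → Fin 4) → M → ℂ

/-- Components `φ_{A B … A' B' …}` of a spinor field with `n` unprimed and `m` primed indices, all
of them lower indices: the first argument lists the unprimed ones, the second the primed ones. -/
abbrev SpinorField (M : Type*) (n m : ℕ) := (Fin n → Fin 2) → (Fin m → Fin 2) → M → ℂ

/-! ### Spinor algebra -/

/-- The symbol `ε_{AB} = ε^{AB}` with `ε_{01} = 1`; it serves for primed indices as well.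
Indices are moved by `ψ^A = ε^{AB} ψ_B`, `ψ_B = ψ^A ε_{AB}`. -/
def eps : Fin 2 → Fin 2 → ℂ := !![0, 1; -1, 0]

/-- The Euclidean Infeld-van der Waerden symbols `σ_a^{AA'}`: a vector `V` has the spinor components
`V^{AA'} = σ_a^{AA'} V^a`, with `ε_{AB} ε_{A'B'} V^{AA'} V^{BB'} = δ_{ab} V^a V^b`. -/
def sigma (a : Fin 4) : Fin 2 → Fin 2 → ℂ := fun A X =>
  (1 / (Real.sqrt 2 : ℂ)) *
    (![!![1, 0; 0, 1],
       !![0, Complex.I; Complex.I, 0],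
       !![0, 1; -1, 0],
       !![Complex.I, 0; 0, -Complex.I]] a : Matrix (Fin 2) (Fin 2) ℂ) A X

/-- `σ^a_{AA'}`, the symbol `σ_a^{AA'}` with its spinor indices lowered: `V_{AA'} = σ^a_{AA'} V_a`
and `V^a = σ^a_{AA'} V^{AA'}`. -/
def sigmaLow (a : Fin 4) (A X : Fin 2) : ℂ :=
  ∑ B, ∑ Y, sigma a B Y * eps B A * eps Y X

/-- Total symmetrisation `F_{(A B …)}`, with weight one. -/
def symm {n : ℕ} (F : (Fin n → Fin 2) → ℂ) (I : Fin n → Fin 2) : ℂ :=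
  (n.factorial : ℂ)⁻¹ * ∑ p : Equiv.Perm (Fin n), F (I ∘ p)

section

variable {M : Type*} [TopologicalSpace M] [ChartedSpace R4 M] [IsManifold (𝓡 4) ∞ M]

/-! ### Frames, connections and curvature -/

/-- `E` is a smooth `g`-orthonormal frame over `U`. -/
structure IsOrthonormalFrame (g : Metric M) (E : Frame M) (U : Set M) : Prop where
  smooth : ∀ a, ContMDiffOn (𝓡 4) (𝓡 4).tangent ∞
    (fun x => (⟨x, E a x⟩ : TangentBundle (𝓡 4) M)) U
  orthonormal : ∀ x ∈ U, ∀ a b, g.inner x (E a x) (E b x) = if a = b then 1 else 0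

/-- Smoothness of a complex function on `U`. -/
def SmoothFn (f : M → ℂ) (U : Set M) : Prop := ContMDiffOn (𝓡 4) 𝓘(ℝ, ℂ) ∞ f U

/-- The derivative `E_a f` of a complex function along the frame. -/
def D (E : Frame M) (a : Fin 4) (f : M → ℂ) : M → ℂ :=
  fun x => mfderiv (𝓡 4) 𝓘(ℝ, ℂ) f x (E a x)

/-- Structure functions of an orthonormal frame: `[E_a, E_b] = ∑_c structureFn a b c • E_c`. -/
def structureFn (g : Metric M) (E : Frame M) (a b c : Fin 4) : M → ℂ :=
  fun x => ((g.inner x (VectorField.mlieBracket (𝓡 4) (E a) (E b) x) (E c x) : ℝ) : ℂ)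

/-- `Γ_{ab}{}^d` of the Levi-Civita connection `∇_{E_a} E_b = Γ_{ab}{}^d E_d` of the (possibly
complex) metric whose component matrix in the frame `E` is `G`, by the Koszul formula. -/
def christoffel (g : Metric M) (E : Frame M) (G : M → Matrix (Fin 4) (Fin 4) ℂ)
    (a b d : Fin 4) : M → ℂ := fun x =>
  (1 / 2) * ∑ e, (G x)⁻¹ d e *
    (D E a (fun y => G y b e) x + D E b (fun y => G y a e) x - D E e (fun y => G y a b) x
      + ∑ f, (structureFn g E a b f x * G x f e - structureFn g E a e f x * G x f b
        - structureFn g E b e f x * G x f a))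

/-- The component `R_{abc}{}^d` of the curvature of the metric `G`, where
`([∇_{E_a}, ∇_{E_b}] - ∇_{[E_a, E_b]}) E_c = R_{abc}{}^d E_d`. -/
def riemann (g : Metric M) (E : Frame M) (G : M → Matrix (Fin 4) (Fin 4) ℂ)
    (a b c d : Fin 4) : M → ℂ := fun x =>
  D E a (christoffel g E G b c d) x - D E b (christoffel g E G a c d) x
    + ∑ e, (christoffel g E G b c e x * christoffel g E G a e d x
      - christoffel g E G a c e x * christoffel g E G b e d x
      - structureFn g E a b e x * christoffel g E G e c d x)

/-- The Ricci tensor of the metric `G` (positive on round spheres). -/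
def ricci (g : Metric M) (E : Frame M) (G : M → Matrix (Fin 4) (Fin 4) ℂ)
    (b c : Fin 4) : M → ℂ := fun x => ∑ a, riemann g E G a b c a x

/-- The scalar curvature of the metric `G`. -/
def scalarCurv (g : Metric M) (E : Frame M) (G : M → Matrix (Fin 4) (Fin 4) ℂ) : M → ℂ :=
  fun x => ∑ a, ∑ b, (G x)⁻¹ a b * ricci g E G a b x

/-- The Weyl tensor `C_{abcd}` of the metric `G`, in dimension four. -/
def weyl (g : Metric M) (E : Frame M) (G : M → Matrix (Fin 4) (Fin 4) ℂ)
    (a b c d : Fin 4) : M → ℂ := fun x =>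
  (∑ e, riemann g E G a b c e x * G x e d)
    - (1 / 2) * (ricci g E G b c x * G x a d + G x b c * ricci g E G a d x
      - ricci g E G a c x * G x b d - G x a c * ricci g E G b d x)
    + (1 / 6) * scalarCurv g E G x * (G x b c * G x a d - G x a c * G x b d)

/-- The part `(1/4) C_{AA'BB'CC'DD'} ε^{A'B'} ε^{C'D'}` of the Weyl tensor of the metric `G`, the
spinor indices being those of the frame `E`. For `G = 1` (the metric `g`) it is the anti-self-dual
Weyl spinor `Ψ_{ABCD}` of `g`. When `Ψ_{ABCD} = 0`, its first variation along `G = 1 + t h` is the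
linearised anti-self-dual Weyl spinor of `h`: the self-dual part of the Weyl tensor is a section of
`Λ⁺ ⊗ Λ⁺`, whose first variation has no component in `Λ⁻ ⊗ Λ⁻`. -/
def weylSpinor (g : Metric M) (E : Frame M) (G : M → Matrix (Fin 4) (Fin 4) ℂ)
    (I : Fin 4 → Fin 2) : M → ℂ := fun x =>
  (1 / 4) * ∑ a, ∑ b, ∑ c, ∑ d, ∑ X : Fin 4 → Fin 2,
    sigmaLow a (I 0) (X 0) * sigmaLow b (I 1) (X 1) * sigmaLow c (I 2) (X 2) *
      sigmaLow d (I 3) (X 3) * eps (X 0) (X 1) * eps (X 2) (X 3) * weyl g E G a b c d x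

/-- The component matrix of `g` itself in an orthonormal frame. -/
def background : M → Matrix (Fin 4) (Fin 4) ℂ := fun _ => 1

/-- `(U, g)` is quaternionic-Kähler (self-dual Einstein) with cosmological constant `lam`:
`Ψ_{ABCD} = 0`, `R_{ab} = lam g_{ab}`, `lam ≠ 0`. -/
structure IsQuaternionicKahler (g : Metric M) (E : Frame M) (U : Set M) (lam : ℝ) : Prop where
  selfDual : ∀ x ∈ U, ∀ I, weylSpinor g E background I x = 0
  einstein : ∀ x ∈ U, ∀ a b,
    ricci g E background a b x = (lam : ℂ) * background x a b
  ne_zero : lam ≠ 0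

/-! ### Covariant derivatives of tensor and spinor fields -/

/-- The Levi-Civita connection of `g`: `∇_{E_a} E_b = Γ_{ab}{}^d E_d`. -/
def leviCivita (g : Metric M) (E : Frame M) (a b d : Fin 4) : M → ℂ :=
  christoffel g E background a b d

/-- The covariant derivative of tensor fields; index `0` is the differentiation index. -/
def nablaT (g : Metric M) (E : Frame M) {n : ℕ} (T : TensorField M n) : TensorField M (n + 1) :=
  fun I x => D E (I 0) (T (Fin.tail I)) x
    - ∑ k : Fin n, ∑ b, leviCivita g E (I 0) (I k.succ) b x *
        T (Function.update (Fin.tail I) k b) x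

/-- The unprimed spin connection `Γ_{aC}{}^B`: `∇_a φ^B = E_a φ^B + Γ_{aC}{}^B φ^C`. It is the trace
over primed indices in `Γ_{a CC'}{}^{BB'} = Γ_{aC}{}^B δ_{C'}^{B'} + Γ_{aC'}{}^{B'} δ_C^B`. -/
def spinConn (g : Metric M) (E : Frame M) (a : Fin 4) (C B : Fin 2) : M → ℂ := fun x =>
  (1 / 2) * ∑ b, ∑ c, ∑ X, leviCivita g E a c b x * sigma b B X * sigmaLow c C X

/-- The primed spin connection `Γ_{aC'}{}^{B'}`. -/
def spinConnPrimed (g : Metric M) (E : Frame M) (a : Fin 4) (C B : Fin 2) : M → ℂ := fun x =>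
  (1 / 2) * ∑ b, ∑ c, ∑ X, leviCivita g E a c b x * sigma b X B * sigmaLow c X C

/-- The covariant derivative `∇_a φ` of a spinor field along `E_a`. -/
def covS (g : Metric M) (E : Frame M) {n m : ℕ} (a : Fin 4) (φ : SpinorField M n m) :
    SpinorField M n m := fun I X x =>
  D E a (φ I X) x
    - ∑ k : Fin n, ∑ B, spinConn g E a (I k) B x * φ (Function.update I k B) X x
    - ∑ k : Fin m, ∑ Y, spinConnPrimed g E a (X k) Y x * φ I (Function.update X k Y) x

/-- The spinor covariant derivative `∇_{AA'} φ`; the indices `A`, `A'` come first. -/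
def nabla (g : Metric M) (E : Frame M) {n m : ℕ} (φ : SpinorField M n m) :
    SpinorField M (n + 1) (m + 1) := fun I X x =>
  ∑ a, sigmaLow a (I 0) (X 0) * covS g E a φ (Fin.tail I) (Fin.tail X) x

/-! ### The potential and its second-order field -/

/-- Smoothness of a spinor field on `U`. -/
def SmoothSpinor {n m : ℕ} (φ : SpinorField M n m) (U : Set M) : Prop :=
  ∀ I X, SmoothFn (φ I X) U

/-- `∇^{A'}_{(A} Π_{BCD)A'}` for a field `Π_{A'ABC}`. -/
def potentialEq (g : Metric M) (E : Frame M) (Pot : SpinorField M 3 1) (I : Fin 4 → Fin 2) :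
    M → ℂ := fun x =>
  symm (fun K => ∑ X, ∑ Y, eps X Y * nabla g E Pot K ![Y, X] x) I

/-- `γ_{CDA'B'} = ∇^A_{(A'} Π_{B')ACD}`. -/
def gammaOf (g : Metric M) (E : Frame M) (Pot : SpinorField M 3 1) : SpinorField M 2 2 :=
  fun I X x => ∑ A, ∑ B, eps A B *
    ((1 / 2) * (nabla g E Pot ![B, A, I 0, I 1] ![X 0, X 1] x
      + nabla g E Pot ![B, A, I 0, I 1] ![X 1, X 0] x))

/-- `∇_{(A}^{A'} ∇_B^{B'} γ_{CD)A'B'}`. -/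
def secondOrderOp (g : Metric M) (E : Frame M) (γ : SpinorField M 2 2) (I : Fin 4 → Fin 2) :
    M → ℂ := fun x =>
  symm (fun K => ∑ X, ∑ Y, ∑ Z, ∑ W, eps X Z * eps Y W *
    nabla g E (nabla g E γ) K ![Z, W, X, Y] x) I

/-! ### Integrable complex structures, weighted scalars and the Teukolsky equation -/

/-- A field of endomorphisms of the tangent spaces. -/
abbrev EndField (M : Type*) [TopologicalSpace M] [ChartedSpace R4 M] :=
  (x : M) → TangentSpace (𝓡 4) x →L[ℝ] TangentSpace (𝓡 4) x

/-- The spinor `o_A` as a spinor field with one unprimed index. -/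
def ofPair (o : Fin 2 → M → ℂ) : SpinorField M 1 0 := fun I _ => o (I 0)

/-- Raising the index: `o^A = ε^{AB} o_B`. -/
def raise (o : Fin 2 → M → ℂ) (A : Fin 2) : M → ℂ := fun x => ∑ B, eps A B * o B x

/-- The frame components `J^a{}_b`. -/
def comp (g : Metric M) (E : Frame M) (J : EndField M) : TensorField M 2 :=
  fun I x => ((g.inner x (E (I 0) x) (J x (E (I 1) x)) : ℝ) : ℂ)

/-- `J` is an integrable anti-self-dual compatible almost-complex structure on `U` with principal
spinors `o_A`, `ι_A`: `J^a{}_b = i (o^A ι_B + ι^A o_B) δ^{A'}_{B'}`, `o_A ι^A = 1`, and the Nijenhuis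
tensor of `J` vanishes. (`J² = -1`, compatibility and anti-self-duality follow from the form of
`J`.) -/
structure IsIntegrableComplexStructure (g : Metric M) (E : Frame M) (U : Set M) (J : EndField M)
    (o ι : Fin 2 → M → ℂ) : Prop where
  smooth_o : ∀ A, SmoothFn (o A) U
  smooth_iota : ∀ A, SmoothFn (ι A) U
  normalised : ∀ x ∈ U, ∑ A, o A x * raise ι A x = 1
  principal : ∀ x ∈ U, ∀ a b, comp g E J ![a, b] x =
    ∑ A, ∑ B, ∑ X, sigmaLow a A X *
      (Complex.I * (raise o A x * ι B x + raise ι A x * o B x)) * sigma b B X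
  integrable : ∀ x ∈ U, ∀ a b,
    VectorField.mlieBracket (𝓡 4) (fun y => J y (E a y)) (fun y => J y (E b y)) x
      - J x (VectorField.mlieBracket (𝓡 4) (fun y => J y (E a y)) (E b) x)
      - J x (VectorField.mlieBracket (𝓡 4) (E a) (fun y => J y (E b y)) x)
      - VectorField.mlieBracket (𝓡 4) (E a) (E b) x = 0

/-- The Lee form `f_a = -(1/2) J^b{}_c ∇_b J^c{}_a`. -/
def leeForm (g : Metric M) (E : Frame M) (J : EndField M) (a : Fin 4) : M → ℂ := fun x =>
  -(1 / 2) * ∑ b, ∑ c, comp g E J ![b, c] x * nablaT g E (comp g E J) ![b, c, a] x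

/-- The GHP connection form `ω_a = ι_B ∇_a o^B`. -/
def ghpForm (g : Metric M) (E : Frame M) (o ι : Fin 2 → M → ℂ) (a : Fin 4) : M → ℂ := fun x =>
  ∑ B, ∑ C, ι B x * (eps B C * covS g E a (ofPair o) ![C] ![] x)

/-- The form `P_a = ω_a - (1/2) i J^b{}_a f_b`. -/
def pForm (g : Metric M) (E : Frame M) (J : EndField M) (o ι : Fin 2 → M → ℂ) (a : Fin 4) :
    M → ℂ := fun x =>
  ghpForm g E o ι a x
    - (1 / 2) * Complex.I * ∑ b, comp g E J ![b, a] x * leeForm g E J b x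

/-- `𝒞_a ψ = ∇_a ψ + (w f_a + p P_a) ψ` on scalars of weights `(w, p)`. -/
def weightedD (g : Metric M) (E : Frame M) (J : EndField M) (o ι : Fin 2 → M → ℂ) (w p : ℂ)
    (ψ : M → ℂ) : TensorField M 1 := fun I x =>
  D E (I 0) ψ x + (w * leeForm g E J (I 0) x + p * pForm g E J o ι (I 0) x) * ψ x

/-- `𝒞_a v_b = ∇_a v_b + (w f_a + p P_a) v_b - (f_a δ^c_b + f_b δ^c_a - g_{ab} f^c) v_c` on covectors
of weights `(w, p)`. -/
def weightedDCov (g : Metric M) (E : Frame M) (J : EndField M) (o ι : Fin 2 → M → ℂ) (w p : ℂ)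
    (v : TensorField M 1) : TensorField M 2 := fun I x =>
  nablaT g E v I x
    + (w * leeForm g E J (I 0) x + p * pForm g E J o ι (I 0) x) * v ![I 1] x
    - (leeForm g E J (I 0) x * v ![I 1] x + leeForm g E J (I 1) x * v ![I 0] x
      - (if I 0 = I 1 then 1 else 0) * ∑ c, leeForm g E J c x * v ![c] x)

/-- The Teukolsky operator `□^𝒞 = g^{ab} 𝒞_a 𝒞_b` on scalars of weights `(w, p)`. -/
def teukolsky (g : Metric M) (E : Frame M) (J : EndField M) (o ι : Fin 2 → M → ℂ) (w p : ℂ)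
    (ψ : M → ℂ) : M → ℂ := fun x =>
  ∑ a, weightedDCov g E J o ι w p (weightedD g E J o ι w p ψ) ![a, a] x

/-! ### The metric perturbations -/

/-- `S^i_{ABCD}`: the symmetrised product of `4 - i` factors `o` and `i` factors `ι`. -/
def spinS (o ι : Fin 2 → M → ℂ) (i : Fin 5) (I : Fin 4 → Fin 2) : M → ℂ := fun x =>
  symm (fun K => ∏ k : Fin 4, if (k : ℕ) < 4 - (i : ℕ) then o (K k) x else ι (K k) x) I

/-- `W^i_{abcd} = S^i_{ABCD} ε_{A'B'} ε_{C'D'}`. -/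
def tensorW (o ι : Fin 2 → M → ℂ) (i : Fin 5) : TensorField M 4 := fun I x =>
  ∑ A : Fin 4 → Fin 2, ∑ X : Fin 4 → Fin 2,
    spinS o ι i A x * eps (X 0) (X 1) * eps (X 2) (X 3) *
      (sigma (I 0) (A 0) (X 0) * sigma (I 1) (A 1) (X 1) * sigma (I 2) (A 2) (X 2) *
        sigma (I 3) (A 3) (X 3))

/-- `W^i_{c(ab)d} Φ`. -/
def symW (o ι : Fin 2 → M → ℂ) (i : Fin 5) (Φ : M → ℂ) : TensorField M 4 := fun I x =>
  (1 / 2) * (tensorW o ι i ![I 0, I 1, I 2, I 3] x + tensorW o ι i ![I 0, I 2, I 1, I 3] x) * Φ x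

/-- `(∇^c + 4 f^c) (W^i_{c(ab)d} Φ)`, with index order `a, b, d`. -/
def divW (g : Metric M) (E : Frame M) (J : EndField M) (o ι : Fin 2 → M → ℂ) (i : Fin 5)
    (Φ : M → ℂ) : TensorField M 3 := fun I x =>
  ∑ c, (nablaT g E (symW o ι i Φ) ![c, c, I 0, I 1, I 2] x
    + 4 * leeForm g E J c x * symW o ι i Φ ![c, I 0, I 1, I 2] x)

/-- The metric perturbation `h^i_{ab} = -∇^d [(∇^c + 4 f^c) W^i_{c(ab)d} Φ]`. -/
def metricPert (g : Metric M) (E : Frame M) (J : EndField M) (o ι : Fin 2 → M → ℂ) (i : Fin 5)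
    (Φ : M → ℂ) : M → Matrix (Fin 4) (Fin 4) ℂ := fun x a b =>
  -∑ d, nablaT g E (divW g E J o ι i Φ) ![d, a, b, d] x

/-- The component matrix of the perturbed metric `g + t h`. -/
def perturbed (h : M → Matrix (Fin 4) (Fin 4) ℂ) (t : ℝ) : M → Matrix (Fin 4) (Fin 4) ℂ :=
  fun x => background x + (t : ℂ) • h x

/-- The linearised anti-self-dual Weyl spinor of the perturbation `h` of a metric with
`Ψ_{ABCD} = 0` exists and vanishes identically on `U`. -/
def LinearisedASDWeylVanishes (g : Metric M) (E : Frame M) (U : Set M)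
    (h : M → Matrix (Fin 4) (Fin 4) ℂ) : Prop :=
  ∀ x ∈ U, ∀ I, HasDerivAt (fun t : ℝ => weylSpinor g E (perturbed h t) I x) 0 0

/-- The perturbation `h` satisfies the linearised Einstein equations with cosmological constant
`lam`, that is, `Ric - lam g` vanishes to first order in `t` along `g + t h`. -/
def LinearisedEinstein (g : Metric M) (E : Frame M) (U : Set M) (lam : ℝ)
    (h : M → Matrix (Fin 4) (Fin 4) ℂ) : Prop :=
  ∀ x ∈ U, ∀ a b, HasDerivAt
    (fun t : ℝ => ricci g E (perturbed h t) a b x - (lam : ℂ) * perturbed h t x a b) 0 0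

/-- `h` is a quaternionic deformation: a symmetric perturbation which preserves `Ψ_{ABCD} = 0` and
`R_{ab} = lam g_{ab}` to first order. -/
structure IsQuaternionicDeformation (g : Metric M) (E : Frame M) (U : Set M) (lam : ℝ)
    (h : M → Matrix (Fin 4) (Fin 4) ℂ) : Prop where
  symmetric : ∀ x ∈ U, (h x).IsSymm
  weyl : LinearisedASDWeylVanishes g E U h
  einstein : LinearisedEinstein g E U lam h

end

end QK

end

/-! The proof rests on the shape of the curvature of a quaternionic-Kähler metric. As `Ψ = 0` and
the trace-free Ricci tensor vanishes, the unprimed spin bundle has the curvature of a space of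
constant sectional curvature `λ/3` (`IsQuaternionicKahler.curvS_eq`), and the curvature of the
primed bundle is a self-dual 2-form whose trace is fixed by `λ` (`curvSPrimed_eq`,
`primedCurv_trace`). The Ricci identity therefore acts on unprimed indices only through terms with a
factor `ε`, and such terms disappear under total symmetrisation.

Part 1. The potential equation says that `∇^{A'}_A Π_{BCDA'}` reduces to its trace `μ_{CD}`.
Commuting derivatives in `∇γ` and inserting the differentiated equation gives a first-order identity
(`IsPotential.gamma_identity`): a primed contraction of `∇γ`, symmetrised in two unprimed indices,
equals `-(λ/3) Π + ¼ ∇μ`. Applying `∇^{A'}` once more and symmetrising, the first term vanishes by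
the potential equation and the second by the Ricci identity (`symm_box_eq_zero`).

Part 2 shows that `h` is the `γ` of a potential, and that any such `γ`, read as a symmetric tensor,
is a quaternionic deformation.

For the second claim, the metric variation is followed in the co-varied orthonormal frame `E_a - ½
h_a{}^b E_b`. There the connection changes by the `so(4)`-valued `rotation`, and the curvature
components by `rotationCurv`, which has the symmetries of an algebraic curvature tensor. If its
unprimed part in the last index pair vanishes, it is self-dual in both pairs, and the first Bianchi
identity makes it trace-free. The linearised Einstein and Weyl equations both follow from this
single condition (`IsQuaternionicDeformation.of_spinPart`). For `h = γ` the first-order identity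
says that, up to normalisation, the unprimed spin connection changes by `-(λ/3) Π` plus the gradient
of `μ`; its curvature then changes exactly as the change of frame requires
(`IsPotential.spinPart_rotationCurv`).

For the first claim, the potential is `Π_{A'BCD} = S^i_{BCD}{}^A 𝒞_{AA'} Φ`. Integrability of `J`
gives `o^A o^B ∇_{AA'} o_B = 0` and the same for `ι`, so that `∇o` and `∇ι` are expressed by the
forms `f` and `P` alone (`IsPrincipalPair.nabla_spinors`). The integrability conditions of these
equations, with `Ψ = 0`, show that `df` and `dP` have no anti-self-dual part
(`IsPrincipalPair.closed`). Hence the anti-self-dual part of the weighted curl of `𝒞Φ` vanishes, and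
what remains of the potential equation is the Teukolsky equation (`weighted_potential_algebra`).
Finally the two divergences in the definition of `h` are computed in spinors: the inner one yields
`Π`, thanks to the term `4f`, and the outer one yields `γ`. -/

namespace QK

set_option linter.unusedSectionVars false
set_option linter.unusedSimpArgs false
set_option linter.unusedTactic false
set_option linter.unreachableTactic false

/-! ### Smooth complex functions and their frame derivatives -/

section Analysis

variable {M : Type*} [TopologicalSpace M] [ChartedSpace R4 M] [IsManifold (𝓡 4) ∞ M]
  {U : Set M} {x : M}

attribute [fun_prop] SmoothFn

@[fun_prop] theorem SmoothFn.const (z : ℂ) : SmoothFn (fun _ : M => z) U := contMDiffOn_const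

@[fun_prop] theorem SmoothFn.add {f f' : M → ℂ} (hf : SmoothFn f U) (hf' : SmoothFn f' U) :
    SmoothFn (fun x => f x + f' x) U := ContMDiffOn.add hf hf'

@[fun_prop] theorem SmoothFn.mul {f f' : M → ℂ} (hf : SmoothFn f U) (hf' : SmoothFn f' U) :
    SmoothFn (fun x => f x * f' x) U :=
  (contDiff_mul (𝕜 := ℝ) (𝔸 := ℂ)).contMDiff.comp_contMDiffOn (ContMDiffOn.prodMk_space hf hf')

@[fun_prop] theorem SmoothFn.neg {f : M → ℂ} (hf : SmoothFn f U) :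
    SmoothFn (fun x => -f x) U := ContMDiffOn.neg hf

@[fun_prop] theorem SmoothFn.sub {f f' : M → ℂ} (hf : SmoothFn f U) (hf' : SmoothFn f' U) :
    SmoothFn (fun x => f x - f' x) U := ContMDiffOn.sub hf hf'

@[fun_prop] theorem SmoothFn.sum {κ : Type*} {s : Finset κ} {f : κ → M → ℂ}
    (hf : ∀ i, SmoothFn (f i) U) : SmoothFn (fun x => ∑ i ∈ s, f i x) U :=
  contMDiffOn_finsetSum fun i _ => hf i

theorem SmoothFn.prod {κ : Type*} {s : Finset κ} {f : κ → M → ℂ}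
    (hf : ∀ i, SmoothFn (f i) U) : SmoothFn (fun x => ∏ i ∈ s, f i x) U := by
  classical
  induction s using Finset.induction_on with
  | empty => simpa using SmoothFn.const 1
  | insert a s ha ih => simpa [Finset.prod_insert ha] using (hf a).mul ih

theorem SmoothFn.congr {f f' : M → ℂ} (hf : SmoothFn f U) (h : ∀ y ∈ U, f' y = f y) :
    SmoothFn f' U := ContMDiffOn.congr hf h

theorem SmoothFn.contMDiffAt {f : M → ℂ} (hf : SmoothFn f U) (hU : IsOpen U) (hx : x ∈ U) :
    ContMDiffAt (𝓡 4) 𝓘(ℝ, ℂ) ∞ f x :=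
  ContMDiffOn.contMDiffAt hf (hU.mem_nhds hx)

theorem SmoothFn.mdifferentiableAt {f : M → ℂ} (hf : SmoothFn f U) (hU : IsOpen U) (hx : x ∈ U) :
    MDifferentiableAt (𝓡 4) 𝓘(ℝ, ℂ) f x :=
  (hf.contMDiffAt hU hx).mdifferentiableAt (by simp)

theorem D_congr {E : Frame M} {f f' : M → ℂ} (hU : IsOpen U) (hx : x ∈ U) (a : Fin 4)
    (h : ∀ y ∈ U, f y = f' y) : D E a f x = D E a f' x := by
  have : f =ᶠ[nhds x] f' := Filter.eventually_of_mem (hU.mem_nhds hx) h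
  simp only [D, this.mfderiv_eq]
  rfl

theorem D_const (E : Frame M) (a : Fin 4) (z : ℂ) : D E a (fun _ => z) x = 0 := by
  simp [D]
  rfl

theorem D_add {E : Frame M} {f f' : M → ℂ} (hU : IsOpen U) (hx : x ∈ U) (a : Fin 4)
    (hf : SmoothFn f U) (hf' : SmoothFn f' U) :
    D E a (fun y => f y + f' y) x = D E a f x + D E a f' x := by
  have := mfderiv_add (hf.mdifferentiableAt hU hx) (hf'.mdifferentiableAt hU hx)
  exact congrArg (fun L => L (E a x)) this

theorem D_mul {E : Frame M} {f f' : M → ℂ} (hU : IsOpen U) (hx : x ∈ U) (a : Fin 4)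
    (hf : SmoothFn f U) (hf' : SmoothFn f' U) :
    D E a (fun y => f y * f' y) x = f x * D E a f' x + D E a f x * f' x := by
  have := ((hf.mdifferentiableAt hU hx).hasMFDerivAt.mul
    (hf'.mdifferentiableAt hU hx).hasMFDerivAt).mfderiv
  have h2 := congrArg (fun L => L (E a x)) this
  rw [mul_comm (D E a f x)]
  exact h2

theorem D_const_mul {E : Frame M} {f : M → ℂ} (hU : IsOpen U) (hx : x ∈ U) (a : Fin 4)
    (z : ℂ) (hf : SmoothFn f U) : D E a (fun y => z * f y) x = z * D E a f x := by
  rw [D_mul hU hx a (SmoothFn.const z) hf, D_const]; ring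

theorem D_neg {E : Frame M} {f : M → ℂ} (hU : IsOpen U) (hx : x ∈ U) (a : Fin 4)
    (hf : SmoothFn f U) : D E a (fun y => -f y) x = -D E a f x := by
  simpa using D_const_mul (E := E) hU hx a (-1) hf

theorem D_sub {E : Frame M} {f f' : M → ℂ} (hU : IsOpen U) (hx : x ∈ U) (a : Fin 4)
    (hf : SmoothFn f U) (hf' : SmoothFn f' U) :
    D E a (fun y => f y - f' y) x = D E a f x - D E a f' x := by
  simp only [sub_eq_add_neg]
  rw [D_add hU hx a hf hf'.neg, D_neg hU hx a hf']

theorem D_sum {E : Frame M} {κ : Type*} {s : Finset κ} {f : κ → M → ℂ} (hU : IsOpen U)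
    (hx : x ∈ U) (a : Fin 4) (hf : ∀ i, SmoothFn (f i) U) :
    D E a (fun y => ∑ i ∈ s, f i y) x = ∑ i ∈ s, D E a (f i) x := by
  classical
  induction s using Finset.induction_on with
  | empty => simpa using D_const E a 0
  | insert i s hi ih =>
    simp only [Finset.sum_insert hi]
    rw [D_add hU hx a (hf i) (SmoothFn.sum hf), ih]

/-- The derivative of a complex function along a vector field. -/
noncomputable def along (V : (x : M) → TangentSpace (𝓡 4) x) (f : M → ℂ) : M → ℂ :=
  fun x => mfderiv (𝓡 4) 𝓘(ℝ, ℂ) f x (V x)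

/-- The derivative is the fibre component of the tangent map of `f` evaluated on the section `V`,
and both of these are smooth. -/
theorem smoothFn_along {V : (x : M) → TangentSpace (𝓡 4) x} {f : M → ℂ}
    (hU : IsOpen U) (hV : ContMDiffOn (𝓡 4) (𝓡 4).tangent ∞
      (fun x => (⟨x, V x⟩ : TangentBundle (𝓡 4) M)) U) (hf : SmoothFn f U) :
    SmoothFn (along V f) U := by
  intro x hx
  have h1 := (hf.contMDiffOn_tangentMapWithin (m := ∞) (by simp) hU.uniqueMDiffOn)
  have h2 : ContMDiffOn (𝓡 4) 𝓘(ℝ, ℂ).tangent ∞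
      (fun x => tangentMapWithin (𝓡 4) 𝓘(ℝ, ℂ) f U (⟨x, V x⟩ : TangentBundle (𝓡 4) M)) U :=
    h1.comp hV (fun x hx => hx)
  have h3 := (contMDiff_snd_tangentBundle_modelSpace ℂ 𝓘(ℝ, ℂ) (n := ∞)).comp_contMDiffOn h2
  refine (h3.congr fun y hy => ?_) x hx
  simp only [Function.comp, tangentMapWithin]
  rw [mfderivWithin_of_isOpen hU hy]
  rfl

theorem IsOrthonormalFrame.smooth_D {g : Metric M} {E : Frame M} (hE : IsOrthonormalFrame g E U)
    (hU : IsOpen U) (a : Fin 4) {f : M → ℂ} (hf : SmoothFn f U) : SmoothFn (D E a f) U :=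
  smoothFn_along hU (hE.smooth a) hf

end Analysis

/-! ### Lie brackets as commutators of derivations -/

section LieBracket

open VectorField

variable {M : Type*} [TopologicalSpace M] [ChartedSpace R4 M] [IsManifold (𝓡 4) ∞ M]
  {U : Set M} {x : M}

theorem two_le_infty : (2 : WithTop ℕ∞) ≤ ∞ :=
  WithTop.coe_le_coe.2 (le_top : (2 : ℕ∞) ≤ ⊤)

/-- The derivative of a function along a vector field, computed in a chart. -/
theorem fderiv_comp_chart_symm (V : (y : M) → TangentSpace (𝓡 4) y) {f : M → ℂ} {z : R4}
    (hz : z ∈ (extChartAt (𝓡 4) x).target)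
    (hf : MDifferentiableAt (𝓡 4) 𝓘(ℝ, ℂ) f ((extChartAt (𝓡 4) x).symm z)) :
    fderiv ℝ (fun w => f ((extChartAt (𝓡 4) x).symm w)) z
      (mpullbackWithin 𝓘(ℝ, R4) (𝓡 4) (extChartAt (𝓡 4) x).symm V (Set.range (𝓡 4)) z)
      = along V f ((extChartAt (𝓡 4) x).symm z) := by
  have : IsManifold (𝓡 4) 1 M := IsManifold.of_le (n := ∞) (by exact_mod_cast le_top)
  have hinv := isInvertible_mfderivWithin_extChartAt_symm (I := 𝓡 4) (x := x) hz
  have hd : MDifferentiableAt 𝓘(ℝ, R4) (𝓡 4) (extChartAt (𝓡 4) x).symm z := by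
    have := (contMDiffOn_extChartAt_symm (n := 1) (I := 𝓡 4) x).contMDiffAt
      ((isOpen_extChartAt_target x).mem_nhds hz)
    exact this.mdifferentiableAt (by simp)
  have h1 := mfderiv_comp z hf hd
  rw [← mfderiv_eq_fderiv]
  have h2 := congrArg (fun L => L (mpullbackWithin 𝓘(ℝ, R4) (𝓡 4) (extChartAt (𝓡 4) x).symm V
    (Set.range (𝓡 4)) z)) h1
  refine h2.trans ?_
  have hr : Set.range (𝓡 4) = (Set.univ : Set R4) := by simp
  simp only [mpullbackWithin_apply, ContinuousLinearMap.comp_apply, along]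
  rw [hr, mfderivWithin_univ] at hinv ⊢
  congr 1
  obtain ⟨L, hL⟩ := hinv
  rw [← hL, ContinuousLinearMap.inverse_equiv]
  exact L.apply_symm_apply _

/-- The manifold bracket is the bracket of the fields pulled back to a chart, where the commutator
formula is the symmetry of the second derivative. The rest transports the terms through the chart,
whose derivative is invertible. -/
theorem mfderiv_apply_mlieBracket {V W : (y : M) → TangentSpace (𝓡 4) y} {f : M → ℂ}
    (hU : IsOpen U) (hx : x ∈ U)
    (hV : ContMDiffOn (𝓡 4) (𝓡 4).tangent ∞ (fun x => (⟨x, V x⟩ : TangentBundle (𝓡 4) M)) U)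
    (hW : ContMDiffOn (𝓡 4) (𝓡 4).tangent ∞ (fun x => (⟨x, W x⟩ : TangentBundle (𝓡 4) M)) U)
    (hf : SmoothFn f U) :
    along (mlieBracket (𝓡 4) V W) f x = along V (along W f) x - along W (along V f) x := by
  have : IsManifold (𝓡 4) 1 M := IsManifold.of_le (n := ∞) (by exact_mod_cast le_top)
  have : IsManifold (𝓡 4) 2 M := IsManifold.of_le (n := ∞) two_le_infty
  set φ := extChartAt (𝓡 4) x with hφ
  have hr : Set.range (𝓡 4) = (Set.univ : Set R4) := by simp
  have hzt : φ x ∈ φ.target := mem_extChartAt_target x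
  have hsx : φ.symm (φ x) = x := extChartAt_to_inv x
  -- the chart domain where everything is smooth
  have hnear : ∀ᶠ z in nhds (φ x), z ∈ φ.target ∧ φ.symm z ∈ U := by
    refine Filter.Eventually.and ((isOpen_extChartAt_target x).mem_nhds hzt) ?_
    have hc : ContinuousAt φ.symm (φ x) := continuousAt_extChartAt_symm x
    exact hc (by rw [hsx]; exact hU.mem_nhds hx)
  have hds : ∀ {V : (y : M) → TangentSpace (𝓡 4) y},
      ContMDiffOn (𝓡 4) (𝓡 4).tangent ∞ (fun x => (⟨x, V x⟩ : TangentBundle (𝓡 4) M)) U →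
      DifferentiableAt ℝ (mpullbackWithin 𝓘(ℝ, R4) (𝓡 4) φ.symm V (Set.range (𝓡 4))) (φ x) := by
    intro V hV
    have h1 : MDifferentiableWithinAt (𝓡 4) (𝓡 4).tangent
        (fun x => (⟨x, V x⟩ : TangentBundle (𝓡 4) M)) Set.univ x :=
      ((hV.contMDiffAt (hU.mem_nhds hx)).mdifferentiableAt (by simp)).mdifferentiableWithinAt
    have := h1.differentiableWithinAt_mpullbackWithin_vectorField
    rw [Set.preimage_univ, Set.univ_inter] at this
    exact this.differentiableAt (by rw [hr]; exact Filter.univ_mem)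
  have hF : ContDiffAt ℝ ∞ (fun w => f (φ.symm w)) (φ x) := by
    have h1 : ContMDiffAt 𝓘(ℝ, R4) (𝓡 4) ∞ φ.symm (φ x) :=
      (contMDiffOn_extChartAt_symm (n := ∞) (I := 𝓡 4) x).contMDiffAt
        ((isOpen_extChartAt_target x).mem_nhds hzt)
    have h2 : ContMDiffAt 𝓘(ℝ, R4) 𝓘(ℝ, ℂ) ∞ (f ∘ φ.symm) (φ x) :=
      ContMDiffAt.comp (φ x) (by rw [hsx]; exact hf.contMDiffAt hU hx) h1
    exact contMDiffAt_iff_contDiffAt.1 h2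
  -- The formula in the model space. The inner derivatives it contains are derivatives along pulled
  -- back fields, identified with `along` on a neighbourhood by `hev`.
  have key := fderiv_apply_lieBracket (𝕜 := ℝ) (n := ∞) hF (by simpa using two_le_infty) (hds hW) (hds hV)
  have hev : ∀ V : (y : M) → TangentSpace (𝓡 4) y,
      (fun z => fderiv ℝ (fun w => f (φ.symm w)) z
        (mpullbackWithin 𝓘(ℝ, R4) (𝓡 4) φ.symm V (Set.range (𝓡 4)) z)) =ᶠ[nhds (φ x)]
      fun z => along V f (φ.symm z) := by
    intro V
    filter_upwards [hnear] with z hz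
    exact fderiv_comp_chart_symm V hz.1 (hf.mdifferentiableAt hU hz.2)
  have hend : ∀ (V : (y : M) → TangentSpace (𝓡 4) y) {h : M → ℂ}, SmoothFn h U →
      fderiv ℝ (fun w => h (φ.symm w)) (φ x)
        (mpullbackWithin 𝓘(ℝ, R4) (𝓡 4) φ.symm V (Set.range (𝓡 4)) (φ x)) =
      along V h x := by
    intro V h hh
    have := fderiv_comp_chart_symm (x := x) V (f := h) hzt
      (by rw [← hφ, hsx]; exact hh.mdifferentiableAt hU hx)
    rw [← hφ, hsx] at this
    exact this
  rw [(hev W).fderiv_eq, (hev V).fderiv_eq,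
    hend V (smoothFn_along hU hW hf), hend W (smoothFn_along hU hV hf)]
    at key
  rw [← key]
  change mfderiv (𝓡 4) 𝓘(ℝ, ℂ) f x (mlieBracketWithin (𝓡 4) V W Set.univ x) = _
  rw [mlieBracketWithin_apply]
  have hset : φ.symm ⁻¹' Set.univ ∩ Set.range (𝓡 4) = (Set.univ : Set R4) := by simp
  rw [← hφ, hset]
  have hi := isInvertible_mfderiv_extChartAt (I := 𝓡 4) (mem_extChartAt_source (I := 𝓡 4) x)
  have hcomp : mfderiv (𝓡 4) 𝓘(ℝ, ℂ) f x =
      (fderiv ℝ (fun w => f (φ.symm w)) (φ x)).comp (mfderiv (𝓡 4) 𝓘(ℝ, R4) φ x) := by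
    have hFd : MDifferentiableAt 𝓘(ℝ, R4) 𝓘(ℝ, ℂ) (fun w => f (φ.symm w)) (φ x) :=
      (hF.differentiableAt (by simp)).mdifferentiableAt
    have h1 := mfderiv_comp x hFd (mdifferentiableAt_extChartAt (mem_chart_source R4 x))
    rw [mfderiv_eq_fderiv] at h1
    refine Eq.trans ?_ h1
    refine Filter.EventuallyEq.mfderiv_eq ?_
    filter_upwards [extChartAt_source_mem_nhds (I := 𝓡 4) x] with y hy
    simp only [Function.comp]
    rw [φ.left_inv hy]
  rw [← hφ] at hi
  obtain ⟨L, hL⟩ := hi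
  have hLL : ∀ v, mfderiv (𝓡 4) 𝓘(ℝ, R4) φ x ((mfderiv (𝓡 4) 𝓘(ℝ, R4) φ x).inverse v) = v := by
    intro v
    rw [← hL, ContinuousLinearMap.inverse_equiv]
    exact L.apply_symm_apply _
  rw [hcomp]
  refine congrArg (fderiv ℝ (fun w => f (φ.symm w)) (φ x)) ((hLL _).trans ?_)
  exact congrFun (lieBracketWithin_univ (𝕜 := ℝ)
    (V := mpullbackWithin 𝓘(ℝ, R4) (𝓡 4) φ.symm V (Set.range (𝓡 4)))
    (W := mpullbackWithin 𝓘(ℝ, R4) (𝓡 4) φ.symm W (Set.range (𝓡 4)))) (φ x)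

end LieBracket

/-! ### Orthonormal frames, structure functions and the Jacobi identity -/

section Frames

open VectorField

variable {M : Type*} [TopologicalSpace M] [ChartedSpace R4 M] [IsManifold (𝓡 4) ∞ M]
  {U : Set M} {x : M} {g : Metric M} {E : Frame M}

theorem IsOrthonormalFrame.mono {V : Set M} (hE : IsOrthonormalFrame g E U) (h : V ⊆ U) :
    IsOrthonormalFrame g E V :=
  ⟨fun a => (hE.smooth a).mono h, fun x hx => hE.orthonormal x (h hx)⟩

/-- Orthonormality gives linear independence, and four independent vectors span a four-dimensional
tangent space. -/
theorem IsOrthonormalFrame.expand (hE : IsOrthonormalFrame g E U) (hx : x ∈ U)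
    (v : TangentSpace (𝓡 4) x) : v = ∑ a, g.inner x v (E a x) • E a x := by
  have hcoef : ∀ (c : Fin 4 → ℝ) b, g.inner x (∑ a, c a • E a x) (E b x) = c b := by
    intro c b
    simp only [map_sum, map_smul, sum_apply, smul_apply,
      hE.orthonormal x hx, smul_eq_mul]
    simp
  have hli : LinearIndependent ℝ (fun a => E a x) := by
    rw [Fintype.linearIndependent_iff]
    intro c hc b
    rw [← hcoef c b, hc]
    simp
  have hfr : Module.finrank ℝ (TangentSpace (𝓡 4) x) = 4 :=
    finrank_euclideanSpace_fin (𝕜 := ℝ) (n := 4)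
  have : FiniteDimensional ℝ (TangentSpace (𝓡 4) x) :=
    inferInstanceAs (FiniteDimensional ℝ R4)
  have hsp := hli.span_eq_top_of_card_eq_finrank' (by rw [hfr]; simp)
  have hv : v ∈ Submodule.span ℝ (Set.range fun a => E a x) := by rw [hsp]; trivial
  obtain ⟨c, rfl⟩ := (Submodule.mem_span_range_iff_exists_fun ℝ).1 hv
  simp only [hcoef]

theorem IsOrthonormalFrame.along_eq (hE : IsOrthonormalFrame g E U) (hx : x ∈ U)
    (V : (y : M) → TangentSpace (𝓡 4) y) (f : M → ℂ) :
    along V f x = ∑ a, ((g.inner x (V x) (E a x) : ℝ) : ℂ) * D E a f x := by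
  have h := congrArg (mfderiv (𝓡 4) 𝓘(ℝ, ℂ) f x) (hE.expand hx (V x))
  rw [map_sum] at h
  refine h.trans (Finset.sum_congr rfl fun a _ => ?_)
  rw [map_smul]
  exact Complex.real_smul

/-- The commutator of two frame derivatives. -/
theorem IsOrthonormalFrame.D_comm (hE : IsOrthonormalFrame g E U) (hU : IsOpen U) (hx : x ∈ U)
    (a b : Fin 4) {f : M → ℂ} (hf : SmoothFn f U) :
    D E a (D E b f) x - D E b (D E a f) x = ∑ c, structureFn g E a b c x * D E c f x :=
  (mfderiv_apply_mlieBracket hU hx (hE.smooth a) (hE.smooth b) hf).symm.trans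
    (hE.along_eq hx _ f)

theorem IsOrthonormalFrame.contMDiffOn_mlieBracket {V W : (y : M) → TangentSpace (𝓡 4) y}
    (hU : IsOpen U)
    (hV : ContMDiffOn (𝓡 4) (𝓡 4).tangent ∞ (fun x => (⟨x, V x⟩ : TangentBundle (𝓡 4) M)) U)
    (hW : ContMDiffOn (𝓡 4) (𝓡 4).tangent ∞ (fun x => (⟨x, W x⟩ : TangentBundle (𝓡 4) M)) U) :
    ContMDiffOn (𝓡 4) (𝓡 4).tangent ∞
      (fun x => (⟨x, mlieBracket (𝓡 4) V W x⟩ : TangentBundle (𝓡 4) M)) U := by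
  intro x hx
  have : IsManifold (𝓡 4) (((⊤ : ℕ∞) : WithTop ℕ∞) + 1) M := by simpa using! ‹IsManifold (𝓡 4) ∞ M›
  have : IsManifold (𝓡 4) (minSmoothness ℝ 2) M :=
    IsManifold.of_le (n := ∞) (by simpa using two_le_infty)
  exact (ContMDiffAt.mlieBracket_vectorField (m := ⊤) (n := ⊤) (hV.contMDiffAt (hU.mem_nhds hx))
    (hW.contMDiffAt (hU.mem_nhds hx)) (by simp)).contMDiffWithinAt

theorem smoothFn_inner {V W : (y : M) → TangentSpace (𝓡 4) y} (g : Metric M)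
    (hV : ContMDiffOn (𝓡 4) (𝓡 4).tangent ∞ (fun x => (⟨x, V x⟩ : TangentBundle (𝓡 4) M)) U)
    (hW : ContMDiffOn (𝓡 4) (𝓡 4).tangent ∞ (fun x => (⟨x, W x⟩ : TangentBundle (𝓡 4) M)) U) :
    SmoothFn (fun x => ((g.inner x (V x) (W x) : ℝ) : ℂ)) U := by
  have h : ContMDiffOn (𝓡 4) ((𝓡 4).prod 𝓘(ℝ)) ∞
      (fun m ↦ Bundle.TotalSpace.mk' ℝ (E := Bundle.Trivial M ℝ) m (g.inner m (V m) (W m))) U := by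
    apply ContMDiffOn.clm_bundle_apply₂ (F₁ := R4) (F₂ := R4)
    · exact g.contMDiff.contMDiffOn
    · exact hV
    · exact hW
  have h2 : ContMDiffOn (𝓡 4) 𝓘(ℝ) ∞ (fun m => g.inner m (V m) (W m)) U := by
    intro y hy
    have := h y hy
    simp only [Bundle.contMDiffWithinAt_totalSpace] at this
    exact this.2
  exact Complex.ofRealCLM.contDiff.contMDiff.comp_contMDiffOn h2

theorem IsOrthonormalFrame.smooth_structureFn (hE : IsOrthonormalFrame g E U) (hU : IsOpen U)
    (a b c : Fin 4) : SmoothFn (structureFn g E a b c) U :=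
  smoothFn_inner g (contMDiffOn_mlieBracket hU (hE.smooth a) (hE.smooth b)) (hE.smooth c)

theorem structureFn_swap (g : Metric M) (E : Frame M) (a b c : Fin 4) (x : M) :
    structureFn g E a b c x = -structureFn g E b a c x := by
  simp only [structureFn]
  rw [mlieBracket_swap_apply]
  simp

/-- Differentials of smooth functions separate tangent vectors. -/
theorem IsOrthonormalFrame.eq_zero_of_forall_D (hE : IsOrthonormalFrame g E U) (hU : IsOpen U)
    (hx : x ∈ U) {u : Fin 4 → ℂ}
    (h : ∀ V ⊆ U, IsOpen V → x ∈ V → ∀ f : M → ℂ, SmoothFn f V → ∑ a, u a * D E a f x = 0)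
    (d : Fin 4) : u d = 0 := by
  have : IsManifold (𝓡 4) 1 M := IsManifold.of_le (n := ∞) (by simp)
  set φ := extChartAt (𝓡 4) x with hφ
  -- The test function is a linear functional composed with the chart, chosen so that its
  -- differential at `x` is `g(E_d, ·)`. It is smooth only on the chart domain, which is why the
  -- hypothesis ranges over smaller neighbourhoods.
  let L : TangentSpace (𝓡 4) x →L[ℝ] ℂ := Complex.ofRealCLM.comp (g.inner x (E d x))
  let L' : R4 →L[ℝ] ℂ := L.comp (mfderiv (𝓡 4) 𝓘(ℝ, R4) φ x).inverse
  have hs : IsOpen φ.source := isOpen_extChartAt_source x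
  have hsm : SmoothFn (fun y => L' (φ y)) (U ∩ φ.source) := by
    refine L'.contDiff.contMDiff.comp_contMDiffOn ?_
    exact (contMDiffOn_extChartAt (n := ∞) (I := 𝓡 4) (x := x)).mono
      (by rw [← extChartAt_source (𝓡 4)]; exact Set.inter_subset_right)
  have h1 := h (U ∩ φ.source) Set.inter_subset_left (hU.inter hs)
    ⟨hx, mem_extChartAt_source x⟩ _ hsm
  have hD : ∀ a, D E a (fun y => L' (φ y)) x = if d = a then 1 else 0 := by
    intro a
    have hc := mfderiv_comp x (I'' := 𝓘(ℝ, ℂ)) (g := L') L'.differentiableAt.mdifferentiableAt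
      (mdifferentiableAt_extChartAt (I := 𝓡 4) (mem_chart_source R4 x))
    rw [mfderiv_eq_fderiv, L'.fderiv] at hc
    have h2 : D E a (fun y => L' (φ y)) x = L' (mfderiv (𝓡 4) 𝓘(ℝ, R4) φ x (E a x)) :=
      congrArg (fun T => T (E a x)) hc
    have h3 : (mfderiv (𝓡 4) 𝓘(ℝ, R4) φ x).inverse (mfderiv (𝓡 4) 𝓘(ℝ, R4) φ x (E a x)) = E a x := by
      obtain ⟨T, hT⟩ := isInvertible_mfderiv_extChartAt (I := 𝓡 4) (mem_extChartAt_source (I := 𝓡 4) x)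
      rw [← hφ] at hT
      rw [← hT, ContinuousLinearMap.inverse_equiv]
      exact T.symm_apply_apply _
    rw [h2]
    refine (congrArg L h3).trans ?_
    change ((g.inner x (E d x) (E a x) : ℝ) : ℂ) = _
    rw [hE.orthonormal x hx]
    split_ifs <;> simp
  simpa [hD] using h1

/-- The Jacobi identity for the structure functions. -/
theorem IsOrthonormalFrame.jacobi (hE : IsOrthonormalFrame g E U) (hU : IsOpen U)
    (hx : x ∈ U) (a b c d : Fin 4) :
    D E a (structureFn g E b c d) x + D E b (structureFn g E c a d) x
      + D E c (structureFn g E a b d) x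
      + ∑ e, (structureFn g E b c e x * structureFn g E a e d x
        + structureFn g E c a e x * structureFn g E b e d x
        + structureFn g E a b e x * structureFn g E c e d x) = 0 := by
  refine hE.eq_zero_of_forall_D hU hx (u := fun d => D E a (structureFn g E b c d) x
      + D E b (structureFn g E c a d) x + D E c (structureFn g E a b d) x
      + ∑ e, (structureFn g E b c e x * structureFn g E a e d x
        + structureFn g E c a e x * structureFn g E b e d x
        + structureFn g E a b e x * structureFn g E c e d x)) (fun V hVU hV hxV f hf => ?_) d
  have hEV := hE.mono hVU
  have hsm := hEV.smooth_structureFn hV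
  have hD := fun a {f : M → ℂ} (hf : SmoothFn f V) => hEV.smooth_D hV a hf
  have key : ∀ a b c, D E a (D E b (D E c f)) x - D E a (D E c (D E b f)) x =
      ∑ d, (D E a (structureFn g E b c d) x * D E d f x
        + structureFn g E b c d x * D E a (D E d f) x) := by
    intro a b c
    rw [← D_sub hV hxV a (hD b (hD c hf)) (hD c (hD b hf)),
      D_congr hV hxV a (fun y hy => hEV.D_comm hV hy b c hf),
      D_sum hV hxV a (fun d => (hsm b c d).mul (hD d hf))]
    refine Finset.sum_congr rfl fun d _ => ?_
    rw [D_mul hV hxV a (hsm b c d) (hD d hf)]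
    ring
  have k1 := key a b c
  have k2 := key b c a
  have k3 := key c a b
  have c1 := fun e => hEV.D_comm hV hxV a e hf
  have c2 := fun e => hEV.D_comm hV hxV b e hf
  have c3 := fun e => hEV.D_comm hV hxV c e hf
  have d1 := hEV.D_comm hV hxV a b (hD c hf)
  have d2 := hEV.D_comm hV hxV b c (hD a hf)
  have d3 := hEV.D_comm hV hxV c a (hD b hf)
  simp only [Fin.sum_univ_four] at k1 k2 k3 c1 c2 c3 d1 d2 d3 ⊢
  -- The cyclic sum of `[E_a, [E_b, E_c]] f` vanishes identically. Expanded by `k1`, `k2`, `k3` and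
  -- reordered by the commutators, it is the Jacobi expression contracted with the differential of
  -- an arbitrary `f`.
  linear_combination -k1 - k2 - k3 + d1 + d2 + d3
    - structureFn g E b c 0 x * c1 0 - structureFn g E b c 1 x * c1 1
    - structureFn g E b c 2 x * c1 2 - structureFn g E b c 3 x * c1 3
    - structureFn g E c a 0 x * c2 0 - structureFn g E c a 1 x * c2 1
    - structureFn g E c a 2 x * c2 2 - structureFn g E c a 3 x * c2 3
    - structureFn g E a b 0 x * c3 0 - structureFn g E a b 1 x * c3 1
    - structureFn g E a b 2 x * c3 2 - structureFn g E a b 3 x * c3 3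

end Frames

/-! ### The Levi-Civita connection and the symmetries of its curvature -/

section LeviCivita

variable {M : Type*} [TopologicalSpace M] [ChartedSpace R4 M] [IsManifold (𝓡 4) ∞ M]
  {U : Set M} {x : M} {g : Metric M} {E : Frame M}

/-- In an orthonormal frame the metric components are constant, so only the structure functions
survive in the Koszul formula. -/
theorem leviCivita_eq (g : Metric M) (E : Frame M) (a b d : Fin 4) : leviCivita g E a b d =
    fun x => (1 / 2) * (structureFn g E a b d x - structureFn g E a d b x
      - structureFn g E b d a x) := by
  funext x
  simp [leviCivita, christoffel, background, D_const, Matrix.one_apply]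

theorem leviCivita_swap (g : Metric M) (E : Frame M) (a b d : Fin 4) (x : M) :
    leviCivita g E a b d x = -leviCivita g E a d b x := by
  simp only [leviCivita_eq]
  rw [structureFn_swap g E d b a]
  ring

theorem leviCivita_torsion (g : Metric M) (E : Frame M) (a b d : Fin 4) (x : M) :
    leviCivita g E a b d x - leviCivita g E b a d x = structureFn g E a b d x := by
  simp only [leviCivita_eq]
  rw [structureFn_swap g E b a d]
  ring

theorem IsOrthonormalFrame.smooth_leviCivita (hE : IsOrthonormalFrame g E U) (hU : IsOpen U)
    (a b d : Fin 4) : SmoothFn (leviCivita g E a b d) U := by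
  have h1 := hE.smooth_structureFn hU a b d
  have h2 := hE.smooth_structureFn hU a d b
  have h3 := hE.smooth_structureFn hU b d a
  rw [leviCivita_eq]
  fun_prop

/-- The curvature `R_{abc}{}^d` of the Levi-Civita connection of `g`. -/
noncomputable def curv (g : Metric M) (E : Frame M) (a b c d : Fin 4) : M → ℂ :=
  riemann g E background a b c d

theorem curv_eq (g : Metric M) (E : Frame M) (a b c d : Fin 4) (x : M) :
    curv g E a b c d x = D E a (leviCivita g E b c d) x - D E b (leviCivita g E a c d) x
    + ∑ e, (leviCivita g E b c e x * leviCivita g E a e d x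
      - leviCivita g E a c e x * leviCivita g E b e d x
      - structureFn g E a b e x * leviCivita g E e c d x) := rfl

theorem curv_swap_left (g : Metric M) (E : Frame M) (a b c d : Fin 4) (x : M) :
    curv g E a b c d x = -curv g E b a c d x := by
  simp only [curv_eq, structureFn_swap g E b a, Fin.sum_univ_four]
  ring

/-- The connection is metric: its matrices lie in `so(4)`, hence so do their derivatives and
commutators. -/
theorem IsOrthonormalFrame.curv_swap_right (hE : IsOrthonormalFrame g E U) (hU : IsOpen U)
    (hx : x ∈ U) (a b c d : Fin 4) : curv g E a b c d x = -curv g E a b d c x := by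
  have h1 : ∀ a b c d, D E a (leviCivita g E b c d) x = -D E a (leviCivita g E b d c) x := by
    intro a b c d
    rw [D_congr hU hx a (fun y _ => leviCivita_swap g E b c d y),
      D_neg hU hx a (hE.smooth_leviCivita hU b d c)]
  have h2 := leviCivita_swap g E
  rw [curv_eq, curv_eq, h1 a, h1 b]
  have h3 : ∀ e, leviCivita g E b c e x * leviCivita g E a e d x
      = leviCivita g E a d e x * leviCivita g E b e c x := fun e => by
    rw [h2 b c e, h2 a e d]; ring
  have h4 : ∀ e, leviCivita g E a c e x * leviCivita g E b e d x
      = leviCivita g E b d e x * leviCivita g E a e c x := fun e => by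
    rw [h2 a c e, h2 b e d]; ring
  simp only [h3, h4, Finset.sum_sub_distrib]
  have h5 : ∑ e, structureFn g E a b e x * leviCivita g E e c d x
      = -∑ e, structureFn g E a b e x * leviCivita g E e d c x := by
    rw [← Finset.sum_neg_distrib]
    exact Finset.sum_congr rfl fun e _ => by rw [h2 e c d]; ring
  rw [h5]
  ring

/-- Vanishing torsion expresses the structure functions through the connection, and the Jacobi
identity becomes the first Bianchi identity. -/
theorem IsOrthonormalFrame.bianchi (hE : IsOrthonormalFrame g E U) (hU : IsOpen U)
    (hx : x ∈ U) (a b c d : Fin 4) :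
    curv g E a b c d x + curv g E b c a d x + curv g E c a b d x = 0 := by
  have hsm := hE.smooth_leviCivita hU
  have hD : ∀ a b c, D E a (structureFn g E b c d) x
      = D E a (leviCivita g E b c d) x - D E a (leviCivita g E c b d) x := by
    intro a b c
    rw [← D_sub hU hx a (hsm b c d) (hsm c b d)]
    exact D_congr hU hx a fun y _ => (leviCivita_torsion g E b c d y).symm
  have hj := hE.jacobi hU hx a b c d
  rw [hD, hD, hD] at hj
  have t := fun a b d => (leviCivita_torsion g E a b d x).symm
  simp only [curv_eq, Fin.sum_univ_four, t] at hj ⊢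
  linear_combination hj

/-- The classical octahedron argument: four Bianchi identities, one for each cyclic rotation of `a b
c d`, combined with signs. -/
theorem curv_pair_of_symmetries {R : Fin 4 → Fin 4 → Fin 4 → Fin 4 → ℂ}
    (h1 : ∀ a b c d, R a b c d = -R b a c d) (h2 : ∀ a b c d, R a b c d = -R a b d c)
    (h3 : ∀ a b c d, R a b c d + R b c a d + R c a b d = 0) (a b c d : Fin 4) :
    R a b c d = R c d a b := by
  have e1 := h3 a b c d
  have e2 := h3 b c d a
  have e3 := h3 c d a b
  have e4 := h3 d a b c
  rw [h2 b c a d, h1 c a b d] at e1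
  rw [h2 c d b a, h1 d b c a] at e2
  rw [h2 d a c b, h2 a c d b] at e3
  rw [h2 a b d c, h2 b d a c] at e4
  linear_combination (1 / 2) * (e1 + e2 - e3 - e4)

end LeviCivita

/-! ### Infeld-van der Waerden symbols and the splitting of `so(4)` -/

section SpinorAlgebra

/-- In quadratic expressions in the symbols `σ` the normalising factor occurs only squared, so this
is all that has to be known about it. -/
theorem inv_sqrt_two_mul_self : ((Real.sqrt 2 : ℂ))⁻¹ * ((Real.sqrt 2 : ℂ))⁻¹ = 1 / 2 := by
  rw [← mul_inv, ← Complex.ofReal_mul, Real.mul_self_sqrt (by norm_num)]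
  norm_num

theorem eps_zero_zero : eps 0 0 = 0 := rfl
theorem eps_zero_one : eps 0 1 = 1 := rfl
theorem eps_one_zero : eps 1 0 = -1 := rfl
theorem eps_one_one : eps 1 1 = 0 := rfl

theorem eps_swap (A B : Fin 2) : eps A B = -eps B A := by
  fin_cases A <;> fin_cases B <;> simp [eps]

theorem sum_sigmaLow_mul_sigma (A X B Y : Fin 2) :
    ∑ a, sigmaLow a A X * sigma a B Y = (if A = B then 1 else 0) * (if X = Y then 1 else 0) := by
  have h := inv_sqrt_two_mul_self
  fin_cases A <;> fin_cases X <;> fin_cases B <;> fin_cases Y <;>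
  simp [sigmaLow, sigma, eps, Fin.sum_univ_four] <;> ring_nf <;>
  simp [Complex.I_sq, ← mul_inv, pow_two, h] <;> norm_num

theorem sum_sigma_mul_sigmaLow (a b : Fin 4) :
    ∑ A, ∑ X, sigma a A X * sigmaLow b A X = if a = b then 1 else 0 := by
  have h := inv_sqrt_two_mul_self
  fin_cases a <;> fin_cases b <;>
  simp [sigmaLow, sigma, eps] <;> ring_nf <;>
  simp [Complex.I_sq, ← mul_inv, pow_two, h] <;> norm_num

theorem sum_sigmaLow_mul_sigmaLow (A X B Y : Fin 2) :
    ∑ a, sigmaLow a A X * sigmaLow a B Y = eps A B * eps X Y := by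
  have h := inv_sqrt_two_mul_self
  fin_cases A <;> fin_cases X <;> fin_cases B <;> fin_cases Y <;>
  simp [sigmaLow, sigma, eps, Fin.sum_univ_four] <;> ring_nf <;>
  simp [Complex.I_sq, ← mul_inv, pow_two, h] <;> norm_num

/-- The unprimed part of a matrix `G_c{}^b` in `so(4)`. -/
noncomputable def spinPart (G : Fin 4 → Fin 4 → ℂ) (C B : Fin 2) : ℂ :=
  (1 / 2) * ∑ b, ∑ c, ∑ X, G c b * sigma b B X * sigmaLow c C X

/-- The primed part of a matrix `G_c{}^b` in `so(4)`. -/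
noncomputable def spinPartPrimed (G : Fin 4 → Fin 4 → ℂ) (C B : Fin 2) : ℂ :=
  (1 / 2) * ∑ b, ∑ c, ∑ X, G c b * sigma b X B * sigmaLow c X C

/-- In `so(4, ℂ) = sl(2) ⊕ sl(2)` the unprimed factor is the anti-self-dual one: only `G₀₁ - G₂₃`,
`G₀₂ + G₁₃` and `G₀₃ - G₁₂` enter, so that `spinPart` vanishes exactly on self-dual matrices. The
primed factor sees the complementary combinations. -/
theorem spinPart_antisymm {G : Fin 4 → Fin 4 → ℂ} (hG : ∀ b c, G b c = -G c b) :
    spinPart G 0 0 = Complex.I / 2 * (G 0 3 - G 1 2) ∧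
    spinPart G 0 1 = (Complex.I * (G 0 1 - G 2 3) - G 0 2 - G 1 3) / 2 ∧
    spinPart G 1 0 = (Complex.I * (G 0 1 - G 2 3) + G 0 2 + G 1 3) / 2 ∧
    spinPart G 1 1 = -(Complex.I / 2 * (G 0 3 - G 1 2)) := by
  have h := inv_sqrt_two_mul_self
  have h0 : ∀ b, G b b = 0 := fun b => by linear_combination (1 / 2) * hG b b
  refine ⟨?_, ?_, ?_, ?_⟩ <;>
  simp [spinPart, sigmaLow, sigma, eps, Fin.sum_univ_four, h0, hG 1 0, hG 2 0, hG 3 0, hG 2 1,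
    hG 3 1, hG 3 2] <;> ring_nf <;>
  simp [Complex.I_sq, ← mul_inv, pow_two, h] <;> ring

theorem spinPartPrimed_antisymm {G : Fin 4 → Fin 4 → ℂ} (hG : ∀ b c, G b c = -G c b) :
    spinPartPrimed G 0 0 = Complex.I / 2 * (G 0 3 + G 1 2) ∧
    spinPartPrimed G 0 1 = (Complex.I * (G 0 1 + G 2 3) + G 0 2 - G 1 3) / 2 ∧
    spinPartPrimed G 1 0 = (Complex.I * (G 0 1 + G 2 3) - G 0 2 + G 1 3) / 2 ∧
    spinPartPrimed G 1 1 = -(Complex.I / 2 * (G 0 3 + G 1 2)) := by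
  have h := inv_sqrt_two_mul_self
  have h0 : ∀ b, G b b = 0 := fun b => by linear_combination (1 / 2) * hG b b
  refine ⟨?_, ?_, ?_, ?_⟩ <;>
  simp [spinPartPrimed, sigmaLow, sigma, eps, Fin.sum_univ_four, h0, hG 1 0, hG 2 0, hG 3 0,
    hG 2 1, hG 3 1, hG 3 2] <;> ring_nf <;>
  simp [Complex.I_sq, ← mul_inv, pow_two, h] <;> ring

/-- The action of `so(4)` on vectors in spinor terms. -/
theorem sum_sigmaLow_mul_antisymm {G : Fin 4 → Fin 4 → ℂ} (hG : ∀ b c, G b c = -G c b)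
    (b : Fin 4) (C X : Fin 2) :
    ∑ c, sigmaLow c C X * G c b = ∑ B, spinPart G C B * sigmaLow b B X
      + ∑ Y, spinPartPrimed G X Y * sigmaLow b C Y := by
  have h0 : ∀ b, G b b = 0 := fun b => by linear_combination (1 / 2) * hG b b
  obtain ⟨p00, p01, p10, p11⟩ := spinPart_antisymm hG
  obtain ⟨q00, q01, q10, q11⟩ := spinPartPrimed_antisymm hG
  fin_cases b <;> fin_cases C <;> fin_cases X <;>
  simp [sigmaLow, sigma, eps, Fin.sum_univ_four, h0, hG 1 0, hG 2 0, hG 3 0, hG 2 1,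
    hG 3 1, hG 3 2, p00, p01, p10, p11, q00, q01, q10, q11] <;> ring_nf <;>
  simp [Complex.I_sq] <;> ring

/-- Projection onto an ideal summand of `so(4)` is a homomorphism of Lie algebras. This is what
makes the curvature of the spin connection the spin part of the Riemann tensor. -/
theorem spinPart_commutator {G H K : Fin 4 → Fin 4 → ℂ} (hG : ∀ b c, G b c = -G c b)
    (hH : ∀ b c, H b c = -H c b) (hK : ∀ c d, K c d = ∑ e, (G c e * H e d - H c e * G e d))
    (C B : Fin 2) :
    spinPart K C B = ∑ A, (spinPart G C A * spinPart H A B - spinPart H C A * spinPart G A B) := by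
  have hKa : ∀ b c, K b c = -K c b := by
    intro b c
    rw [hK, hK, ← Finset.sum_neg_distrib]
    refine Finset.sum_congr rfl fun e _ => ?_
    rw [hG c e, hG e b, hH c e, hH e b]; ring
  have g0 : ∀ b, G b b = 0 := fun b => by linear_combination (1 / 2) * hG b b
  have h0 : ∀ b, H b b = 0 := fun b => by linear_combination (1 / 2) * hH b b
  obtain ⟨p00, p01, p10, p11⟩ := spinPart_antisymm hG
  obtain ⟨q00, q01, q10, q11⟩ := spinPart_antisymm hH
  obtain ⟨k00, k01, k10, k11⟩ := spinPart_antisymm hKa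
  fin_cases C <;> fin_cases B <;>
  simp [p00, p01, p10, p11, q00, q01, q10, q11, k00, k01, k10, k11, hK, Fin.sum_univ_four, g0, h0,
    hG 1 0, hG 2 0, hG 3 0, hG 2 1, hG 3 1, hG 3 2, hH 1 0, hH 2 0, hH 3 0, hH 2 1, hH 3 1, hH 3 2]
    <;> ring_nf <;> simp only [Complex.I_sq] <;> ring

theorem spinPartPrimed_commutator {G H K : Fin 4 → Fin 4 → ℂ} (hG : ∀ b c, G b c = -G c b)
    (hH : ∀ b c, H b c = -H c b) (hK : ∀ c d, K c d = ∑ e, (G c e * H e d - H c e * G e d))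
    (C B : Fin 2) :
    spinPartPrimed K C B = ∑ A, (spinPartPrimed G C A * spinPartPrimed H A B
      - spinPartPrimed H C A * spinPartPrimed G A B) := by
  have hKa : ∀ b c, K b c = -K c b := by
    intro b c
    rw [hK, hK, ← Finset.sum_neg_distrib]
    refine Finset.sum_congr rfl fun e _ => ?_
    rw [hG c e, hG e b, hH c e, hH e b]; ring
  have g0 : ∀ b, G b b = 0 := fun b => by linear_combination (1 / 2) * hG b b
  have h0 : ∀ b, H b b = 0 := fun b => by linear_combination (1 / 2) * hH b b
  obtain ⟨p00, p01, p10, p11⟩ := spinPartPrimed_antisymm hG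
  obtain ⟨q00, q01, q10, q11⟩ := spinPartPrimed_antisymm hH
  obtain ⟨k00, k01, k10, k11⟩ := spinPartPrimed_antisymm hKa
  fin_cases C <;> fin_cases B <;>
  simp [p00, p01, p10, p11, q00, q01, q10, q11, k00, k01, k10, k11, hK, Fin.sum_univ_four, g0, h0,
    hG 1 0, hG 2 0, hG 3 0, hG 2 1, hG 3 1, hG 3 2, hH 1 0, hH 2 0, hH 3 0, hH 2 1, hH 3 1, hH 3 2]
    <;> ring_nf <;> simp only [Complex.I_sq] <;> ring

end SpinorAlgebra

/-! ### Matrices acting on arrays of indices -/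

section Action

variable {κ : Type*} [Fintype κ] {n m : ℕ}

/-- The action of a matrix on all the (lower) indices of an array. -/
def act (A : κ → κ → ℂ) (φ : (Fin n → κ) → ℂ) (I : Fin n → κ) : ℂ :=
  ∑ k, ∑ b, A (I k) b * φ (Function.update I k b)

theorem act_nil (A : κ → κ → ℂ) (φ : (Fin 0 → κ) → ℂ) (I : Fin 0 → κ) : act A φ I = 0 := by
  simp [act]

theorem act_cons (A : κ → κ → ℂ) (φ : (Fin (n + 1) → κ) → ℂ) (i : κ) (I : Fin n → κ) :
    act A φ (Fin.cons i I : Fin (n + 1) → κ) = ∑ b, A i b * φ (Fin.cons b I : Fin (n + 1) → κ)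
      + act A (fun J => φ (Fin.cons i J : Fin (n + 1) → κ)) I := by
  simp only [act, Fin.sum_univ_succ, Fin.cons_zero, Fin.cons_succ, Fin.update_cons_zero,
    Fin.cons_update]

theorem act_vecCons (A : κ → κ → ℂ) (φ : (Fin (n + 1) → κ) → ℂ) (i : κ) (I : Fin n → κ) :
    act A φ (Matrix.vecCons i I) = ∑ b, A i b * φ (Matrix.vecCons b I)
      + act A (fun J => φ (Matrix.vecCons i J)) I := act_cons A φ i I

theorem act_add (A : κ → κ → ℂ) (φ ψ : (Fin n → κ) → ℂ) (I : Fin n → κ) :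
    act A (fun J => φ J + ψ J) I = act A φ I + act A ψ I := by
  simp only [act, mul_add, Finset.sum_add_distrib]

theorem act_sub (A : κ → κ → ℂ) (φ ψ : (Fin n → κ) → ℂ) (I : Fin n → κ) :
    act A (fun J => φ J - ψ J) I = act A φ I - act A ψ I := by
  simp only [act, mul_sub, Finset.sum_sub_distrib]

theorem act_mul_left (A : κ → κ → ℂ) (z : ℂ) (φ : (Fin n → κ) → ℂ) (I : Fin n → κ) :
    act A (fun J => z * φ J) I = z * act A φ I := by
  simp only [act, Finset.mul_sum, mul_left_comm]

theorem act_sum {τ : Type*} (s : Finset τ) (A : κ → κ → ℂ) (φ : τ → (Fin n → κ) → ℂ)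
    (I : Fin n → κ) : act A (fun J => ∑ t ∈ s, φ t J) I = ∑ t ∈ s, act A (φ t) I := by
  simp only [act, Finset.mul_sum]
  exact (Finset.sum_congr rfl fun k _ => Finset.sum_comm).trans Finset.sum_comm

theorem act_matrix_add (A B : κ → κ → ℂ) (φ : (Fin n → κ) → ℂ) (I : Fin n → κ) :
    act (fun c d => A c d + B c d) φ I = act A φ I + act B φ I := by
  simp only [act, add_mul, Finset.sum_add_distrib]

theorem act_matrix_sub (A B : κ → κ → ℂ) (φ : (Fin n → κ) → ℂ) (I : Fin n → κ) :
    act (fun c d => A c d - B c d) φ I = act A φ I - act B φ I := by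
  simp only [act, sub_mul, Finset.sum_sub_distrib]

theorem act_matrix_mul (z : ℂ) (A : κ → κ → ℂ) (φ : (Fin n → κ) → ℂ) (I : Fin n → κ) :
    act (fun c d => z * A c d) φ I = z * act A φ I := by
  simp only [act, Finset.mul_sum, mul_assoc]

theorem act_matrix_sum {τ : Type*} (s : Finset τ) (A : τ → κ → κ → ℂ) (φ : (Fin n → κ) → ℂ)
    (I : Fin n → κ) :
    act (fun c d => ∑ t ∈ s, A t c d) φ I = ∑ t ∈ s, act (A t) φ I := by
  simp only [act, Finset.sum_mul]
  exact (Finset.sum_congr rfl fun k _ => Finset.sum_comm).trans Finset.sum_comm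

theorem act_perm (A : κ → κ → ℂ) (φ : (Fin n → κ) → ℂ) (I : Fin n → κ)
    (p : Equiv.Perm (Fin n)) : act A φ (I ∘ p) = act A (fun J => φ (J ∘ p)) I := by
  simp only [act]
  refine Fintype.sum_equiv p _ _ fun k => Finset.sum_congr rfl fun b _ => ?_
  have : Function.update (I ∘ p) k b = Function.update I (p k) b ∘ p := by
    funext j
    simp [Function.update_apply]
  rw [this]
  rfl

theorem act_act_comm {κ' : Type*} [Fintype κ'] (A : κ → κ → ℂ) (B : κ' → κ' → ℂ)
    (φ : (Fin n → κ) → (Fin m → κ') → ℂ) (I : Fin n → κ) (X : Fin m → κ') :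
    act A (fun J => act B (φ J) X) I = act B (fun Y => act A (fun J => φ J Y) I) X := by
  have h : ∀ J : Fin n → κ, act B (φ J) X = ∑ k, ∑ b, B (X k) b * φ J (Function.update X k b) :=
    fun _ => rfl
  simp only [h, act_sum, act_mul_left]
  rfl

/-- The actions on different slots commute, so only the commutator within each slot remains; the
induction peels off one slot at a time. -/
theorem act_commutator (A B : κ → κ → ℂ) (φ : (Fin n → κ) → ℂ) (I : Fin n → κ) :
    act A (fun J => act B φ J) I - act B (fun J => act A φ J) I
      = act (fun c d => ∑ e, (A c e * B e d - B c e * A e d)) φ I := by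
  induction n with
  | zero => simp [act]
  | succ n ih =>
    obtain ⟨i, I, rfl⟩ : ∃ i J, I = (Fin.cons i J : Fin (n + 1) → κ) :=
      ⟨I 0, Fin.tail I, (Fin.cons_self_tail I).symm⟩
    simp only [act_cons, act_add, act_sum, act_mul_left, mul_add, Finset.sum_add_distrib]
    rw [← ih]
    have h : ∑ b, (∑ e, (A i e * B e b - B i e * A e b)) * φ (Fin.cons b I)
        = ∑ b, A i b * ∑ c, B b c * φ (Fin.cons c I)
          - ∑ b, B i b * ∑ c, A b c * φ (Fin.cons c I) := by
      simp only [Finset.sum_mul, Finset.mul_sum, sub_mul, Finset.sum_sub_distrib, mul_assoc]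
      congr 1 <;> exact Finset.sum_comm
    rw [h]
    ring

end Action

/-! ### Spin connections and the commutator of covariant derivatives -/

section Covariant

variable {M : Type*} [TopologicalSpace M] [ChartedSpace R4 M] [IsManifold (𝓡 4) ∞ M]
  {U : Set M} {x : M} {g : Metric M} {E : Frame M} {n m : ℕ}

theorem spinConn_eq (g : Metric M) (E : Frame M) (a : Fin 4) (C B : Fin 2) (x : M) :
    spinConn g E a C B x = spinPart (fun c b => leviCivita g E a c b x) C B := rfl

theorem spinConnPrimed_eq (g : Metric M) (E : Frame M) (a : Fin 4) (C B : Fin 2) (x : M) :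
    spinConnPrimed g E a C B x = spinPartPrimed (fun c b => leviCivita g E a c b x) C B := rfl

/-- Tracelessness of the connection matrices is the statement that `ε_{AB}` is parallel, which lets
contractions pass through covariant derivatives. -/
theorem spinConn_trace (g : Metric M) (E : Frame M) (a : Fin 4) (x : M) :
    spinConn g E a 1 1 x = -spinConn g E a 0 0 x := by
  obtain ⟨h0, -, -, h1⟩ := spinPart_antisymm fun b c => leviCivita_swap g E a b c x
  rw [spinConn_eq, spinConn_eq, h0, h1]

theorem spinConnPrimed_trace (g : Metric M) (E : Frame M) (a : Fin 4) (x : M) :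
    spinConnPrimed g E a 1 1 x = -spinConnPrimed g E a 0 0 x := by
  obtain ⟨h0, -, -, h1⟩ := spinPartPrimed_antisymm fun b c => leviCivita_swap g E a b c x
  rw [spinConnPrimed_eq, spinConnPrimed_eq, h0, h1]

theorem IsOrthonormalFrame.smooth_spinConn (hE : IsOrthonormalFrame g E U) (hU : IsOpen U)
    (a : Fin 4) (C B : Fin 2) : SmoothFn (spinConn g E a C B) U := by
  have := hE.smooth_leviCivita hU a
  unfold spinConn
  fun_prop

theorem IsOrthonormalFrame.smooth_spinConnPrimed (hE : IsOrthonormalFrame g E U) (hU : IsOpen U)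
    (a : Fin 4) (C B : Fin 2) : SmoothFn (spinConnPrimed g E a C B) U := by
  have := hE.smooth_leviCivita hU a
  unfold spinConnPrimed
  fun_prop

/-- The curvature of the unprimed spin bundle. -/
noncomputable def spinCurv (g : Metric M) (E : Frame M) (a b : Fin 4) (C B : Fin 2) : M → ℂ :=
  fun x => spinPart (fun c d => curv g E a b c d x) C B

/-- The curvature of the primed spin bundle. -/
noncomputable def spinCurvPrimed (g : Metric M) (E : Frame M) (a b : Fin 4) (C B : Fin 2) :
    M → ℂ := fun x => spinPartPrimed (fun c d => curv g E a b c d x) C B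

theorem IsOrthonormalFrame.D_spinConn (hE : IsOrthonormalFrame g E U) (hU : IsOpen U)
    (hx : x ∈ U) (e a : Fin 4) (C B : Fin 2) : D E e (spinConn g E a C B) x
      = spinPart (fun c b => D E e (leviCivita g E a c b) x) C B := by
  have h := hE.smooth_leviCivita hU a
  unfold spinConn spinPart
  rw [D_const_mul hU hx _ _ (by fun_prop)]
  congr 1
  rw [D_sum hU hx _ (fun b => by fun_prop)]
  refine Finset.sum_congr rfl fun b _ => ?_
  rw [D_sum hU hx _ (fun b => by fun_prop)]
  refine Finset.sum_congr rfl fun c _ => ?_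
  rw [D_sum hU hx _ (fun b => by fun_prop)]
  refine Finset.sum_congr rfl fun X _ => ?_
  rw [D_mul hU hx _ (by fun_prop) (by fun_prop), D_mul hU hx _ (by fun_prop) (by fun_prop),
    D_const, D_const]
  ring

theorem IsOrthonormalFrame.D_spinConnPrimed (hE : IsOrthonormalFrame g E U) (hU : IsOpen U)
    (hx : x ∈ U) (e a : Fin 4) (C B : Fin 2) : D E e (spinConnPrimed g E a C B) x
      = spinPartPrimed (fun c b => D E e (leviCivita g E a c b) x) C B := by
  have h := hE.smooth_leviCivita hU a
  unfold spinConnPrimed spinPartPrimed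
  rw [D_const_mul hU hx _ _ (by fun_prop)]
  congr 1
  rw [D_sum hU hx _ (fun b => by fun_prop)]
  refine Finset.sum_congr rfl fun b _ => ?_
  rw [D_sum hU hx _ (fun b => by fun_prop)]
  refine Finset.sum_congr rfl fun c _ => ?_
  rw [D_sum hU hx _ (fun b => by fun_prop)]
  refine Finset.sum_congr rfl fun X _ => ?_
  rw [D_mul hU hx _ (by fun_prop) (by fun_prop), D_mul hU hx _ (by fun_prop) (by fun_prop),
    D_const, D_const]
  ring

/-- All terms of the Riemann tensor are linear in the connection except the commutator, and
`spinPart` respects that one too. -/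
theorem IsOrthonormalFrame.spinCurv_eq (hE : IsOrthonormalFrame g E U) (hU : IsOpen U)
    (hx : x ∈ U) (a b : Fin 4) (C B : Fin 2) : spinCurv g E a b C B x =
      D E a (spinConn g E b C B) x - D E b (spinConn g E a C B) x
      + ∑ A, (spinConn g E b C A x * spinConn g E a A B x
        - spinConn g E a C A x * spinConn g E b A B x)
      - ∑ e, structureFn g E a b e x * spinConn g E e C B x := by
  have hc := spinPart_commutator (fun c d => leviCivita_swap g E b c d x)
    (fun c d => leviCivita_swap g E a c d x) (K := fun c d =>
      ∑ e, (leviCivita g E b c e x * leviCivita g E a e d x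
        - leviCivita g E a c e x * leviCivita g E b e d x)) (fun c d => rfl) C B
  simp only [hE.D_spinConn hU hx, spinConn_eq, ← hc]
  simp only [spinCurv, spinPart, curv_eq, Fin.sum_univ_four, Fin.sum_univ_two]
  ring

theorem IsOrthonormalFrame.spinCurvPrimed_eq (hE : IsOrthonormalFrame g E U) (hU : IsOpen U)
    (hx : x ∈ U) (a b : Fin 4) (C B : Fin 2) : spinCurvPrimed g E a b C B x =
      D E a (spinConnPrimed g E b C B) x - D E b (spinConnPrimed g E a C B) x
      + ∑ A, (spinConnPrimed g E b C A x * spinConnPrimed g E a A B x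
        - spinConnPrimed g E a C A x * spinConnPrimed g E b A B x)
      - ∑ e, structureFn g E a b e x * spinConnPrimed g E e C B x := by
  have hc := spinPartPrimed_commutator (fun c d => leviCivita_swap g E b c d x)
    (fun c d => leviCivita_swap g E a c d x) (K := fun c d =>
      ∑ e, (leviCivita g E b c e x * leviCivita g E a e d x
        - leviCivita g E a c e x * leviCivita g E b e d x)) (fun c d => rfl) C B
  simp only [hE.D_spinConnPrimed hU hx, spinConnPrimed_eq, ← hc]
  simp only [spinCurvPrimed, spinPartPrimed, curv_eq, Fin.sum_univ_four, Fin.sum_univ_two]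
  ring

theorem covS_eq (g : Metric M) (E : Frame M) (a : Fin 4) (φ : SpinorField M n m)
    (I : Fin n → Fin 2) (X : Fin m → Fin 2) (x : M) : covS g E a φ I X x = D E a (φ I X) x
      - act (fun C B => spinConn g E a C B x) (fun J => φ J X x) I
      - act (fun C B => spinConnPrimed g E a C B x) (fun Y => φ I Y x) X := rfl

theorem nabla_cons (g : Metric M) (E : Frame M) (φ : SpinorField M n m) (A V : Fin 2)
    (I : Fin n → Fin 2) (X : Fin m → Fin 2) (x : M) :
    nabla g E φ (Matrix.vecCons A I) (Matrix.vecCons V X) x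
      = ∑ a, sigmaLow a A V * covS g E a φ I X x := rfl

theorem nablaT_cons (g : Metric M) (E : Frame M) (T : TensorField M n) (a : Fin 4)
    (I : Fin n → Fin 4) (x : M) : nablaT g E T (Matrix.vecCons a I) x = D E a (T I) x
      - act (fun c b => leviCivita g E a c b x) (fun J => T J x) I := rfl

@[fun_prop] theorem SmoothFn.act {κ : Type*} [Fintype κ] {A : κ → κ → M → ℂ}
    {φ : (Fin n → κ) → M → ℂ} (hA : ∀ c b, SmoothFn (A c b) U) (hφ : ∀ I, SmoothFn (φ I) U)
    (I : Fin n → κ) : SmoothFn (fun x => act (fun c b => A c b x) (fun J => φ J x) I) U := by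
  unfold QK.act
  fun_prop

theorem D_act {κ : Type*} [Fintype κ] {A : κ → κ → M → ℂ} {φ : (Fin n → κ) → M → ℂ}
    (hU : IsOpen U) (hx : x ∈ U) (hA : ∀ c b, SmoothFn (A c b) U) (hφ : ∀ I, SmoothFn (φ I) U)
    (a : Fin 4) (I : Fin n → κ) : D E a (fun x => act (fun c b => A c b x) (fun J => φ J x) I) x
      = act (fun c b => D E a (A c b) x) (fun J => φ J x) I
        + act (fun c b => A c b x) (fun J => D E a (φ J) x) I := by
  unfold QK.act
  rw [D_sum hU hx _ (fun k => by fun_prop), ← Finset.sum_add_distrib]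
  refine Finset.sum_congr rfl fun k _ => ?_
  rw [D_sum hU hx _ (fun k => by fun_prop), ← Finset.sum_add_distrib]
  refine Finset.sum_congr rfl fun b _ => ?_
  rw [D_mul hU hx _ (hA _ _) (hφ _)]
  ring

theorem SmoothSpinor.covS (hE : IsOrthonormalFrame g E U) (hU : IsOpen U)
    {φ : SpinorField M n m} (hφ : SmoothSpinor φ U) (a : Fin 4) :
    SmoothSpinor (covS g E a φ) U := by
  intro I X
  have h1 := hE.smooth_spinConn hU a
  have h2 := hE.smooth_spinConnPrimed hU a
  have h3 := hE.smooth_D hU a (hφ I X)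
  have h4 := SmoothFn.act h1 (fun J => hφ J X) I
  have h5 := SmoothFn.act h2 (fun Y => hφ I Y) X
  exact (h3.sub h4).sub h5

theorem SmoothSpinor.nabla (hE : IsOrthonormalFrame g E U) (hU : IsOpen U)
    {φ : SpinorField M n m} (hφ : SmoothSpinor φ U) : SmoothSpinor (nabla g E φ) U := by
  intro I X
  have h : ∀ a, SmoothFn (QK.covS g E a φ (Fin.tail I) (Fin.tail X)) U :=
    fun a => hφ.covS hE hU a _ _
  unfold QK.nabla
  fun_prop

theorem covS_congr {φ ψ : SpinorField M n m} (hU : IsOpen U) (hx : x ∈ U)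
    (h : ∀ y ∈ U, ∀ I X, φ I X y = ψ I X y) (a : Fin 4) (I : Fin n → Fin 2) (X : Fin m → Fin 2) :
    covS g E a φ I X x = covS g E a ψ I X x := by
  simp only [covS_eq, D_congr hU hx a (fun y hy => h y hy I X), h x hx]

theorem nabla_congr {φ ψ : SpinorField M n m} (hU : IsOpen U) (hx : x ∈ U)
    (h : ∀ y ∈ U, ∀ I X, φ I X y = ψ I X y) (I : Fin (n + 1) → Fin 2) (X : Fin (m + 1) → Fin 2) :
    nabla g E φ I X x = nabla g E ψ I X x := by
  simp only [nabla, covS_congr hU hx h]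

/-- The commutator of covariant derivatives along the frame. -/
theorem IsOrthonormalFrame.covS_comm (hE : IsOrthonormalFrame g E U) (hU : IsOpen U)
    (hx : x ∈ U) {φ : SpinorField M n m} (hφ : SmoothSpinor φ U) (a b : Fin 4)
    (I : Fin n → Fin 2) (X : Fin m → Fin 2) :
    covS g E a (covS g E b φ) I X x - covS g E b (covS g E a φ) I X x
      = ∑ e, structureFn g E a b e x * covS g E e φ I X x
        - act (fun C B => spinCurv g E a b C B x) (fun J => φ J X x) I
        - act (fun C B => spinCurvPrimed g E a b C B x) (fun Y => φ I Y x) X := by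
  have key : ∀ a b, covS g E a (covS g E b φ) I X x = D E a (D E b (φ I X)) x
      - act (fun C B => D E a (spinConn g E b C B) x) (fun J => φ J X x) I
      - act (fun C B => spinConn g E b C B x) (fun J => D E a (φ J X) x) I
      - act (fun C B => D E a (spinConnPrimed g E b C B) x) (fun Y => φ I Y x) X
      - act (fun C B => spinConnPrimed g E b C B x) (fun Y => D E a (φ I Y) x) X
      - act (fun C B => spinConn g E a C B x) (fun J => D E b (φ J X) x) I
      + act (fun C B => spinConn g E a C B x) (fun J =>
          act (fun C B => spinConn g E b C B x) (fun J => φ J X x) J) I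
      + act (fun C B => spinConn g E a C B x) (fun J =>
          act (fun C B => spinConnPrimed g E b C B x) (fun Y => φ J Y x) X) I
      - act (fun C B => spinConnPrimed g E a C B x) (fun Y => D E b (φ I Y) x) X
      + act (fun C B => spinConn g E b C B x) (fun J =>
          act (fun C B => spinConnPrimed g E a C B x) (fun Y => φ J Y x) X) I
      + act (fun C B => spinConnPrimed g E a C B x) (fun Y =>
          act (fun C B => spinConnPrimed g E b C B x) (fun Y => φ I Y x) Y) X := by
    intro a b
    have s1 := hE.smooth_spinConn hU
    have s2 := hE.smooth_spinConnPrimed hU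
    have h1 := SmoothFn.act (s1 b) (fun J => hφ J X) I
    have h2 := SmoothFn.act (s2 b) (fun Y => hφ I Y) X
    have hD : D E a (covS g E b φ I X) x = D E a (fun y => D E b (φ I X) y
      - act (fun C B => spinConn g E b C B y) (fun J => φ J X y) I
      - act (fun C B => spinConnPrimed g E b C B y) (fun Y => φ I Y y) X) x := rfl
    rw [covS_eq, hD, D_sub hU hx a ((hE.smooth_D hU b (hφ I X)).sub h1) h2,
      D_sub hU hx a (hE.smooth_D hU b (hφ I X)) h1, D_act hU hx (s1 b) (fun J => hφ J X),
      D_act hU hx (s2 b) (fun Y => hφ I Y)]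
    simp only [covS_eq, act_sub]
    -- With this term reordered, the mixed primed and unprimed terms are together symmetric in `a`
    -- and `b` and cancel from the commutator.
    rw [act_act_comm (fun C B => spinConn g E b C B x) (fun C B => spinConnPrimed g E a C B x)
      (fun J Y => φ J Y x)]
    ring
  have hc1 := act_commutator (fun C B => spinConn g E b C B x) (fun C B => spinConn g E a C B x)
    (fun J => φ J X x) I
  have hc2 := act_commutator (fun C B => spinConnPrimed g E b C B x)
    (fun C B => spinConnPrimed g E a C B x) (fun Y => φ I Y x) X
  have hd := hE.D_comm hU hx a b (hφ I X)
  have hs : ∀ C B, spinCurv g E a b C B x = _ := hE.spinCurv_eq hU hx a b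
  have hs' : ∀ C B, spinCurvPrimed g E a b C B x = _ := hE.spinCurvPrimed_eq hU hx a b
  simp only [key, hs, hs', act_matrix_sub, act_matrix_add, act_matrix_sum, act_matrix_mul, covS_eq,
    mul_sub, Finset.sum_sub_distrib] at hc1 hc2 ⊢
  linear_combination hd - hc1 - hc2

end Covariant

/-! ### The Ricci identity in spinor indices and translation of tensors to spinors -/

section SecondDerivatives

variable {M : Type*} [TopologicalSpace M] [ChartedSpace R4 M] [IsManifold (𝓡 4) ∞ M]
  {U : Set M} {x : M} {g : Metric M} {E : Frame M} {n m : ℕ}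

/-- The symbols `σ` are parallel: the two spin connections acting on the inner derivative's spinor
indices recombine into the Levi-Civita connection acting on its frame index. -/
theorem IsOrthonormalFrame.nabla_nabla (hE : IsOrthonormalFrame g E U) (hU : IsOpen U)
    (hx : x ∈ U) {φ : SpinorField M n m} (hφ : SmoothSpinor φ U) (A B V Y : Fin 2)
    (I : Fin n → Fin 2) (X : Fin m → Fin 2) :
    nabla g E (nabla g E φ) (Matrix.vecCons A (Matrix.vecCons B I))
      (Matrix.vecCons V (Matrix.vecCons Y X)) x
    = ∑ a, ∑ b, sigmaLow a A V * sigmaLow b B Y * (covS g E a (covS g E b φ) I X x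
      - ∑ d, leviCivita g E a b d x * covS g E d φ I X x) := by
  rw [nabla_cons]
  refine Finset.sum_congr rfl fun a _ => ?_
  have hs := hφ.covS hE hU
  have hD : D E a (nabla g E φ (Matrix.vecCons B I) (Matrix.vecCons Y X)) x
      = ∑ b, sigmaLow b B Y * D E a (covS g E b φ I X) x := by
    have h : nabla g E φ (Matrix.vecCons B I) (Matrix.vecCons Y X)
      = fun y => ∑ b, sigmaLow b B Y * covS g E b φ I X y := rfl
    rw [h, D_sum hU hx a (fun b => (SmoothFn.const _).mul (hs b I X))]
    exact Finset.sum_congr rfl fun b _ => D_const_mul hU hx a _ (hs b I X)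
  rw [covS_eq, hD, act_vecCons, act_vecCons]
  simp only [nabla_cons, act_sum, act_mul_left]
  have hc := fun d => sum_sigmaLow_mul_antisymm
    (G := fun c b => leviCivita g E a c b x) (fun c b => leviCivita_swap g E a c b x) d B Y
  have e1 : ∑ b, sigmaLow b B Y * ∑ d, leviCivita g E a b d x * covS g E d φ I X x
      = ∑ b, spinConn g E a B b x * ∑ d, sigmaLow d b Y * covS g E d φ I X x
        + ∑ b, spinConnPrimed g E a Y b x * ∑ d, sigmaLow d B b * covS g E d φ I X x := by
    simp only [Finset.mul_sum]
    rw [Finset.sum_comm, Finset.sum_comm (s := (Finset.univ : Finset (Fin 2))),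
      Finset.sum_comm (s := (Finset.univ : Finset (Fin 2))), ← Finset.sum_add_distrib]
    refine Finset.sum_congr rfl fun d _ => ?_
    simp only [← mul_assoc, ← Finset.sum_mul, ← add_mul]
    rw [hc d]
    rfl
  simp only [mul_assoc, ← Finset.mul_sum]
  congr 1
  have e2 : ∑ b, sigmaLow b B Y * (covS g E a (covS g E b φ) I X x
      - ∑ d, leviCivita g E a b d x * covS g E d φ I X x)
      = ∑ b, sigmaLow b B Y * covS g E a (covS g E b φ) I X x
        - ∑ b, sigmaLow b B Y * ∑ d, leviCivita g E a b d x * covS g E d φ I X x := by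
    simp only [mul_sub, Finset.sum_sub_distrib]
  rw [e2, e1]
  simp only [covS_eq, mul_sub, Finset.sum_sub_distrib]
  ring

/-- The unprimed spin curvature with all indices converted to spinor indices. -/
noncomputable def curvS (g : Metric M) (E : Frame M) (x : M) (A V B Y C D : Fin 2) : ℂ :=
  ∑ a, ∑ b, sigmaLow a A V * sigmaLow b B Y * spinCurv g E a b C D x

/-- The primed spin curvature with all indices converted to spinor indices. -/
noncomputable def curvSPrimed (g : Metric M) (E : Frame M) (x : M) (A V B Y C D : Fin 2) : ℂ :=
  ∑ a, ∑ b, sigmaLow a A V * sigmaLow b B Y * spinCurvPrimed g E a b C D x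

/-- The Ricci identity for spinor fields. -/
theorem IsOrthonormalFrame.nabla_comm (hE : IsOrthonormalFrame g E U) (hU : IsOpen U)
    (hx : x ∈ U) {φ : SpinorField M n m} (hφ : SmoothSpinor φ U) (A B V Y : Fin 2)
    (I : Fin n → Fin 2) (X : Fin m → Fin 2) :
    nabla g E (nabla g E φ) (Matrix.vecCons A (Matrix.vecCons B I))
      (Matrix.vecCons V (Matrix.vecCons Y X)) x
    - nabla g E (nabla g E φ) (Matrix.vecCons B (Matrix.vecCons A I))
      (Matrix.vecCons Y (Matrix.vecCons V X)) x
    = -act (curvS g E x A V B Y) (fun J => φ J X x) I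
      - act (curvSPrimed g E x A V B Y) (fun Z => φ I Z x) X := by
  rw [hE.nabla_nabla hU hx hφ, hE.nabla_nabla hU hx hφ,
    Finset.sum_comm (f := fun a b => sigmaLow a B Y * sigmaLow b A V * _),
    ← Finset.sum_sub_distrib]
  have hS : act (curvS g E x A V B Y) (fun J => φ J X x) I = ∑ a, ∑ b, sigmaLow a A V *
      sigmaLow b B Y * act (fun C B => spinCurv g E a b C B x) (fun J => φ J X x) I := by
    have : curvS g E x A V B Y = fun C D => ∑ a, ∑ b, sigmaLow a A V * sigmaLow b B Y *
      spinCurv g E a b C D x := rfl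
    simp only [this, act_matrix_sum, act_matrix_mul]
  have hS' : act (curvSPrimed g E x A V B Y) (fun Z => φ I Z x) X = ∑ a, ∑ b, sigmaLow a A V *
      sigmaLow b B Y * act (fun C B => spinCurvPrimed g E a b C B x) (fun Z => φ I Z x) X := by
    have : curvSPrimed g E x A V B Y = fun C D => ∑ a, ∑ b, sigmaLow a A V * sigmaLow b B Y *
      spinCurvPrimed g E a b C D x := rfl
    simp only [this, act_matrix_sum, act_matrix_mul]
  rw [hS, hS', ← Finset.sum_neg_distrib, ← Finset.sum_sub_distrib]
  refine Finset.sum_congr rfl fun a _ => ?_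
  rw [← Finset.sum_sub_distrib, ← Finset.sum_neg_distrib, ← Finset.sum_sub_distrib]
  refine Finset.sum_congr rfl fun b _ => ?_
  have hc := hE.covS_comm hU hx hφ a b I X
  have ht : ∑ d, leviCivita g E a b d x * covS g E d φ I X x
      - ∑ d, leviCivita g E b a d x * covS g E d φ I X x
      = ∑ e, structureFn g E a b e x * covS g E e φ I X x := by
    simp only [← Finset.sum_sub_distrib, ← sub_mul, leviCivita_torsion]
  linear_combination sigmaLow a A V * sigmaLow b B Y * (hc - ht)

/-- Conversion of all indices of an array to spinor indices. -/
noncomputable def toSpinor (T : (Fin n → Fin 4) → ℂ) (I X : Fin n → Fin 2) : ℂ :=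
  ∑ a : Fin n → Fin 4, (∏ k, sigmaLow (a k) (I k) (X k)) * T a

theorem toSpinor_vecCons (T : (Fin (n + 1) → Fin 4) → ℂ) (A V : Fin 2) (I X : Fin n → Fin 2) :
    toSpinor T (Matrix.vecCons A I) (Matrix.vecCons V X)
      = ∑ a, sigmaLow a A V * toSpinor (fun J => T (Matrix.vecCons a J)) I X := by
  simp only [toSpinor, Finset.mul_sum]
  rw [← Fintype.sum_prod_type', ← (Fin.consEquiv fun _ => Fin 4).sum_comp]
  refine Finset.sum_congr rfl fun p _ => ?_
  rw [Fin.prod_univ_succ]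
  simp only [Fin.consEquiv, Equiv.coe_fn_mk, Fin.cons_zero, Fin.cons_succ, Matrix.cons_val_zero,
    Matrix.cons_val_succ, mul_assoc]
  rfl

theorem toSpinor_sum {τ : Type*} (s : Finset τ) (T : τ → (Fin n → Fin 4) → ℂ) (I X : Fin n → Fin 2) :
    toSpinor (fun J => ∑ t ∈ s, T t J) I X = ∑ t ∈ s, toSpinor (T t) I X := by
  simp only [toSpinor, Finset.mul_sum]
  exact Finset.sum_comm

theorem toSpinor_mul (z : ℂ) (T : (Fin n → Fin 4) → ℂ) (I X : Fin n → Fin 2) :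
    toSpinor (fun J => z * T J) I X = z * toSpinor T I X := by
  simp only [toSpinor, Finset.mul_sum, mul_left_comm]

theorem toSpinor_add (S T : (Fin n → Fin 4) → ℂ) (I X : Fin n → Fin 2) :
    toSpinor (fun J => S J + T J) I X = toSpinor S I X + toSpinor T I X := by
  simp only [toSpinor, mul_add, Finset.sum_add_distrib]

theorem toSpinor_sub (S T : (Fin n → Fin 4) → ℂ) (I X : Fin n → Fin 2) :
    toSpinor (fun J => S J - T J) I X = toSpinor S I X - toSpinor T I X := by
  simp only [toSpinor, mul_sub, Finset.sum_sub_distrib]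

/-- The splitting of a vector index into a primed and an unprimed one intertwines `so(4)` with its
two factors; induction handles one index at a time. -/
theorem toSpinor_act {G : Fin 4 → Fin 4 → ℂ} (hG : ∀ b c, G b c = -G c b)
    (T : (Fin n → Fin 4) → ℂ) (I X : Fin n → Fin 2) :
    toSpinor (act G T) I X = act (spinPart G) (fun J => toSpinor T J X) I
      + act (spinPartPrimed G) (fun Y => toSpinor T I Y) X := by
  induction n with
  | zero => simp [act, toSpinor]
  | succ n ih =>
    obtain ⟨A, I, rfl⟩ : ∃ i J, I = (Matrix.vecCons i J : Fin (n + 1) → Fin 2) :=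
      ⟨I 0, Fin.tail I, (Fin.cons_self_tail I).symm⟩
    obtain ⟨V, X, rfl⟩ : ∃ i J, X = (Matrix.vecCons i J : Fin (n + 1) → Fin 2) :=
      ⟨X 0, Fin.tail X, (Fin.cons_self_tail X).symm⟩
    rw [toSpinor_vecCons, act_vecCons, act_vecCons]
    simp only [toSpinor_vecCons, act_vecCons, toSpinor_add, toSpinor_sum, toSpinor_mul, ih,
      act_sum, act_mul_left, mul_add, Finset.sum_add_distrib]
    have h : ∑ a, sigmaLow a A V * ∑ b, G a b * toSpinor (fun J => T (Matrix.vecCons b J)) I X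
        = ∑ b, spinPart G A b * ∑ a, sigmaLow a b V * toSpinor (fun J => T (Matrix.vecCons a J)) I X
          + ∑ b, spinPartPrimed G V b *
            ∑ a, sigmaLow a A b * toSpinor (fun J => T (Matrix.vecCons a J)) I X := by
      simp only [Finset.mul_sum]
      rw [Finset.sum_comm, Finset.sum_comm (s := (Finset.univ : Finset (Fin 2))),
        Finset.sum_comm (s := (Finset.univ : Finset (Fin 2))), ← Finset.sum_add_distrib]
      refine Finset.sum_congr rfl fun d _ => ?_
      simp only [← mul_assoc, ← Finset.sum_mul, ← add_mul]
      rw [sum_sigmaLow_mul_antisymm hG d A V]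
    rw [h]
    ring

/-- The spinor field of a tensor field. -/
noncomputable def spinorOf (T : TensorField M n) : SpinorField M n n :=
  fun I X x => toSpinor (fun J => T J x) I X

theorem smoothSpinor_spinorOf {T : TensorField M n} (hT : ∀ J, SmoothFn (T J) U) :
    SmoothSpinor (spinorOf T) U := by
  intro I X
  unfold spinorOf toSpinor
  fun_prop

theorem D_toSpinor (hU : IsOpen U) (hx : x ∈ U) {T : TensorField M n}
    (hT : ∀ J, SmoothFn (T J) U) (a : Fin 4) (I X : Fin n → Fin 2) :
    D E a (spinorOf T I X) x = toSpinor (fun J => D E a (T J) x) I X := by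
  unfold spinorOf toSpinor
  rw [D_sum hU hx a (fun J => by fun_prop)]
  exact Finset.sum_congr rfl fun J _ => D_const_mul hU hx a _ (hT J)

/-- Again because `σ` is parallel, tensor and spinor derivatives correspond. This is the bridge by
which the tensorial definitions of `h`, `J` and `f` are evaluated in spinors. -/
theorem nabla_spinorOf (hU : IsOpen U) (hx : x ∈ U) {T : TensorField M n}
    (hT : ∀ J, SmoothFn (T J) U) (I X : Fin (n + 1) → Fin 2) :
    nabla g E (spinorOf T) I X x = spinorOf (nablaT g E T) I X x := by
  obtain ⟨A, I, rfl⟩ : ∃ i J, I = (Matrix.vecCons i J : Fin (n + 1) → Fin 2) :=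
    ⟨I 0, Fin.tail I, (Fin.cons_self_tail I).symm⟩
  obtain ⟨V, X, rfl⟩ : ∃ i J, X = (Matrix.vecCons i J : Fin (n + 1) → Fin 2) :=
    ⟨X 0, Fin.tail X, (Fin.cons_self_tail X).symm⟩
  rw [nabla_cons, spinorOf, toSpinor_vecCons]
  refine Finset.sum_congr rfl fun a _ => ?_
  simp only [nablaT_cons, toSpinor_sub]
  rw [covS_eq, D_toSpinor hU hx hT,
    toSpinor_act (G := fun c b => leviCivita g E a c b x)
      (fun b c => leviCivita_swap g E a b c x) (fun J => T J x) I X]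
  simp only [sub_sub]
  rfl

end SecondDerivatives

/-! ### Self-duality of algebraic curvature tensors -/

section CurvatureAlgebra

variable {C : Fin 4 → Fin 4 → Fin 4 → Fin 4 → ℂ}

/-- The decomposition of a 2-form into `φ_{AB} ε_{A'B'} + ε_{AB} ψ_{A'B'}`. -/
theorem sum_sigmaLow_mul_sigmaLow_mul_antisymm {G : Fin 4 → Fin 4 → ℂ}
    (hG : ∀ b c, G b c = -G c b) (A V B Y : Fin 2) :
    ∑ a, ∑ b, sigmaLow a A V * sigmaLow b B Y * G a b
      = (∑ D, spinPart G A D * eps D B) * eps V Y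
        + eps A B * ∑ Z, spinPartPrimed G V Z * eps Z Y := by
  have h : ∀ b, ∑ a, sigmaLow a A V * sigmaLow b B Y * G a b
      = sigmaLow b B Y * ∑ a, sigmaLow a A V * G a b := fun b => by
    rw [Finset.mul_sum]; exact Finset.sum_congr rfl fun _ _ => by ring
  rw [Finset.sum_comm]
  simp only [h, sum_sigmaLow_mul_antisymm hG]
  have h2 : ∀ D Z, ∑ b, sigmaLow b B Y * sigmaLow b D Z = eps B D * eps Y Z :=
    fun D Z => sum_sigmaLow_mul_sigmaLow B Y D Z
  have h3 : ∀ (s t u v : ℂ) , ∑ b, sigmaLow b B Y * (s * sigmaLow b 0 V + t * sigmaLow b 1 V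
      + (u * sigmaLow b A 0 + v * sigmaLow b A 1)) = s * (eps B 0 * eps Y V)
      + t * (eps B 1 * eps Y V) + u * (eps B A * eps Y 0) + v * (eps B A * eps Y 1) := by
    intro s t u v
    simp only [← h2, Finset.mul_sum, ← Finset.sum_add_distrib]
    exact Finset.sum_congr rfl fun _ _ => by ring
  simp only [Fin.sum_univ_two, h3]
  rw [eps_swap B 0, eps_swap B 1, eps_swap Y V, eps_swap B A, eps_swap Y 0, eps_swap Y 1]
  ring

theorem spinPartPrimed_trace {G : Fin 4 → Fin 4 → ℂ} (hG : ∀ b c, G b c = -G c b) :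
    spinPartPrimed G 1 1 = -spinPartPrimed G 0 0 := by
  obtain ⟨h0, -, -, h1⟩ := spinPartPrimed_antisymm hG
  rw [h0, h1]

theorem sum_asd_contraction {G : Fin 4 → Fin 4 → ℂ} (hG : ∀ b c, G b c = -G c b) (A B : Fin 2) :
    ∑ V, ∑ Y, eps V Y * ∑ a, ∑ b, sigmaLow a A V * sigmaLow b B Y * G a b
      = 2 * ∑ D, spinPart G A D * eps D B := by
  simp only [sum_sigmaLow_mul_sigmaLow_mul_antisymm hG, Fin.sum_univ_two, eps_zero_zero,
    eps_zero_one, eps_one_zero, eps_one_one, spinPartPrimed_trace hG]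
  ring

theorem spinPart_sub (G H : Fin 4 → Fin 4 → ℂ) (A B : Fin 2) :
    spinPart (fun c d => G c d - H c d) A B = spinPart G A B - spinPart H A B := by
  simp only [spinPart, sub_mul, Finset.sum_sub_distrib, mul_sub]

theorem spinPart_add (G H : Fin 4 → Fin 4 → ℂ) (A B : Fin 2) :
    spinPart (fun c d => G c d + H c d) A B = spinPart G A B + spinPart H A B := by
  simp only [spinPart, add_mul, Finset.sum_add_distrib, mul_add]

theorem selfDual_of_spinPart_eq_zero {G : Fin 4 → Fin 4 → ℂ} (hG : ∀ b c, G b c = -G c b)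
    (h : ∀ A B, spinPart G A B = 0) : G 0 1 = G 2 3 ∧ G 0 2 = -G 1 3 ∧ G 0 3 = G 1 2 := by
  obtain ⟨h0, h1, h2, -⟩ := spinPart_antisymm hG
  rw [h] at h0 h1 h2
  have hI := Complex.I_mul_I
  refine ⟨?_, ?_, ?_⟩
  · linear_combination Complex.I * (h1 + h2) + (G 0 1 - G 2 3) * hI
  · linear_combination h1 - h2
  · linear_combination 2 * Complex.I * h0 + (G 0 3 - G 1 2) * hI

/-- The anti-self-dual part of an array in both index pairs. -/
noncomputable def asdPart (T : Fin 4 → Fin 4 → Fin 4 → Fin 4 → ℂ) (I : Fin 4 → Fin 2) : ℂ :=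
  (1 / 4) * ∑ a, ∑ b, ∑ c, ∑ d, ∑ X : Fin 4 → Fin 2,
    sigmaLow a (I 0) (X 0) * sigmaLow b (I 1) (X 1) * sigmaLow c (I 2) (X 2) *
      sigmaLow d (I 3) (X 3) * eps (X 0) (X 1) * eps (X 2) (X 3) * T a b c d

/-- As a symmetric form on `Λ⁺ ⊕ Λ⁻`, the tensor has no block on `Λ⁻` by `h5`, and its mixed block
is carried by the trace-free Ricci tensor, which `h4` kills. Only the block on `Λ⁺` is left. -/
theorem eq_of_traceless_of_asd (h1 : ∀ a b c d, C a b c d = -C b a c d)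
    (h2 : ∀ a b c d, C a b c d = -C a b d c) (h3 : ∀ a b c d, C a b c d = C c d a b)
    (h4 : ∀ b c, ∑ a, C a b c a = 0)
    (h5 : ∀ A B D F, spinPart (fun a b => spinPart (C a b) A B) D F = 0) (a b : Fin 4) :
    C a b 0 1 = C a b 2 3 ∧ C a b 0 2 = -C a b 1 3 ∧ C a b 0 3 = C a b 1 2 := by
  have hs : ∀ A B a b, spinPart (C a b) A B = -spinPart (C b a) A B := by
    intro A B a b
    simp only [spinPart, fun c d => h1 a b c d, neg_mul, Finset.sum_neg_distrib, mul_neg]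
  have k := fun A B => selfDual_of_spinPart_eq_zero (hs A B) (h5 A B)
  -- Differences of rows which are anti-self-dual in the first pair have no anti-self-dual part in
  -- the second; the mixed block is then removed by the ten trace conditions.
  obtain ⟨a1, a2, a3⟩ := selfDual_of_spinPart_eq_zero (G := fun c d => C 0 1 c d - C 2 3 c d)
    (fun c d => by linear_combination h2 0 1 c d - h2 2 3 c d)
    (fun A B => by rw [spinPart_sub, (k A B).1, sub_self])
  obtain ⟨b1, b2, b3⟩ := selfDual_of_spinPart_eq_zero (G := fun c d => C 0 2 c d + C 1 3 c d)
    (fun c d => by linear_combination h2 0 2 c d + h2 1 3 c d)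
    (fun A B => by rw [spinPart_add, (k A B).2.1, neg_add_cancel])
  obtain ⟨c1, c2, c3⟩ := selfDual_of_spinPart_eq_zero (G := fun c d => C 0 3 c d - C 1 2 c d)
    (fun c d => by linear_combination h2 0 3 c d - h2 1 2 c d)
    (fun A B => by rw [spinPart_sub, (k A B).2.2, sub_self])
  have z : ∀ a b c, C a b c c = 0 := fun a b c => by linear_combination (1 / 2) * h2 a b c c
  have z' : ∀ a c d, C a a c d = 0 := fun a c d => by linear_combination (1 / 2) * h1 a a c d
  have r00 := h4 0 0
  have r11 := h4 1 1
  have r22 := h4 2 2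
  have r33 := h4 3 3
  have r01 := h4 0 1
  have r02 := h4 0 2
  have r03 := h4 0 3
  have r12 := h4 1 2
  have r13 := h4 1 3
  have r23 := h4 2 3
  simp only [Fin.sum_univ_four, z, z'] at *
  have key : ∀ p : Fin 4 × Fin 4, p ∈ [((0 : Fin 4), (1 : Fin 4)), (0, 2), (0, 3), (1, 2), (1, 3),
      (2, 3)] → C p.1 p.2 0 1 = C p.1 p.2 2 3 ∧ C p.1 p.2 0 2 = -C p.1 p.2 1 3 ∧
        C p.1 p.2 0 3 = C p.1 p.2 1 2 := by
    intro p hp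
    simp only [List.mem_cons, List.not_mem_nil, or_false] at hp
    rcases hp with rfl | rfl | rfl | rfl | rfl | rfl
    all_goals refine ⟨?_, ?_, ?_⟩ <;> dsimp only
    all_goals grind
  rcases lt_trichotomy a b with hab | rfl | hab
  · exact key (a, b) (by revert hab; revert a b; decide)
  · rw [h1 a a 0 1, h1 a a 2 3, h1 a a 0 2]
    have y : ∀ c d, C a a c d = 0 := fun c d => by linear_combination (1 / 2) * h1 a a c d
    simp only [y, neg_zero, and_self]
  · obtain ⟨p, q, r⟩ := key (b, a) (by revert hab; revert a b; decide)
    refine ⟨?_, ?_, ?_⟩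
    · linear_combination h1 a b 0 1 - h1 a b 2 3 - p
    · linear_combination h1 a b 0 2 + h1 a b 1 3 - q
    · linear_combination h1 a b 0 3 - h1 a b 1 2 - r

theorem spinPart_eq_zero_of_selfDual {G : Fin 4 → Fin 4 → ℂ} (hG : ∀ b c, G b c = -G c b)
    (h : G 0 1 = G 2 3 ∧ G 0 2 = -G 1 3 ∧ G 0 3 = G 1 2) (A B : Fin 2) : spinPart G A B = 0 := by
  obtain ⟨h0, h1, h2, h3⟩ := spinPart_antisymm hG
  obtain ⟨p, q, r⟩ := h
  fin_cases A <;> fin_cases B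
  all_goals simp only [Fin.zero_eta, Fin.mk_one, h0, h1, h2, h3, p, q, r]
  all_goals ring

theorem sum_vecCons {κ : Type*} [Fintype κ] [DecidableEq κ] {n : ℕ}
    (f : (Fin (n + 1) → κ) → ℂ) :
    ∑ X, f X = ∑ a, ∑ X : Fin n → κ, f (Matrix.vecCons a X) := by
  rw [← Fintype.sum_prod_type', ← (Fin.consEquiv fun _ => κ).sum_comp]
  rfl

theorem sum_vecEmpty {κ : Type*} [Fintype κ] [DecidableEq κ] (f : (Fin 0 → κ) → ℂ) :
    ∑ X, f X = f ![] := by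
  rw [Fintype.sum_unique]
  exact congrArg f (Subsingleton.elim _ _)

theorem asdPart_eq (T : Fin 4 → Fin 4 → Fin 4 → Fin 4 → ℂ) (I : Fin 4 → Fin 2) :
    asdPart T I = (1 / 4) * ∑ V, ∑ Y, eps V Y * ∑ a, ∑ b, sigmaLow a (I 0) V * sigmaLow b (I 1) Y *
      ∑ Z, ∑ W, eps Z W * ∑ c, ∑ d, sigmaLow c (I 2) Z * sigmaLow d (I 3) W * T a b c d := by
  simp only [asdPart, sum_vecCons, sum_vecEmpty, Fin.sum_univ_two, Matrix.cons_val_zero,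
    Matrix.cons_val_one, Matrix.cons_val, eps_zero_zero, eps_zero_one, eps_one_zero, eps_one_one,
    mul_zero, zero_mul, zero_add, add_zero, mul_one]
  simp only [Finset.mul_sum, ← Finset.sum_add_distrib]
  refine Finset.sum_congr rfl fun a _ => Finset.sum_congr rfl fun b _ =>
    Finset.sum_congr rfl fun c _ => Finset.sum_congr rfl fun d _ => ?_
  ring

/-- Each contraction of a pair of primed indices projects onto the anti-self-dual part of that pair,
up to a factor `2`; the two factors absorb the `1/4`. -/
theorem asdPart_of_antisymm (h1 : ∀ a b c d, C a b c d = -C b a c d)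
    (h2 : ∀ a b c d, C a b c d = -C a b d c) (I : Fin 4 → Fin 2) :
    asdPart C I = ∑ A, ∑ B, eps A (I 1) * eps B (I 3) *
      spinPart (fun a b => spinPart (C a b) (I 2) B) (I 0) A := by
  rw [asdPart_eq]
  simp only [fun a b => sum_asd_contraction (G := C a b) (h2 a b) (I 2) (I 3)]
  rw [sum_asd_contraction (G := fun a b => 2 * ∑ D, spinPart (C a b) (I 2) D * eps D (I 3))]
  · have e : ∀ A, spinPart (fun a b => 2 * ∑ D, spinPart (C a b) (I 2) D * eps D (I 3)) (I 0) A
        = 2 * ∑ D, spinPart (fun a b => spinPart (C a b) (I 2) D) (I 0) A * eps D (I 3) := by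
      intro A
      simp only [Fin.sum_univ_two]
      rw [spinPart]
      conv_rhs => rw [spinPart, spinPart]
      simp only [Finset.mul_sum, Finset.sum_mul, ← Finset.sum_add_distrib]
      exact Finset.sum_congr rfl fun b _ => Finset.sum_congr rfl fun c _ =>
        Finset.sum_congr rfl fun X _ => by ring
    simp only [e]
    simp only [Fin.sum_univ_two]
    ring
  · intro b c
    have hs : ∀ B, spinPart (C b c) (I 2) B = -spinPart (C c b) (I 2) B := by
      intro B
      simp only [spinPart, fun c d => h1 b c c d, neg_mul, Finset.sum_neg_distrib, mul_neg,
        h1 b c]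
    simp only [hs, neg_mul, Finset.sum_neg_distrib, mul_neg]

theorem spinPart_eq_zero_of_asdPart (h1 : ∀ a b c d, C a b c d = -C b a c d)
    (h2 : ∀ a b c d, C a b c d = -C a b d c) (h : ∀ I, asdPart C I = 0) (A B D F : Fin 2) :
    spinPart (fun a b => spinPart (C a b) A B) D F = 0 := by
  have := fun p q => h ![D, p, A, q]
  simp only [asdPart_of_antisymm h1 h2, Matrix.cons_val_zero, Matrix.cons_val_one, Matrix.cons_val,
    Fin.sum_univ_two] at this
  have h00 := this 0 0
  have h01 := this 0 1
  have h10 := this 1 0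
  have h11 := this 1 1
  simp only [eps_zero_zero, eps_zero_one, eps_one_zero, eps_one_one] at h00 h01 h10 h11
  fin_cases B <;> fin_cases F <;> simp only [Fin.zero_eta, Fin.mk_one]
  · linear_combination h11
  · linear_combination -h01
  · linear_combination -h10
  · linear_combination h00

end CurvatureAlgebra

/-! ### Curvature of a quaternionic-Kähler metric in spinors -/

section QuaternionicKahlerCurvature

variable {M : Type*} [TopologicalSpace M] [ChartedSpace R4 M] [IsManifold (𝓡 4) ∞ M]
  {U : Set M} {x : M} {g : Metric M} {E : Frame M} {lam : ℝ}

/-- The curvature tensor of constant sectional curvature `lam / 3`. -/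
noncomputable def constCurv (lam : ℝ) (a b c d : Fin 4) : ℂ :=
  (lam / 3 : ℂ) * ((if b = c then 1 else 0) * (if a = d then 1 else 0)
    - (if a = c then 1 else 0) * (if b = d then 1 else 0))

theorem constCurv_swap_left (a b c d : Fin 4) : constCurv lam a b c d = -constCurv lam b a c d := by
  unfold constCurv; ring

theorem constCurv_swap_right (a b c d : Fin 4) :
    constCurv lam a b c d = -constCurv lam a b d c := by
  unfold constCurv; ring

theorem constCurv_pair (a b c d : Fin 4) : constCurv lam a b c d = constCurv lam c d a b := by
  unfold constCurv
  simp only [eq_comm (a := d), eq_comm (a := c)]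
  ring

theorem sum_constCurv (b c : Fin 4) :
    ∑ a, constCurv lam a b c a = lam * if b = c then 1 else 0 := by
  unfold constCurv
  fin_cases b <;> fin_cases c <;> simp [Fin.sum_univ_four] <;> ring

/-- The self-dual Weyl tensor of a quaternionic-Kähler metric. -/
noncomputable def sdWeyl (g : Metric M) (E : Frame M) (lam : ℝ) (x : M) (a b c d : Fin 4) : ℂ :=
  curv g E a b c d x - constCurv lam a b c d

theorem IsOrthonormalFrame.curv_pair (hE : IsOrthonormalFrame g E U) (hU : IsOpen U) (hx : x ∈ U)
    (a b c d : Fin 4) : curv g E a b c d x = curv g E c d a b x :=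
  curv_pair_of_symmetries (R := fun a b c d => curv g E a b c d x)
    (fun a b c d => curv_swap_left g E a b c d x) (hE.curv_swap_right hU hx)
    (hE.bianchi hU hx) a b c d

theorem sdWeyl_swap_left (a b c d : Fin 4) :
    sdWeyl g E lam x a b c d = -sdWeyl g E lam x b a c d := by
  rw [sdWeyl, sdWeyl, curv_swap_left, constCurv_swap_left]; ring

theorem IsOrthonormalFrame.sdWeyl_swap_right (hE : IsOrthonormalFrame g E U) (hU : IsOpen U)
    (hx : x ∈ U) (a b c d : Fin 4) : sdWeyl g E lam x a b c d = -sdWeyl g E lam x a b d c := by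
  rw [sdWeyl, sdWeyl, hE.curv_swap_right hU hx, constCurv_swap_right]; ring

theorem IsOrthonormalFrame.sdWeyl_pair (hE : IsOrthonormalFrame g E U) (hU : IsOpen U)
    (hx : x ∈ U) (a b c d : Fin 4) : sdWeyl g E lam x a b c d = sdWeyl g E lam x c d a b := by
  rw [sdWeyl, sdWeyl, hE.curv_pair hU hx, constCurv_pair]

theorem IsQuaternionicKahler.ricci_eq (hq : IsQuaternionicKahler g E U lam) (hx : x ∈ U)
    (b c : Fin 4) : ∑ a, curv g E a b c a x = lam * if b = c then 1 else 0 := by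
  rw [← Matrix.one_apply (α := ℂ)]
  exact hq.einstein x hx b c

theorem IsQuaternionicKahler.sum_sdWeyl (hq : IsQuaternionicKahler g E U lam) (hx : x ∈ U)
    (b c : Fin 4) : ∑ a, sdWeyl g E lam x a b c a = 0 := by
  simp only [sdWeyl, Finset.sum_sub_distrib, hq.ricci_eq hx, sum_constCurv, sub_self]

/-- With `R_{ab} = λ g_{ab}` the scalar curvature is `4λ`, and the Ricci terms of the Weyl tensor
add up to the curvature of constant sectional curvature `λ/3`. -/
theorem IsQuaternionicKahler.weyl_eq (hq : IsQuaternionicKahler g E U lam) (hx : x ∈ U)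
    (a b c d : Fin 4) : weyl g E background a b c d x = sdWeyl g E lam x a b c d := by
  have hr : ∀ b c, ricci g E background b c x = lam * if b = c then 1 else 0 := hq.ricci_eq hx
  have h1 : ∀ a b, (background x : Matrix (Fin 4) (Fin 4) ℂ) a b = if a = b then 1 else 0 :=
    fun a b => Matrix.one_apply
  have h2 : ∀ a b, (background x : Matrix (Fin 4) (Fin 4) ℂ)⁻¹ a b = if a = b then 1 else 0 := by
    intro a b
    rw [background, inv_one, Matrix.one_apply]
  have hs : scalarCurv g E background x = 4 * lam := by
    simp only [scalarCurv, hr, h2]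
    simp
  simp only [weyl, hr, h1, hs, mul_ite, mul_one, mul_zero, Finset.sum_ite_eq',
    Finset.mem_univ, if_true]
  rw [sdWeyl, constCurv, curv]
  simp only [mul_ite, mul_one, mul_zero]
  split_ifs <;> ring

theorem IsQuaternionicKahler.asdPart_sdWeyl (hq : IsQuaternionicKahler g E U lam) (hx : x ∈ U)
    (I : Fin 4 → Fin 2) : asdPart (sdWeyl g E lam x) I = 0 := by
  rw [← hq.selfDual x hx I]
  simp only [asdPart, weylSpinor, hq.weyl_eq hx]

theorem IsQuaternionicKahler.sdWeyl_selfDual (hq : IsQuaternionicKahler g E U lam) (hE : IsOrthonormalFrame g E U)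
    (hU : IsOpen U) (hx : x ∈ U) (a b : Fin 4) :
    sdWeyl g E lam x a b 0 1 = sdWeyl g E lam x a b 2 3 ∧
    sdWeyl g E lam x a b 0 2 = -sdWeyl g E lam x a b 1 3 ∧
    sdWeyl g E lam x a b 0 3 = sdWeyl g E lam x a b 1 2 :=
  eq_of_traceless_of_asd sdWeyl_swap_left (hE.sdWeyl_swap_right hU hx) (hE.sdWeyl_pair hU hx)
    (hq.sum_sdWeyl hx) (spinPart_eq_zero_of_asdPart sdWeyl_swap_left
      (hE.sdWeyl_swap_right hU hx) (hq.asdPart_sdWeyl hx)) a b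

theorem IsQuaternionicKahler.spinPart_sdWeyl (hq : IsQuaternionicKahler g E U lam) (hE : IsOrthonormalFrame g E U)
    (hU : IsOpen U) (hx : x ∈ U) (a b : Fin 4) (C D : Fin 2) :
    spinPart (sdWeyl g E lam x a b) C D = 0 :=
  spinPart_eq_zero_of_selfDual (hE.sdWeyl_swap_right hU hx a b)
    (hq.sdWeyl_selfDual hE hU hx a b) C D

theorem spinPart_constCurv (a b : Fin 4) (C D : Fin 2) :
    spinPart (constCurv lam a b) C D = (lam / 6 : ℂ) *
      ∑ X, (sigma a D X * sigmaLow b C X - sigma b D X * sigmaLow a C X) := by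
  simp only [spinPart, constCurv]
  fin_cases a <;> fin_cases b <;> simp [Fin.sum_univ_four] <;> ring

/-- The Weyl tensor is self-dual and invisible to the unprimed spinors, so the unprimed curvature is
computed from the constant curvature tensor alone. Each resulting term carries an `ε` in its
unprimed indices. -/
theorem IsQuaternionicKahler.curvS_eq (hq : IsQuaternionicKahler g E U lam) (hE : IsOrthonormalFrame g E U)
    (hU : IsOpen U) (hx : x ∈ U)
    (A V B Y C D : Fin 2) : curvS g E x A V B Y C D = -(lam / 6 : ℂ) * eps V Y *
      ((if A = D then 1 else 0) * eps B C + (if B = D then 1 else 0) * eps A C) := by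
  have h : ∀ a b, spinCurv g E a b C D x = spinPart (constCurv lam a b) C D := by
    intro a b
    rw [← sub_eq_zero, ← hq.spinPart_sdWeyl hE hU hx a b C D, spinCurv, ← spinPart_sub]
    rfl
  simp only [curvS, h, spinPart_constCurv]
  have e : ∑ a, ∑ b, sigmaLow a A V * sigmaLow b B Y * ((lam / 6 : ℂ) *
      ∑ X, (sigma a D X * sigmaLow b C X - sigma b D X * sigmaLow a C X))
      = (lam / 6 : ℂ) * ∑ X, ((∑ a, sigmaLow a A V * sigma a D X) *
        (∑ b, sigmaLow b B Y * sigmaLow b C X) - (∑ a, sigmaLow a A V * sigmaLow a C X) *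
        (∑ b, sigmaLow b B Y * sigma b D X)) := by
    simp only [Finset.sum_mul_sum]
    simp only [Finset.mul_sum, ← Finset.sum_sub_distrib, Fin.sum_univ_two, ← Finset.sum_add_distrib]
    exact Finset.sum_congr rfl fun a _ => Finset.sum_congr rfl fun b _ => by ring
  rw [e]
  simp only [sum_sigmaLow_mul_sigma, sum_sigmaLow_mul_sigmaLow, Fin.sum_univ_two]
  fin_cases V <;> fin_cases Y <;>
    simp [eps_zero_zero, eps_zero_one, eps_one_zero, eps_one_one, -mul_eq_mul_left_iff] <;>
    split_ifs <;> ring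

theorem spinCurvPrimed_swap (a b : Fin 4) (Z W : Fin 2) :
    spinCurvPrimed g E a b Z W x = -spinCurvPrimed g E b a Z W x := by
  simp only [spinCurvPrimed, spinPartPrimed, curv_swap_left g E a b, neg_mul,
    Finset.sum_neg_distrib, mul_neg]

/-- Pair symmetry moves the self-duality of the Weyl tensor to the form indices, and the constant
curvature tensor preserves self-dual 2-forms; so the primed curvature is a self-dual form. -/
theorem IsQuaternionicKahler.spinPart_spinCurvPrimed (hq : IsQuaternionicKahler g E U lam) (hE : IsOrthonormalFrame g E U)
    (hU : IsOpen U) (hx : x ∈ U)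
    (Z W A B : Fin 2) : spinPart (fun a b => spinCurvPrimed g E a b Z W x) A B = 0 := by
  have k := fun c d => hq.sdWeyl_selfDual hE hU hx c d
  simp only [fun c d => hE.sdWeyl_pair (lam := lam) hU hx c d 0 1,
    fun c d => hE.sdWeyl_pair (lam := lam) hU hx c d 2 3,
    fun c d => hE.sdWeyl_pair (lam := lam) hU hx c d 0 2,
    fun c d => hE.sdWeyl_pair (lam := lam) hU hx c d 1 3,
    fun c d => hE.sdWeyl_pair (lam := lam) hU hx c d 0 3,
    fun c d => hE.sdWeyl_pair (lam := lam) hU hx c d 1 2] at k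
  have k01 := k 0 1
  have k23 := k 2 3
  have k02 := k 0 2
  have k13 := k 1 3
  have k03 := k 0 3
  have k12 := k 1 2
  simp [sdWeyl, constCurv] at k01 k23 k02 k13 k03 k12
  have l := fun a b => spinPartPrimed_antisymm (G := fun c d => curv g E a b c d x)
    (hE.curv_swap_right hU hx a b)
  refine spinPart_eq_zero_of_selfDual (fun a b => spinCurvPrimed_swap a b Z W) ?_ A B
  simp only [spinCurvPrimed]
  fin_cases Z <;> fin_cases W <;> simp only [Fin.zero_eta, Fin.mk_one, l]
  · refine ⟨?_, ?_, ?_⟩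
    · linear_combination Complex.I / 2 * (k03.1 + k12.1)
    · linear_combination Complex.I / 2 * (k03.2.1 + k12.2.1)
    · linear_combination Complex.I / 2 * (k03.2.2 + k12.2.2)
  · refine ⟨?_, ?_, ?_⟩
    · linear_combination Complex.I / 2 * (k01.1 + k23.1) + (k02.1 - k13.1) / 2
    · linear_combination Complex.I / 2 * (k01.2.1 + k23.2.1) + (k02.2.1 - k13.2.1) / 2
    · linear_combination Complex.I / 2 * (k01.2.2 + k23.2.2) + (k02.2.2 - k13.2.2) / 2
  · refine ⟨?_, ?_, ?_⟩
    · linear_combination Complex.I / 2 * (k01.1 + k23.1) - (k02.1 - k13.1) / 2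
    · linear_combination Complex.I / 2 * (k01.2.1 + k23.2.1) - (k02.2.1 - k13.2.1) / 2
    · linear_combination Complex.I / 2 * (k01.2.2 + k23.2.2) - (k02.2.2 - k13.2.2) / 2
  · refine ⟨?_, ?_, ?_⟩
    · linear_combination -Complex.I / 2 * (k03.1 + k12.1)
    · linear_combination -Complex.I / 2 * (k03.2.1 + k12.2.1)
    · linear_combination -Complex.I / 2 * (k03.2.2 + k12.2.2)

/-- The part of the primed spin curvature which is symmetric in its primed form indices. -/
noncomputable def primedCurv (g : Metric M) (E : Frame M) (x : M) (V Y Z W : Fin 2) : ℂ :=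
  ∑ D, spinPartPrimed (fun a b => spinCurvPrimed g E a b Z W x) V D * eps D Y

theorem IsQuaternionicKahler.curvSPrimed_eq (hq : IsQuaternionicKahler g E U lam) (hE : IsOrthonormalFrame g E U)
    (hU : IsOpen U) (hx : x ∈ U)
    (A V B Y Z W : Fin 2) : curvSPrimed g E x A V B Y Z W = eps A B * primedCurv g E x V Y Z W := by
  rw [curvSPrimed, sum_sigmaLow_mul_sigmaLow_mul_antisymm (fun a b => spinCurvPrimed_swap a b Z W)]
  simp only [hq.spinPart_spinCurvPrimed hE hU hx, zero_mul, Finset.sum_const_zero, zero_add,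
    primedCurv]

theorem primedCurv_comm (V Y Z W : Fin 2) :
    primedCurv g E x V Y Z W = primedCurv g E x Y V Z W := by
  have h := spinPartPrimed_trace (fun a b => spinCurvPrimed_swap (g := g) (E := E) (x := x) a b Z W)
  unfold primedCurv
  fin_cases V <;> fin_cases Y <;> simp [eps_zero_zero, eps_zero_one, eps_one_zero, eps_one_one, h]

/-- The self-dual Weyl spinor is totally symmetric and does not contribute. The remaining trace of
the self-dual block is read off from the Ricci trace with the help of the first Bianchi identity. -/
theorem IsQuaternionicKahler.primedCurv_trace (hq : IsQuaternionicKahler g E U lam) (hE : IsOrthonormalFrame g E U)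
    (hU : IsOpen U) (hx : x ∈ U)
    (V W : Fin 2) : ∑ Y, ∑ Z, eps Y Z * primedCurv g E x V Y Z W
      = -(lam / 2 : ℂ) * if V = W then 1 else 0 := by
  have b1 := hE.bianchi hU hx 0 1 2 3
  have l := fun a b => spinPartPrimed_antisymm (G := fun c d => curv g E a b c d x)
    (hE.curv_swap_right hU hx a b)
  have l' := fun Z W => spinPartPrimed_antisymm
    (fun a b => spinCurvPrimed_swap (g := g) (E := E) (x := x) a b Z W)
  have r00 := hq.ricci_eq hx 0 0
  have r11 := hq.ricci_eq hx 1 1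
  have r22 := hq.ricci_eq hx 2 2
  have r33 := hq.ricci_eq hx 3 3
  have s1 := fun a b c d => curv_swap_left g E a b c d x
  have s2 := hE.curv_swap_right hU hx
  have s3 := hE.curv_pair hU hx
  have z : ∀ a b c, curv g E a b c c x = 0 := fun a b c => by
    linear_combination (1 / 2) * s2 a b c c
  have z' : ∀ a c d, curv g E a a c d x = 0 := fun a c d => by
    linear_combination (1 / 2) * s1 a a c d
  have n1 : ∀ c d, _ ∧ _ ∧ _ ∧ _ ∧ _ ∧ _ := fun c d =>
    ⟨s1 1 0 c d, s1 2 0 c d, s1 3 0 c d, s1 2 1 c d, s1 3 1 c d, s1 3 2 c d⟩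
  have n2 : ∀ a b, _ ∧ _ ∧ _ ∧ _ ∧ _ ∧ _ := fun a b =>
    ⟨s2 a b 1 0, s2 a b 2 0, s2 a b 3 0, s2 a b 2 1, s2 a b 3 1, s2 a b 3 2⟩
  simp [Fin.sum_univ_four, z, z', n1, n2] at r00 r11 r22 r33 b1
  simp only [primedCurv, Fin.sum_univ_two]
  have hI := Complex.I_mul_I
  fin_cases V <;> fin_cases W <;> simp only [Fin.zero_eta, Fin.mk_one, l', eps_zero_zero,
    eps_zero_one, eps_one_zero, eps_one_one] <;> simp only [spinCurvPrimed, l] <;> simp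
  all_goals simp only [s3 0 2 0 1, s3 0 3 0 1, s3 1 2 0 1, s3 1 3 0 1, s3 2 3 0 1, s3 0 3 0 2,
    s3 1 2 0 2, s3 1 3 0 2, s3 2 3 0 2, s3 1 2 0 3, s3 1 3 0 3, s3 2 3 0 3, s3 1 3 1 2, s3 2 3 1 2,
    s3 2 3 1 3] at *
  all_goals ring_nf
  all_goals simp only [Complex.I_sq]
  all_goals grind

end QuaternionicKahlerCurvature

/-! ### Covariant derivatives of contractions, sums, products and permutations -/

section Contractions

variable {M : Type*} [TopologicalSpace M] [ChartedSpace R4 M] [IsManifold (𝓡 4) ∞ M]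
  {U : Set M} {x : M} {g : Metric M} {E : Frame M} {n m : ℕ}

/-- The contraction `ε^{AB} φ_{BA…}` of the first two unprimed indices. -/
noncomputable def contr (φ : SpinorField M (n + 2) m) : SpinorField M n m := fun I X x =>
  ∑ A, ∑ B, eps A B * φ (Matrix.vecCons B (Matrix.vecCons A I)) X x

/-- The contraction `ε^{A'B'} φ_{B'A'…}` of the first two primed indices. -/
noncomputable def contrPrimed (φ : SpinorField M n (m + 2)) : SpinorField M n m := fun I X x =>
  ∑ Y, ∑ Z, eps Y Z * φ I (Matrix.vecCons Z (Matrix.vecCons Y X)) x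

theorem SmoothSpinor.contr {φ : SpinorField M (n + 2) m} (hφ : SmoothSpinor φ U) :
    SmoothSpinor (contr φ) U := by
  intro I X
  have := hφ
  unfold SmoothSpinor at this
  unfold QK.contr
  fun_prop

theorem SmoothSpinor.contrPrimed {φ : SpinorField M n (m + 2)} (hφ : SmoothSpinor φ U) :
    SmoothSpinor (contrPrimed φ) U := by
  intro I X
  have := hφ
  unfold SmoothSpinor at this
  unfold QK.contrPrimed
  fun_prop

theorem covS_contr (hU : IsOpen U) (hx : x ∈ U) {φ : SpinorField M (n + 2) m}
    (hφ : SmoothSpinor φ U) (a : Fin 4) (I : Fin n → Fin 2) (X : Fin m → Fin 2) :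
    covS g E a (contr φ) I X x = ∑ A, ∑ B, eps A B *
      covS g E a φ (Matrix.vecCons B (Matrix.vecCons A I)) X x := by
  have hD : D E a (contr φ I X) x = ∑ A, ∑ B, eps A B *
      D E a (φ (Matrix.vecCons B (Matrix.vecCons A I)) X) x := by
    have h := fun A B => hφ (Matrix.vecCons B (Matrix.vecCons A I)) X
    unfold contr
    rw [D_sum hU hx a (fun A => by fun_prop)]
    refine Finset.sum_congr rfl fun A _ => ?_
    rw [D_sum hU hx a (fun B => by fun_prop)]
    exact Finset.sum_congr rfl fun B _ => D_const_mul hU hx a _ (h A B)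
  have ht := spinConn_trace g E a x
  rw [covS_eq, hD]
  simp only [covS_eq, act_vecCons, contr, act_add, act_mul_left, Fin.sum_univ_two]
  simp only [eps_zero_zero, eps_zero_one, eps_one_zero, eps_one_one, ht]
  ring

theorem covS_contrPrimed (hU : IsOpen U) (hx : x ∈ U) {φ : SpinorField M n (m + 2)}
    (hφ : SmoothSpinor φ U) (a : Fin 4) (I : Fin n → Fin 2) (X : Fin m → Fin 2) :
    covS g E a (contrPrimed φ) I X x = ∑ Y, ∑ Z, eps Y Z *
      covS g E a φ I (Matrix.vecCons Z (Matrix.vecCons Y X)) x := by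
  have hD : D E a (contrPrimed φ I X) x = ∑ A, ∑ B, eps A B *
      D E a (φ I (Matrix.vecCons B (Matrix.vecCons A X))) x := by
    have h := fun A B => hφ I (Matrix.vecCons B (Matrix.vecCons A X))
    unfold contrPrimed
    rw [D_sum hU hx a (fun A => by fun_prop)]
    refine Finset.sum_congr rfl fun A _ => ?_
    rw [D_sum hU hx a (fun B => by fun_prop)]
    exact Finset.sum_congr rfl fun B _ => D_const_mul hU hx a _ (h A B)
  have ht := spinConnPrimed_trace g E a x
  rw [covS_eq, hD]
  simp only [covS_eq, act_vecCons, contrPrimed, act_add, act_mul_left, Fin.sum_univ_two]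
  simp only [eps_zero_zero, eps_zero_one, eps_one_zero, eps_one_one, ht]
  ring

theorem nabla_contr (hU : IsOpen U) (hx : x ∈ U) {φ : SpinorField M (n + 2) m}
    (hφ : SmoothSpinor φ U) (P V : Fin 2) (I : Fin n → Fin 2) (X : Fin m → Fin 2) :
    nabla g E (contr φ) (Matrix.vecCons P I) (Matrix.vecCons V X) x = ∑ A, ∑ B, eps A B *
      nabla g E φ (Matrix.vecCons P (Matrix.vecCons B (Matrix.vecCons A I)))
        (Matrix.vecCons V X) x := by
  simp only [nabla_cons, covS_contr hU hx hφ, Fin.sum_univ_two, Finset.mul_sum,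
    ← Finset.sum_add_distrib]
  exact Finset.sum_congr rfl fun _ _ => by ring

theorem nabla_contrPrimed (hU : IsOpen U) (hx : x ∈ U) {φ : SpinorField M n (m + 2)}
    (hφ : SmoothSpinor φ U) (P V : Fin 2) (I : Fin n → Fin 2) (X : Fin m → Fin 2) :
    nabla g E (contrPrimed φ) (Matrix.vecCons P I) (Matrix.vecCons V X) x = ∑ Y, ∑ Z, eps Y Z *
      nabla g E φ (Matrix.vecCons P I)
        (Matrix.vecCons V (Matrix.vecCons Z (Matrix.vecCons Y X))) x := by
  simp only [nabla_cons, covS_contrPrimed hU hx hφ, Fin.sum_univ_two, Finset.mul_sum,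
    ← Finset.sum_add_distrib]
  exact Finset.sum_congr rfl fun _ _ => by ring

theorem covS_sum {τ : Type*} (s : Finset τ) (hU : IsOpen U) (hx : x ∈ U)
    {φ : τ → SpinorField M n m} (hφ : ∀ t, SmoothSpinor (φ t) U) (a : Fin 4) (I : Fin n → Fin 2)
    (X : Fin m → Fin 2) :
    covS g E a (fun I X x => ∑ t ∈ s, φ t I X x) I X x = ∑ t ∈ s, covS g E a (φ t) I X x := by
  simp only [covS_eq, act_sum, Finset.sum_sub_distrib]
  rw [D_sum hU hx a fun t => hφ t I X]

theorem covS_const_mul (hU : IsOpen U) (hx : x ∈ U) {φ : SpinorField M n m}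
    (hφ : SmoothSpinor φ U) (z : ℂ) (a : Fin 4) (I : Fin n → Fin 2) (X : Fin m → Fin 2) :
    covS g E a (fun I X x => z * φ I X x) I X x = z * covS g E a φ I X x := by
  simp only [covS_eq, act_mul_left]
  rw [D_const_mul hU hx a z (hφ I X)]
  ring

theorem covS_add (hU : IsOpen U) (hx : x ∈ U) {φ ψ : SpinorField M n m} (hφ : SmoothSpinor φ U)
    (hψ : SmoothSpinor ψ U) (a : Fin 4) (I : Fin n → Fin 2) (X : Fin m → Fin 2) :
    covS g E a (fun I X x => φ I X x + ψ I X x) I X x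
      = covS g E a φ I X x + covS g E a ψ I X x := by
  simp only [covS_eq, act_add]
  rw [D_add hU hx a (hφ I X) (hψ I X)]
  ring

theorem covS_mul (hU : IsOpen U) (hx : x ∈ U) {f : M → ℂ} (hf : SmoothFn f U)
    {φ : SpinorField M n m} (hφ : SmoothSpinor φ U) (a : Fin 4) (I : Fin n → Fin 2)
    (X : Fin m → Fin 2) :
    covS g E a (fun I X x => f x * φ I X x) I X x
      = D E a f x * φ I X x + f x * covS g E a φ I X x := by
  simp only [covS_eq, act_mul_left]
  rw [D_mul hU hx a hf (hφ I X)]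
  ring

theorem covS_perm (φ : SpinorField M n m) (p : Equiv.Perm (Fin n)) (q : Equiv.Perm (Fin m))
    (a : Fin 4) (I : Fin n → Fin 2) (X : Fin m → Fin 2) :
    covS g E a (fun I X => φ (I ∘ p) (X ∘ q)) I X x = covS g E a φ (I ∘ p) (X ∘ q) x := by
  simp only [covS_eq]
  rw [← act_perm _ (fun J => φ J (X ∘ q) x) I p, ← act_perm _ (fun Y => φ (I ∘ p) Y x) X q]

theorem nabla_add (hU : IsOpen U) (hx : x ∈ U) {φ ψ : SpinorField M n m} (hφ : SmoothSpinor φ U)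
    (hψ : SmoothSpinor ψ U) (I : Fin (n + 1) → Fin 2) (X : Fin (m + 1) → Fin 2) :
    nabla g E (fun I X x => φ I X x + ψ I X x) I X x
      = nabla g E φ I X x + nabla g E ψ I X x := by
  simp only [nabla, covS_add hU hx hφ hψ, mul_add, Finset.sum_add_distrib]

theorem nabla_const_mul (hU : IsOpen U) (hx : x ∈ U) {φ : SpinorField M n m}
    (hφ : SmoothSpinor φ U) (z : ℂ) (I : Fin (n + 1) → Fin 2) (X : Fin (m + 1) → Fin 2) :
    nabla g E (fun I X x => z * φ I X x) I X x = z * nabla g E φ I X x := by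
  simp only [nabla, covS_const_mul hU hx hφ, Finset.mul_sum, mul_left_comm]

theorem nabla_sum {τ : Type*} (s : Finset τ) (hU : IsOpen U) (hx : x ∈ U)
    {φ : τ → SpinorField M n m} (hφ : ∀ t, SmoothSpinor (φ t) U) (I : Fin (n + 1) → Fin 2)
    (X : Fin (m + 1) → Fin 2) :
    nabla g E (fun I X x => ∑ t ∈ s, φ t I X x) I X x = ∑ t ∈ s, nabla g E (φ t) I X x := by
  simp only [nabla, covS_sum s hU hx hφ, Finset.mul_sum]
  exact Finset.sum_comm

theorem nabla_perm (φ : SpinorField M n m) (p : Equiv.Perm (Fin n)) (q : Equiv.Perm (Fin m))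
    (P V : Fin 2) (I : Fin n → Fin 2) (X : Fin m → Fin 2) :
    nabla g E (fun I X => φ (I ∘ p) (X ∘ q)) (Matrix.vecCons P I) (Matrix.vecCons V X) x
      = nabla g E φ (Matrix.vecCons P (I ∘ p)) (Matrix.vecCons V (X ∘ q)) x := by
  simp only [nabla_cons, covS_perm]

theorem covS_zero (a : Fin 4) (I : Fin n → Fin 2) (X : Fin m → Fin 2) :
    covS g E a (fun _ _ _ => 0 : SpinorField M n m) I X x = 0 := by
  rw [covS_eq, D_const]
  simp [act]

theorem nabla_zero (I : Fin (n + 1) → Fin 2) (X : Fin (m + 1) → Fin 2) :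
    nabla g E (fun _ _ _ => 0 : SpinorField M n m) I X x = 0 := by
  simp only [nabla, covS_zero, mul_zero, Finset.sum_const_zero]

end Contractions

/-! ### Component algebra of the first-order identity for `γ` -/

section PotentialAlgebra

/-- The pointwise algebra behind the first-order identity for the field `γ` of a potential: `N` is
the second derivative of the potential `Q`, and `G` is the primed curvature. -/
theorem potential_algebra {N : Fin 2 → Fin 2 → Fin 2 → Fin 2 → Fin 2 → Fin 2 → Fin 2 → Fin 2 → ℂ}
    {Q G : Fin 2 → Fin 2 → Fin 2 → Fin 2 → ℂ} {l : ℂ}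
    (hN1 : ∀ P A B C D V Y X, N P A B C D V Y X = N P A C B D V Y X)
    (hN2 : ∀ P A B C D V Y X, N P A B C D V Y X = N P A B D C V Y X)
    (hQ1 : ∀ B C D X, Q B C D X = Q C B D X) (hQ2 : ∀ B C D X, Q B C D X = Q B D C X)
    (hGs : ∀ V Y Z W, G V Y Z W = G Y V Z W)
    (hG : ∀ V W, ∑ Y, ∑ Z, eps Y Z * G V Y Z W = -(l / 2) * if V = W then 1 else 0)
    (hc : ∀ P A B C D V Y X, N P A B C D V Y X - N A P B C D Y V X
      = (∑ F, l / 6 * eps V Y * (((if P = F then 1 else 0) * eps A B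
          + (if A = F then 1 else 0) * eps P B) * Q F C D X
        + ((if P = F then 1 else 0) * eps A C + (if A = F then 1 else 0) * eps P C) * Q B F D X
        + ((if P = F then 1 else 0) * eps A D + (if A = F then 1 else 0) * eps P D) * Q B C F X))
        - ∑ F, eps P A * G V Y X F * Q B C D F)
    (hq : ∀ P A B C D V, (∑ X, ∑ Y, eps X Y * N P A B C D V Y X)
      + (∑ X, ∑ Y, eps X Y * N P B A C D V Y X) + (∑ X, ∑ Y, eps X Y * N P C B A D V Y X)
      + (∑ X, ∑ Y, eps X Y * N P D B C A V Y X) = 0) (A X C D : Fin 2) :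
    (1 / 2) * ∑ Y, ∑ Z, eps Y Z *
      ((∑ F, ∑ B, eps F B * ((1 / 2) * (N C B F A D Y X Z + N C B F A D Y Z X)))
        + ∑ F, ∑ B, eps F B * ((1 / 2) * (N D B F A C Y X Z + N D B F A C Y Z X)))
    = -(l / 3) * Q A C D X
      + (1 / 4) * ∑ F, ∑ B, eps F B * ∑ Y, ∑ Z, eps Y Z * N A B F C D X Z Y := by
  -- These put the symmetric indices of `N` and `Q`, and the form indices of `G`, into a standard
  -- order, so that the sixteen components become linear identities in independent unknowns.
  have n100 := fun P A V Y X => hN1 P A 1 0 0 V Y X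
  have n010 := fun P A V Y X => hN2 P A 0 1 0 V Y X
  have n110 := fun P A V Y X => hN2 P A 1 1 0 V Y X
  have n101 := fun P A V Y X => hN1 P A 1 0 1 V Y X
  have q100 := fun X => hQ1 1 0 0 X
  have q010 := fun X => hQ2 0 1 0 X
  have q110 := fun X => hQ2 1 1 0 X
  have q101 := fun X => hQ1 1 0 1 X
  have g10 := fun Z W => hGs 1 0 Z W
  fin_cases A <;> fin_cases X <;> fin_cases C <;> fin_cases D <;>
    simp only [Fin.zero_eta, Fin.mk_one]
  -- In every component the Ricci identities `hc` reorder derivatives, `hG` evaluates the primed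
  -- curvature they produce, and two components of the differentiated equation `hq` remove
  -- everything except the trace term.
  on_goal 1 =>
    linear_combination (norm := skip) -hc 0 0 0 0 1 0 1 0 + hc 0 1 0 0 0 0 0 1 - hc 0 1 0 0 0 1 0
      0 - Q 0 0 0 0 * hG 0 0 - Q 0 0 0 1 * hG 0 1 + (1 / 4) * hq 0 0 0 0 1 0 - (1 / 4) * hq 1 0 0
      0 0 0
  on_goal 2 =>
    linear_combination (norm := skip) (-1 / 2) * hc 0 0 0 1 1 0 1 0 + hc 0 1 0 0 1 0 0 1 - (1 / 2)
      * hc 0 1 0 0 1 0 1 0 - (1 / 2) * hc 0 1 0 0 1 1 0 0 + (1 / 2) * hc 1 1 0 0 0 0 1 0 - Q 0 0 1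
      0 * hG 0 0 - Q 0 0 1 1 * hG 0 1 + (1 / 4) * hq 0 0 0 1 1 0 - (1 / 4) * hq 1 0 0 0 1 0
  on_goal 3 =>
    linear_combination (norm := skip) (-1 / 2) * hc 0 0 0 1 1 0 1 0 + hc 0 1 0 0 1 0 0 1 - (1 / 2)
      * hc 0 1 0 0 1 0 1 0 - (1 / 2) * hc 0 1 0 0 1 1 0 0 + (1 / 2) * hc 1 1 0 0 0 0 1 0 - Q 0 0 1
      0 * hG 0 0 - Q 0 0 1 1 * hG 0 1 + (1 / 4) * hq 0 0 0 1 1 0 - (1 / 4) * hq 1 0 0 0 1 0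
  on_goal 4 =>
    linear_combination (norm := skip) hc 0 1 0 1 1 0 0 1 - hc 0 1 0 1 1 0 1 0 + hc 1 1 0 0 1 0 1 0
      - Q 0 1 1 0 * hG 0 0 - Q 0 1 1 1 * hG 0 1 + (1 / 4) * hq 0 0 1 1 1 0 - (1 / 4) * hq 1 0 0 1
      1 0
  on_goal 5 =>
    linear_combination (norm := skip) -hc 0 0 0 0 1 0 1 1 + hc 0 1 0 0 0 0 1 1 - hc 0 1 0 0 0 1 1
      0 - Q 0 0 0 0 * hG 1 0 - Q 0 0 0 1 * hG 1 1 + (1 / 4) * hq 0 0 0 0 1 1 - (1 / 4) * hq 1 0 0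
      0 0 1
  on_goal 6 =>
    linear_combination (norm := skip) (-1 / 2) * hc 0 0 0 1 1 0 1 1 + (1 / 2) * hc 0 1 0 0 1 0 1 1
      + (1 / 2) * hc 0 1 0 0 1 1 0 1 - hc 0 1 0 0 1 1 1 0 + (1 / 2) * hc 1 1 0 0 0 0 1 1 - Q 0 0 1
      0 * hG 1 0 - Q 0 0 1 1 * hG 1 1 + (1 / 4) * hq 0 0 0 1 1 1 - (1 / 4) * hq 1 0 0 0 1 1
  on_goal 7 =>
    linear_combination (norm := skip) (-1 / 2) * hc 0 0 0 1 1 0 1 1 + (1 / 2) * hc 0 1 0 0 1 0 1 1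
      + (1 / 2) * hc 0 1 0 0 1 1 0 1 - hc 0 1 0 0 1 1 1 0 + (1 / 2) * hc 1 1 0 0 0 0 1 1 - Q 0 0 1
      0 * hG 1 0 - Q 0 0 1 1 * hG 1 1 + (1 / 4) * hq 0 0 0 1 1 1 - (1 / 4) * hq 1 0 0 0 1 1
  on_goal 8 =>
    linear_combination (norm := skip) hc 0 1 0 1 1 1 0 1 - hc 0 1 0 1 1 1 1 0 + hc 1 1 0 0 1 0 1 1
      - Q 0 1 1 0 * hG 1 0 - Q 0 1 1 1 * hG 1 1 + (1 / 4) * hq 0 0 1 1 1 1 - (1 / 4) * hq 1 0 0 1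
      1 1
  on_goal 9 =>
    linear_combination (norm := skip) -hc 0 0 0 1 1 0 1 0 + hc 0 1 0 0 1 0 0 1 - hc 0 1 0 0 1 1 0
      0 - Q 0 0 1 0 * hG 0 0 - Q 0 0 1 1 * hG 0 1 + (1 / 4) * hq 0 0 0 1 1 0 - (1 / 4) * hq 1 0 0
      0 1 0
  on_goal 10 =>
    linear_combination (norm := skip) (-1 / 2) * hc 0 0 1 1 1 0 1 0 + hc 0 1 0 1 1 0 0 1 - (1 / 2)
      * hc 0 1 0 1 1 0 1 0 - (1 / 2) * hc 0 1 0 1 1 1 0 0 + (1 / 2) * hc 1 1 0 0 1 0 1 0 - Q 0 1 1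
      0 * hG 0 0 - Q 0 1 1 1 * hG 0 1 + (1 / 4) * hq 0 0 1 1 1 0 - (1 / 4) * hq 1 0 0 1 1 0
  on_goal 11 =>
    linear_combination (norm := skip) (-1 / 2) * hc 0 0 1 1 1 0 1 0 + hc 0 1 0 1 1 0 0 1 - (1 / 2)
      * hc 0 1 0 1 1 0 1 0 - (1 / 2) * hc 0 1 0 1 1 1 0 0 + (1 / 2) * hc 1 1 0 0 1 0 1 0 - Q 0 1 1
      0 * hG 0 0 - Q 0 1 1 1 * hG 0 1 + (1 / 4) * hq 0 0 1 1 1 0 - (1 / 4) * hq 1 0 0 1 1 0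
  on_goal 12 =>
    linear_combination (norm := skip) hc 0 1 1 1 1 0 0 1 - hc 0 1 1 1 1 0 1 0 + hc 1 1 0 1 1 0 1 0
      - Q 1 1 1 0 * hG 0 0 - Q 1 1 1 1 * hG 0 1 + (1 / 4) * hq 0 1 1 1 1 0 - (1 / 4) * hq 1 0 1 1
      1 0
  on_goal 13 =>
    linear_combination (norm := skip) -hc 0 0 0 1 1 0 1 1 + hc 0 1 0 0 1 0 1 1 - hc 0 1 0 0 1 1 1
      0 - Q 0 0 1 0 * hG 1 0 - Q 0 0 1 1 * hG 1 1 + (1 / 4) * hq 0 0 0 1 1 1 - (1 / 4) * hq 1 0 0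
      0 1 1
  on_goal 14 =>
    linear_combination (norm := skip) (-1 / 2) * hc 0 0 1 1 1 0 1 1 + (1 / 2) * hc 0 1 0 1 1 0 1 1
      + (1 / 2) * hc 0 1 0 1 1 1 0 1 - hc 0 1 0 1 1 1 1 0 + (1 / 2) * hc 1 1 0 0 1 0 1 1 - Q 0 1 1
      0 * hG 1 0 - Q 0 1 1 1 * hG 1 1 + (1 / 4) * hq 0 0 1 1 1 1 - (1 / 4) * hq 1 0 0 1 1 1
  on_goal 15 =>
    linear_combination (norm := skip) (-1 / 2) * hc 0 0 1 1 1 0 1 1 + (1 / 2) * hc 0 1 0 1 1 0 1 1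
      + (1 / 2) * hc 0 1 0 1 1 1 0 1 - hc 0 1 0 1 1 1 1 0 + (1 / 2) * hc 1 1 0 0 1 0 1 1 - Q 0 1 1
      0 * hG 1 0 - Q 0 1 1 1 * hG 1 1 + (1 / 4) * hq 0 0 1 1 1 1 - (1 / 4) * hq 1 0 0 1 1 1
  on_goal 16 =>
    linear_combination (norm := skip) hc 0 1 1 1 1 1 0 1 - hc 0 1 1 1 1 1 1 0 + hc 1 1 0 1 1 0 1 1
      - Q 1 1 1 0 * hG 1 0 - Q 1 1 1 1 * hG 1 1 + (1 / 4) * hq 0 1 1 1 1 1 - (1 / 4) * hq 1 0 1 1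
      1 1
  all_goals
    simp only [Fin.sum_univ_two, eps_zero_zero, eps_zero_one, eps_one_zero, eps_one_one, n100, n010,
      n110, n101, q100, q010, q110, q101, g10, if_true, if_false, zero_ne_one, one_ne_zero]
    ring1

end PotentialAlgebra

/-! ### Total symmetrisation -/

section Symmetrisation

theorem symm_comp {n : ℕ} (F : (Fin n → Fin 2) → ℂ) (p : Equiv.Perm (Fin n)) (I : Fin n → Fin 2) :
    symm (fun K => F (K ∘ p)) I = symm F I := by
  unfold symm
  congr 1
  exact Equiv.sum_comp (Equiv.mulRight p) fun q : Equiv.Perm (Fin n) => F (I ∘ q)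

theorem symm_comp_right {n : ℕ} (F : (Fin n → Fin 2) → ℂ) (p : Equiv.Perm (Fin n))
    (I : Fin n → Fin 2) : symm F (I ∘ p) = symm F I := by
  unfold symm
  congr 1
  exact Equiv.sum_comp (Equiv.mulLeft p) fun q : Equiv.Perm (Fin n) => F (I ∘ q)

theorem symm_add {n : ℕ} (F G : (Fin n → Fin 2) → ℂ) (I : Fin n → Fin 2) :
    symm (fun K => F K + G K) I = symm F I + symm G I := by
  unfold symm
  rw [Finset.sum_add_distrib, mul_add]

theorem symm_const_mul {n : ℕ} (z : ℂ) (F : (Fin n → Fin 2) → ℂ) (I : Fin n → Fin 2) :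
    symm (fun K => z * F K) I = z * symm F I := by
  unfold symm
  rw [← Finset.mul_sum, mul_left_comm]

theorem symm_eq_zero_of_antisymm {n : ℕ} {F : (Fin n → Fin 2) → ℂ} (p : Equiv.Perm (Fin n))
    (h : ∀ K, F (K ∘ p) = -F K) (I : Fin n → Fin 2) : symm F I = 0 := by
  have h1 := symm_comp F p I
  have h2 := symm_const_mul (-1) F I
  simp only [h] at h1
  simp only [neg_mul, one_mul] at h2
  linear_combination (1 / 2) * (h2 - h1)

/-- The permutations of four slots split into cosets of those fixing the first, and `F` is constant
on each of the four cosets; the `3!` elements of a coset turn `1/4!` into `1/4`. -/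
theorem symm_of_symmetric_tail {F : (Fin 4 → Fin 2) → ℂ}
    (h : ∀ a (I : Fin 3 → Fin 2) (p : Equiv.Perm (Fin 3)),
      F (Matrix.vecCons a (I ∘ p)) = F (Matrix.vecCons a I)) (I : Fin 4 → Fin 2) :
    symm F I = (1 / 4) * ∑ k, F (I ∘ Equiv.swap 0 k) := by
  unfold symm
  rw [← (Equiv.Perm.decomposeFin (n := 3)).symm.sum_comp, Fintype.sum_prod_type]
  have e : ∀ k p, F (I ∘ Equiv.Perm.decomposeFin.symm (k, p)) = F (I ∘ Equiv.swap 0 k) := by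
    intro k p
    have h1 : I ∘ Equiv.Perm.decomposeFin.symm (k, p)
        = Matrix.vecCons (I k) ((I ∘ Equiv.swap 0 k ∘ Fin.succ) ∘ p) := by
      funext j
      refine Fin.cases ?_ (fun j => ?_) j
      · simp
      · simp [Equiv.Perm.decomposeFin_symm_apply_succ]
    have h2 : I ∘ Equiv.swap 0 k = Matrix.vecCons (I k) (I ∘ Equiv.swap 0 k ∘ Fin.succ) := by
      funext j
      refine Fin.cases ?_ (fun j => ?_) j <;> simp
    rw [h1, h2, h]
  simp only [e, Finset.sum_const, Finset.card_univ, Fintype.card_perm, Fintype.card_fin,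
    nsmul_eq_mul, ← Finset.mul_sum, ← mul_assoc]
  norm_num [Nat.factorial]

theorem sum_swap_vec {F : (Fin 4 → Fin 2) → ℂ} (A B C D : Fin 2) :
    ∑ k, F (![A, B, C, D] ∘ Equiv.swap 0 k)
      = F ![A, B, C, D] + F ![B, A, C, D] + F ![C, B, A, D] + F ![D, B, C, A] := by
  have h0 : ![A, B, C, D] ∘ Equiv.swap (0 : Fin 4) 0 = ![A, B, C, D] := by
    funext j; fin_cases j <;> rfl
  have h1 : ![A, B, C, D] ∘ Equiv.swap (0 : Fin 4) 1 = ![B, A, C, D] := by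
    funext j; fin_cases j <;> rfl
  have h2 : ![A, B, C, D] ∘ Equiv.swap (0 : Fin 4) 2 = ![C, B, A, D] := by
    funext j; fin_cases j <;> rfl
  have h3 : ![A, B, C, D] ∘ Equiv.swap (0 : Fin 4) 3 = ![D, B, C, A] := by
    funext j; fin_cases j <;> rfl
  rw [Fin.sum_univ_four, h0, h1, h2, h3]

end Symmetrisation

/-! ### Symmetries and derivatives of a potential -/

section Potential

variable {M : Type*} [TopologicalSpace M] [ChartedSpace R4 M] [IsManifold (𝓡 4) ∞ M]
  {U : Set M} {x : M} {g : Metric M} {E : Frame M} {lam : ℝ}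

theorem nabla_perm_of_invariant {n m : ℕ} {φ : SpinorField M n m} (hU : IsOpen U) (hx : x ∈ U)
    (p : Equiv.Perm (Fin n)) (h : ∀ y ∈ U, ∀ I X, φ (I ∘ p) X y = φ I X y)
    (P V : Fin 2) (I : Fin n → Fin 2) (X : Fin m → Fin 2) :
    nabla g E φ (Matrix.vecCons P (I ∘ p)) (Matrix.vecCons V X) x
      = nabla g E φ (Matrix.vecCons P I) (Matrix.vecCons V X) x := by
  have := nabla_perm (g := g) (E := E) (x := x) φ p 1 P V I X
  rw [Equiv.Perm.coe_one, Function.comp_id] at this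
  rw [← this]
  exact nabla_congr hU hx (fun y hy I X => h y hy I X) _ _

/-- A field `Π_{A'ABC}` which is symmetric in its unprimed indices and solves
`∇^{A'}_{(A} Π_{BCD)A'} = 0`. -/
structure IsPotential (g : Metric M) (E : Frame M) (U : Set M) (Pot : SpinorField M 3 1) :
    Prop where
  smooth : SmoothSpinor Pot U
  symmetric : ∀ x ∈ U, ∀ (p : Equiv.Perm (Fin 3)) I X, Pot (I ∘ p) X x = Pot I X x
  equation : ∀ x ∈ U, ∀ I, potentialEq g E Pot I x = 0

variable {Pot : SpinorField M 3 1}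

theorem IsPotential.swap01 (hP : IsPotential g E U Pot) (hx : x ∈ U) (A B C : Fin 2)
    (X : Fin 1 → Fin 2) : Pot ![A, B, C] X x = Pot ![B, A, C] X x := by
  rw [← hP.symmetric x hx (Equiv.swap 0 1) ![A, B, C]]
  congr 1
  funext j; fin_cases j <;> rfl

theorem IsPotential.swap12 (hP : IsPotential g E U Pot) (hx : x ∈ U) (A B C : Fin 2)
    (X : Fin 1 → Fin 2) : Pot ![A, B, C] X x = Pot ![A, C, B] X x := by
  rw [← hP.symmetric x hx (Equiv.swap 1 2) ![A, B, C]]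
  congr 1
  funext j; fin_cases j <;> rfl

theorem IsPotential.nabla_perm (hP : IsPotential g E U Pot) (hU : IsOpen U) (hx : x ∈ U)
    (p : Equiv.Perm (Fin 3)) (P : Fin 2) (I : Fin 3 → Fin 2) (X : Fin 2 → Fin 2) :
    nabla g E Pot (Matrix.vecCons P (I ∘ p)) X x = nabla g E Pot (Matrix.vecCons P I) X x := by
  obtain ⟨V, X, rfl⟩ : ∃ i J, X = (Matrix.vecCons i J : Fin 2 → Fin 2) :=
    ⟨X 0, Fin.tail X, (Fin.cons_self_tail X).symm⟩
  exact nabla_perm_of_invariant hU hx p (fun y hy I X => hP.symmetric y hy p I X) P V I X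

theorem IsPotential.nabla_swap12 (hP : IsPotential g E U Pot) (hU : IsOpen U) (hx : x ∈ U)
    (I : Fin 4 → Fin 2) (X : Fin 2 → Fin 2) :
    nabla g E Pot (I ∘ Equiv.swap 1 2) X x = nabla g E Pot I X x := by
  have h1 : I ∘ Equiv.swap 1 2 = Matrix.vecCons (I 0) ((I ∘ Fin.succ) ∘ Equiv.swap 0 1) := by
    funext j; fin_cases j <;> rfl
  have h2 : I = Matrix.vecCons (I 0) (I ∘ Fin.succ) := by
    funext j; fin_cases j <;> rfl
  rw [h1, hP.nabla_perm hU hx, ← h2]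

theorem IsPotential.nabla_swap23 (hP : IsPotential g E U Pot) (hU : IsOpen U) (hx : x ∈ U)
    (I : Fin 4 → Fin 2) (X : Fin 2 → Fin 2) :
    nabla g E Pot (I ∘ Equiv.swap 2 3) X x = nabla g E Pot I X x := by
  have h1 : I ∘ Equiv.swap 2 3 = Matrix.vecCons (I 0) ((I ∘ Fin.succ) ∘ Equiv.swap 1 2) := by
    funext j; fin_cases j <;> rfl
  have h2 : I = Matrix.vecCons (I 0) (I ∘ Fin.succ) := by
    funext j; fin_cases j <;> rfl
  rw [h1, hP.nabla_perm hU hx, ← h2]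

theorem IsPotential.sum_swap_eq_zero (hP : IsPotential g E U Pot) (hU : IsOpen U) (hx : x ∈ U)
    (I : Fin 4 → Fin 2) :
    ∑ k, contrPrimed (nabla g E Pot) (I ∘ Equiv.swap 0 k) ![] x = 0 := by
  have h := hP.equation x hx I
  have h2 : potentialEq g E Pot I x = symm (fun K => contrPrimed (nabla g E Pot) K ![] x) I := rfl
  rw [h2, symm_of_symmetric_tail] at h
  · linear_combination 4 * h
  · intro a I p
    simp only [contrPrimed, hP.nabla_perm hU hx]

/-- The potential equation, written as a sum of four terms that vanishes on the open set `U`, may be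
differentiated there. -/
theorem IsPotential.sum_nabla_eq_zero (hP : IsPotential g E U Pot) (hE : IsOrthonormalFrame g E U)
    (hU : IsOpen U) (hx : x ∈ U) (P A B C D V : Fin 2) :
    (∑ X, ∑ Y, eps X Y * nabla g E (nabla g E Pot) ![P, A, B, C, D] ![V, Y, X] x)
    + (∑ X, ∑ Y, eps X Y * nabla g E (nabla g E Pot) ![P, B, A, C, D] ![V, Y, X] x)
    + (∑ X, ∑ Y, eps X Y * nabla g E (nabla g E Pot) ![P, C, B, A, D] ![V, Y, X] x)
    + (∑ X, ∑ Y, eps X Y * nabla g E (nabla g E Pot) ![P, D, B, C, A] ![V, Y, X] x) = 0 := by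
  have hs : SmoothSpinor (nabla g E Pot) U := hP.smooth.nabla hE hU
  have h0 : nabla g E (fun I X x => ∑ k, contrPrimed (nabla g E Pot) (I ∘ Equiv.swap 0 k) X x)
      ![P, A, B, C, D] ![V] x = 0 := by
    rw [← nabla_zero (g := g) (E := E) (x := x) (n := 4) (m := 0) ![P, A, B, C, D] ![V]]
    refine nabla_congr hU hx (fun y hy I X => ?_) _ _
    rw [Subsingleton.elim X ![]]
    exact hP.sum_swap_eq_zero hU hy I
  rw [nabla_sum Finset.univ hU hx
    (φ := fun k I X x => contrPrimed (nabla g E Pot) (I ∘ Equiv.swap 0 k) X x)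
    (fun k I X => hs.contrPrimed _ _)] at h0
  have h1 : ∀ k, nabla g E (fun I X x => contrPrimed (nabla g E Pot) (I ∘ Equiv.swap 0 k) X x)
      ![P, A, B, C, D] ![V] x
      = ∑ X, ∑ Y, eps X Y * nabla g E (nabla g E Pot)
        (Matrix.vecCons P (![A, B, C, D] ∘ Equiv.swap 0 k)) ![V, Y, X] x := by
    intro k
    rw [← nabla_contrPrimed hU hx hs]
    exact QK.nabla_perm (contrPrimed (nabla g E Pot)) (Equiv.swap 0 k) 1 P V ![A, B, C, D] ![]
  simp only [h1] at h0
  rw [sum_swap_vec (F := fun K => ∑ X, ∑ Y, eps X Y * nabla g E (nabla g E Pot)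
    (Matrix.vecCons P K) ![V, Y, X] x)] at h0
  exact h0

end Potential

/-! ### The first-order identity for `γ` -/

section PotentialIdentity

variable {M : Type*} [TopologicalSpace M] [ChartedSpace R4 M] [IsManifold (𝓡 4) ∞ M]
  {U : Set M} {x : M} {g : Metric M} {E : Frame M} {lam : ℝ} {Pot : SpinorField M 3 1}

theorem act_three {κ : Type*} [Fintype κ] (A : κ → κ → ℂ) (φ : (Fin 3 → κ) → ℂ) (B C D : κ) :
    act A φ ![B, C, D]
      = ∑ F, (A B F * φ ![F, C, D] + A C F * φ ![B, F, D] + A D F * φ ![B, C, F]) := by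
  simp only [act_vecCons, act_nil, Finset.sum_add_distrib]
  ring

theorem act_two {κ : Type*} [Fintype κ] (A : κ → κ → ℂ) (φ : (Fin 2 → κ) → ℂ) (B C : κ) :
    act A φ ![B, C] = ∑ F, (A B F * φ ![F, C] + A C F * φ ![B, F]) := by
  simp only [act_vecCons, act_nil, Finset.sum_add_distrib]
  ring

theorem act_one {κ : Type*} [Fintype κ] (A : κ → κ → ℂ) (φ : (Fin 1 → κ) → ℂ) (B : κ) :
    act A φ ![B] = ∑ F, A B F * φ ![F] := by
  simp only [act_vecCons, act_nil, add_zero]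

/-- The trace `μ_{CD}` of `∇^{A'}_A Π_{BCDA'}`. -/
noncomputable def potMu (g : Metric M) (E : Frame M) (Pot : SpinorField M 3 1) :
    SpinorField M 2 0 := contr (contrPrimed (nabla g E Pot))

theorem smooth_gammaOf (hE : IsOrthonormalFrame g E U) (hU : IsOpen U)
    (hP : SmoothSpinor Pot U) : SmoothSpinor (gammaOf g E Pot) U := by
  intro I X
  have := hP.nabla (g := g) (E := E) hE hU
  unfold SmoothSpinor at this
  unfold gammaOf
  fun_prop

theorem nabla_gammaOf (hE : IsOrthonormalFrame g E U) (hU : IsOpen U) (hx : x ∈ U)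
    (hP : SmoothSpinor Pot U) (P C D V X Y : Fin 2) :
    nabla g E (gammaOf g E Pot) ![P, C, D] ![V, X, Y] x = ∑ A, ∑ B, eps A B * ((1 / 2) *
      (nabla g E (nabla g E Pot) ![P, B, A, C, D] ![V, X, Y] x
        + nabla g E (nabla g E Pot) ![P, B, A, C, D] ![V, Y, X] x)) := by
  have hs : SmoothSpinor (nabla g E Pot) U := hP.nabla hE hU
  have hs' : SmoothSpinor (fun I (X : Fin 2 → Fin 2) =>
      contr (nabla g E Pot) I (X ∘ Equiv.swap 0 1)) U := fun I X => hs.contr _ _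
  have h : ∀ y ∈ U, ∀ I X, gammaOf g E Pot I X y = (1 / 2) * (contr (nabla g E Pot) I X y
      + contr (nabla g E Pot) I (X ∘ Equiv.swap 0 1) y) := by
    intro y hy I X
    have hI : I = ![I 0, I 1] := by funext j; fin_cases j <;> rfl
    have hX : X = ![X 0, X 1] := by funext j; fin_cases j <;> rfl
    have hX' : X ∘ Equiv.swap 0 1 = ![X 1, X 0] := by funext j; fin_cases j <;> rfl
    rw [gammaOf, hX', contr, contr, ← hX, ← hI]
    simp only [Fin.sum_univ_two]
    ring
  rw [nabla_congr hU hx h]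
  rw [nabla_const_mul hU hx (φ := fun I X y => contr (nabla g E Pot) I X y
      + contr (nabla g E Pot) I (X ∘ Equiv.swap 0 1) y) (fun I X => (hs.contr I X).add (hs' I X)),
    nabla_add hU hx hs.contr hs', nabla_contr hU hx hs]
  have h2 := nabla_perm (g := g) (E := E) (x := x) (contr (nabla g E Pot)) 1 (Equiv.swap 0 1)
    P V ![C, D] ![X, Y]
  have hX : ![X, Y] ∘ Equiv.swap (0 : Fin 2) 1 = ![Y, X] := by funext j; fin_cases j <;> rfl
  rw [Equiv.Perm.coe_one, hX] at h2
  simp only [Function.comp_id] at h2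
  rw [h2, nabla_contr hU hx hs]
  simp only [Fin.sum_univ_two]
  ring

/-- The key identity of both parts: a first-order expression in `γ` gives back the potential, up to
the gradient of the trace `μ`. It comes from commuting the two derivatives of `Π`; by the shape of
the curvature only `λ` survives. In Part 2 the left side is, up to normalisation, the variation of
the unprimed spin connection. -/
theorem IsPotential.gamma_identity (hP : IsPotential g E U Pot)
    (hq : IsQuaternionicKahler g E U lam) (hE : IsOrthonormalFrame g E U) (hU : IsOpen U)
    (hx : x ∈ U) (A X C D : Fin 2) :
    (1 / 2) * ∑ Y, ∑ Z, eps Y Z * (nabla g E (gammaOf g E Pot) ![C, A, D] ![Y, X, Z] x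
      + nabla g E (gammaOf g E Pot) ![D, A, C] ![Y, X, Z] x)
    = -(lam / 3 : ℂ) * Pot ![A, C, D] ![X] x
      + (1 / 4) * nabla g E (potMu g E Pot) ![A, C, D] ![X] x := by
  have hs : SmoothSpinor (nabla g E Pot) U := hP.smooth.nabla hE hU
  have hmu : nabla g E (potMu g E Pot) ![A, C, D] ![X] x = ∑ F, ∑ B, eps F B * ∑ Y, ∑ Z,
      eps Y Z * nabla g E (nabla g E Pot) ![A, B, F, C, D] ![X, Z, Y] x := by
    rw [potMu, nabla_contr hU hx hs.contrPrimed]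
    simp only [nabla_contrPrimed hU hx hs]
  simp only [nabla_gammaOf hE hU hx hP.smooth, hmu]
  refine potential_algebra
    (N := fun P A B C D V Y X => nabla g E (nabla g E Pot) ![P, A, B, C, D] ![V, Y, X] x)
    (Q := fun B C D X => Pot ![B, C, D] ![X] x) (G := primedCurv g E x) ?_ ?_ ?_ ?_
    (fun V Y Z W => primedCurv_comm V Y Z W) (hq.primedCurv_trace hE hU hx) ?_
    (hP.sum_nabla_eq_zero hE hU hx) A X C D
  · intro P A B C D V Y X
    have := nabla_perm_of_invariant (g := g) (E := E) hU hx (Equiv.swap 1 2)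
      (fun y hy I X => hP.nabla_swap12 hU hy I X) P V ![A, B, C, D] ![Y, X]
    rw [← this]
    congr 1
    funext j; fin_cases j <;> rfl
  · intro P A B C D V Y X
    have := nabla_perm_of_invariant (g := g) (E := E) hU hx (Equiv.swap 2 3)
      (fun y hy I X => hP.nabla_swap23 hU hy I X) P V ![A, B, C, D] ![Y, X]
    rw [← this]
    congr 1
    funext j; fin_cases j <;> rfl
  · exact fun B C D X => hP.swap01 hx B C D _
  · exact fun B C D X => hP.swap12 hx B C D _
  · intro P A B C D V Y X
    have h := hE.nabla_comm hU hx hP.smooth P A V Y ![B, C, D] ![X]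
    rw [act_three, act_one] at h
    simp only [hq.curvS_eq hE hU hx, hq.curvSPrimed_eq hE hU hx] at h
    rw [h]
    simp only [Fin.sum_univ_two]
    ring

end PotentialIdentity

/-! ### The second-order identity of Part 1 -/

section SecondOrderIdentity

variable {M : Type*} [TopologicalSpace M] [ChartedSpace R4 M] [IsManifold (𝓡 4) ∞ M]
  {U : Set M} {x : M} {g : Metric M} {E : Frame M} {lam : ℝ} {Pot : SpinorField M 3 1}

theorem vec_four (K : Fin 4 → Fin 2) : K = ![K 0, K 1, K 2, K 3] := by
  funext j; fin_cases j <;> rfl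

theorem vec_three (K : Fin 3 → Fin 2) : K = ![K 0, K 1, K 2] := by
  funext j; fin_cases j <;> rfl

theorem smooth_potMu (hE : IsOrthonormalFrame g E U) (hU : IsOpen U) (hP : SmoothSpinor Pot U) :
    SmoothSpinor (potMu g E Pot) U := by
  have hs : SmoothSpinor (nabla g E Pot) U := hP.nabla hE hU
  exact hs.contrPrimed.contr

/-- Symmetrised in its derivative indices and contracted over primed ones, a second derivative is a
commutator, that is, curvature; and the unprimed curvature is made of terms with an `ε`, which total
symmetrisation kills. This is where `Ψ = 0` enters. -/
theorem symm_box_eq_zero (hq : IsQuaternionicKahler g E U lam) (hE : IsOrthonormalFrame g E U)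
    (hU : IsOpen U) (hx : x ∈ U) {μ : SpinorField M 2 0} (hμ : SmoothSpinor μ U)
    (I : Fin 4 → Fin 2) :
    symm (fun K => ∑ X, ∑ V, eps X V * nabla g E (nabla g E μ) K ![V, X] x) I = 0 := by
  set R : (Fin 4 → Fin 2) → ℂ :=
    fun K => ∑ X, ∑ V, eps X V * nabla g E (nabla g E μ) K ![V, X] x with hR
  -- Exchanging the first two unprimed indices and relabelling the primed ones changes the sign of
  -- `ε`, so the sum is a commutator, evaluated by the Ricci identity.
  have h1 : ∀ K, R K + R (K ∘ Equiv.swap 0 1) = (-(lam / 3) : ℂ) *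
      ((eps (K 1) (K 2) * μ ![K 0, K 3] ![] x + eps (K 0) (K 2) * μ ![K 1, K 3] ![] x)
      + (eps (K 1) (K 3) * μ ![K 2, K 0] ![] x + eps (K 0) (K 3) * μ ![K 2, K 1] ![] x)) := by
    intro K
    have hK : K ∘ Equiv.swap 0 1 = ![K 1, K 0, K 2, K 3] := by
      funext j; fin_cases j <;> rfl
    have hc := fun V X => hE.nabla_comm hU hx hμ (K 0) (K 1) V X ![K 2, K 3] ![]
    simp only [act_two, act_nil, hq.curvS_eq hE hU hx] at hc
    have c01 := hc 0 1
    have c10 := hc 1 0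
    rw [hK, hR]
    nth_rw 1 [vec_four K]
    generalize K 0 = A at *
    generalize K 1 = B at *
    simp only [Fin.sum_univ_two, eps_zero_zero, eps_zero_one, eps_one_zero, eps_one_one] at *
    fin_cases A <;> fin_cases B <;> simp at * <;> linear_combination c10 - c01
  have h2 : symm (fun K => R K + R (K ∘ Equiv.swap 0 1)) I = 0 := by
    simp only [h1]
    rw [symm_const_mul, symm_add, symm_add, symm_add]
    rw [symm_eq_zero_of_antisymm (Equiv.swap 1 2), symm_eq_zero_of_antisymm (Equiv.swap 0 2),
      symm_eq_zero_of_antisymm (Equiv.swap 1 3), symm_eq_zero_of_antisymm (Equiv.swap 0 3)]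
    · simp
    all_goals
      intro K
      simp only [Function.comp_apply]
      rw [eps_swap, neg_mul]
      rfl
  rw [symm_add, symm_comp] at h2
  linear_combination (1 / 2) * h2

theorem IsPotential.secondOrderOp_gammaOf (hP : IsPotential g E U Pot)
    (hq : IsQuaternionicKahler g E U lam) (hE : IsOrthonormalFrame g E U) (hU : IsOpen U)
    (hx : x ∈ U) (I : Fin 4 → Fin 2) : secondOrderOp g E (gammaOf g E Pot) I x = 0 := by
  have hγ := smooth_gammaOf (g := g) hE hU hP.smooth
  have hs : SmoothSpinor (nabla g E (gammaOf g E Pot)) U := hγ.nabla hE hU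
  have hμ := smooth_potMu (g := g) hE hU hP.smooth
  have hsμ : SmoothSpinor (nabla g E (potMu g E Pot)) U := hμ.nabla hE hU
  -- The rotation of the primed slots brings the derivative index and the last index of `γ` to the
  -- front, where `contrPrimed` contracts them. The permutations `p₁` and `p₂` give the two terms
  -- symmetrised in the first-order identity.
  set ψ : Equiv.Perm (Fin 3) → SpinorField M 3 3 := fun p I X =>
    nabla g E (gammaOf g E Pot) (I ∘ p) (X ∘ finRotate 3) with hψ
  have hψs : ∀ p, SmoothSpinor (ψ p) U := fun p I X => hs _ _
  set p₁ : Equiv.Perm (Fin 3) := Equiv.swap 0 1 with hp₁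
  set p₂ : Equiv.Perm (Fin 3) := (finRotate 3).symm with hp₂
  have hid : ∀ y ∈ U, ∀ (I : Fin 3 → Fin 2) (X : Fin 1 → Fin 2),
      (1 / 2) * (contrPrimed (ψ p₁) I X y + contrPrimed (ψ p₂) I X y)
      = -(lam / 3 : ℂ) * Pot I X y + (1 / 4) * nabla g E (potMu g E Pot) I X y := by
    intro y hy I X
    have h := hP.gamma_identity hq hE hU hy (I 0) (X 0) (I 1) (I 2)
    have hX : ![X 0] = X := by funext j; fin_cases j; rfl
    rw [← vec_three I, hX] at h
    rw [← h]
    have e1 : I ∘ p₁ = ![I 1, I 0, I 2] := by funext j; fin_cases j <;> rfl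
    have e2 : I ∘ p₂ = ![I 2, I 0, I 1] := by funext j; fin_cases j <;> rfl
    have e3 : ∀ Y Z, Matrix.vecCons Z (Matrix.vecCons Y X) ∘ finRotate 3 = ![Y, X 0, Z] := by
      intro Y Z; funext j; fin_cases j <;> rfl
    simp only [contrPrimed, hψ, e1, e2, e3, Fin.sum_univ_two]
    ring
  set FF : (Fin 4 → Fin 2) → ℂ := fun K => ∑ X, ∑ V, eps X V * ∑ Y, ∑ Z, eps Y Z *
    nabla g E (nabla g E (gammaOf g E Pot)) K ![V, Y, X, Z] x with hFF
  -- The permutation `p₂` acting on the last three of four slots: the first slot belongs to the new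
  -- derivative.
  set r : Equiv.Perm (Fin 4) := Equiv.Perm.decomposeFin.symm (0, p₂) with hr
  have hF : ∀ K, (1 / 2) * (FF (K ∘ Equiv.swap 1 2) + FF (K ∘ r))
      = -(lam / 3 : ℂ) * (∑ X, ∑ V, eps X V * nabla g E Pot K ![V, X] x)
        + (1 / 4) * ∑ X, ∑ V, eps X V * nabla g E (nabla g E (potMu g E Pot)) K ![V, X] x := by
    intro K
    obtain ⟨a, J, rfl⟩ : ∃ a J, K = (Matrix.vecCons a J : Fin 4 → Fin 2) :=
      ⟨K 0, Fin.tail K, (Fin.cons_self_tail K).symm⟩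
    have e1 : Matrix.vecCons a J ∘ Equiv.swap 1 2 = Matrix.vecCons a (J ∘ p₁) := by
      funext j; fin_cases j <;> rfl
    have e2 : Matrix.vecCons a J ∘ r = Matrix.vecCons a (J ∘ p₂) := by
      funext j; fin_cases j <;> rfl
    have e3 : ∀ X Y Z : Fin 2, ![Z, Y, X] ∘ finRotate 3 = ![Y, X, Z] := by
      intro X Y Z; funext j; fin_cases j <;> rfl
    have hn := fun V X => nabla_congr (g := g) (E := E) hU hx hid (Matrix.vecCons a J) ![V, X]
    have hc := fun p => (hψs p).contrPrimed
    have hψn : ∀ p V X Y Z, nabla g E (ψ p) (Matrix.vecCons a J) ![V, Z, Y, X] x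
        = nabla g E (nabla g E (gammaOf g E Pot)) (Matrix.vecCons a (J ∘ p))
          ![V, Y, X, Z] x := by
      intro p V X Y Z
      rw [← e3 X Y Z]
      exact QK.nabla_perm (nabla g E (gammaOf g E Pot)) p (finRotate 3) a V J ![Z, Y, X]
    have hl : ∀ V X, nabla g E (fun I X y => (1 / 2 : ℂ) * (contrPrimed (ψ p₁) I X y
        + contrPrimed (ψ p₂) I X y)) (Matrix.vecCons a J) ![V, X] x = (1 / 2) * (
        (∑ Y, ∑ Z, eps Y Z * nabla g E (nabla g E (gammaOf g E Pot)) (Matrix.vecCons a J ∘ Equiv.swap 1 2)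
          ![V, Y, X, Z] x)
        + ∑ Y, ∑ Z, eps Y Z * nabla g E (nabla g E (gammaOf g E Pot)) (Matrix.vecCons a J ∘ r) ![V, Y, X, Z] x) := by
      intro V X
      rw [nabla_const_mul hU hx (φ := fun I X y => contrPrimed (ψ p₁) I X y
        + contrPrimed (ψ p₂) I X y) (fun I X => (hc p₁ I X).add (hc p₂ I X)),
        nabla_add hU hx (hc p₁) (hc p₂), e1, e2]
      rw [nabla_contrPrimed hU hx (hψs p₁), nabla_contrPrimed hU hx (hψs p₂)]
      simp only [hψn]
    have hr : ∀ V X, nabla g E (fun I X y => -(lam / 3 : ℂ) * Pot I X y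
        + (1 / 4) * nabla g E (potMu g E Pot) I X y) (Matrix.vecCons a J) ![V, X] x
        = -(lam / 3 : ℂ) * nabla g E Pot (Matrix.vecCons a J) ![V, X] x
          + (1 / 4) * nabla g E (nabla g E (potMu g E Pot)) (Matrix.vecCons a J) ![V, X] x := by
      intro V X
      rw [nabla_add hU hx (φ := fun I X y => -(lam / 3 : ℂ) * Pot I X y)
        (ψ := fun I X y => (1 / 4) * nabla g E (potMu g E Pot) I X y)
        (fun I X => (SmoothFn.const _).mul (hP.smooth I X))
        (fun I X => (SmoothFn.const _).mul (hsμ I X)), nabla_const_mul hU hx hP.smooth,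
        nabla_const_mul hU hx hsμ]
    simp only [hl, hr] at hn
    have n00 := hn 0 1
    have n10 := hn 1 0
    simp only [hFF, Fin.sum_univ_two, eps_zero_zero, eps_zero_one, eps_one_zero,
      eps_one_one] at n00 n10 ⊢
    linear_combination n10 - n00
  -- Under total symmetrisation both index orders give the same term, so the left side of `hF` is
  -- `FF` itself.
  have hsymm : symm (fun K => (1 / 2) * (FF (K ∘ Equiv.swap 1 2) + FF (K ∘ r))) I = symm FF I := by
    rw [symm_const_mul, symm_add, symm_comp, symm_comp]
    ring
  have hzero : symm (fun K => (1 / 2) * (FF (K ∘ Equiv.swap 1 2) + FF (K ∘ r))) I = 0 := by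
    simp only [hF]
    rw [symm_add, symm_const_mul, symm_const_mul, symm_box_eq_zero hq hE hU hx hμ]
    have h : symm (fun K => ∑ X, ∑ V, eps X V * nabla g E Pot K ![V, X] x) I = 0 :=
      hP.equation x hx I
    rw [h]
    ring
  -- The second pair of primed indices is contracted in the opposite order in `FF`, hence the sign.
  have hop : secondOrderOp g E (gammaOf g E Pot) I x = symm (fun K => (-1) * FF K) I := by
    unfold secondOrderOp
    congr 1
    funext K
    simp only [hFF, Fin.sum_univ_two, eps_zero_zero, eps_zero_one, eps_one_zero, eps_one_one]
    ring
  rw [hop, symm_const_mul, ← hsymm, hzero, mul_zero]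

end SecondOrderIdentity

/-! ### Inverses of the perturbed metric -/

section MatrixInverse

variable {M : Type*} [TopologicalSpace M] [ChartedSpace R4 M] [IsManifold (𝓡 4) ∞ M]
  {U : Set M} {x : M} {g : Metric M} {E : Frame M}

theorem SmoothFn.inv {f : M → ℂ} (hf : SmoothFn f U) (h : ∀ y ∈ U, f y ≠ 0) :
    SmoothFn (fun y => (f y)⁻¹) U := fun y hy =>
  ((contDiffAt_inv ℝ (h y hy)).contMDiffAt).comp_contMDiffWithinAt y (hf y hy)

theorem SmoothFn.det {ι : Type*} [Fintype ι] [DecidableEq ι] {A : M → Matrix ι ι ℂ}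
    (hA : ∀ i j, SmoothFn (fun y => A y i j) U) : SmoothFn (fun y => (A y).det) U := by
  simp only [Matrix.det_apply']
  exact SmoothFn.sum fun p => (SmoothFn.const _).mul (SmoothFn.prod fun i => hA _ _)

theorem SmoothFn.matrix_inv {ι : Type*} [Fintype ι] [DecidableEq ι] {A : M → Matrix ι ι ℂ}
    (hA : ∀ i j, SmoothFn (fun y => A y i j) U) (h : ∀ y ∈ U, (A y).det ≠ 0) (i j : ι) :
    SmoothFn (fun y => (A y)⁻¹ i j) U := by
  simp only [Matrix.inv_def, Ring.inverse_eq_inv', Matrix.smul_apply, smul_eq_mul,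
    Matrix.adjugate_apply]
  refine ((SmoothFn.det hA).inv h).mul (SmoothFn.det fun k l => ?_)
  by_cases hk : k = j
  · subst hk
    simp only [Matrix.updateRow_self]
    exact SmoothFn.const _
  · simp only [Matrix.updateRow_ne hk]
    exact hA k l

theorem D_matrix_inv {A : M → Matrix (Fin 4) (Fin 4) ℂ} (hU : IsOpen U) (hx : x ∈ U)
    (hA : ∀ i j, SmoothFn (fun y => A y i j) U) (h : ∀ y ∈ U, (A y).det ≠ 0) (a i j : Fin 4) :
    D E a (fun y => (A y)⁻¹ i j) x
      = -∑ p, ∑ q, (A x)⁻¹ i p * D E a (fun y => A y p q) x * (A x)⁻¹ q j := by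
  have hi := SmoothFn.matrix_inv hA h
  have h1 : ∀ k, ∑ e, ((A x)⁻¹ i e * D E a (fun y => A y e k) x
      + D E a (fun y => (A y)⁻¹ i e) x * A x e k) = 0 := by
    intro k
    rw [← D_const E a (if i = k then 1 else 0) (x := x), ← D_congr hU hx a (f := fun y =>
      ∑ e, (A y)⁻¹ i e * A y e k), D_sum hU hx a (fun e => (hi i e).mul (hA e k))]
    · exact Finset.sum_congr rfl fun e _ => (D_mul hU hx a (hi i e) (hA e k)).symm
    · intro y hy
      rw [← Matrix.mul_apply, Matrix.nonsing_inv_mul _ (Ne.isUnit (h y hy)), Matrix.one_apply]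
  have h2 : ∀ e, ∑ k, A x e k * (A x)⁻¹ k j = if e = j then 1 else 0 := by
    intro e
    rw [← Matrix.mul_apply, Matrix.mul_nonsing_inv _ (Ne.isUnit (h x hx)), Matrix.one_apply]
  have h3 : ∑ k, (∑ e, ((A x)⁻¹ i e * D E a (fun y => A y e k) x
      + D E a (fun y => (A y)⁻¹ i e) x * A x e k)) * (A x)⁻¹ k j = 0 := by
    simp only [h1, zero_mul, Finset.sum_const_zero]
  have h4 : ∑ e, D E a (fun y => (A y)⁻¹ i e) x * ∑ k, A x e k * (A x)⁻¹ k j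
      = D E a (fun y => (A y)⁻¹ i j) x := by
    simp only [h2, mul_ite, mul_one, mul_zero, Finset.sum_ite_eq', Finset.mem_univ, if_true]
  rw [← h4]
  simp only [Finset.sum_add_distrib, add_mul, Finset.sum_mul, Finset.mul_sum] at h3 ⊢
  rw [eq_neg_iff_add_eq_zero, ← h3, add_comm, Finset.sum_comm]
  congr 1
  rw [Finset.sum_comm]
  exact Finset.sum_congr rfl fun _ _ => Finset.sum_congr rfl fun _ _ => by ring

/-- The determinant (`none`) and the entries of the adjugate (`some p`) are polynomials in `t`; the
inverse matrix is their quotient. -/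
theorem differentiable_det_perturbed (h : M → Matrix (Fin 4) (Fin 4) ℂ) (x : M)
    (i : Option (Fin 4 × Fin 4)) :
    Differentiable ℝ fun t : ℝ => (match i with
      | none => (perturbed h t x).det
      | some p => (perturbed h t x).adjugate p.1 p.2) := by
  have e : ∀ k l, Differentiable ℝ fun t : ℝ => perturbed h t x k l := by
    intro k l
    simp only [perturbed, Matrix.add_apply, Matrix.smul_apply, smul_eq_mul]
    fun_prop
  cases i with
  | none =>
    simp only [Matrix.det_apply']
    intro t
    exact DifferentiableAt.fun_sum fun p _ => (differentiableAt_const _).mul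
      (DifferentiableAt.fun_finsetProd fun i _ => e _ _ t)
  | some p =>
    simp only [Matrix.adjugate_apply, Matrix.det_apply']
    intro t
    refine DifferentiableAt.fun_sum fun q _ => (differentiableAt_const _).mul
      (DifferentiableAt.fun_finsetProd fun i _ => ?_)
    by_cases hk : q i = p.2
    · simp only [hk, Matrix.updateRow_self]
      exact differentiableAt_const _
    · simp only [Matrix.updateRow_ne hk]
      exact e _ _ t

theorem perturbed_zero (h : M → Matrix (Fin 4) (Fin 4) ℂ) (x : M) : perturbed h 0 x = 1 := by
  simp [perturbed, background]

/-- The matrix inverse takes the value `0` at singular matrices, so formulas for the perturbed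
connection hold only for small `t`; this is enough for derivatives at `t = 0`. -/
theorem eventually_det_ne_zero (h : M → Matrix (Fin 4) (Fin 4) ℂ) (x : M) :
    ∀ᶠ t : ℝ in nhds 0, (perturbed h t x).det ≠ 0 := by
  have hc := (differentiable_det_perturbed h x none).continuous.continuousAt (x := 0)
  refine hc.eventually_ne ?_
  simp [perturbed_zero]

theorem hasDerivAt_perturbed (h : M → Matrix (Fin 4) (Fin 4) ℂ) (x : M) (i j : Fin 4) :
    HasDerivAt (fun t : ℝ => perturbed h t x i j) (h x i j) 0 := by
  simp only [perturbed, Matrix.add_apply, Matrix.smul_apply, smul_eq_mul]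
  have h1 : HasDerivAt (fun t : ℝ => (t : ℂ)) 1 0 := Complex.ofRealCLM.hasDerivAt
  simpa using h1.mul_const (h x i j)

theorem hasDerivAt_perturbed_inv (h : M → Matrix (Fin 4) (Fin 4) ℂ) (x : M) (i j : Fin 4) :
    HasDerivAt (fun t : ℝ => (perturbed h t x)⁻¹ i j) (-h x i j) 0 := by
  have hd : ∀ i j, DifferentiableAt ℝ (fun t : ℝ => (perturbed h t x)⁻¹ i j) 0 := by
    intro i j
    simp only [Matrix.inv_def, Ring.inverse_eq_inv', Matrix.smul_apply, smul_eq_mul]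
    refine DifferentiableAt.mul (DifferentiableAt.inv (differentiable_det_perturbed h x none 0) ?_)
      (differentiable_det_perturbed h x (some (i, j)) 0)
    simp [perturbed_zero]
  have hm : HasDerivAt (fun t : ℝ => ∑ e, (perturbed h t x)⁻¹ i e * perturbed h t x e j)
      (∑ e, (deriv (fun t : ℝ => (perturbed h t x)⁻¹ i e) 0 * perturbed h 0 x e j
        + (perturbed h 0 x)⁻¹ i e * h x e j)) 0 :=
    HasDerivAt.fun_sum fun e _ => (hd i e).hasDerivAt.fun_mul (hasDerivAt_perturbed h x e j)
  have hc : HasDerivAt (fun t : ℝ => ∑ e, (perturbed h t x)⁻¹ i e * perturbed h t x e j) 0 0 := by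
    refine (hasDerivAt_const (0 : ℝ) (if i = j then (1 : ℂ) else 0)).congr_of_eventuallyEq ?_
    filter_upwards [eventually_det_ne_zero h x] with t ht
    rw [← Matrix.mul_apply, Matrix.nonsing_inv_mul _ (Ne.isUnit ht), Matrix.one_apply]
  have hu := hm.unique hc
  simp only [perturbed_zero, inv_one, Matrix.one_apply, mul_ite, mul_one, mul_zero, ite_mul,
    one_mul, zero_mul, Finset.sum_add_distrib, Finset.sum_ite_eq, Finset.sum_ite_eq',
    Finset.mem_univ, if_true] at hu
  rw [← eq_neg_of_add_eq_zero_left hu]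
  exact (hd i j).hasDerivAt

end MatrixInverse

/-! ### First variation of the connection and of the curvature -/

section Linearisation

variable {M : Type*} [TopologicalSpace M] [ChartedSpace R4 M] [IsManifold (𝓡 4) ∞ M]
  {U : Set M} {x : M} {g : Metric M} {E : Frame M} {h : M → Matrix (Fin 4) (Fin 4) ℂ}

/-- Twice the Christoffel symbol with all indices lowered, by the Koszul formula. -/
noncomputable def koszul (g : Metric M) (E : Frame M) (G : M → Matrix (Fin 4) (Fin 4) ℂ)
    (a b e : Fin 4) : M → ℂ := fun x =>
  D E a (fun y => G y b e) x + D E b (fun y => G y a e) x - D E e (fun y => G y a b) x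
    + ∑ f, (structureFn g E a b f x * G x f e - structureFn g E a e f x * G x f b
      - structureFn g E b e f x * G x f a)

theorem christoffel_eq_koszul (G : M → Matrix (Fin 4) (Fin 4) ℂ) (a b d : Fin 4) :
    christoffel g E G a b d = fun x => (1 / 2) * ∑ e, (G x)⁻¹ d e * koszul g E G a b e x := rfl

theorem koszul_background (a b e : Fin 4) :
    koszul g E background a b e x = 2 * leviCivita g E a b e x := by
  have h := congrFun (christoffel_eq_koszul (g := g) (E := E) background a b e) x
  rw [leviCivita, h]
  simp [background, Matrix.one_apply]

theorem smooth_koszul (hE : IsOrthonormalFrame g E U) (hU : IsOpen U)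
    (hh : ∀ i j, SmoothFn (fun y => h y i j) U) (a b e : Fin 4) :
    SmoothFn (koszul g E h a b e) U := by
  have h1 := hE.smooth_structureFn hU
  have h2 := fun a i j => hE.smooth_D hU a (hh i j)
  unfold koszul
  fun_prop

theorem D_perturbed (hU : IsOpen U) (hx : x ∈ U) (hh : ∀ i j, SmoothFn (fun y => h y i j) U)
    (t : ℝ) (a i j : Fin 4) :
    D E a (fun y => perturbed h t y i j) x = t * D E a (fun y => h y i j) x := by
  rw [← D_const_mul hU hx a _ (hh i j)]
  have := D_add hU hx a (E := E) (SmoothFn.const ((background x : Matrix (Fin 4) (Fin 4) ℂ) i j))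
    ((SmoothFn.const (t : ℂ)).mul (hh i j))
  rw [D_const, zero_add] at this
  exact this

/-- The lowered Koszul expression is linear in the metric, so all nonlinearity in `t` sits in the
inverse metric. -/
theorem koszul_perturbed (hU : IsOpen U) (hx : x ∈ U) (hh : ∀ i j, SmoothFn (fun y => h y i j) U)
    (t : ℝ) (a b e : Fin 4) : koszul g E (perturbed h t) a b e x
      = 2 * leviCivita g E a b e x + t * koszul g E h a b e x := by
  have hD := D_perturbed (E := E) hU hx hh t
  have hb : ∀ a i j, D E a (fun y => (background y : Matrix (Fin 4) (Fin 4) ℂ) i j) x = 0 :=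
    fun a i j => D_const E a _
  have hp : ∀ i j, perturbed h t x i j = (background x : Matrix (Fin 4) (Fin 4) ℂ) i j
      + t * h x i j := fun i j => rfl
  rw [← koszul_background]
  unfold koszul
  simp only [hD, hb, hp, mul_add, Finset.sum_add_distrib, Finset.sum_sub_distrib, Finset.mul_sum,
    mul_left_comm, mul_sub]
  ring

/-- The first variation of the Christoffel symbols in the direction `h`. -/
noncomputable def varChristoffel (g : Metric M) (E : Frame M) (h : M → Matrix (Fin 4) (Fin 4) ℂ)
    (a b d : Fin 4) : M → ℂ := fun x =>
  (1 / 2) * koszul g E h a b d x - ∑ e, h x d e * leviCivita g E a b e x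

theorem hasDerivAt_christoffel (hU : IsOpen U) (hx : x ∈ U)
    (hh : ∀ i j, SmoothFn (fun y => h y i j) U) (a b d : Fin 4) :
    HasDerivAt (fun t : ℝ => christoffel g E (perturbed h t) a b d x)
      (varChristoffel g E h a b d x) 0 := by
  simp only [christoffel_eq_koszul, koszul_perturbed hU hx hh]
  have h1 : HasDerivAt (fun t : ℝ => (t : ℂ)) 1 0 := Complex.ofRealCLM.hasDerivAt
  have := (HasDerivAt.fun_sum (u := Finset.univ) fun e _ =>
    (hasDerivAt_perturbed_inv h x d e).fun_mul
    ((h1.mul_const (koszul g E h a b e x)).const_add (2 * leviCivita g E a b e x))).const_mul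
      (1 / 2 : ℂ)
  refine this.congr_deriv ?_
  simp only [perturbed_zero, inv_one, Matrix.one_apply, varChristoffel, Complex.ofReal_zero,
    zero_mul, add_zero, one_mul, ite_mul, Finset.sum_add_distrib, Finset.sum_ite_eq,
    Finset.mem_univ, if_true, neg_mul, Finset.sum_neg_distrib, mul_left_comm _ (2 : ℂ),
    ← Finset.mul_sum]
  ring

theorem D_christoffel_perturbed (hE : IsOrthonormalFrame g E U) (hU : IsOpen U) (hx : x ∈ U)
    (hh : ∀ i j, SmoothFn (fun y => h y i j) U) {t : ℝ} (ht : (perturbed h t x).det ≠ 0)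
    (a b c d : Fin 4) : D E a (christoffel g E (perturbed h t) b c d) x
      = (1 / 2) * ∑ e, ((-∑ p, ∑ q, (perturbed h t x)⁻¹ d p * (t * D E a (fun y => h y p q) x)
          * (perturbed h t x)⁻¹ q e) * (2 * leviCivita g E b c e x + t * koszul g E h b c e x)
        + (perturbed h t x)⁻¹ d e * (2 * D E a (leviCivita g E b c e) x
          + t * D E a (koszul g E h b c e) x)) := by
  have hp : ∀ i j, SmoothFn (fun y => perturbed h t y i j) U := fun i j =>
    (SmoothFn.const _).add ((SmoothFn.const _).mul (hh i j))
  have hdet := SmoothFn.det hp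
  -- For a fixed `t` the perturbed metric is known to be invertible only at `x`; spatial
  -- differentiation requires a neighbourhood, supplied by continuity of the determinant.
  set V := U ∩ (fun y => (perturbed h t y).det) ⁻¹' {0}ᶜ with hV
  have hVo : IsOpen V := hdet.continuousOn.isOpen_inter_preimage hU isOpen_compl_singleton
  have hxV : x ∈ V := ⟨hx, ht⟩
  have hsub : V ⊆ U := Set.inter_subset_left
  have hpV : ∀ i j, SmoothFn (fun y => perturbed h t y i j) V := fun i j => (hp i j).mono hsub
  have hne : ∀ y ∈ V, (perturbed h t y).det ≠ 0 := fun y hy => hy.2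
  have hi := SmoothFn.matrix_inv hpV hne
  have hΓ : ∀ e, SmoothFn (leviCivita g E b c e) V := fun e =>
    (hE.smooth_leviCivita hU b c e).mono hsub
  have hκ : ∀ e, SmoothFn (koszul g E h b c e) V := fun e => (smooth_koszul hE hU hh b c e).mono hsub
  have hk : ∀ e, SmoothFn (fun y => 2 * leviCivita g E b c e y + t * koszul g E h b c e y) V :=
    fun e => by have := hΓ e; have := hκ e; fun_prop
  have hD := D_perturbed (E := E) hU hx hh t a
  have hDk : ∀ e, D E a (fun y => 2 * leviCivita g E b c e y + t * koszul g E h b c e y) x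
      = 2 * D E a (leviCivita g E b c e) x + t * D E a (koszul g E h b c e) x := by
    intro e
    rw [D_add hVo hxV a ((SmoothFn.const _).mul (hΓ e)) ((SmoothFn.const _).mul (hκ e)),
      D_const_mul hVo hxV a _ (hΓ e), D_const_mul hVo hxV a _ (hκ e)]
  have hc : D E a (christoffel g E (perturbed h t) b c d) x = D E a (fun y => (1 / 2) *
      ∑ e, (perturbed h t y)⁻¹ d e *
        (2 * leviCivita g E b c e y + t * koszul g E h b c e y)) x := by
    refine D_congr hVo hxV a fun y hy => ?_
    simp only [christoffel_eq_koszul, koszul_perturbed hU (hsub hy) hh]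
  have hm : ∀ e, SmoothFn (fun y => (perturbed h t y)⁻¹ d e *
      (2 * leviCivita g E b c e y + t * koszul g E h b c e y)) V := fun e => (hi d e).mul (hk e)
  rw [hc, D_const_mul hVo hxV a _ (SmoothFn.sum hm), D_sum hVo hxV a hm]
  congr 1
  refine Finset.sum_congr rfl fun e _ => ?_
  rw [D_mul hVo hxV a (hi d e) (hk e), D_matrix_inv hVo hxV hpV hne, hDk]
  simp only [hD]
  ring

theorem D_varChristoffel (hE : IsOrthonormalFrame g E U) (hU : IsOpen U) (hx : x ∈ U)
    (hh : ∀ i j, SmoothFn (fun y => h y i j) U) (a b c d : Fin 4) :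
    D E a (varChristoffel g E h b c d) x = (1 / 2) * D E a (koszul g E h b c d) x
      - ∑ e, (D E a (fun y => h y d e) x * leviCivita g E b c e x
        + h x d e * D E a (leviCivita g E b c e) x) := by
  have h1 := smooth_koszul hE hU hh
  have h2 := hE.smooth_leviCivita hU
  unfold varChristoffel
  rw [D_sub hU hx a (by fun_prop) (by fun_prop), D_const_mul hU hx a _ (h1 b c d),
    D_sum hU hx a (fun e => (hh d e).mul (h2 b c e))]
  congr 1
  refine Finset.sum_congr rfl fun e _ => ?_
  rw [D_mul hU hx a (hh d e) (h2 b c e)]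
  ring

theorem hasDerivAt_D_christoffel (hE : IsOrthonormalFrame g E U) (hU : IsOpen U) (hx : x ∈ U)
    (hh : ∀ i j, SmoothFn (fun y => h y i j) U) (a b c d : Fin 4) :
    HasDerivAt (fun t : ℝ => D E a (christoffel g E (perturbed h t) b c d) x)
      (D E a (varChristoffel g E h b c d) x) 0 := by
  have h1 : HasDerivAt (fun t : ℝ => (t : ℂ)) 1 0 := Complex.ofRealCLM.hasDerivAt
  have hi := hasDerivAt_perturbed_inv h x
  have key := (HasDerivAt.fun_sum (u := Finset.univ) fun e _ =>
    (((HasDerivAt.fun_sum (u := Finset.univ) fun p _ => HasDerivAt.fun_sum (u := Finset.univ)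
      fun q _ => (((hi d p).fun_mul (h1.mul_const (D E a (fun y => h y p q) x))).fun_mul
        (hi q e))).fun_neg).fun_mul
      ((h1.mul_const (koszul g E h b c e x)).const_add (2 * leviCivita g E b c e x))).fun_add
    ((hi d e).fun_mul ((h1.mul_const (D E a (koszul g E h b c e) x)).const_add
      (2 * D E a (leviCivita g E b c e) x)))).const_mul (1 / 2 : ℂ)
  -- The frame derivative has been written explicitly through derivatives of `h` and of the
  -- background, so differentiating in `t` needs no exchange of limits.
  refine (key.congr_of_eventuallyEq ?_).congr_deriv ?_
  · filter_upwards [eventually_det_ne_zero h x] with t ht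
    exact D_christoffel_perturbed hE hU hx hh ht a b c d
  · rw [D_varChristoffel hE hU hx hh]
    simp only [perturbed_zero, inv_one, Matrix.one_apply, Complex.ofReal_zero, zero_mul, add_zero,
      one_mul, ite_mul, mul_ite, mul_zero, mul_one, neg_zero, zero_add, Finset.sum_ite_eq,
      Finset.sum_ite_eq', Finset.mem_univ, if_true, Finset.sum_add_distrib, neg_mul,
      Finset.sum_neg_distrib, mul_left_comm _ (2 : ℂ), ← Finset.mul_sum]
    simp
    ring

/-- The first variation of the curvature in the direction `h`. -/
noncomputable def varRiemann (g : Metric M) (E : Frame M) (h : M → Matrix (Fin 4) (Fin 4) ℂ)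
    (a b c d : Fin 4) : M → ℂ := fun x =>
  D E a (varChristoffel g E h b c d) x - D E b (varChristoffel g E h a c d) x
    + ∑ e, (varChristoffel g E h b c e x * leviCivita g E a e d x
      + leviCivita g E b c e x * varChristoffel g E h a e d x
      - (varChristoffel g E h a c e x * leviCivita g E b e d x
        + leviCivita g E a c e x * varChristoffel g E h b e d x)
      - structureFn g E a b e x * varChristoffel g E h e c d x)

theorem christoffel_perturbed_zero (a b d : Fin 4) :
    christoffel g E (perturbed h 0) a b d = leviCivita g E a b d := by
  have : perturbed h 0 = background := funext fun y => perturbed_zero h y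
  rw [this, leviCivita]

theorem riemann_perturbed_zero (a b c d : Fin 4) :
    riemann g E (perturbed h 0) a b c d x = curv g E a b c d x := by
  have : perturbed h 0 = background := funext fun y => perturbed_zero h y
  rw [this, curv]

theorem hasDerivAt_riemann (hE : IsOrthonormalFrame g E U) (hU : IsOpen U) (hx : x ∈ U)
    (hh : ∀ i j, SmoothFn (fun y => h y i j) U) (a b c d : Fin 4) :
    HasDerivAt (fun t : ℝ => riemann g E (perturbed h t) a b c d x)
      (varRiemann g E h a b c d x) 0 := by
  have h1 := hasDerivAt_D_christoffel hE hU hx hh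
  have h2 := hasDerivAt_christoffel (g := g) (E := E) hU hx hh
  have key := ((h1 a b c d).fun_sub (h1 b a c d)).fun_add (HasDerivAt.fun_sum (u := Finset.univ)
    fun e _ => ((((h2 b c e).fun_mul (h2 a e d)).fun_sub
      ((h2 a c e).fun_mul (h2 b e d))).fun_sub ((h2 e c d).const_mul (structureFn g E a b e x))))
  refine key.congr_deriv ?_
  simp only [christoffel_perturbed_zero]
  rfl

end Linearisation

/-! ### The curvature variation in covariant form -/

section TensorCalculus

variable {M : Type*} [TopologicalSpace M] [ChartedSpace R4 M] [IsManifold (𝓡 4) ∞ M]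
  {U : Set M} {x : M} {g : Metric M} {E : Frame M} {n : ℕ}

theorem smooth_nablaT (hE : IsOrthonormalFrame g E U) (hU : IsOpen U) {T : TensorField M n}
    (hT : ∀ I, SmoothFn (T I) U) (I : Fin (n + 1) → Fin 4) : SmoothFn (nablaT g E T I) U := by
  have h1 := hE.smooth_D hU (I 0) (hT (Fin.tail I))
  have h2 := SmoothFn.act (hE.smooth_leviCivita hU (I 0)) hT (Fin.tail I)
  exact h1.sub h2

/-- The Ricci identity for tensor fields. -/
theorem IsOrthonormalFrame.nablaT_comm (hE : IsOrthonormalFrame g E U) (hU : IsOpen U)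
    (hx : x ∈ U) {T : TensorField M n} (hT : ∀ I, SmoothFn (T I) U) (a b : Fin 4)
    (I : Fin n → Fin 4) :
    nablaT g E (nablaT g E T) (Matrix.vecCons a (Matrix.vecCons b I)) x
      - nablaT g E (nablaT g E T) (Matrix.vecCons b (Matrix.vecCons a I)) x
      = -act (fun c d => curv g E a b c d x) (fun J => T J x) I := by
  have s1 := hE.smooth_leviCivita hU
  have key : ∀ a b, nablaT g E (nablaT g E T) (Matrix.vecCons a (Matrix.vecCons b I)) x
      = D E a (D E b (T I)) x
      - act (fun c d => D E a (leviCivita g E b c d) x) (fun J => T J x) I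
      - act (fun c d => leviCivita g E b c d x) (fun J => D E a (T J) x) I
      - act (fun c d => leviCivita g E a c d x) (fun J => D E b (T J) x) I
      + act (fun c d => leviCivita g E a c d x) (fun J =>
          act (fun c d => leviCivita g E b c d x) (fun J => T J x) J) I
      - ∑ e, leviCivita g E a b e x * (D E e (T I) x
        - act (fun c d => leviCivita g E e c d x) (fun J => T J x) I) := by
    intro a b
    have hD : D E a (nablaT g E T (Matrix.vecCons b I)) x = D E a (fun y => D E b (T I) y
      - act (fun c d => leviCivita g E b c d y) (fun J => T J y) I) x := rfl
    rw [nablaT_cons, hD, D_sub hU hx a (hE.smooth_D hU b (hT I)) (SmoothFn.act (s1 b) hT I),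
      D_act hU hx (s1 b) hT, act_vecCons]
    simp only [nablaT_cons, act_sub]
    ring
  have hc := act_commutator (fun c d => leviCivita g E b c d x) (fun c d => leviCivita g E a c d x)
    (fun J => T J x) I
  have hd := hE.D_comm hU hx a b (hT I)
  have ht : ∑ e, leviCivita g E a b e x * (D E e (T I) x
        - act (fun c d => leviCivita g E e c d x) (fun J => T J x) I)
      - ∑ e, leviCivita g E b a e x * (D E e (T I) x
        - act (fun c d => leviCivita g E e c d x) (fun J => T J x) I)
      = ∑ e, structureFn g E a b e x * (D E e (T I) x
        - act (fun c d => leviCivita g E e c d x) (fun J => T J x) I) := by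
    simp only [← Finset.sum_sub_distrib, ← sub_mul, leviCivita_torsion]
  simp only [key, curv_eq, act_matrix_sub, act_matrix_add, act_matrix_sum, act_matrix_mul,
    mul_sub, Finset.sum_sub_distrib] at hc ht ⊢
  linear_combination hd - hc - ht

theorem nablaT_add (hU : IsOpen U) (hx : x ∈ U) {S T : TensorField M n}
    (hS : ∀ I, SmoothFn (S I) U) (hT : ∀ I, SmoothFn (T I) U) (a : Fin 4) (I : Fin n → Fin 4) :
    nablaT g E (fun I x => S I x + T I x) (Matrix.vecCons a I) x
      = nablaT g E S (Matrix.vecCons a I) x + nablaT g E T (Matrix.vecCons a I) x := by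
  simp only [nablaT_cons, act_add]
  rw [D_add hU hx a (hS I) (hT I)]
  ring

theorem nablaT_const_mul (hU : IsOpen U) (hx : x ∈ U) {T : TensorField M n}
    (hT : ∀ I, SmoothFn (T I) U) (z : ℂ) (a : Fin 4) (I : Fin n → Fin 4) :
    nablaT g E (fun I x => z * T I x) (Matrix.vecCons a I) x
      = z * nablaT g E T (Matrix.vecCons a I) x := by
  simp only [nablaT_cons, act_mul_left]
  rw [D_const_mul hU hx a z (hT I)]
  ring

theorem nablaT_congr {S T : TensorField M n} (hU : IsOpen U) (hx : x ∈ U)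
    (h : ∀ y ∈ U, ∀ I, S I y = T I y) (I : Fin (n + 1) → Fin 4) :
    nablaT g E S I x = nablaT g E T I x := by
  simp only [nablaT, h x hx]
  rw [D_congr hU hx _ (h · · _)]

variable {h : M → Matrix (Fin 4) (Fin 4) ℂ}

/-- The tensor field of a matrix-valued function. -/
def tensorOf (h : M → Matrix (Fin 4) (Fin 4) ℂ) : TensorField M 2 := fun I x => h x (I 0) (I 1)

theorem nablaT_tensorOf (a b c : Fin 4) : nablaT g E (tensorOf h) ![a, b, c] x
    = D E a (fun y => h y b c) x - ∑ e, (leviCivita g E a b e x * h x e c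
      + leviCivita g E a c e x * h x b e) := by
  rw [nablaT_cons, act_two]
  rfl

/-- The part `½ (∇_b h_{ac} - ∇_c h_{ab})` of the variation of the connection. -/
noncomputable def rotation (g : Metric M) (E : Frame M) (h : M → Matrix (Fin 4) (Fin 4) ℂ) :
    TensorField M 3 := fun I x => (1 / 2) * (nablaT g E (tensorOf h) ![I 1, I 0, I 2] x
      - nablaT g E (tensorOf h) ![I 2, I 0, I 1] x)

/-- The variation of the connection is the tensor `½ (∇_a h_{bd} + ∇_b h_{ad} - ∇_d h_{ab})`. Its
part symmetric in `b, d` is the effect of the change of frame by `½ h`; the rest is `so(4)`-valued.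
-/
theorem varChristoffel_eq (hs : (h x).IsSymm) (a b d : Fin 4) :
    varChristoffel g E h a b d x
      = (1 / 2) * nablaT g E (tensorOf h) ![a, b, d] x + rotation g E h ![a, b, d] x := by
  have hs' : ∀ i j, h x i j = h x j i := fun i j => hs.apply j i
  have h1 : koszul g E h a b d x = D E a (fun y => h y b d) x + D E b (fun y => h y a d) x
      - D E d (fun y => h y a b) x + ∑ f, ((leviCivita g E a b f x - leviCivita g E b a f x) * h x f d
      - (leviCivita g E a d f x - leviCivita g E d a f x) * h x f b
      - (leviCivita g E b d f x - leviCivita g E d b f x) * h x f a) := by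
    simp only [leviCivita_torsion]
    rfl
  simp only [varChristoffel, rotation, Matrix.cons_val_zero, Matrix.cons_val_one, Matrix.cons_val,
    nablaT_tensorOf, h1, Fin.sum_univ_four, hs' a 0, hs' a 1, hs' a 2, hs' a 3, hs' b 0, hs' b 1,
    hs' b 2, hs' b 3, hs' d 0, hs' d 1, hs' d 2, hs' d 3]
  ring

theorem smooth_tensorOf (hh : ∀ i j, SmoothFn (fun y => h y i j) U) (I : Fin 2 → Fin 4) :
    SmoothFn (tensorOf h I) U := hh (I 0) (I 1)

theorem smooth_rotation (hE : IsOrthonormalFrame g E U) (hU : IsOpen U)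
    (hh : ∀ i j, SmoothFn (fun y => h y i j) U) (I : Fin 3 → Fin 4) :
    SmoothFn (rotation g E h I) U := by
  have := smooth_nablaT (g := g) hE hU (smooth_tensorOf hh)
  unfold rotation
  fun_prop

/-- The symmetric part `½ ∇h` of the connection variation enters through an antisymmetrised second
derivative of `h`, which the Ricci identity turns into curvature acting on `h`. -/
theorem varRiemann_eq (hE : IsOrthonormalFrame g E U) (hU : IsOpen U) (hx : x ∈ U)
    (hh : ∀ i j, SmoothFn (fun y => h y i j) U) (hs : ∀ y ∈ U, (h y).IsSymm) (a b c d : Fin 4) :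
    varRiemann g E h a b c d x
      = -(1 / 2) * (∑ e, (curv g E a b c e x * h x e d + curv g E a b d e x * h x c e))
        + (nablaT g E (rotation g E h) ![a, b, c, d] x
          - nablaT g E (rotation g E h) ![b, a, c, d] x) := by
  have sh := smooth_tensorOf hh
  have sH := smooth_nablaT (g := g) hE hU sh
  have sr := smooth_rotation (g := g) hE hU hh
  set S : TensorField M 3 := fun I y => (1 / 2) * nablaT g E (tensorOf h) I y + rotation g E h I y
    with hS
  have hv : ∀ y ∈ U, ∀ a b d, varChristoffel g E h a b d y = S ![a, b, d] y :=
    fun y hy a b d => varChristoffel_eq (hs y hy) a b d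
  have hn : ∀ a b c d, nablaT g E S ![a, b, c, d] x
      = D E a (varChristoffel g E h b c d) x - ∑ e, (leviCivita g E a b e x *
          varChristoffel g E h e c d x + leviCivita g E a c e x * varChristoffel g E h b e d x
          + leviCivita g E a d e x * varChristoffel g E h b c e x) := by
    intro a b c d
    rw [nablaT_cons, act_three, D_congr hU hx a (fun y hy => hv y hy b c d)]
    simp only [hv x hx]
  have hd : ∀ a b c d, nablaT g E S ![a, b, c, d] x
      = (1 / 2) * nablaT g E (nablaT g E (tensorOf h)) ![a, b, c, d] x
        + nablaT g E (rotation g E h) ![a, b, c, d] x := by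
    intro a b c d
    rw [← nablaT_const_mul hU hx sH, ← nablaT_add hU hx (fun I => (SmoothFn.const _).mul (sH I)) sr]
  have hc := hE.nablaT_comm hU hx sh a b ![c, d]
  rw [act_two] at hc
  -- The Palatini formula: by vanishing torsion the structure function term completes the
  -- antisymmetrised covariant derivative of the connection variation.
  have ht : varRiemann g E h a b c d x
      = nablaT g E S ![a, b, c, d] x - nablaT g E S ![b, a, c, d] x := by
    have t : ∀ e, structureFn g E a b e x = _ := fun e => (leviCivita_torsion g E a b e x).symm
    simp only [hn, varRiemann, t, leviCivita_swap g E a d, leviCivita_swap g E b d]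
    simp only [Fin.sum_univ_four]
    ring
  have hc' : ∑ F, (curv g E a b c F x * tensorOf h ![F, d] x
      + curv g E a b d F x * tensorOf h ![c, F] x)
      = ∑ e, (curv g E a b c e x * h x e d + curv g E a b d e x * h x c e) := rfl
  rw [hc'] at hc
  rw [ht, hd, hd]
  linear_combination (1 / 2) * hc

end TensorCalculus

/-! ### Algebra of the curvature variation -/

section VariationAlgebra

/-- The algebraic identities between the curvature `R`, the perturbation `k`, and the second
derivatives `N` of the perturbation. -/
structure IsVariation (lam : ℂ) (R N : Fin 4 → Fin 4 → Fin 4 → Fin 4 → ℂ)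
    (k : Fin 4 → Fin 4 → ℂ) : Prop where
  swap_left : ∀ a b c d, R a b c d = -R b a c d
  swap_right : ∀ a b c d, R a b c d = -R a b d c
  bianchi : ∀ a b c d, R a b c d + R b c a d + R c a b d = 0
  ricci : ∀ b c, ∑ a, R a b c a = lam * if b = c then 1 else 0
  symm_k : ∀ a b, k a b = k b a
  symm_N : ∀ a b c d, N a b c d = N a b d c
  comm : ∀ a b c d, N a b c d - N b a c d = -∑ e, (R a b c e * k e d + R a b d e * k c e)

/-- The part of the variation of the curvature which has the symmetries of a curvature tensor. -/
noncomputable def curvatureVariation (R N : Fin 4 → Fin 4 → Fin 4 → Fin 4 → ℂ)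
    (k : Fin 4 → Fin 4 → ℂ) (a b c d : Fin 4) : ℂ :=
  (1 / 2) * (N a c b d - N a d b c - N b c a d + N b d a c)
    - (1 / 2) * ∑ e, (k a e * R e b c d + k b e * R a e c d)

variable {lam : ℂ} {R N : Fin 4 → Fin 4 → Fin 4 → Fin 4 → ℂ} {k : Fin 4 → Fin 4 → ℂ}

theorem IsVariation.variation_swap_left (hv : IsVariation lam R N k) (a b c d : Fin 4) :
    curvatureVariation R N k a b c d = -curvatureVariation R N k b a c d := by
  have h : ∀ e, k b e * R e a c d + k a e * R b e c d
      = -(k a e * R e b c d + k b e * R a e c d) := fun e => by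
    rw [hv.swap_left e a, hv.swap_left b e]; ring
  simp only [curvatureVariation, h, Finset.sum_neg_distrib]
  ring

theorem IsVariation.variation_swap_right (hv : IsVariation lam R N k) (a b c d : Fin 4) :
    curvatureVariation R N k a b c d = -curvatureVariation R N k a b d c := by
  have h : ∀ e, k a e * R e b d c + k b e * R a e d c
      = -(k a e * R e b c d + k b e * R a e c d) := fun e => by
    rw [hv.swap_right e b d, hv.swap_right a e d]; ring
  simp only [curvatureVariation, h, Finset.sum_neg_distrib]
  ring

/-- The second derivatives combine into three commutators. Together with the explicit curvature
terms these cancel, summand by summand, by the first Bianchi identity of the background. -/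
theorem IsVariation.variation_bianchi (hv : IsVariation lam R N k) (a b c d : Fin 4) :
    curvatureVariation R N k a b c d + curvatureVariation R N k b c a d
      + curvatureVariation R N k c a b d = 0 := by
  have c1 := hv.comm a b c d
  have c2 := hv.comm b c a d
  have c3 := hv.comm c a b d
  have s1 := hv.symm_N a d b c
  have s2 := hv.symm_N b d a c
  have s3 := hv.symm_N c d a b
  have h : ∑ e, (k a e * R e b c d + k b e * R a e c d) + ∑ e, (k b e * R e c a d + k c e * R b e a d)
      + ∑ e, (k c e * R e a b d + k a e * R c e b d)
      = ∑ e, (R a b c e * k e d + R a b d e * k c e) + ∑ e, (R b c a e * k e d + R b c d e * k a e)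
        + ∑ e, (R c a b e * k e d + R c a d e * k b e) := by
    simp only [← Finset.sum_add_distrib]
    refine Finset.sum_congr rfl fun e _ => ?_
    have b0 := hv.bianchi a b c e
    have b1 := hv.bianchi e b c d
    have b2 := hv.bianchi a e c d
    have b3 := hv.bianchi a b e d
    rw [hv.swap_right a b d e, hv.swap_right b c d e, hv.swap_right c a d e]
    linear_combination k a e * b1 + k b e * b2 + k c e * b3 - k e d * b0
  unfold curvatureVariation
  linear_combination (1 / 2) * (-c1 - c2 - c3 - h - s1 + s2 - s3)

/-- With the symmetries of a curvature tensor and no unprimed part in the second pair, pair symmetry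
leaves an element of `Λ⁺ ⊗ Λ⁺`. Its Ricci tensor is pure trace, and the Bianchi identity sets that
trace to zero. -/
theorem IsVariation.variation_ricci (hv : IsVariation lam R N k)
    (h0 : ∀ a b A B, spinPart (curvatureVariation R N k a b) A B = 0) (b c : Fin 4) :
    ∑ a, curvatureVariation R N k a b c a = 0 := by
  set X := curvatureVariation R N k with hX
  have h1 := hv.variation_swap_left
  have h2 := hv.variation_swap_right
  have h3 := hv.variation_bianchi
  rw [← hX] at h1 h2 h3
  have hp := curv_pair_of_symmetries h1 h2 h3
  have hs := fun a b => selfDual_of_spinPart_eq_zero (h2 a b) (h0 a b)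
  have z : ∀ a b c, X a b c c = 0 := fun a b c => by linear_combination (1 / 2) * h2 a b c c
  have z' : ∀ a c d, X a a c d = 0 := fun a c d => by linear_combination (1 / 2) * h1 a a c d
  have b1 := h3 0 1 2 3
  have t01 := hs 0 1
  have t02 := hs 0 2
  have t03 := hs 0 3
  have t12 := hs 1 2
  have t13 := hs 1 3
  have t23 := hs 2 3
  clear_value X
  have n1 : ∀ c d, _ ∧ _ ∧ _ ∧ _ ∧ _ ∧ _ := fun c d =>
    ⟨h1 1 0 c d, h1 2 0 c d, h1 3 0 c d, h1 2 1 c d, h1 3 1 c d, h1 3 2 c d⟩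
  have n2 : ∀ a b, _ ∧ _ ∧ _ ∧ _ ∧ _ ∧ _ := fun a b =>
    ⟨h2 a b 1 0, h2 a b 2 0, h2 a b 3 0, h2 a b 2 1, h2 a b 3 1, h2 a b 3 2⟩
  have n3 := hp 0 2 0 1
  fin_cases b <;> fin_cases c <;> simp [Fin.sum_univ_four, z, z', n1, n2] at b1 ⊢
  all_goals simp only [hp 0 2 0 1, hp 0 3 0 1, hp 1 2 0 1, hp 1 3 0 1, hp 2 3 0 1, hp 0 3 0 2,
    hp 1 2 0 2, hp 1 3 0 2, hp 2 3 0 2, hp 1 2 0 3, hp 1 3 0 3, hp 2 3 0 3, hp 1 3 1 2, hp 2 3 1 2,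
    hp 2 3 1 3] at *
  all_goals grind

/-- The variation of the Ricci tensor differs from the trace of `curvatureVariation` by contractions
of `R` with `k`. Two of these cancel, and the others are Ricci traces, each contributing half of `λ
k`. -/
theorem IsVariation.ricci_variation (hv : IsVariation lam R N k)
    (h0 : ∀ a b A B, spinPart (curvatureVariation R N k a b) A B = 0) (b c : Fin 4) :
    ∑ a, (-(1 / 2) * (∑ e, (R a b c e * k e a + R a b a e * k c e))
      + (1 / 2) * (N a c b a - N a a b c - N b c a a + N b a a c)) = lam * k b c := by
  have hr := hv.variation_ricci h0 b c
  have e1 : ∀ e, ∑ a, R a b a e = -(lam * if b = e then 1 else 0) := fun e => by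
    rw [← hv.ricci b e, ← Finset.sum_neg_distrib]
    exact Finset.sum_congr rfl fun a _ => hv.swap_right a b a e
  have e2 : ∑ a, ∑ e, R a b a e * k c e = -(lam * k b c) := by
    rw [Finset.sum_comm]
    simp only [← Finset.sum_mul, e1, mul_ite, mul_one, mul_zero, neg_mul, ite_mul, zero_mul,
      Finset.sum_neg_distrib, Finset.sum_ite_eq, Finset.mem_univ, if_true]
    rw [hv.symm_k]
  have e3 : ∑ a, ∑ e, k b e * R a e c a = lam * k b c := by
    rw [Finset.sum_comm]
    simp only [← Finset.mul_sum, hv.ricci, mul_ite, mul_one, mul_zero, Finset.sum_ite_eq',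
      Finset.mem_univ, if_true]
    ring
  have e4 : ∑ a, ∑ e, k a e * R e b c a = ∑ a, ∑ e, R a b c e * k e a := by
    rw [Finset.sum_comm]
    exact Finset.sum_congr rfl fun e _ => Finset.sum_congr rfl fun a _ => by ring
  have e5 : ∀ a, (-(1 / 2) * (∑ e, (R a b c e * k e a + R a b a e * k c e))
      + (1 / 2) * (N a c b a - N a a b c - N b c a a + N b a a c))
      = curvatureVariation R N k a b c a + (1 / 2) * (∑ e, k a e * R e b c a
        + ∑ e, k b e * R a e c a - ∑ e, R a b c e * k e a - ∑ e, R a b a e * k c e) := by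
    intro a
    simp only [curvatureVariation, Finset.sum_add_distrib]
    ring
  rw [Finset.sum_congr rfl fun a _ => e5 a]
  simp only [Finset.sum_add_distrib, hr, ← Finset.mul_sum, Finset.sum_sub_distrib, e2, e3, e4]
  ring

theorem asdPart_add (S T : Fin 4 → Fin 4 → Fin 4 → Fin 4 → ℂ) (I : Fin 4 → Fin 2) :
    asdPart (fun a b c d => S a b c d + T a b c d) I = asdPart S I + asdPart T I := by
  simp only [asdPart, mul_add, Finset.sum_add_distrib]

theorem asdPart_eq_zero_of_right {T : Fin 4 → Fin 4 → Fin 4 → Fin 4 → ℂ}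
    (h1 : ∀ a b c d, T a b c d = -T b a c d) (h2 : ∀ a b c d, T a b c d = -T a b d c)
    (h : ∀ a b A B, spinPart (T a b) A B = 0) (I : Fin 4 → Fin 2) : asdPart T I = 0 := by
  have hz : ∀ A B D F, spinPart (fun a b => spinPart (T a b) A B) D F = 0 := by
    intro A B D F
    simp only [h]
    simp [spinPart]
  rw [asdPart_of_antisymm h1 h2]
  simp only [hz, mul_zero, Finset.sum_const_zero]

theorem asdPart_eq_zero_of_left {T : Fin 4 → Fin 4 → Fin 4 → Fin 4 → ℂ}
    (h1 : ∀ a b c d, T a b c d = -T b a c d) (h2 : ∀ a b c d, T a b c d = -T a b d c)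
    (h : ∀ c d, T 0 1 c d = T 2 3 c d ∧ T 0 2 c d = -T 1 3 c d ∧ T 0 3 c d = T 1 2 c d)
    (I : Fin 4 → Fin 2) : asdPart T I = 0 := by
  have hs : ∀ A B a b, spinPart (T a b) A B = -spinPart (T b a) A B := by
    intro A B a b
    simp only [spinPart, fun c d => h1 a b c d, neg_mul, Finset.sum_neg_distrib, mul_neg]
  have hz : ∀ A B D F, spinPart (fun a b => spinPart (T a b) A B) D F = 0 := by
    intro A B D F
    refine spinPart_eq_zero_of_selfDual (hs A B) ⟨?_, ?_, ?_⟩ D F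
    · simp only [spinPart, fun c d => (h c d).1]
    · simp only [spinPart, fun c d => (h c d).2.1, neg_mul, Finset.sum_neg_distrib, mul_neg]
    · simp only [spinPart, fun c d => (h c d).2.2]
  rw [asdPart_of_antisymm h1 h2]
  simp only [hz, mul_zero, Finset.sum_const_zero]

/-- Acting on the indices of one pair leaves the other pair self-dual, so the part which is
anti-self-dual in both pairs stays zero. Hence the change of frame does not affect the linearised
anti-self-dual Weyl spinor. -/
theorem asdPart_action_eq_zero {C : Fin 4 → Fin 4 → Fin 4 → Fin 4 → ℂ}
    (h1 : ∀ a b c d, C a b c d = -C b a c d) (h2 : ∀ a b c d, C a b c d = -C a b d c)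
    (h3 : ∀ a b c d, C a b c d = C c d a b)
    (h : ∀ a b, C a b 0 1 = C a b 2 3 ∧ C a b 0 2 = -C a b 1 3 ∧ C a b 0 3 = C a b 1 2)
    (k : Fin 4 → Fin 4 → ℂ) (I : Fin 4 → Fin 2) :
    asdPart (fun a b c d => ∑ e, (k a e * C e b c d + k b e * C a e c d)) I = 0 ∧
    asdPart (fun a b c d => ∑ e, (k c e * C a b e d + k d e * C a b c e)) I = 0 := by
  have hl : ∀ c d, C 0 1 c d = C 2 3 c d ∧ C 0 2 c d = -C 1 3 c d ∧ C 0 3 c d = C 1 2 c d := by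
    intro c d
    simp only [fun a b => h3 a b c d]
    exact h c d
  have hr : ∀ a b A B, spinPart (C a b) A B = 0 := fun a b =>
    spinPart_eq_zero_of_selfDual (h2 a b) (h a b)
  constructor
  · refine asdPart_eq_zero_of_right (fun a b c d => ?_) (fun a b c d => ?_) (fun a b => ?_) I
    · rw [← Finset.sum_neg_distrib]
      refine Finset.sum_congr rfl fun e _ => ?_
      rw [h1 e a, h1 b e]; ring
    · rw [← Finset.sum_neg_distrib]
      refine Finset.sum_congr rfl fun e _ => ?_
      rw [h2 e b d, h2 a e d]; ring
    · refine spinPart_eq_zero_of_selfDual (fun c d => ?_) ⟨?_, ?_, ?_⟩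
      · rw [← Finset.sum_neg_distrib]
        refine Finset.sum_congr rfl fun e _ => ?_
        rw [h2 e b d, h2 a e d]; ring
      · simp only [fun a b => (h a b).1]
      · rw [← Finset.sum_neg_distrib]
        refine Finset.sum_congr rfl fun e _ => ?_
        rw [(h e b).2.1, (h a e).2.1]; ring
      · simp only [fun a b => (h a b).2.2]
  · refine asdPart_eq_zero_of_left (fun a b c d => ?_) (fun a b c d => ?_) (fun c d => ⟨?_, ?_, ?_⟩) I
    · rw [← Finset.sum_neg_distrib]
      refine Finset.sum_congr rfl fun e _ => ?_
      rw [h1 a b, h1 a b]; ring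
    · rw [← Finset.sum_neg_distrib]
      refine Finset.sum_congr rfl fun e _ => ?_
      rw [h2 a b c, h2 a b e]; ring
    · simp only [fun c d => (hl c d).1]
    · rw [← Finset.sum_neg_distrib]
      refine Finset.sum_congr rfl fun e _ => ?_
      rw [(hl e d).2.1, (hl c e).2.1]; ring
    · simp only [fun c d => (hl c d).2.2]

end VariationAlgebra

/-! ### Linearised Einstein and Weyl equations from one condition -/

section LinearisedEquations

variable {M : Type*} [TopologicalSpace M] [ChartedSpace R4 M] [IsManifold (𝓡 4) ∞ M]
  {U : Set M} {x : M} {g : Metric M} {E : Frame M} {lam : ℝ} {n : ℕ}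
  {h : M → Matrix (Fin 4) (Fin 4) ℂ}

theorem nablaT_perm (T : TensorField M n) (p : Equiv.Perm (Fin n)) (a : Fin 4)
    (I : Fin n → Fin 4) : nablaT g E (fun I => T (I ∘ p)) (Matrix.vecCons a I) x
      = nablaT g E T (Matrix.vecCons a (I ∘ p)) x := by
  rw [nablaT_cons, nablaT_cons, ← act_perm _ (fun J => T J x) I p]

theorem nablaT_rotation (hE : IsOrthonormalFrame g E U) (hU : IsOpen U) (hx : x ∈ U)
    (hh : ∀ i j, SmoothFn (fun y => h y i j) U) (a b c d : Fin 4) :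
    nablaT g E (rotation g E h) ![a, b, c, d] x
      = (1 / 2) * (nablaT g E (nablaT g E (tensorOf h)) ![a, c, b, d] x
        - nablaT g E (nablaT g E (tensorOf h)) ![a, d, b, c] x) := by
  have sH := smooth_nablaT (g := g) hE hU (smooth_tensorOf hh)
  have hr : rotation g E h = fun I x => (1 / 2 : ℂ) * nablaT g E (tensorOf h) (I ∘ Equiv.swap 0 1) x
      + (-1 / 2 : ℂ) * nablaT g E (tensorOf h) (I ∘ (finRotate 3).symm) x := by
    funext I x
    have e1 : I ∘ Equiv.swap 0 1 = ![I 1, I 0, I 2] := by funext j; fin_cases j <;> rfl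
    have e2 : I ∘ (finRotate 3).symm = ![I 2, I 0, I 1] := by funext j; fin_cases j <;> rfl
    rw [e1, e2, rotation]
    ring
  have e1 : ![b, c, d] ∘ Equiv.swap (0 : Fin 3) 1 = ![c, b, d] := by
    funext j; fin_cases j <;> rfl
  have e2 : ![b, c, d] ∘ (finRotate 3).symm = ![d, b, c] := by funext j; fin_cases j <;> rfl
  rw [hr, nablaT_add hU hx (S := fun I x => (1 / 2 : ℂ) * nablaT g E (tensorOf h)
      (I ∘ Equiv.swap 0 1) x) (T := fun I x => (-1 / 2 : ℂ) *
      nablaT g E (tensorOf h) (I ∘ (finRotate 3).symm) x)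
    (fun I => (SmoothFn.const _).mul (sH _)) (fun I => (SmoothFn.const _).mul (sH _)),
    nablaT_const_mul hU hx (T := fun I x => nablaT g E (tensorOf h) (I ∘ Equiv.swap 0 1) x)
      (fun I => sH _),
    nablaT_const_mul hU hx (T := fun I x => nablaT g E (tensorOf h) (I ∘ (finRotate 3).symm) x)
      (fun I => sH _),
    nablaT_perm (nablaT g E (tensorOf h)) (Equiv.swap 0 1),
    nablaT_perm (nablaT g E (tensorOf h)) (finRotate 3).symm, e1, e2]
  ring

/-- Collects the pointwise identities used by the algebra: the background curvature, the symmetry of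
`h` and of `∇∇h`, and the Ricci identity for `h`. -/
theorem isVariation (hq : IsQuaternionicKahler g E U lam) (hE : IsOrthonormalFrame g E U)
    (hU : IsOpen U) (hx : x ∈ U) (hh : ∀ i j, SmoothFn (fun y => h y i j) U)
    (hs : ∀ y ∈ U, (h y).IsSymm) : IsVariation lam (fun a b c d => curv g E a b c d x)
      (fun a b c d => nablaT g E (nablaT g E (tensorOf h)) ![a, b, c, d] x) (h x) where
  swap_left a b c d := curv_swap_left g E a b c d x
  swap_right := hE.curv_swap_right hU hx
  bianchi := hE.bianchi hU hx
  ricci := hq.ricci_eq hx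
  symm_k a b := (hs x hx).apply b a
  symm_N a b c d := by
    have sh := smooth_tensorOf hh
    have e : ∀ y ∈ U, ∀ I : Fin 3 → Fin 4,
        nablaT g E (tensorOf h) I y = nablaT g E (tensorOf h) (I ∘ Equiv.swap 1 2) y := by
      intro y hy I
      have e1 : I = Matrix.vecCons (I 0) (I ∘ Fin.succ) := by funext j; fin_cases j <;> rfl
      have e2 : I ∘ Equiv.swap 1 2 = Matrix.vecCons (I 0) ((I ∘ Fin.succ) ∘ Equiv.swap 0 1) := by
        funext j; fin_cases j <;> rfl
      rw [e2, ← nablaT_perm, ← e1]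
      refine nablaT_congr hU hy (fun z hz J => ?_) _
      exact (hs z hz).apply (J 1) (J 0)
    have e3 : ![b, c, d] ∘ Equiv.swap (1 : Fin 3) 2 = ![b, d, c] := by
      funext j; fin_cases j <;> rfl
    rw [← e3, ← nablaT_perm]
    exact nablaT_congr hU hx e _
  comm a b c d := by
    have hc := hE.nablaT_comm hU hx (smooth_tensorOf hh) a b ![c, d]
    rw [act_two] at hc
    exact hc

/-- The part of the variation of the curvature in the direction `h` which has the symmetries of a
curvature tensor. -/
noncomputable def rotationCurv (g : Metric M) (E : Frame M) (h : M → Matrix (Fin 4) (Fin 4) ℂ)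
    (x : M) (a b c d : Fin 4) : ℂ :=
  nablaT g E (rotation g E h) ![a, b, c, d] x - nablaT g E (rotation g E h) ![b, a, c, d] x
    - (1 / 2) * ∑ e, (h x a e * curv g E e b c d x + h x b e * curv g E a e c d x)

theorem rotationCurv_eq (hE : IsOrthonormalFrame g E U) (hU : IsOpen U) (hx : x ∈ U)
    (hh : ∀ i j, SmoothFn (fun y => h y i j) U) : rotationCurv g E h x
      = curvatureVariation (fun a b c d => curv g E a b c d x)
        (fun a b c d => nablaT g E (nablaT g E (tensorOf h)) ![a, b, c, d] x) (h x) := by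
  funext a b c d
  rw [rotationCurv, nablaT_rotation hE hU hx hh, nablaT_rotation hE hU hx hh]
  unfold curvatureVariation
  ring

theorem linearisedEinstein (hq : IsQuaternionicKahler g E U lam) (hE : IsOrthonormalFrame g E U)
    (hU : IsOpen U) (hh : ∀ i j, SmoothFn (fun y => h y i j) U) (hs : ∀ y ∈ U, (h y).IsSymm)
    (h0 : ∀ x ∈ U, ∀ a b A B, spinPart (rotationCurv g E h x a b) A B = 0) (hx : x ∈ U)
    (b c : Fin 4) :
    HasDerivAt (fun t : ℝ => ricci g E (perturbed h t) b c x) (lam * h x b c) 0 := by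
  have hv := isVariation hq hE hU hx hh hs
  have h0' := h0 x hx
  rw [rotationCurv_eq hE hU hx hh] at h0'
  rw [← hv.ricci_variation h0']
  refine (HasDerivAt.fun_sum (u := Finset.univ) fun a _ =>
    hasDerivAt_riemann hE hU hx hh a b c a).congr_deriv ?_
  refine Finset.sum_congr rfl fun a _ => ?_
  rw [varRiemann_eq hE hU hx hh hs, nablaT_rotation hE hU hx hh, nablaT_rotation hE hU hx hh]
  ring

theorem sum_mul_constCurv (u : Fin 4 → ℂ) (b c d : Fin 4) : ∑ e, u e * constCurv lam e b c d
    = (lam / 3) * ((if b = c then 1 else 0) * u d - u c * if b = d then 1 else 0) := by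
  have e1 : ∀ e, u e * constCurv lam e b c d
      = (lam / 3) * (if b = c then 1 else 0) * (if e = d then u e else 0)
        - (lam / 3) * (if b = d then 1 else 0) * (if e = c then u e else 0) := by
    intro e
    unfold constCurv
    split_ifs <;> ring
  simp only [e1, Finset.sum_sub_distrib, ← Finset.mul_sum, Finset.sum_ite_eq', Finset.mem_univ,
    if_true]
  ring

/-- The first term is the variation of the components in the co-varied orthonormal frame; the others
undo the change of frame in the four slots. All terms with `λ` cancel, since `δR_{ab} = λ h_{ab}`
and the scalar curvature does not vary. -/
theorem linearisedWeyl (hq : IsQuaternionicKahler g E U lam) (hE : IsOrthonormalFrame g E U)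
    (hU : IsOpen U) (hh : ∀ i j, SmoothFn (fun y => h y i j) U) (hs : ∀ y ∈ U, (h y).IsSymm)
    (h0 : ∀ x ∈ U, ∀ a b A B, spinPart (rotationCurv g E h x a b) A B = 0) (hx : x ∈ U)
    (a b c d : Fin 4) :
    HasDerivAt (fun t : ℝ => weyl g E (perturbed h t) a b c d x)
      (rotationCurv g E h x a b c d + (1 / 2) * (∑ e, (h x a e * sdWeyl g E lam x e b c d
        + h x b e * sdWeyl g E lam x a e c d) + ∑ e, (h x c e * sdWeyl g E lam x a b e d
        + h x d e * sdWeyl g E lam x a b c e))) 0 := by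
  have hR := hasDerivAt_riemann hE hU hx hh
  have hr := fun b c => linearisedEinstein hq hE hU hh hs h0 hx b c
  have hp := hasDerivAt_perturbed h x
  have hi := hasDerivAt_perturbed_inv h x
  have r0 : ∀ b c, ricci g E (perturbed h 0) b c x = lam * if b = c then 1 else 0 := by
    intro b c
    rw [← hq.ricci_eq hx b c]
    exact Finset.sum_congr rfl fun a _ => riemann_perturbed_zero a b c a
  have s0 : scalarCurv g E (perturbed h 0) x = 4 * lam := by
    simp only [scalarCurv, r0, perturbed_zero, inv_one, Matrix.one_apply]
    simp
  have hS : HasDerivAt (fun t : ℝ => scalarCurv g E (perturbed h t) x) 0 0 := by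
    refine (HasDerivAt.fun_sum (u := Finset.univ) fun a _ => HasDerivAt.fun_sum (u := Finset.univ)
      fun b _ => (hi a b).fun_mul (hr a b)).congr_deriv ?_
    simp only [r0, perturbed_zero, inv_one, Matrix.one_apply, Finset.sum_add_distrib, mul_ite,
      mul_one, mul_zero, ite_mul, one_mul, zero_mul, Finset.sum_ite_eq, Finset.mem_univ, if_true,
      ← Finset.mul_sum, neg_mul, Finset.sum_neg_distrib, ← Finset.sum_mul]
    ring
  have key := (((HasDerivAt.fun_sum (u := Finset.univ) fun e _ =>
    (hR a b c e).fun_mul (hp e d)).fun_sub ((((((hr b c).fun_mul (hp a d)).fun_add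
      ((hp b c).fun_mul (hr a d))).fun_sub ((hr a c).fun_mul (hp b d))).fun_sub
      ((hp a c).fun_mul (hr b d))).const_mul (1 / 2 : ℂ))).fun_add
      ((hS.const_mul (1 / 6 : ℂ)).fun_mul
        (((hp b c).fun_mul (hp a d)).fun_sub ((hp a c).fun_mul (hp b d)))))
  refine key.congr_deriv ?_
  have hsym : ∀ i j, h x i j = h x j i := fun i j => (hs x hx).apply j i
  have k1 : ∑ e, (h x a e * constCurv lam e b c d + h x b e * constCurv lam a e c d)
      = (lam / 3) * ((if b = c then 1 else 0) * h x a d - h x a c * (if b = d then 1 else 0)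
        + (h x b c * (if a = d then 1 else 0) - (if a = c then 1 else 0) * h x b d)) := by
    have p0 : ∀ e, constCurv lam a e c d = -constCurv lam e a c d := fun e =>
      constCurv_swap_left a e c d
    simp only [Finset.sum_add_distrib, sum_mul_constCurv, p0, mul_neg, Finset.sum_neg_distrib]
    ring
  have k2 : ∑ e, (h x c e * constCurv lam a b e d + h x d e * constCurv lam a b c e)
      = (lam / 3) * (h x b c * (if a = d then 1 else 0) - h x a c * (if b = d then 1 else 0)
        + ((if b = c then 1 else 0) * h x a d - (if a = c then 1 else 0) * h x b d)) := by
    have p1 : ∀ e, constCurv lam a b e d = constCurv lam e d a b := fun e => constCurv_pair a b e d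
    have p2 : ∀ e, constCurv lam a b c e = -constCurv lam e c a b := fun e => by
      rw [constCurv_pair, constCurv_swap_left]
    simp only [Finset.sum_add_distrib, p1, p2, sum_mul_constCurv, mul_neg, Finset.sum_neg_distrib,
      hsym b c, hsym a c, hsym a d, hsym b d, eq_comm (a := d), eq_comm (a := c)]
    ring
  have e1 : ∑ e, (h x a e * sdWeyl g E lam x e b c d + h x b e * sdWeyl g E lam x a e c d)
      = ∑ e, (h x a e * curv g E e b c d x + h x b e * curv g E a e c d x)
        - ∑ e, (h x a e * constCurv lam e b c d + h x b e * constCurv lam a e c d) := by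
    rw [← Finset.sum_sub_distrib]
    exact Finset.sum_congr rfl fun e _ => by rw [sdWeyl, sdWeyl]; ring
  have e2 : ∑ e, (h x c e * sdWeyl g E lam x a b e d + h x d e * sdWeyl g E lam x a b c e)
      = ∑ e, (h x c e * curv g E a b e d x + h x d e * curv g E a b c e x)
        - ∑ e, (h x c e * constCurv lam a b e d + h x d e * constCurv lam a b c e) := by
    rw [← Finset.sum_sub_distrib]
    exact Finset.sum_congr rfl fun e _ => by rw [sdWeyl, sdWeyl]; ring
  have e3 : ∑ e, (curv g E a b c e x * h x e d + curv g E a b d e x * h x c e)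
      = 2 * ∑ e, curv g E a b c e x * h x e d
        - ∑ e, (h x c e * curv g E a b e d x + h x d e * curv g E a b c e x) + 2 *
        ∑ e, h x c e * (curv g E a b d e x + curv g E a b e d x) := by
    rw [Finset.mul_sum, Finset.mul_sum, ← Finset.sum_sub_distrib, ← Finset.sum_add_distrib]
    exact Finset.sum_congr rfl fun e _ => by rw [hsym d e, hE.curv_swap_right hU hx a b d e]; ring
  have e4 : ∀ e, curv g E a b d e x + curv g E a b e d x = 0 := fun e => by
    rw [hE.curv_swap_right hU hx]; ring
  simp only [e4, mul_zero, Finset.sum_const_zero, add_zero] at e3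
  rw [e1, e2, k1, k2, rotationCurv]
  simp only [riemann_perturbed_zero, r0, s0, perturbed_zero, Matrix.one_apply,
    Finset.sum_add_distrib, mul_ite, mul_one, mul_zero, Finset.sum_ite_eq', Finset.mem_univ,
    if_true, varRiemann_eq hE hU hx hh hs]
  simp only [Finset.sum_add_distrib] at e3
  rw [e3]
  split_ifs <;> ring

/-- The hypothesis linearises the statement that the unprimed spin bundle has the curvature of
constant sectional curvature `λ/3`. It encodes the Einstein and the Weyl conditions at once. -/
theorem IsQuaternionicDeformation.of_spinPart (hq : IsQuaternionicKahler g E U lam)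
    (hE : IsOrthonormalFrame g E U) (hU : IsOpen U) (hh : ∀ i j, SmoothFn (fun y => h y i j) U)
    (hs : ∀ y ∈ U, (h y).IsSymm)
    (h0 : ∀ x ∈ U, ∀ a b A B, spinPart (rotationCurv g E h x a b) A B = 0) :
    IsQuaternionicDeformation g E U lam h where
  symmetric := hs
  einstein x hx a b := by
    refine ((linearisedEinstein hq hE hU hh hs h0 hx a b).fun_sub
      ((hasDerivAt_perturbed h x a b).const_mul (lam : ℂ))).congr_deriv ?_
    ring
  weyl x hx I := by
    have hv := isVariation hq hE hU hx hh hs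
    have hW := linearisedWeyl hq hE hU hh hs h0 hx
    refine ((HasDerivAt.fun_sum (u := Finset.univ) fun a _ => HasDerivAt.fun_sum
      (u := Finset.univ) fun b _ => HasDerivAt.fun_sum (u := Finset.univ) fun c _ =>
      HasDerivAt.fun_sum (u := Finset.univ) fun d _ => HasDerivAt.fun_sum (u := Finset.univ)
      fun X _ => (hW a b c d).const_mul (sigmaLow a (I 0) (X 0) * sigmaLow b (I 1) (X 1) *
        sigmaLow c (I 2) (X 2) * sigmaLow d (I 3) (X 3) * eps (X 0) (X 1) *
        eps (X 2) (X 3))).const_mul (1 / 4 : ℂ)).congr_deriv ?_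
    have hC := asdPart_action_eq_zero (C := sdWeyl g E lam x) sdWeyl_swap_left
      (hE.sdWeyl_swap_right hU hx) (hE.sdWeyl_pair hU hx)
      (hq.sdWeyl_selfDual hE hU hx) (fun a b => (1 / 2) * h x a b) I
    have hX : asdPart (rotationCurv g E h x) I = 0 := by
      refine asdPart_eq_zero_of_right ?_ ?_ (h0 x hx) I
      · rw [rotationCurv_eq hE hU hx hh]
        exact hv.variation_swap_left
      · rw [rotationCurv_eq hE hU hx hh]
        exact hv.variation_swap_right
    have key := asdPart_add (rotationCurv g E h x) (fun a b c d =>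
      (∑ e, ((1 / 2) * h x a e * sdWeyl g E lam x e b c d
        + (1 / 2) * h x b e * sdWeyl g E lam x a e c d))
      + ∑ e, ((1 / 2) * h x c e * sdWeyl g E lam x a b e d
        + (1 / 2) * h x d e * sdWeyl g E lam x a b c e)) I
    have key2 := (asdPart_add _ _ I).trans (congrArg₂ (· + ·) hC.1 hC.2)
    refine Eq.trans ?_ (key.trans ((congrArg₂ (· + ·) hX key2).trans (by simp)))
    unfold asdPart
    simp only [mul_add, Finset.mul_sum, mul_assoc]

end LinearisedEquations

/-! ### Component algebra for the unprimed curvature variation -/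

section FirstOrderAlgebra

set_option maxHeartbeats 2000000 in
/-- The pointwise algebra behind the vanishing of the anti-self-dual curvature of the field `γ` of a
potential whose first derivative is `N`. -/
theorem potential_algebra_first {N : Fin 2 → Fin 2 → Fin 2 → Fin 2 → Fin 2 → Fin 2 → ℂ}
    {m : Fin 2 → Fin 2 → ℂ} {c : Fin 2 → Fin 2 → Fin 2 → Fin 2 → ℂ}
    (hN1 : ∀ P A B C V Y, N P A B C V Y = N P B A C V Y)
    (hN2 : ∀ P A B C V Y, N P A B C V Y = N P A C B V Y)
    (hq : ∀ A B C D, (∑ X, ∑ Y, eps X Y * N A B C D Y X) + (∑ X, ∑ Y, eps X Y * N B A C D Y X)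
      + (∑ X, ∑ Y, eps X Y * N C B A D Y X) + (∑ X, ∑ Y, eps X Y * N D B C A Y X) = 0)
    (hm : ∀ C D, m C D = ∑ F, ∑ B, eps F B * ∑ Y, ∑ Z, eps Y Z * N B F C D Z Y)
    (hc : ∀ A D V W, c A D V W
      = ∑ F, ∑ B, eps F B * ((1 / 2) * (N B F A D V W + N B F A D W V)))
    (A B C D V Y : Fin 2) :
    -(1 / 3) * (N A B C D V Y - N B A C D Y V)
      + (1 / 24) * eps V Y * (∑ F, (((if A = F then 1 else 0) * eps B C
          + (if B = F then 1 else 0) * eps A C) * m F D + ((if A = F then 1 else 0) * eps B D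
          + (if B = F then 1 else 0) * eps A D) * m C F))
      = (1 / 6) * ∑ Z, ∑ W, eps Z W * (eps B C * eps Y Z * c A D V W - c A C V Z * (eps B D * eps Y W)
        + (c B C Y Z * (eps A D * eps V W) - eps A C * eps V Z * c B D Y W)) := by
  have n100 := fun P V Y => hN1 P 1 0 0 V Y
  have n010 := fun P V Y => hN2 P 0 1 0 V Y
  have n110 := fun P V Y => hN2 P 1 1 0 V Y
  have n101 := fun P V Y => hN1 P 1 0 1 V Y
  -- As `N` is symmetric in its last three unprimed indices, the equation is symmetric in all four
  -- of its indices, so these five components carry all of it.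
  have q0 := hq 0 0 0 0
  have q1 := hq 0 0 0 1
  have q2 := hq 0 0 1 1
  have q3 := hq 0 1 1 1
  have q4 := hq 1 1 1 1
  clear hq hN1 hN2
  simp only [hm, hc]
  clear hm hc
  simp only [Fin.sum_univ_two, eps_zero_zero, eps_zero_one, eps_one_zero, eps_one_one, zero_mul,
    one_mul, zero_add, add_zero, neg_mul, n100, n010, n110, n101] at q0 q1 q2 q3 q4 ⊢
  fin_cases A <;> fin_cases B <;> fin_cases C <;> fin_cases D <;> fin_cases V <;> fin_cases Y <;>
    simp [eps_zero_zero, eps_zero_one, eps_one_zero, eps_one_one, n100, n010, n110, n101] <;>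
    clear n100 n010 n110 n101 <;> grind

end FirstOrderAlgebra

/-! ### Detecting the anti-self-dual part by contraction -/

section Contraction

/-- The contraction of the primed indices of `G_{CZ DW}`. -/
noncomputable def asdContr (G : Fin 4 → Fin 4 → ℂ) (C D : Fin 2) : ℂ :=
  ∑ Z, ∑ W, eps Z W * ∑ c, ∑ d, sigmaLow c C Z * sigmaLow d D W * G c d

theorem asdContr_sub (G H : Fin 4 → Fin 4 → ℂ) (C D : Fin 2) :
    asdContr (fun c d => G c d - H c d) C D = asdContr G C D - asdContr H C D := by
  simp only [asdContr, mul_sub, Finset.sum_sub_distrib]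

theorem asdContr_const_mul (z : ℂ) (G : Fin 4 → Fin 4 → ℂ) (C D : Fin 2) :
    asdContr (fun c d => z * G c d) C D = z * asdContr G C D := by
  simp only [asdContr, Finset.mul_sum]
  exact Finset.sum_congr rfl fun _ _ => Finset.sum_congr rfl fun _ _ => Finset.sum_congr rfl
    fun _ _ => Finset.sum_congr rfl fun _ _ => by ring

theorem asdContr_add (G H : Fin 4 → Fin 4 → ℂ) (C D : Fin 2) :
    asdContr (fun c d => G c d + H c d) C D = asdContr G C D + asdContr H C D := by
  simp only [asdContr, mul_add, Finset.sum_add_distrib]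

theorem asdContr_sum {τ : Type*} (s : Finset τ) (G : τ → Fin 4 → Fin 4 → ℂ) (C D : Fin 2) :
    asdContr (fun c d => ∑ t ∈ s, G t c d) C D = ∑ t ∈ s, asdContr (G t) C D := by
  classical
  induction s using Finset.induction_on with
  | empty => simp [asdContr]
  | insert t s ht ih => simp only [Finset.sum_insert ht, asdContr_add, ih]

theorem asdContr_eq_zero_of_spinPart {G : Fin 4 → Fin 4 → ℂ} (hG : ∀ c d, G c d = -G d c)
    (h : ∀ A B, spinPart G A B = 0) (C D : Fin 2) : asdContr G C D = 0 := by
  rw [asdContr, sum_asd_contraction hG]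
  simp [h]

theorem spinPart_eq_zero_of_asdContr {G : Fin 4 → Fin 4 → ℂ} (hG : ∀ c d, G c d = -G d c)
    (h : ∀ C D, asdContr G C D = 0) (A B : Fin 2) : spinPart G A B = 0 := by
  have h2 : ∀ C D, ∑ F, spinPart G C F * eps F D = 0 := by
    intro C D
    have := h C D
    rw [asdContr, sum_asd_contraction hG] at this
    simpa using this
  have h0 := h2 A 0
  have h1 := h2 A 1
  simp only [Fin.sum_univ_two, eps_zero_zero, eps_zero_one, eps_one_zero, eps_one_one] at h0 h1
  fin_cases B
  · simpa using h1
  · simpa using h0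

/-- The symbols `σ` form an invertible matrix, so a covector with vanishing spinor components
vanishes. -/
theorem eq_zero_of_sum_sigmaLow {u : Fin 4 → ℂ} (h : ∀ A V, ∑ a, sigmaLow a A V * u a = 0)
    (a : Fin 4) : u a = 0 := by
  have h1 : ∑ b, (∑ A, ∑ V, sigma a A V * sigmaLow b A V) * u b = 0 := by
    have h2 : ∑ b, (∑ A, ∑ V, sigma a A V * sigmaLow b A V) * u b
        = ∑ A, ∑ V, sigma a A V * ∑ b, sigmaLow b A V * u b := by
      simp only [Fin.sum_univ_two, Fin.sum_univ_four]
      ring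
    rw [h2]
    simp [h]
  simp only [sum_sigma_mul_sigmaLow] at h1
  simpa using h1

theorem toSpinor_comp_perm {n : ℕ} (T : (Fin n → Fin 4) → ℂ) (p : Equiv.Perm (Fin n))
    (I X : Fin n → Fin 2) :
    toSpinor (fun J => T (J ∘ p)) I X = toSpinor T (I ∘ p) (X ∘ p) := by
  unfold toSpinor
  rw [← (Equiv.arrowCongr p (Equiv.refl (Fin 4))).sum_comp]
  refine Finset.sum_congr rfl fun J _ => ?_
  have h : (Equiv.arrowCongr p (Equiv.refl (Fin 4))) J ∘ p = J := by
    funext k; simp [Equiv.arrowCongr]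
  beta_reduce
  rw [h, ← Equiv.prod_comp p]
  congr 2
  funext k
  simp [Equiv.arrowCongr]

theorem toSpinor_two (T : (Fin 2 → Fin 4) → ℂ) (A B V Y : Fin 2) :
    toSpinor T ![A, B] ![V, Y] = ∑ a, ∑ b, sigmaLow a A V * sigmaLow b B Y * T ![a, b] := by
  rw [toSpinor_vecCons]
  refine Finset.sum_congr rfl fun a _ => ?_
  rw [toSpinor_vecCons, Finset.mul_sum]
  refine Finset.sum_congr rfl fun b _ => ?_
  simp [toSpinor, mul_assoc]
  exact Or.inl (Or.inl rfl)

theorem toSpinor_four (T : (Fin 4 → Fin 4) → ℂ) (A B C D V Y Z W : Fin 2) :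
    toSpinor T ![A, B, C, D] ![V, Y, Z, W] = ∑ a, ∑ b, sigmaLow a A V * sigmaLow b B Y *
      ∑ c, ∑ d, sigmaLow c C Z * sigmaLow d D W * T ![a, b, c, d] := by
  rw [toSpinor_vecCons]
  refine Finset.sum_congr rfl fun a _ => ?_
  rw [toSpinor_vecCons, Finset.mul_sum]
  refine Finset.sum_congr rfl fun b _ => ?_
  rw [toSpinor_two, mul_assoc]

theorem sum_asdContr (T : (Fin 4 → Fin 4) → ℂ) (A B C D V Y : Fin 2) :
    ∑ a, ∑ b, sigmaLow a A V * sigmaLow b B Y * asdContr (fun c d => T ![a, b, c, d]) C D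
      = ∑ Z, ∑ W, eps Z W * toSpinor T ![A, B, C, D] ![V, Y, Z, W] := by
  have h : ∀ s : Fin 4 → Fin 4 → ℂ, ∀ F : Fin 2 → Fin 2 → Fin 4 → Fin 4 → ℂ,
      ∑ a, ∑ b, s a b * ∑ Z, ∑ W, eps Z W * F Z W a b
        = ∑ Z, ∑ W, eps Z W * ∑ a, ∑ b, s a b * F Z W a b := by
    intro s F
    simp only [Fin.sum_univ_two, mul_add, Finset.sum_add_distrib, Finset.mul_sum, mul_left_comm]
  simp only [toSpinor_four, asdContr]
  exact h (fun a b => sigmaLow a A V * sigmaLow b B Y)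
    (fun Z W a b => ∑ c, ∑ d, sigmaLow c C Z * sigmaLow d D W * T ![a, b, c, d])

theorem sum_kulkarni (p q r s : Fin 4 → ℂ) (k : Fin 4 → Fin 4 → ℂ) :
    ∑ a, ∑ b, p a * q b * ∑ c, ∑ d, r c * s d * ((if b = c then 1 else 0) * k a d
      - k a c * (if b = d then 1 else 0) + (k b c * (if a = d then 1 else 0)
        - (if a = c then 1 else 0) * k b d))
    = (∑ b, q b * r b) * (∑ a, ∑ d, p a * s d * k a d)
      - (∑ a, ∑ c, p a * r c * k a c) * (∑ b, q b * s b)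
      + ((∑ b, ∑ c, q b * r c * k b c) * (∑ a, p a * s a)
      - (∑ a, p a * r a) * ∑ b, ∑ d, q b * s d * k b d) := by
  simp [Fin.sum_univ_four]
  ring

end Contraction

/-! ### The field `γ` of a potential is a quaternionic deformation -/

section PotentialDeformation

variable {M : Type*} [TopologicalSpace M] [ChartedSpace R4 M] [IsManifold (𝓡 4) ∞ M]
  {U : Set M} {x : M} {g : Metric M} {E : Frame M} {lam : ℝ} {Pot : SpinorField M 3 1}
  {h : M → Matrix (Fin 4) (Fin 4) ℂ} {k : ℂ}

theorem spinorOf_rotation (I X : Fin 3 → Fin 2) : spinorOf (rotation g E h) I X x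
    = (1 / 2) * (spinorOf (nablaT g E (tensorOf h)) ![I 1, I 0, I 2] ![X 1, X 0, X 2] x
      - spinorOf (nablaT g E (tensorOf h)) ![I 2, I 0, I 1] ![X 2, X 0, X 1] x) := by
  have e1 : ∀ {τ : Type} (J : Fin 3 → τ), J ∘ Equiv.swap 0 1 = ![J 1, J 0, J 2] := by
    intro τ J; funext j; fin_cases j <;> rfl
  have e2 : ∀ {τ : Type} (J : Fin 3 → τ), J ∘ (finRotate 3).symm = ![J 2, J 0, J 1] := by
    intro τ J; funext j; fin_cases j <;> rfl
  simp only [spinorOf, rotation, ← e1, ← e2]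
  rw [toSpinor_mul, toSpinor_sub, toSpinor_comp_perm (fun J => nablaT g E (tensorOf h) J x),
    toSpinor_comp_perm (fun J => nablaT g E (tensorOf h) J x)]

/-- Contracting the primed indices of the `so(4)` pair extracts, up to normalisation, the unprimed
part of the connection variation. For a multiple of `γ` this is the left side of `gamma_identity`;
the gradient of `μ` on the right is an infinitesimal gauge transformation. -/
theorem IsPotential.contr_rotation (hP : IsPotential g E U Pot)
    (hq : IsQuaternionicKahler g E U lam) (hE : IsOrthonormalFrame g E U) (hU : IsOpen U)
    (hx : x ∈ U) (hh : ∀ i j, SmoothFn (fun y => h y i j) U)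
    (hγ : ∀ y ∈ U, ∀ I X, spinorOf (tensorOf h) I X y = k * gammaOf g E Pot I X y)
    (I : Fin 3 → Fin 2) (X : Fin 1 → Fin 2) :
    contrPrimed (fun I X => spinorOf (rotation g E h) I (X ∘ Equiv.swap 0 2)) I X x
      = k * (-(lam / 3 : ℂ) * Pot I X x + (1 / 4) * nabla g E (potMu g E Pot) I X x) := by
  have hn : ∀ I X, spinorOf (nablaT g E (tensorOf h)) I X x
      = k * nabla g E (gammaOf g E Pot) I X x := by
    intro I X
    rw [← nabla_spinorOf hU hx (smooth_tensorOf hh), nabla_congr hU hx hγ,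
      nabla_const_mul hU hx (smooth_gammaOf hE hU hP.smooth)]
  have hI := vec_three I
  have hX : X = ![X 0] := by funext j; fin_cases j; rfl
  have e : ∀ Y Z, Matrix.vecCons Z (Matrix.vecCons Y X) ∘ Equiv.swap 0 2 = ![X 0, Y, Z] := by
    intro Y Z; funext j; fin_cases j <;> rfl
  have hg := hP.gamma_identity hq hE hU hx (I 0) (X 0) (I 1) (I 2)
  rw [← hI, ← hX] at hg
  rw [← hg, contrPrimed]
  simp only [e, spinorOf_rotation, hn, Fin.sum_univ_two, eps_zero_zero, eps_zero_one, eps_one_zero,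
    eps_one_one, Matrix.cons_val_zero, Matrix.cons_val_one, Matrix.cons_val]
  ring

theorem IsPotential.sum_nabla_rotation (hP : IsPotential g E U Pot)
    (hq : IsQuaternionicKahler g E U lam) (hE : IsOrthonormalFrame g E U) (hU : IsOpen U)
    (hx : x ∈ U) (hh : ∀ i j, SmoothFn (fun y => h y i j) U)
    (hγ : ∀ y ∈ U, ∀ I X, spinorOf (tensorOf h) I X y = k * gammaOf g E Pot I X y)
    (A B C D V Y : Fin 2) :
    ∑ Z, ∑ W, eps Z W * spinorOf (nablaT g E (rotation g E h)) ![A, B, C, D] ![V, Y, Z, W] x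
      = k * (-(lam / 3 : ℂ) * nabla g E Pot ![A, B, C, D] ![V, Y] x
        + (1 / 4) * nabla g E (nabla g E (potMu g E Pot)) ![A, B, C, D] ![V, Y] x) := by
  have sr : SmoothSpinor (spinorOf (rotation g E h)) U :=
    smoothSpinor_spinorOf (smooth_rotation hE hU hh)
  have sm : SmoothSpinor (nabla g E (potMu g E Pot)) U :=
    (smooth_potMu hE hU hP.smooth).nabla hE hU
  have h1 := nabla_congr (g := g) (E := E) hU hx
    (fun y hy => hP.contr_rotation hq hE hU hy hh hγ) ![A, B, C, D] ![V, Y]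
  rw [nabla_contrPrimed hU hx (φ := fun I X => spinorOf (rotation g E h) I (X ∘ Equiv.swap 0 2))
    (fun I X => sr _ _)] at h1
  have h2 := fun Z W => QK.nabla_perm (g := g) (E := E) (x := x) (spinorOf (rotation g E h)) 1
    (Equiv.swap 0 2) A V ![B, C, D] ![W, Z, Y]
  have e : ∀ Z W, ![W, Z, Y] ∘ Equiv.swap (0 : Fin 3) 2 = ![Y, Z, W] := by
    intro Z W; funext j; fin_cases j <;> rfl
  simp only [Equiv.Perm.coe_one, Function.comp_id, e] at h2
  simp only [h2, nabla_spinorOf hU hx (smooth_rotation hE hU hh)] at h1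
  rw [h1, nabla_const_mul hU hx (φ := fun I X y => -(lam / 3 : ℂ) * Pot I X y
      + (1 / 4) * nabla g E (potMu g E Pot) I X y)
      (fun I X => ((SmoothFn.const _).mul (hP.smooth _ _)).add ((SmoothFn.const _).mul (sm _ _))),
    nabla_add hU hx (φ := fun I X y => -(lam / 3 : ℂ) * Pot I X y)
      (fun I X => (SmoothFn.const _).mul (hP.smooth _ _)) (fun I X => (SmoothFn.const _).mul (sm _ _)),
    nabla_const_mul hU hx hP.smooth, nabla_const_mul hU hx sm]

/-- The action touches only the form indices, so the Weyl part remains self-dual in `c, d` and is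
annihilated; only the constant curvature part contributes. -/
theorem asdContr_curvature_action (hq : IsQuaternionicKahler g E U lam)
    (hE : IsOrthonormalFrame g E U) (hU : IsOpen U) (hx : x ∈ U) (a b : Fin 4) (C D : Fin 2) :
    asdContr (fun c d => ∑ e, (h x a e * curv g E e b c d x + h x b e * curv g E a e c d x)) C D
      = asdContr (fun c d => (lam / 3 : ℂ) * ((if b = c then 1 else 0) * h x a d
        - h x a c * (if b = d then 1 else 0) + (h x b c * (if a = d then 1 else 0)
        - (if a = c then 1 else 0) * h x b d))) C D := by
  have e1 : ∀ c d, ∑ e, (h x a e * curv g E e b c d x + h x b e * curv g E a e c d x)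
      = ∑ e, (h x a e * sdWeyl g E lam x e b c d + h x b e * sdWeyl g E lam x a e c d)
        + (lam / 3) * ((if b = c then 1 else 0) * h x a d - h x a c * (if b = d then 1 else 0)
        + (h x b c * (if a = d then 1 else 0) - (if a = c then 1 else 0) * h x b d)) := by
    intro c d
    have p0 : ∀ e, constCurv lam a e c d = -constCurv lam e a c d := fun e =>
      constCurv_swap_left a e c d
    have k1 : ∑ e, (h x a e * constCurv lam e b c d + h x b e * constCurv lam a e c d)
        = (lam / 3) * ((if b = c then 1 else 0) * h x a d - h x a c * (if b = d then 1 else 0)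
          + (h x b c * (if a = d then 1 else 0) - (if a = c then 1 else 0) * h x b d)) := by
      simp only [Finset.sum_add_distrib, sum_mul_constCurv, p0, mul_neg, Finset.sum_neg_distrib]
      ring
    rw [← k1, ← Finset.sum_add_distrib]
    exact Finset.sum_congr rfl fun e _ => by rw [sdWeyl, sdWeyl]; ring
  have hz : ∀ a b, asdContr (sdWeyl g E lam x a b) C D = 0 := fun a b =>
    asdContr_eq_zero_of_spinPart (hE.sdWeyl_swap_right hU hx a b)
      (hq.spinPart_sdWeyl hE hU hx a b) C D
  simp only [e1]
  rw [asdContr_add, asdContr_sum]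
  simp only [asdContr_add]
  have hz2 : ∀ z a b, asdContr (fun c d => z * sdWeyl g E lam x a b c d) C D = 0 := by
    intro z a b
    rw [asdContr_const_mul]
    exact mul_eq_zero_of_right _ (hz a b)
  simp [hz2]

/-- Three contributions must cancel: `-(λ/3)` times the antisymmetrised derivative of `Π`, the
commutator of derivatives on `μ`, which is `λ` times `μ`, and the change of frame of the constant
curvature, `λ` times `γ`. Since `μ` and `γ` are themselves first derivatives of `Π`, the
cancellation is algebraic. -/
theorem IsPotential.spinPart_rotationCurv (hP : IsPotential g E U Pot)
    (hq : IsQuaternionicKahler g E U lam) (hE : IsOrthonormalFrame g E U) (hU : IsOpen U)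
    (hx : x ∈ U) (hh : ∀ i j, SmoothFn (fun y => h y i j) U) (hs : ∀ y ∈ U, (h y).IsSymm)
    (hγ : ∀ y ∈ U, ∀ I X, spinorOf (tensorOf h) I X y = k * gammaOf g E Pot I X y)
    (a b : Fin 4) (A B : Fin 2) : spinPart (rotationCurv g E h x a b) A B = 0 := by
  have hsw : ∀ c d, rotationCurv g E h x a b c d = -rotationCurv g E h x a b d c := by
    rw [rotationCurv_eq hE hU hx hh]
    exact (isVariation hq hE hU hx hh hs).variation_swap_right a b
  refine spinPart_eq_zero_of_asdContr hsw (fun C D => ?_) A B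
  have key : ∀ A V B Y, ∑ a, sigmaLow a A V * ∑ b, sigmaLow b B Y *
      asdContr (rotationCurv g E h x a b) C D = 0 := by
    intro A V B Y
    have e1 : ∀ a b, asdContr (rotationCurv g E h x a b) C D
        = asdContr (fun c d => nablaT g E (rotation g E h) ![a, b, c, d] x) C D
          - asdContr (fun c d => nablaT g E (rotation g E h) ![b, a, c, d] x) C D
          - (lam / 6) * asdContr (fun c d => ((if b = c then 1 else 0) * h x a d
            - h x a c * (if b = d then 1 else 0) + (h x b c * (if a = d then 1 else 0)
            - (if a = c then 1 else 0) * h x b d))) C D := by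
      intro a b
      have h1 := asdContr_curvature_action (h := h) hq hE hU hx a b C D
      rw [asdContr_const_mul] at h1
      have h2 : asdContr (rotationCurv g E h x a b) C D = asdContr (fun c d =>
          nablaT g E (rotation g E h) ![a, b, c, d] x - nablaT g E (rotation g E h) ![b, a, c, d] x
          - (1 / 2) * ∑ e, (h x a e * curv g E e b c d x + h x b e * curv g E a e c d x)) C D := rfl
      rw [h2, asdContr_sub, asdContr_sub, asdContr_const_mul, h1]
      ring
    have t1 := sum_asdContr (fun J => nablaT g E (rotation g E h) J x) A B C D V Y
    have t2 := sum_asdContr (fun J => nablaT g E (rotation g E h) J x) B A C D Y V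
    have s1 := hP.sum_nabla_rotation hq hE hU hx hh hγ A B C D V Y
    have s2 := hP.sum_nabla_rotation hq hE hU hx hh hγ B A C D Y V
    have hk : ∀ A D V W, ∑ a, ∑ d, sigmaLow a A V * sigmaLow d D W * h x a d
        = k * gammaOf g E Pot ![A, D] ![V, W] x := by
      intro A D V W
      rw [← hγ x hx, spinorOf, toSpinor_two]
      rfl
    have t3 : ∑ a, ∑ b, sigmaLow a A V * sigmaLow b B Y * asdContr (fun c d =>
          ((if b = c then 1 else 0) * h x a d
            - h x a c * (if b = d then 1 else 0) + (h x b c * (if a = d then 1 else 0)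
            - (if a = c then 1 else 0) * h x b d))) C D
        = ∑ Z, ∑ W, eps Z W * ((eps B C * eps Y Z) * (k * gammaOf g E Pot ![A, D] ![V, W] x)
          - (k * gammaOf g E Pot ![A, C] ![V, Z] x) * (eps B D * eps Y W)
          + ((k * gammaOf g E Pot ![B, C] ![Y, Z] x) * (eps A D * eps V W)
          - (eps A C * eps V Z) * (k * gammaOf g E Pot ![B, D] ![Y, W] x))) := by
      have := sum_asdContr (fun J => (if J 1 = J 2 then 1 else 0) * h x (J 0) (J 3)
            - h x (J 0) (J 2) * (if J 1 = J 3 then 1 else 0) + (h x (J 1) (J 2) *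
            (if J 0 = J 3 then 1 else 0) - (if J 0 = J 2 then 1 else 0) * h x (J 1) (J 3)))
            A B C D V Y
      refine this.trans ?_
      refine Finset.sum_congr rfl fun Z _ => Finset.sum_congr rfl fun W _ => ?_
      rw [toSpinor_four]
      congr 1
      simp only [← hk, ← sum_sigmaLow_mul_sigmaLow]
      exact sum_kulkarni (fun a => sigmaLow a A V) (fun a => sigmaLow a B Y)
        (fun a => sigmaLow a C Z) (fun a => sigmaLow a D W) (h x)
    have hc := hE.nabla_comm hU hx (smooth_potMu (g := g) hE hU hP.smooth) A B V Y ![C, D] ![]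
    simp only [act_two, act_nil, hq.curvS_eq hE hU hx] at hc
    have alg := potential_algebra_first
      (N := fun P A B C V Y => nabla g E Pot ![P, A, B, C] ![V, Y] x)
      (m := fun C D => potMu g E Pot ![C, D] ![] x)
      (c := fun A D V W => gammaOf g E Pot ![A, D] ![V, W] x) ?_ ?_ ?_ ?_ ?_ A B C D V Y
    · have split : ∑ a, sigmaLow a A V * ∑ b, sigmaLow b B Y *
          asdContr (rotationCurv g E h x a b) C D
          = ∑ a, ∑ b, sigmaLow a A V * sigmaLow b B Y *
            asdContr (fun c d => nablaT g E (rotation g E h) ![a, b, c, d] x) C D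
          - ∑ b, ∑ a, sigmaLow b B Y * sigmaLow a A V *
            asdContr (fun c d => nablaT g E (rotation g E h) ![b, a, c, d] x) C D
          - (lam / 6) * ∑ a, ∑ b, sigmaLow a A V * sigmaLow b B Y * asdContr (fun c d =>
            ((if b = c then 1 else 0) * h x a d
            - h x a c * (if b = d then 1 else 0) + (h x b c * (if a = d then 1 else 0)
            - (if a = c then 1 else 0) * h x b d))) C D := by
        rw [Finset.sum_comm (f := fun b a => sigmaLow b B Y * sigmaLow a A V * _),
          Finset.mul_sum, ← Finset.sum_sub_distrib, ← Finset.sum_sub_distrib]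
        refine Finset.sum_congr rfl fun a _ => ?_
        rw [Finset.mul_sum, Finset.mul_sum, ← Finset.sum_sub_distrib, ← Finset.sum_sub_distrib]
        refine Finset.sum_congr rfl fun b _ => ?_
        rw [e1]
        ring
      rw [split, t1, t2, t3]
      unfold spinorOf at s1 s2
      rw [s1, s2]
      simp only [Fin.sum_univ_two] at hc alg ⊢
      -- The factor `k / 4` multiplies the Ricci identity for the gradient term `¼ ∇μ`; what remains
      -- is `λ` times the identity of `potential_algebra_first`.
      linear_combination (k / 4) * hc + k * lam * alg
    · intro P A B C V Y
      rw [← hP.nabla_swap12 hU hx]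
      congr 1
      funext j; fin_cases j <;> rfl
    · intro P A B C V Y
      rw [← hP.nabla_swap23 hU hx]
      congr 1
      funext j; fin_cases j <;> rfl
    · intro A B C D
      have := hP.sum_swap_eq_zero hU hx ![A, B, C, D]
      rw [sum_swap_vec (F := fun K => contrPrimed (nabla g E Pot) K ![] x)] at this
      exact this
    · exact fun C D => rfl
    · exact fun A D V W => rfl
  exact eq_zero_of_sum_sigmaLow (u := fun b => asdContr (rotationCurv g E h x a b) C D)
    (fun B Y => eq_zero_of_sum_sigmaLow (u := fun a => ∑ b, sigmaLow b B Y *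
      asdContr (rotationCurv g E h x a b) C D) (fun A V => key A V B Y) a) b

/-- The field of a potential is a quaternionic deformation. -/
theorem IsPotential.isQuaternionicDeformation (hP : IsPotential g E U Pot)
    (hq : IsQuaternionicKahler g E U lam) (hE : IsOrthonormalFrame g E U) (hU : IsOpen U)
    (hh : ∀ i j, SmoothFn (fun y => h y i j) U) (hs : ∀ y ∈ U, (h y).IsSymm)
    (hγ : ∀ y ∈ U, ∀ I X, spinorOf (tensorOf h) I X y = k * gammaOf g E Pot I X y) :
    IsQuaternionicDeformation g E U lam h :=
  .of_spinPart hq hE hU hh hs fun _ hx a b A B =>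
    hP.spinPart_rotationCurv hq hE hU hx hh hs hγ a b A B

end PotentialDeformation

/-! ### Lie brackets in frame components -/

section Components

open VectorField

variable {M : Type*} [TopologicalSpace M] [ChartedSpace R4 M] [IsManifold (𝓡 4) ∞ M]
  {U : Set M} {x : M} {g : Metric M} {E : Frame M} {V W : (y : M) → TangentSpace (𝓡 4) y}

/-- The frame components of a vector field. -/
noncomputable def coord (g : Metric M) (E : Frame M) (V : (y : M) → TangentSpace (𝓡 4) y)
    (a : Fin 4) : M → ℂ := fun y => ((g.inner y (V y) (E a y) : ℝ) : ℂ)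

theorem IsOrthonormalFrame.contMDiffOn_of_coord (hE : IsOrthonormalFrame g E U)
    (h : ∀ a, SmoothFn (coord g E V a) U) :
    ContMDiffOn (𝓡 4) (𝓡 4).tangent ∞ (fun x => (⟨x, V x⟩ : TangentBundle (𝓡 4) M)) U := by
  have hr : ∀ a, ContMDiffOn (𝓡 4) 𝓘(ℝ, ℝ) ∞ (fun y => g.inner y (V y) (E a y)) U := by
    intro a
    exact Complex.reCLM.contDiff.contMDiff.comp_contMDiffOn (h a)
  have hs : ContMDiffOn (𝓡 4) (𝓡 4).tangent ∞ (fun x => (⟨x, ∑ a, g.inner x (V x) (E a x) • E a x⟩ :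
      TangentBundle (𝓡 4) M)) U :=
    ContMDiffOn.sum_section (I := 𝓡 4) (F := R4) (V := fun x : M => TangentSpace (𝓡 4) x)
      (t := fun a x => g.inner x (V x) (E a x) • E a x)
      fun a _ => ContMDiffOn.smul_section (hr a) (hE.smooth a)
  refine hs.congr fun y hy => ?_
  congr 1
  exact hE.expand hy (V y)

/-- Both sides are tested against differentials of local smooth functions, where the bracket is a
commutator of derivations; its second-order terms reduce to structure functions. -/
theorem IsOrthonormalFrame.coord_mlieBracket (hE : IsOrthonormalFrame g E U) (hU : IsOpen U)
    (hx : x ∈ U) (hV : ∀ a, SmoothFn (coord g E V a) U) (hW : ∀ a, SmoothFn (coord g E W a) U)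
    (e : Fin 4) : coord g E (mlieBracket (𝓡 4) V W) e x
      = ∑ c, (coord g E V c x * D E c (coord g E W e) x - coord g E W c x * D E c (coord g E V e) x)
        + ∑ c, ∑ d, coord g E V c x * coord g E W d x * structureFn g E c d e x := by
  refine sub_eq_zero.1 (hE.eq_zero_of_forall_D hU hx (u := fun e =>
    coord g E (mlieBracket (𝓡 4) V W) e x - (∑ c, (coord g E V c x * D E c (coord g E W e) x
      - coord g E W c x * D E c (coord g E V e) x)
      + ∑ c, ∑ d, coord g E V c x * coord g E W d x * structureFn g E c d e x)) ?_ e)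
  intro N hN hNo hxN f hf
  have hE' := hE.mono hN
  have hD := fun d => hE'.smooth_D hNo d hf
  have hVn := fun a => ContMDiffOn.mono (hV a) hN
  have hWn := fun a => ContMDiffOn.mono (hW a) hN
  have h := mfderiv_apply_mlieBracket hNo hxN ((hE.contMDiffOn_of_coord hV).mono hN)
    ((hE.contMDiffOn_of_coord hW).mono hN) hf
  have hal : ∀ {V W : (y : M) → TangentSpace (𝓡 4) y}, (∀ a, SmoothFn (coord g E W a) N) →
      along V (along W f) x = ∑ c, coord g E V c x *
        ∑ d, (coord g E W d x * D E c (D E d f) x + D E c (coord g E W d) x * D E d f x) := by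
    intro V W hW
    rw [hE'.along_eq hxN]
    refine Finset.sum_congr rfl fun c _ => ?_
    rw [D_congr hNo hxN c (f' := fun y => ∑ d, coord g E W d y * D E d f y)
      (fun y hy => hE'.along_eq hy W f), D_sum hNo hxN c fun d => (hW d).mul (hD d)]
    congr 1
    exact Finset.sum_congr rfl fun d _ => D_mul hNo hxN c (hW d) (hD d)
  rw [hE'.along_eq hxN, hal hWn, hal hVn] at h
  have hc := fun c d => hE'.D_comm hNo hxN c d hf
  simp only [sub_mul, Finset.sum_sub_distrib]
  refine sub_eq_zero.2 (h.trans ?_)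
  have e1 : ∑ c, coord g E W c x * ∑ d, coord g E V d x * D E c (D E d f) x
      = ∑ c, coord g E V c x * ∑ d, coord g E W d x * D E d (D E c f) x := by
    simp only [Finset.mul_sum]
    rw [Finset.sum_comm]
    exact Finset.sum_congr rfl fun _ _ => Finset.sum_congr rfl fun _ _ => by ring
  have e2 : ∑ c, coord g E V c x * ∑ d, coord g E W d x * D E c (D E d f) x
      - ∑ c, coord g E V c x * ∑ d, coord g E W d x * D E d (D E c f) x
      = ∑ e, (∑ c, ∑ d, coord g E V c x * coord g E W d x * structureFn g E c d e x)
        * D E e f x := by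
    simp only [← Finset.sum_sub_distrib, ← mul_sub, hc]
    simp only [Fin.sum_univ_four]
    ring
  have e3 : ∀ V W : (y : M) → TangentSpace (𝓡 4) y,
      ∑ c, coord g E V c x * ∑ d, D E c (coord g E W d) x * D E d f x
      = ∑ e, (∑ c, coord g E V c x * D E c (coord g E W e) x) * D E e f x := by
    intro V W
    simp only [Finset.mul_sum, Finset.sum_mul]
    rw [Finset.sum_comm]
    exact Finset.sum_congr rfl fun _ _ => Finset.sum_congr rfl fun _ _ => by ring
  simp only [mul_add, Finset.sum_add_distrib, add_mul, sub_mul, Finset.sum_sub_distrib]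
  rw [← e2, e1, e3, e3]
  ring

end Components

/-! ### The Nijenhuis tensor through `∇J` -/

section Nijenhuis

open VectorField

variable {M : Type*} [TopologicalSpace M] [ChartedSpace R4 M] [IsManifold (𝓡 4) ∞ M]
  {U : Set M} {x : M} {g : Metric M} {E : Frame M} {J : EndField M}

/-- For a torsion-free connection the brackets in the Nijenhuis tensor may be computed with
covariant derivatives, and only derivatives of `J` survive. -/
theorem nijenhuis_algebra {j δ : Fin 4 → Fin 4 → ℂ} {Dj Nj S G : Fin 4 → Fin 4 → Fin 4 → ℂ}
    (hδ : ∀ a b, δ a b = if a = b then 1 else 0)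
    (hj : ∀ a b, ∑ c, j a c * j c b = -δ a b) (hG : ∀ a b c, G a b c = -G a c b)
    (hS : ∀ a b c, S a b c = G a b c - G b a c)
    (hN : ∀ d c b, Nj d c b = Dj d c b - ∑ e, (G d c e * j e b + G d b e * j c e))
    {a b f : Fin 4}
    (h : (∑ c, (j c a * Dj c f b - j c b * Dj c f a) + ∑ c, ∑ d, j c a * j d b * S c d f)
      - ∑ e, (-Dj b e a + ∑ c, j c a * S c b e) * j f e
      - ∑ e, (Dj a e b + ∑ c, j c b * S a c e) * j f e - S a b f = 0) :
    ∑ d, (j d a * Nj d f b - j d b * Nj d f a - j f d * Nj a d b + j f d * Nj b d a) = 0 := by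
  -- Undifferentiated connection terms meet two factors `j` contracted with each other; these are
  -- removed by `J² = -1`.
  have h1 : ∑ e, G a b e * (∑ c, j f c * j c e + δ f e) = 0 := by simp [hj]
  have h2 : ∑ e, G b a e * (∑ c, j f c * j c e + δ f e) = 0 := by simp [hj]
  simp only [mul_add, Finset.sum_add_distrib, hδ, mul_ite, mul_one, mul_zero, Finset.sum_ite_eq,
    Finset.mem_univ, if_true] at h1 h2
  have hN' : ∀ d c b, Nj d c b = Dj d c b + ∑ e, (G d e c * j e b - G d b e * j c e) := by
    intro d c b
    rw [hN, sub_eq_add_neg, ← Finset.sum_neg_distrib]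
    congr 1
    refine Finset.sum_congr rfl fun e _ => ?_
    rw [hG d c e]; ring
  simp only [hN', hS] at *
  simp only [Fin.sum_univ_four] at *
  linear_combination h - h2 + h1

theorem IsOrthonormalFrame.nablaT_comp (hE : IsOrthonormalFrame g E U) (hU : IsOpen U) (hx : x ∈ U)
    (hJ : ∀ a b, SmoothFn (comp g E J ![a, b]) U)
    (hJ2 : ∀ a b, ∑ c, comp g E J ![a, c] x * comp g E J ![c, b] x = -if a = b then 1 else 0)
    (hN : ∀ a b, mlieBracket (𝓡 4) (fun y => J y (E a y)) (fun y => J y (E b y)) x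
      - J x (mlieBracket (𝓡 4) (fun y => J y (E a y)) (E b) x)
      - J x (mlieBracket (𝓡 4) (E a) (fun y => J y (E b y)) x)
      - mlieBracket (𝓡 4) (E a) (E b) x = 0) (a b f : Fin 4) :
    ∑ d, (comp g E J ![d, a] x * nablaT g E (comp g E J) ![d, f, b] x
      - comp g E J ![d, b] x * nablaT g E (comp g E J) ![d, f, a] x
      - comp g E J ![f, d] x * nablaT g E (comp g E J) ![a, d, b] x
      + comp g E J ![f, d] x * nablaT g E (comp g E J) ![b, d, a] x) = 0 := by
  have cJ : ∀ a c, coord g E (fun y => J y (E a y)) c = comp g E J ![c, a] := by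
    intro a c
    funext y
    rw [coord, g.symm]
    rfl
  have cE : ∀ a c, ∀ y ∈ U, coord g E (E a) c y = if a = c then 1 else 0 := by
    intro a c y hy
    rw [coord, hE.orthonormal y hy]
    split_ifs <;> simp
  have sJ : ∀ a c, SmoothFn (coord g E (fun y => J y (E a y)) c) U := fun a c => by
    rw [cJ]; exact hJ c a
  have sE : ∀ a c, SmoothFn (coord g E (E a) c) U := fun a c =>
    (SmoothFn.const _).congr (cE a c)
  have dE : ∀ d a c, D E d (coord g E (E a) c) x = 0 := fun d a c => by
    rw [D_congr hU hx d (cE a c), D_const]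
  have hJv : ∀ v : TangentSpace (𝓡 4) x, ((g.inner x (J x v) (E f x) : ℝ) : ℂ)
      = ∑ e, ((g.inner x v (E e x) : ℝ) : ℂ) * comp g E J ![f, e] x := by
    intro v
    conv_lhs => rw [hE.expand hx v]
    simp only [map_sum, map_smul, sum_apply, smul_apply, smul_eq_mul]
    push_cast
    refine Finset.sum_congr rfl fun e _ => ?_
    rw [g.symm x (J x (E e x))]
    rfl
  have h0 := congrArg (fun v => ((g.inner x v (E f x) : ℝ) : ℂ)) (hN a b)
  simp only [map_sub, map_zero, sub_apply, zero_apply, Complex.ofReal_sub, Complex.ofReal_zero, hJv]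
    at h0
  have b1 := hE.coord_mlieBracket hU hx (sJ a) (sJ b) f
  have b2 := fun e => hE.coord_mlieBracket hU hx (sJ a) (sE b) e
  have b3 := fun e => hE.coord_mlieBracket hU hx (sE a) (sJ b) e
  have b4 : structureFn g E a b f x = _ := rfl
  simp only [cJ, dE, cE _ _ x hx, mul_zero, zero_sub, sub_zero, ite_mul, mul_ite, one_mul, zero_mul,
    mul_one, Finset.sum_ite_eq, Finset.mem_univ, if_true, Finset.sum_neg_distrib,
    Finset.sum_ite_irrel, Finset.sum_const_zero] at b1 b2 b3
  unfold coord at b1 b2 b3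
  simp only [b1, b2, b3] at h0
  refine nijenhuis_algebra (j := fun a b => comp g E J ![a, b] x)
    (δ := fun a b => if a = b then 1 else 0) (Dj := fun d c b => D E d (comp g E J ![c, b]) x)
    (Nj := fun d c b => nablaT g E (comp g E J) ![d, c, b] x)
    (S := fun a b c => structureFn g E a b c x) (G := fun a b c => leviCivita g E a b c x)
    (fun _ _ => rfl) hJ2 (fun a b c => leviCivita_swap g E a b c x)
    (fun a b c => (leviCivita_torsion g E a b c x).symm) (fun d c b => ?_) ?_
  · rw [nablaT_cons, act_two]
  · exact h0

end Nijenhuis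

/-! ### Products of spinors and traces in spinor indices -/

section Products

variable {M : Type*} [TopologicalSpace M] [ChartedSpace R4 M] [IsManifold (𝓡 4) ∞ M]
  {U : Set M} {x : M} {g : Metric M} {E : Frame M} {n m : ℕ}

/-- The product `α_A φ_{B …}` with a spinor `α`. -/
def tensMul (α : Fin 2 → M → ℂ) (φ : SpinorField M n m) : SpinorField M (n + 1) m :=
  fun I X x => α (I 0) x * φ (Fin.tail I) X x

/-- The product `ε_{A'B'} φ_{… C' …}`. -/
noncomputable def epsMul (φ : SpinorField M n m) : SpinorField M n (m + 2) :=
  fun I X x => eps (X 0) (X 1) * φ I (Fin.tail (Fin.tail X)) x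

theorem smooth_tensMul {α : Fin 2 → M → ℂ} (hα : ∀ A, SmoothFn (α A) U) {φ : SpinorField M n m}
    (hφ : SmoothSpinor φ U) : SmoothSpinor (tensMul α φ) U :=
  fun I X => (hα (I 0)).mul (hφ _ X)

theorem smooth_ofPair {α : Fin 2 → M → ℂ} (hα : ∀ A, SmoothFn (α A) U) :
    SmoothSpinor (ofPair α) U := fun I _ => hα (I 0)

theorem smooth_epsMul {φ : SpinorField M n m} (hφ : SmoothSpinor φ U) :
    SmoothSpinor (epsMul φ) U := fun I X => (SmoothFn.const _).mul (hφ I _)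

theorem covS_tensMul (hU : IsOpen U) (hx : x ∈ U) {α : Fin 2 → M → ℂ}
    (hα : ∀ A, SmoothFn (α A) U) {φ : SpinorField M n m} (hφ : SmoothSpinor φ U) (a : Fin 4)
    (A : Fin 2) (I : Fin n → Fin 2) (X : Fin m → Fin 2) :
    covS g E a (tensMul α φ) (Matrix.vecCons A I) X x
      = covS g E a (ofPair α) ![A] ![] x * φ I X x + α A x * covS g E a φ I X x := by
  have hD : D E a (tensMul α φ (Matrix.vecCons A I) X) x
      = α A x * D E a (φ I X) x + D E a (α A) x * φ I X x := D_mul hU hx a (hα A) (hφ I X)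
  have h1 : D E a (ofPair α ![A] ![]) x = D E a (α A) x := rfl
  rw [covS_eq, covS_eq, covS_eq, hD, act_vecCons, act_one, act_nil, h1]
  have e : ∀ B (K : Fin n → Fin 2) (Y : Fin m → Fin 2),
    tensMul α φ (Matrix.vecCons B K) Y x = α B x * φ K Y x := fun _ _ _ => rfl
  have e' : ∀ B, ofPair α ![B] ![] x = α B x := fun _ => rfl
  simp only [e, e', act_mul_left, Fin.sum_univ_two]
  ring

theorem nabla_tensMul (hU : IsOpen U) (hx : x ∈ U) {α : Fin 2 → M → ℂ}
    (hα : ∀ A, SmoothFn (α A) U) {φ : SpinorField M n m} (hφ : SmoothSpinor φ U) (P V A : Fin 2)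
    (I : Fin n → Fin 2) (X : Fin m → Fin 2) :
    nabla g E (tensMul α φ) (Matrix.vecCons P (Matrix.vecCons A I)) (Matrix.vecCons V X) x
      = nabla g E (ofPair α) ![P, A] ![V] x * φ I X x
        + α A x * nabla g E φ (Matrix.vecCons P I) (Matrix.vecCons V X) x := by
  simp only [nabla_cons, covS_tensMul hU hx hα hφ, Fin.sum_univ_four]
  ring

theorem covS_epsMul (hU : IsOpen U) (hx : x ∈ U) {φ : SpinorField M n m}
    (hφ : SmoothSpinor φ U) (a : Fin 4) (Z W : Fin 2) (I : Fin n → Fin 2) (X : Fin m → Fin 2) :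
    covS g E a (epsMul φ) I (Matrix.vecCons Z (Matrix.vecCons W X)) x
      = eps Z W * covS g E a φ I X x := by
  have hD : D E a (epsMul φ I (Matrix.vecCons Z (Matrix.vecCons W X))) x
      = eps Z W * D E a (φ I X) x := D_const_mul hU hx a _ (hφ I X)
  have e : ∀ Z W (K : Fin n → Fin 2) (Y : Fin m → Fin 2),
    epsMul φ K (Matrix.vecCons Z (Matrix.vecCons W Y)) x = eps Z W * φ K Y x := fun _ _ _ _ => rfl
  rw [covS_eq, covS_eq, hD, act_vecCons, act_vecCons]
  have ht := spinConnPrimed_trace g E a x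
  simp only [e, act_mul_left, Fin.sum_univ_two] at ht ⊢
  fin_cases Z <;> fin_cases W <;>
    simp [eps_zero_zero, eps_zero_one, eps_one_zero, eps_one_one] <;> grind

theorem nabla_epsMul (hU : IsOpen U) (hx : x ∈ U) {φ : SpinorField M n m}
    (hφ : SmoothSpinor φ U) (P V Z W : Fin 2) (I : Fin n → Fin 2) (X : Fin m → Fin 2) :
    nabla g E (epsMul φ) (Matrix.vecCons P I)
        (Matrix.vecCons V (Matrix.vecCons Z (Matrix.vecCons W X))) x
      = eps Z W * nabla g E φ (Matrix.vecCons P I) (Matrix.vecCons V X) x := by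
  simp only [nabla_cons, covS_epsMul hU hx hφ, Finset.mul_sum, mul_left_comm]

theorem sum_mul_spinor {P Q : Fin 2 → Fin 2 → ℂ} {r s : Fin 4 → Fin 2 → Fin 2 → ℂ}
    {G : Fin 2 → Fin 2 → Fin 2 → Fin 2 → ℂ} (h : ∀ A X B Y, ∑ c, r c A X * s c B Y = G A X B Y) :
    ∑ c, (∑ A, ∑ X, P A X * r c A X) * (∑ B, ∑ Y, s c B Y * Q B Y)
      = ∑ A, ∑ X, ∑ B, ∑ Y, P A X * Q B Y * G A X B Y := by
  simp only [← h]
  simp only [Fin.sum_univ_two, Fin.sum_univ_four]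
  ring

/-- The inner product of two covectors in terms of their spinor components. -/
theorem sum_mul_eq (u v : Fin 4 → ℂ) : ∑ a, u a * v a = ∑ A, ∑ B, ∑ X, ∑ Y, eps A B * eps X Y *
    ((∑ a, sigmaLow a A X * u a) * ∑ a, sigmaLow a B Y * v a) := by
  have h1 : ∀ u : Fin 4 → ℂ, ∀ c, u c = ∑ A, ∑ X, sigma c A X * ∑ a, sigmaLow a A X * u a := by
    intro u c
    have h2 : ∑ A, ∑ X, sigma c A X * ∑ a, sigmaLow a A X * u a
        = ∑ a, (∑ A, ∑ X, sigma c A X * sigmaLow a A X) * u a := by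
      simp only [Fin.sum_univ_two, Fin.sum_univ_four]; ring
    rw [h2]
    simp only [sum_sigma_mul_sigmaLow]
    simp
  have h3 : ∀ B Y, ∑ a, sigmaLow a B Y * v a
      = ∑ A, ∑ X, eps A B * eps X Y * ∑ a, sigma a A X * v a := by
    intro B Y
    simp only [sigmaLow, Fin.sum_univ_two, Fin.sum_univ_four]; ring
  have h4 : ∑ a, u a * v a = ∑ A, ∑ X, (∑ a, sigmaLow a A X * u a) * ∑ a, sigma a A X * v a := by
    have h5 : ∑ a, u a * v a = ∑ a, (∑ A, ∑ X, sigma a A X * ∑ b, sigmaLow b A X * u b) * v a :=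
      Finset.sum_congr rfl fun a _ => by rw [← h1 u a]
    rw [h5]
    generalize (fun A X => ∑ b, sigmaLow b A X * u b) = w
    simp only [Fin.sum_univ_two, Fin.sum_univ_four]; ring
  rw [h4]
  simp only [h3]
  generalize (fun A X => ∑ a, sigmaLow a A X * u a) = w
  simp only [Fin.sum_univ_two, eps_zero_zero, eps_zero_one, eps_one_zero, eps_one_one]
  ring

theorem toSpinor_trace {n : ℕ} (T : (Fin (n + 2) → Fin 4) → ℂ) (I X : Fin n → Fin 2) :
    toSpinor (fun J => ∑ c, T (Matrix.vecCons c (Matrix.vecCons c J))) I X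
      = ∑ A, ∑ B, ∑ V, ∑ Y, eps A B * eps V Y *
        toSpinor T (Matrix.vecCons A (Matrix.vecCons B I))
          (Matrix.vecCons V (Matrix.vecCons Y X)) := by
  rw [toSpinor_sum]
  simp only [toSpinor_vecCons]
  have h : ∀ F : Fin 4 → Fin 4 → ℂ, ∑ c, F c c = ∑ A, ∑ B, ∑ V, ∑ Y, eps A B * eps V Y *
      ∑ a, sigmaLow a A V * ∑ b, sigmaLow b B Y * F a b := by
    intro F
    have h1 : ∑ c, F c c = ∑ d, ∑ c, (if c = d then 1 else 0) * F c d := by simp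
    rw [h1]
    simp only [sum_mul_eq (fun c => if c = _ then (1 : ℂ) else 0)]
    simp only [mul_ite, mul_one, mul_zero, Finset.sum_ite_eq', Finset.mem_univ, if_true]
    simp only [Fin.sum_univ_two, eps_zero_zero, eps_zero_one, eps_one_zero, eps_one_one,
      Fin.sum_univ_four]
    ring
  exact h fun a b => toSpinor (fun J => T (Matrix.vecCons a (Matrix.vecCons b J))) I X

end Products

/-! ### Principal spinors of the complex structure -/

section PrincipalSpinors

open VectorField

variable {M : Type*} [TopologicalSpace M] [ChartedSpace R4 M] [IsManifold (𝓡 4) ∞ M]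
  {U : Set M} {x : M} {g : Metric M} {E : Frame M} {J : EndField M} {α β : Fin 2 → M → ℂ} {n : ℂ}

/-- An integrable complex structure with principal spinors `α_A`, `β_A`, where `α_A β^A = n` is `1`
or `-1`. -/
structure IsPrincipalPair (g : Metric M) (E : Frame M) (U : Set M) (J : EndField M)
    (α β : Fin 2 → M → ℂ) (n : ℂ) : Prop where
  smooth_left : ∀ A, SmoothFn (α A) U
  smooth_right : ∀ A, SmoothFn (β A) U
  sq : n * n = 1
  normalised : ∀ x ∈ U, α 0 x * β 1 x - α 1 x * β 0 x = n
  principal : ∀ x ∈ U, ∀ a b, comp g E J ![a, b] x = ∑ A, ∑ B, ∑ X, sigmaLow a A X *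
      (Complex.I * (raise α A x * β B x + raise β A x * α B x)) * sigma b B X
  integrable : ∀ x ∈ U, ∀ a b,
    mlieBracket (𝓡 4) (fun y => J y (E a y)) (fun y => J y (E b y)) x
      - J x (mlieBracket (𝓡 4) (fun y => J y (E a y)) (E b) x)
      - J x (mlieBracket (𝓡 4) (E a) (fun y => J y (E b y)) x)
      - mlieBracket (𝓡 4) (E a) (E b) x = 0

theorem raise_zero (o : Fin 2 → M → ℂ) (x : M) : raise o 0 x = o 1 x := by
  simp [raise, eps_zero_zero, eps_zero_one]

theorem raise_one (o : Fin 2 → M → ℂ) (x : M) : raise o 1 x = -o 0 x := by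
  simp [raise, eps_one_zero, eps_one_one]

theorem IsIntegrableComplexStructure.isPrincipalPair
    (hJ : IsIntegrableComplexStructure g E U J α β) : IsPrincipalPair g E U J α β 1 where
  smooth_left := hJ.smooth_o
  smooth_right := hJ.smooth_iota
  sq := one_mul 1
  normalised x hx := by
    have := hJ.normalised x hx
    simp only [Fin.sum_univ_two, raise_zero, raise_one] at this
    linear_combination this
  principal := hJ.principal
  integrable := hJ.integrable

/-- The form of `J` is symmetric in the two spinors, and only the sign of the normalisation changes.
Statements proved for the left spinor thus apply to both `o` and `ι`. -/
theorem IsPrincipalPair.swap (h : IsPrincipalPair g E U J α β n) :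
    IsPrincipalPair g E U J β α (-n) where
  smooth_left := h.smooth_right
  smooth_right := h.smooth_left
  sq := by rw [neg_mul_neg, h.sq]
  normalised x hx := by linear_combination -(h.normalised x hx)
  principal x hx a b := by
    rw [h.principal x hx]
    refine Finset.sum_congr rfl fun A _ => Finset.sum_congr rfl fun B _ =>
      Finset.sum_congr rfl fun X _ => ?_
    ring
  integrable := h.integrable

theorem IsPrincipalPair.smooth_comp (h : IsPrincipalPair g E U J α β n) (a b : Fin 4) :
    SmoothFn (comp g E J ![a, b]) U := by
  have h1 := h.smooth_left
  have h2 := h.smooth_right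
  refine SmoothFn.congr ?_ fun y hy => h.principal y hy a b
  unfold raise
  fun_prop

theorem IsPrincipalPair.comp_eq (h : IsPrincipalPair g E U J α β n) (hx : x ∈ U) (a b : Fin 4) :
    comp g E J ![a, b] x = ∑ A, ∑ X, (∑ B, (Complex.I * (raise α A x * β B x + raise β A x * α B x)) *
      sigma b B X) * sigmaLow a A X := by
  rw [h.principal x hx]
  simp only [Fin.sum_univ_two]
  ring

theorem IsPrincipalPair.comp_eq' (h : IsPrincipalPair g E U J α β n) (hx : x ∈ U) (a b : Fin 4) :
    comp g E J ![a, b] x = ∑ B, ∑ X, (∑ A, sigmaLow a A X *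
      (Complex.I * (raise α A x * β B x + raise β A x * α B x))) * sigma b B X := by
  rw [h.principal x hx]
  simp only [Fin.sum_univ_two]
  ring

theorem sum_sigma_mul_sigmaLow' (A X B Y : Fin 2) : ∑ c, sigma c A X * sigmaLow c B Y
    = if A = B ∧ X = Y then 1 else 0 := by
  have := sum_sigmaLow_mul_sigma B Y A X
  simp only [mul_comm (sigma _ _ _), this]
  fin_cases A <;> fin_cases B <;> fin_cases X <;> fin_cases Y <;> simp

theorem IsPrincipalPair.sum_comp_mul_sigmaLow (h : IsPrincipalPair g E U J α β n) (hx : x ∈ U)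
    (a : Fin 4) (Q : Fin 2 → Fin 2 → ℂ) :
    ∑ c, comp g E J ![a, c] x * (∑ B, ∑ Y, sigmaLow c B Y * Q B Y)
      = ∑ A, ∑ X, sigmaLow a A X * ∑ B,
        (Complex.I * (raise α A x * β B x + raise β A x * α B x)) * Q B X := by
  simp only [h.comp_eq' hx a]
  rw [sum_mul_spinor sum_sigma_mul_sigmaLow']
  simp only [Fin.sum_univ_two]
  simp
  ring

theorem IsPrincipalPair.sum_comp_mul_comp (h : IsPrincipalPair g E U J α β n) (hx : x ∈ U)
    (a b : Fin 4) : ∑ c, comp g E J ![a, c] x * comp g E J ![c, b] x = -if a = b then 1 else 0 := by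
  have h1 : ∀ c, comp g E J ![c, b] x = ∑ B, ∑ Y, sigmaLow c B Y * ∑ D,
      (Complex.I * (raise α B x * β D x + raise β B x * α D x)) * sigma b D Y := by
    intro c
    rw [h.comp_eq hx]
    exact Finset.sum_congr rfl fun _ _ => Finset.sum_congr rfl fun _ _ => mul_comm _ _
  simp only [h1, h.sum_comp_mul_sigmaLow hx]
  have h2 := sum_sigma_mul_sigmaLow b a
  have h3 := h.normalised x hx
  have h4 := h.sq
  simp only [eq_comm (a := a)]
  rw [← h2]
  simp only [Fin.sum_univ_two, raise_zero, raise_one]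
  have hI := Complex.I_sq
  have hn : (α 0 x * β 1 x - α 1 x * β 0 x) * (α 0 x * β 1 x - α 1 x * β 0 x) = 1 := by rw [h3, h4]
  set p := α 0 x
  set q := α 1 x
  set r := β 0 x
  set s := β 1 x
  linear_combination (norm := skip) (sigmaLow a 0 0 * sigma b 0 0 + sigmaLow a 0 1 * sigma b 0 1 + sigmaLow a 1 0 * sigma b 1 0
    + sigmaLow a 1 1 * sigma b 1 1) * ((p * s - q * r) * (p * s - q * r) * hI - hn)
  ring

/-- The vectors `α^A κ^{A'}` form an eigenspace of `J`, since `J` acts on the unprimed index alone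
and `α^A α_A = 0`. -/
theorem IsPrincipalPair.sum_comp_eigen (h : IsPrincipalPair g E U J α β n) (hx : x ∈ U)
    (c : Fin 4) (V : Fin 2) : ∑ b, comp g E J ![c, b] x * ∑ A, sigmaLow b A V * raise α A x
      = -(Complex.I * n) * ∑ A, sigmaLow c A V * raise α A x := by
  have h1 : ∀ b, ∑ A, sigmaLow b A V * raise α A x
      = ∑ A, ∑ Y, sigmaLow b A Y * (if Y = V then raise α A x else 0) := by
    intro b; simp
  have h3 := h.normalised x hx
  rw [← h3]
  simp only [h1 _, h.sum_comp_mul_sigmaLow hx]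
  fin_cases V <;> simp [Fin.sum_univ_two, raise_zero, raise_one] <;> ring

theorem IsPrincipalPair.sum_eigen_comp (h : IsPrincipalPair g E U J α β n) (hx : x ∈ U)
    (c : Fin 4) (V : Fin 2) : ∑ b, (∑ A, sigmaLow b A V * raise α A x) * comp g E J ![b, c] x
      = (Complex.I * n) * ∑ A, sigmaLow c A V * raise α A x := by
  have h1 : ∀ b, ∑ A, sigmaLow b A V * raise α A x
      = ∑ A, ∑ Y, sigmaLow b A Y * (if Y = V then raise α A x else 0) := by
    intro b; simp
  have h3 := h.normalised x hx
  rw [← h3]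
  simp only [h1 _, h.comp_eq hx, mul_comm (∑ A, ∑ Y, sigmaLow _ A Y * _)]
  rw [sum_mul_spinor sum_sigmaLow_mul_sigmaLow]
  fin_cases V <;> simp [Fin.sum_univ_two, raise_zero, raise_one, eps_zero_zero, eps_zero_one,
    eps_one_zero, eps_one_one, sigmaLow] <;> ring

end PrincipalSpinors

/-! ### Integrability in terms of the principal spinors -/

section Integrability

variable {M : Type*} [TopologicalSpace M] [ChartedSpace R4 M] [IsManifold (𝓡 4) ∞ M]
  {U : Set M} {x : M} {g : Metric M} {E : Frame M} {J : EndField M} {α β : Fin 2 → M → ℂ} {n : ℂ}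

/-- On these eigenvectors the four terms of the Nijenhuis tensor agree in pairs instead of
cancelling, and leave `-2c` times the difference of the two sides. -/
theorem nijenhuis_contraction {j : Fin 4 → Fin 4 → ℂ} {T : Fin 4 → Fin 4 → Fin 4 → ℂ}
    {u v w : Fin 4 → ℂ} {c : ℂ} (hu : ∀ d, ∑ b, j d b * u b = -c * u d)
    (hv : ∀ d, ∑ b, j d b * v b = -c * v d) (hw : ∀ d, ∑ b, w b * j b d = c * w d)
    (h : ∀ a b f, ∑ d, (j d a * T d f b - j d b * T d f a - j f d * T a d b + j f d * T b d a) = 0)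
    (hc : c ≠ 0) :
    ∑ a, u a * ∑ f, w f * ∑ b, v b * T a f b = ∑ a, v a * ∑ f, w f * ∑ b, u b * T a f b := by
  have h1 : ∀ b f, -c * ∑ d, u d * T d f b - ∑ d, j d b * ∑ a, u a * T d f a
      - ∑ d, j f d * ∑ a, u a * T a d b + ∑ d, j f d * ∑ a, u a * T b d a = 0 := by
    intro b f
    have e : -c * ∑ d, u d * T d f b = ∑ d, (∑ a, j d a * u a) * T d f b := by
      simp only [hu, Finset.mul_sum, mul_assoc]
    have h0 : ∑ a, u a * (∑ d, (j d a * T d f b - j d b * T d f a - j f d * T a d b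
        + j f d * T b d a)) = 0 := by simp [h]
    rw [e, ← h0]
    simp only [Fin.sum_univ_four]
    ring
  have h2 : ∀ f, -c * ∑ b, v b * ∑ d, u d * T d f b + c * ∑ d, v d * ∑ a, u a * T d f a
      - ∑ d, j f d * ∑ b, v b * ∑ a, u a * T a d b + ∑ d, j f d * ∑ b, v b * ∑ a, u a * T b d a
      = 0 := by
    intro f
    have e : c * ∑ d, v d * ∑ a, u a * T d f a
        = -∑ d, (∑ b, j d b * v b) * ∑ a, u a * T d f a := by
      simp only [hv, Finset.mul_sum, ← Finset.sum_neg_distrib]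
      exact Finset.sum_congr rfl fun _ _ => Finset.sum_congr rfl fun _ _ => by ring
    have h0 : ∑ b, v b * (-c * ∑ d, u d * T d f b - ∑ d, j d b * ∑ a, u a * T d f a
        - ∑ d, j f d * ∑ a, u a * T a d b + ∑ d, j f d * ∑ a, u a * T b d a) = 0 :=
      Finset.sum_eq_zero fun b _ => mul_eq_zero_of_right _ (h1 b f)
    rw [e, ← h0]
    generalize (fun d f a => ∑ b, u b * T d f b) = S1
    simp only [Fin.sum_univ_four]
    ring
  set A : Fin 4 → ℂ := fun f => ∑ b, v b * ∑ a, u a * T a f b with hA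
  set B : Fin 4 → ℂ := fun f => ∑ b, v b * ∑ a, u a * T b f a with hB
  have h3 : -c * ∑ f, w f * A f + c * ∑ f, w f * B f = 0 := by
    have h0 : ∑ f, w f * (-c * A f + c * B f - ∑ d, j f d * A d + ∑ d, j f d * B d) = 0 :=
      Finset.sum_eq_zero fun f _ => mul_eq_zero_of_right _ (h2 f)
    have e : ∀ X : Fin 4 → ℂ, ∑ f, w f * ∑ d, j f d * X d = c * ∑ f, w f * X f := by
      intro X
      have : c * ∑ f, w f * X f = ∑ d, (∑ f, w f * j f d) * X d := by
        simp only [hw, Finset.mul_sum, mul_assoc]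
      rw [this]
      simp only [Fin.sum_univ_four]
      ring
    simp only [mul_add, mul_sub, Finset.sum_add_distrib, Finset.sum_sub_distrib, e] at h0
    have e2 : ∀ X : Fin 4 → ℂ, ∀ z, ∑ f, w f * (z * X f) = z * ∑ f, w f * X f := by
      intro X z
      rw [Finset.mul_sum]
      exact Finset.sum_congr rfl fun _ _ => by ring
    simp only [e2] at h0
    linear_combination (1 / 2) * h0
  have h4 : ∑ f, w f * A f = ∑ f, w f * B f := by
    have : c * (∑ f, w f * A f - ∑ f, w f * B f) = 0 := by linear_combination -h3
    exact sub_eq_zero.1 ((mul_eq_zero.1 this).resolve_left hc)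
  have e1 : ∑ a, u a * ∑ f, w f * ∑ b, v b * T a f b = ∑ f, w f * A f := by
    simp only [hA, Fin.sum_univ_four]; ring
  have e2 : ∑ a, v a * ∑ f, w f * ∑ b, u b * T a f b = ∑ f, w f * B f := by
    simp only [hB, Fin.sum_univ_four]; ring
  rw [e1, e2, h4]

theorem toSpinor_three (T : (Fin 3 → Fin 4) → ℂ) (A B C V Y Z : Fin 2) :
    toSpinor T ![A, B, C] ![V, Y, Z] = ∑ a, sigmaLow a A V * ∑ b, sigmaLow b B Y *
      ∑ c, sigmaLow c C Z * T ![a, b, c] := by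
  rw [toSpinor_vecCons]
  refine Finset.sum_congr rfl fun a _ => ?_
  rw [toSpinor_two]
  congr 1
  refine Finset.sum_congr rfl fun b _ => ?_
  rw [Finset.mul_sum]
  exact Finset.sum_congr rfl fun c _ => by rw [mul_assoc]

theorem IsPrincipalPair.spinorOf_comp (h : IsPrincipalPair g E U J α β n) (hx : x ∈ U)
    (A B V Y : Fin 2) : spinorOf (comp g E J) ![A, B] ![V, Y] x
      = -Complex.I * (eps V Y * (α A x * β B x + β A x * α B x)) := by
  have h1 : ∀ a, ∑ b, sigmaLow b B Y * comp g E J ![a, b] x = ∑ C, sigmaLow a C Y *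
      (Complex.I * (raise α C x * β B x + raise β C x * α B x)) := by
    intro a
    have e : ∀ b, sigmaLow b B Y = ∑ C, ∑ Z, sigmaLow b C Z * if C = B ∧ Z = Y then 1 else 0 := by
      intro b
      fin_cases B <;> fin_cases Y <;> simp
    simp only [mul_comm (sigmaLow _ B Y) (comp _ _ _ _ _)]
    simp only [e, h.sum_comp_mul_sigmaLow hx]
    fin_cases B <;> fin_cases Y <;> simp [Fin.sum_univ_two]
  rw [spinorOf, toSpinor_two]
  simp only [mul_assoc, ← Finset.mul_sum]
  simp only [h1]
  have e2 : ∀ u v : ℂ, ∑ a, sigmaLow a A V * (sigmaLow a 0 Y * u + sigmaLow a 1 Y * v)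
      = eps A 0 * eps V Y * u + eps A 1 * eps V Y * v := by
    intro u v
    simp only [← sum_sigmaLow_mul_sigmaLow, Fin.sum_univ_four]
    ring
  simp only [Fin.sum_univ_two, e2, raise_zero, raise_one]
  fin_cases A <;> simp [eps_zero_zero, eps_zero_one, eps_one_zero, eps_one_one] <;> ring

theorem IsPrincipalPair.spinorOf_nabla_comp (h : IsPrincipalPair g E U J α β n) (hU : IsOpen U)
    (hx : x ∈ U) (P A B W V Y : Fin 2) :
    spinorOf (nablaT g E (comp g E J)) ![P, A, B] ![W, V, Y] x = -Complex.I * (eps V Y *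
      (nabla g E (ofPair α) ![P, A] ![W] x * β B x + α A x * nabla g E (ofPair β) ![P, B] ![W] x
        + (nabla g E (ofPair β) ![P, A] ![W] x * α B x
          + β A x * nabla g E (ofPair α) ![P, B] ![W] x))) := by
  have sα := smooth_ofPair h.smooth_left
  have sβ := smooth_ofPair h.smooth_right
  have t1 := smooth_tensMul h.smooth_left sβ
  have t2 := smooth_tensMul h.smooth_right sα
  have e : ∀ y ∈ U, ∀ I X, spinorOf (comp g E J) I X y = -Complex.I * epsMul (fun I X y =>
      tensMul α (ofPair β) I X y + tensMul β (ofPair α) I X y) I X y := by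
    intro y hy I X
    have hI : I = ![I 0, I 1] := by funext j; fin_cases j <;> rfl
    have hX : X = ![X 0, X 1] := by funext j; fin_cases j <;> rfl
    rw [hI, hX, h.spinorOf_comp hy]
    rfl
  have sJ : ∀ K, SmoothFn (comp g E J K) U := by
    intro K
    have hK : K = ![K 0, K 1] := by funext j; fin_cases j <;> rfl
    rw [hK]
    exact h.smooth_comp _ _
  have s12 : SmoothSpinor (fun I X y => tensMul α (ofPair β) I X y
      + tensMul β (ofPair α) I X y : SpinorField M 2 0) U := fun I X => (t1 I X).add (t2 I X)
  rw [← nabla_spinorOf hU hx sJ, nabla_congr hU hx e, nabla_const_mul hU hx (smooth_epsMul s12),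
    nabla_epsMul hU hx s12, nabla_add hU hx t1 t2, nabla_tensMul hU hx h.smooth_left sβ,
    nabla_tensMul hU hx h.smooth_right sα]
  rfl

/-- Contracting `∇J` with three vectors built from `α^A` leaves a nonzero multiple of `ε_{W'Y'}
κ_{V'}`, where `κ` is the expression in question. Integrability makes this symmetric in `V'` and
`Y'`, which forces `κ = 0`: the principal spinors are geodesic and shear-free. -/
theorem IsPrincipalPair.nabla_left (h : IsPrincipalPair g E U J α β n)
    (hE : IsOrthonormalFrame g E U) (hU : IsOpen U) (hx : x ∈ U) (V : Fin 2) :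
    ∑ A, ∑ B, raise α A x * raise α B x * nabla g E (ofPair α) ![A, B] ![V] x = 0 := by
  have hn : Complex.I * n ≠ 0 := by
    have := h.sq
    refine mul_ne_zero Complex.I_ne_zero fun h0 => ?_
    simp [h0] at this
  have hj : ∀ a b, SmoothFn (comp g E J ![a, b]) U := h.smooth_comp
  have key := fun V Y W => nijenhuis_contraction (j := fun a b => comp g E J ![a, b] x)
    (T := fun a b c => nablaT g E (comp g E J) ![a, b, c] x)
    (u := fun b => ∑ A, sigmaLow b A V * raise α A x) (v := fun b => ∑ A, sigmaLow b A Y * raise α A x)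
    (w := fun b => ∑ A, sigmaLow b A W * raise α A x)
    (fun d => h.sum_comp_eigen hx d V) (fun d => h.sum_comp_eigen hx d Y)
    (fun d => h.sum_eigen_comp hx d W)
    (fun a b f => hE.nablaT_comp hU hx hj (h.sum_comp_mul_comp hx) (h.integrable x hx) a b f) hn
  have ht : ∀ V W Y, ∑ a, (∑ A, sigmaLow a A V * raise α A x) * ∑ f,
      (∑ A, sigmaLow f A W * raise α A x) * ∑ b, (∑ A, sigmaLow b A Y * raise α A x) *
      nablaT g E (comp g E J) ![a, f, b] x = ∑ A, ∑ B, ∑ C, raise α A x * raise α B x * raise α C x *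
      spinorOf (nablaT g E (comp g E J)) ![A, B, C] ![V, W, Y] x := by
    intro V W Y
    simp only [spinorOf, toSpinor_three]
    have e : ∀ (F : Fin 4 → ℂ) (Z : Fin 2), ∑ a, (∑ A, sigmaLow a A Z * raise α A x) * F a
        = ∑ A, raise α A x * ∑ a, sigmaLow a A Z * F a := by
      intro F Z
      simp only [Fin.sum_univ_two, Fin.sum_univ_four]
      ring
    simp only [e]
    simp only [Fin.sum_univ_two, Fin.sum_univ_four]
    ring
  simp only [ht] at key
  simp only [h.spinorOf_nabla_comp hU hx, raise_zero, raise_one, Fin.sum_univ_two] at key ⊢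
  have h3 := h.normalised x hx
  -- For these primed indices one side of the symmetry has `ε_{00}` or `ε_{11}` as a factor, so each
  -- equation isolates one component of `κ`.
  have k0 := key 0 1 0
  have k1 := key 0 1 1

  simp only [eps_zero_zero, eps_zero_one, eps_one_zero, eps_one_one] at k0 k1
  refine (mul_eq_zero_iff_left hn).1 ?_
  rw [← h3]
  revert V
  rw [Fin.forall_fin_two]
  constructor
  · linear_combination (1 / 2) * k0
  · linear_combination (1 / 2) * k1

end Integrability

/-! ### Connection coefficients of the principal spinors -/

section GHP

variable {M : Type*} [TopologicalSpace M] [ChartedSpace R4 M] [IsManifold (𝓡 4) ∞ M]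
  {U : Set M} {x : M} {g : Metric M} {E : Frame M} {J : EndField M} {α β o ι : Fin 2 → M → ℂ} {n : ℂ}

theorem IsPrincipalPair.nabla_normalised (h : IsPrincipalPair g E U J α β n) (hU : IsOpen U)
    (hx : x ∈ U) (A X : Fin 2) :
    nabla g E (ofPair α) ![A, 0] ![X] x * β 1 x + α 0 x * nabla g E (ofPair β) ![A, 1] ![X] x
      - (nabla g E (ofPair α) ![A, 1] ![X] x * β 0 x
        + α 1 x * nabla g E (ofPair β) ![A, 0] ![X] x) = 0 := by
  have sβ := smooth_ofPair h.smooth_right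
  have t1 := smooth_tensMul h.smooth_left sβ
  have h0 : nabla g E (contr (tensMul α (ofPair β))) ![A] ![X] x = 0 := by
    have e : ∀ y ∈ U, ∀ I X, contr (tensMul α (ofPair β)) I X y = -n := by
      intro y hy I X
      rw [← h.normalised y hy]
      simp [contr, tensMul, ofPair, eps_zero_zero, eps_zero_one, eps_one_zero, eps_one_one,
        Fin.tail]
      ring
    rw [nabla_congr hU hx (ψ := fun _ _ _ => -n) e, nabla_cons]
    simp only [covS_eq, act_nil, D_const]
    simp
  rw [nabla_contr hU hx t1] at h0
  simp only [nabla_tensMul hU hx h.smooth_left sβ] at h0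
  simp only [Fin.sum_univ_two, eps_zero_zero, eps_zero_one, eps_one_zero, eps_one_one] at h0
  have e : ∀ A, ofPair β ![A] ![] x = β A x := fun _ => rfl
  simp only [e] at h0
  linear_combination -h0

/-- Expand the derivatives in the basis `o_B, ι_B`. The shear-free conditions make the `ι_B` part of
`∇o` proportional to `o_A` and the `o_B` part of `∇ι` proportional to `ι_A`; the differentiated
normalisation gives the diagonal parts opposite coefficients. -/
theorem exists_ghp_coefficients {o ι : Fin 2 → ℂ} {a b : Fin 2 → Fin 2 → ℂ}
    (hn : o 0 * ι 1 - o 1 * ι 0 = 1)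
    (hd : ∀ A, a A 0 * ι 1 + o 0 * b A 1 - (a A 1 * ι 0 + o 1 * b A 0) = 0)
    (ho : o 1 * o 1 * a 0 0 - o 1 * o 0 * a 0 1 - o 0 * o 1 * a 1 0 + o 0 * o 0 * a 1 1 = 0)
    (hι : ι 1 * ι 1 * b 0 0 - ι 1 * ι 0 * b 0 1 - ι 0 * ι 1 * b 1 0 + ι 0 * ι 0 * b 1 1 = 0) :
    ∃ (w : Fin 2 → ℂ) (u v : ℂ), (∀ A B, a A B = -w A * o B + u * o A * ι B) ∧
      ∀ A B, b A B = w A * ι B + v * ι A * o B := by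
  -- The witnesses are the contractions of the derivatives with `o` and `ι` that isolate the
  -- coefficients under the normalisation `hn`.
  refine ⟨fun A => a A 1 * ι 0 - a A 0 * ι 1,
    (o 0 * a 0 1 - o 1 * a 0 0) * ι 1 - (o 0 * a 1 1 - o 1 * a 1 0) * ι 0,
    -((b 0 0 * ι 1 - b 0 1 * ι 0) * o 1 - (b 1 0 * ι 1 - b 1 1 * ι 0) * o 0), ?_, ?_⟩
  · intro A B
    fin_cases A <;> fin_cases B <;> simp only [Fin.zero_eta, Fin.mk_one] <;> grind
  · intro A B
    have h0 := hd 0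
    have h1 := hd 1
    fin_cases A <;> fin_cases B <;> simp only [Fin.zero_eta, Fin.mk_one] <;> grind

/-- The spinor components of the Lee form. -/
noncomputable def leeSpinor (g : Metric M) (E : Frame M) (J : EndField M) : SpinorField M 1 1 :=
  spinorOf (fun I => leeForm g E J (I 0))

/-- The spinor components of the form `P`. -/
noncomputable def pSpinor (g : Metric M) (E : Frame M) (J : EndField M) (o ι : Fin 2 → M → ℂ) :
    SpinorField M 1 1 := spinorOf (fun I => pForm g E J o ι (I 0))

theorem toSpinor_one (T : (Fin 1 → Fin 4) → ℂ) (A V : Fin 2) :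
    toSpinor T ![A] ![V] = ∑ a, sigmaLow a A V * T ![a] := by
  rw [toSpinor_vecCons]
  refine Finset.sum_congr rfl fun a _ => ?_
  simp [toSpinor]
  exact Or.inl rfl

theorem sum_sum_mul_eq (u v : Fin 4 → Fin 4 → ℂ) : ∑ a, ∑ b, u a b * v a b
    = ∑ A, ∑ B, ∑ X, ∑ Y, eps A B * eps X Y * ∑ C, ∑ D, ∑ V, ∑ Z, eps C D * eps V Z *
      ((∑ a, ∑ b, sigmaLow a A X * sigmaLow b C V * u a b)
        * ∑ a, ∑ b, sigmaLow a B Y * sigmaLow b D Z * v a b) := by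
  have e0 : ∀ (w : Fin 4 → Fin 4 → ℂ) A X C V, ∑ a, ∑ b, sigmaLow a A X * sigmaLow b C V * w a b
      = ∑ a, sigmaLow a A X * ∑ b, sigmaLow b C V * w a b := by
    intro w A X C V
    simp only [Finset.mul_sum, mul_assoc]
  simp only [e0]
  have h1 : ∀ a, ∑ b, u a b * v a b = ∑ C, ∑ D, ∑ V, ∑ Z, eps C D * eps V Z *
      ((∑ b, sigmaLow b C V * u a b) * ∑ b, sigmaLow b D Z * v a b) := fun a =>
    sum_mul_eq (u a) (v a)
  have h2 := fun C V D Z => sum_mul_eq (fun a => ∑ b, sigmaLow b C V * u a b)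
    (fun a => ∑ b, sigmaLow b D Z * v a b)
  simp only [h1]
  have h3 : ∀ F : Fin 2 → Fin 2 → Fin 2 → Fin 2 → Fin 4 → ℂ,
      ∑ a, ∑ C, ∑ D, ∑ V, ∑ Z, eps C D * eps V Z * F C D V Z a
      = ∑ C, ∑ D, ∑ V, ∑ Z, eps C D * eps V Z * ∑ a, F C D V Z a := by
    intro F
    simp only [Fin.sum_univ_two, Fin.sum_univ_four, eps_zero_zero, eps_zero_one, eps_one_zero,
      eps_one_one]
    ring
  rw [h3]
  simp only [h2]
  simp only [Fin.sum_univ_two, eps_zero_zero, eps_zero_one, eps_one_zero, eps_one_one, zero_mul,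
    mul_zero, zero_add, add_zero]
  ring

theorem leeSpinor_eq (D Y : Fin 2) : leeSpinor g E J ![D] ![Y] x
      = -(1 / 2) * ∑ A, ∑ B, ∑ X, ∑ Z, eps A B * eps X Z * ∑ C, ∑ F, ∑ V, ∑ W, eps C F * eps V W *
        (spinorOf (comp g E J) ![A, C] ![X, V] x
          * spinorOf (nablaT g E (comp g E J)) ![B, F, D] ![Z, W, Y] x) := by
  simp only [leeSpinor, spinorOf, toSpinor_one, leeForm, toSpinor_two]
  have e : ∀ B F Z W, toSpinor (fun J' => nablaT g E (comp g E J) J' x) ![B, F, D] ![Z, W, Y]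
      = ∑ a, ∑ b, sigmaLow a B Z * sigmaLow b F W *
        ∑ c, sigmaLow c D Y * nablaT g E (comp g E J) ![a, b, c] x := by
    intro B F Z W
    rw [toSpinor_three]
    exact Finset.sum_congr rfl fun a _ => by
      rw [Finset.mul_sum]
      exact Finset.sum_congr rfl fun b _ => by ring
  simp only [e]
  rw [← sum_sum_mul_eq (fun a b => comp g E J ![a, b] x)
    (fun a b => ∑ c, sigmaLow c D Y * nablaT g E (comp g E J) ![a, b, c] x)]
  simp only [Matrix.cons_val_zero, Finset.mul_sum]
  rw [Finset.sum_comm]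
  refine Finset.sum_congr rfl fun b _ => ?_
  rw [Finset.sum_comm]
  exact Finset.sum_congr rfl fun _ _ => Finset.sum_congr rfl fun _ _ => by ring

end GHP

/-! ### Derivatives of `o` and `ι` through `f` and `P` -/

section GHPFormulas

variable {M : Type*} [TopologicalSpace M] [ChartedSpace R4 M] [IsManifold (𝓡 4) ∞ M]
  {U : Set M} {x : M} {g : Metric M} {E : Frame M} {J : EndField M} {o ι : Fin 2 → M → ℂ}

theorem ghp_sum (A X : Fin 2) : ∑ a, sigmaLow a A X * ghpForm g E o ι a x
    = ι 0 x * nabla g E (ofPair o) ![A, 1] ![X] x - ι 1 x * nabla g E (ofPair o) ![A, 0] ![X] x := by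
  simp only [nabla_cons, ghpForm, Fin.sum_univ_two, Fin.sum_univ_four, eps_zero_zero, eps_zero_one,
    eps_one_zero, eps_one_one]
  ring

theorem pSpinor_eq (A X : Fin 2) : pSpinor g E J o ι ![A] ![X] x
    = ι 0 x * nabla g E (ofPair o) ![A, 1] ![X] x - ι 1 x * nabla g E (ofPair o) ![A, 0] ![X] x
      - (1 / 2) * Complex.I * ∑ B, ∑ C, ∑ V, ∑ Z, eps B C * eps V Z *
        (spinorOf (comp g E J) ![B, A] ![V, X] x * leeSpinor g E J ![C] ![Z] x) := by
  simp only [pSpinor, leeSpinor, spinorOf, toSpinor_one, toSpinor_two, pForm, ← ghp_sum (x := x)]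
  have h := sum_mul_eq (fun b => ∑ a, sigmaLow a A X * comp g E J ![b, a] x)
    (fun b => leeForm g E J b x)
  simp only [Finset.mul_sum, ← mul_assoc] at h
  simp only [Matrix.cons_val_zero, mul_sub, Finset.sum_sub_distrib]
  congr 1
  simp only [← mul_assoc, Finset.mul_sum] at h ⊢
  simp only [← Finset.mul_sum, mul_assoc] at h ⊢
  simp only [Fin.sum_univ_two, Fin.sum_univ_four, eps_zero_zero, eps_zero_one,
    eps_one_zero, eps_one_one] at h ⊢
  linear_combination (1 / 2) * Complex.I * h

theorem IsPrincipalPair.exists_coefficients (h : IsPrincipalPair g E U J o ι 1)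
    (hE : IsOrthonormalFrame g E U) (hU : IsOpen U) (hx : x ∈ U) :
    ∃ (w : Fin 2 → Fin 2 → ℂ) (u v : Fin 2 → ℂ),
      (∀ A B X, nabla g E (ofPair o) ![A, B] ![X] x = -w A X * o B x + u X * o A x * ι B x) ∧
      (∀ A B X, nabla g E (ofPair ι) ![A, B] ![X] x = w A X * ι B x + v X * ι A x * o B x) := by
  have key : ∀ X, ∃ (w : Fin 2 → ℂ) (u v : ℂ),
      (∀ A B, nabla g E (ofPair o) ![A, B] ![X] x = -w A * o B x + u * o A x * ι B x) ∧
      (∀ A B, nabla g E (ofPair ι) ![A, B] ![X] x = w A * ι B x + v * ι A x * o B x) := by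
    intro X
    have ho := h.nabla_left hE hU hx X
    have hi := h.swap.nabla_left hE hU hx X
    simp only [Fin.sum_univ_two, raise_zero, raise_one] at ho hi
    refine exists_ghp_coefficients (o := fun A => o A x) (ι := fun A => ι A x)
      (a := fun A B => nabla g E (ofPair o) ![A, B] ![X] x)
      (b := fun A B => nabla g E (ofPair ι) ![A, B] ![X] x) (h.normalised x hx)
      (fun A => h.nabla_normalised hU hx A X) ?_ ?_
    · linear_combination ho
    · linear_combination hi
  choose w u v h1 h2 using key
  exact ⟨fun A X => w X A, u, v, fun A B X => h1 X A B, fun A B X => h2 X A B⟩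

/-- In terms of the coefficients, `f = u ι + v o` and `P = w + ½ (v o - u ι)`. Both principal
spinors then satisfy one equation, with weight `-1` for `o` and `+1` for `ι` in front of `P`. -/
theorem IsPrincipalPair.nabla_spinors (h : IsPrincipalPair g E U J o ι 1)
    (hE : IsOrthonormalFrame g E U) (hU : IsOpen U) (hx : x ∈ U) (A B X : Fin 2) :
    nabla g E (ofPair o) ![A, B] ![X] x
      = -pSpinor g E J o ι ![A] ![X] x * o B x - (1 / 2) * leeSpinor g E J ![A] ![X] x * o B x
        + leeSpinor g E J ![B] ![X] x * o A x ∧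
    nabla g E (ofPair ι) ![A, B] ![X] x
      = pSpinor g E J o ι ![A] ![X] x * ι B x - (1 / 2) * leeSpinor g E J ![A] ![X] x * ι B x
        + leeSpinor g E J ![B] ![X] x * ι A x := by
  obtain ⟨w, u, v, ho, hi⟩ := h.exists_coefficients hE hU hx
  have hn := h.normalised x hx
  have hn2 : (o 0 x * ι 1 x - o 1 x * ι 0 x) * (o 0 x * ι 1 x - o 1 x * ι 0 x) = 1 := by
    rw [hn, one_mul]
  have hI := Complex.I_mul_I
  have hf : ∀ D Y, leeSpinor g E J ![D] ![Y] x = u Y * ι D x + v Y * o D x := by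
    intro D Y
    rw [leeSpinor_eq]
    -- The right side is multiplied by powers of `o_A ι^A = 1` and by `-i² = 1`, so that the claim
    -- becomes a polynomial identity not using the normalisation.
    have e : u Y * ι D x + v Y * o D x = (o 0 x * ι 1 x - o 1 x * ι 0 x) *
        (o 0 x * ι 1 x - o 1 x * ι 0 x) * (-(Complex.I * Complex.I)) *
        (u Y * ι D x + v Y * o D x) := by rw [hn2, hI]; ring
    rw [e]
    simp only [h.spinorOf_comp hx, h.spinorOf_nabla_comp hU hx, ho, hi]
    fin_cases Y <;> simp [Fin.sum_univ_two, eps_zero_zero, eps_zero_one, eps_one_zero,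
      eps_one_one] <;> ring_nf <;> simp only [Complex.I_sq] <;> ring
  have hp : ∀ A X, pSpinor g E J o ι ![A] ![X] x
      = w A X + (1 / 2) * (v X * o A x - u X * ι A x) := by
    intro A X
    rw [pSpinor_eq]
    have e : w A X + (1 / 2) * (v X * o A x - u X * ι A x) = (o 0 x * ι 1 x - o 1 x * ι 0 x) *
        (w A X + (1 / 2) * (-(Complex.I * Complex.I)) * (v X * o A x - u X * ι A x)) := by
      rw [hn, hI]; ring
    rw [e]
    simp only [h.spinorOf_comp hx, ho, hf]
    fin_cases X <;> simp [Fin.sum_univ_two, eps_zero_zero, eps_zero_one, eps_one_zero,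
      eps_one_one] <;> ring_nf <;> simp only [Complex.I_sq] <;> ring
  rw [ho, hi, hp, hf, hf]
  constructor <;> ring

end GHPFormulas

/-! ### Vanishing anti-self-dual parts of `df` and `dP` -/

section Closure

variable {M : Type*} [TopologicalSpace M] [ChartedSpace R4 M] [IsManifold (𝓡 4) ∞ M]
  {U : Set M} {x : M} {g : Metric M} {E : Frame M} {J : EndField M} {o ι α : Fin 2 → M → ℂ}
  {lam : ℝ} {p f : SpinorField M 1 1} {z : ℂ}

theorem IsPrincipalPair.smooth_leeForm (h : IsPrincipalPair g E U J o ι 1)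
    (hE : IsOrthonormalFrame g E U) (hU : IsOpen U) (a : Fin 4) :
    SmoothFn (leeForm g E J a) U := by
  have h1 := h.smooth_comp
  have sJ : ∀ K, SmoothFn (comp g E J K) U := by
    intro K
    have hK : K = ![K 0, K 1] := by funext j; fin_cases j <;> rfl
    rw [hK]
    exact h.smooth_comp _ _
  have h2 := smooth_nablaT (g := g) hE hU sJ
  unfold leeForm
  fun_prop

theorem IsPrincipalPair.smooth_pForm (h : IsPrincipalPair g E U J o ι 1)
    (hE : IsOrthonormalFrame g E U) (hU : IsOpen U) (a : Fin 4) :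
    SmoothFn (pForm g E J o ι a) U := by
  have h1 := h.smooth_comp
  have h2 := h.smooth_leeForm hE hU
  have h3 := h.smooth_right
  have h4 : ∀ a I X, SmoothFn (covS g E a (ofPair o) I X) U := fun a =>
    (smooth_ofPair h.smooth_left).covS hE hU a
  unfold pForm ghpForm
  fun_prop

theorem IsPrincipalPair.smooth_leeSpinor (h : IsPrincipalPair g E U J o ι 1)
    (hE : IsOrthonormalFrame g E U) (hU : IsOpen U) : SmoothSpinor (leeSpinor g E J) U :=
  smoothSpinor_spinorOf fun _ => h.smooth_leeForm hE hU _

theorem IsPrincipalPair.smooth_pSpinor (h : IsPrincipalPair g E U J o ι 1)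
    (hE : IsOrthonormalFrame g E U) (hU : IsOpen U) : SmoothSpinor (pSpinor g E J o ι) U :=
  smoothSpinor_spinorOf fun _ => h.smooth_pForm hE hU _

/-- Symmetrised multiplication by a nonzero spinor is injective, as multiplication of binary forms
by a nonzero linear form. -/
theorem eq_zero_of_symm_mul {o : Fin 2 → ℂ} {s00 s01 s11 : ℂ} (ho : o 0 ≠ 0 ∨ o 1 ≠ 0)
    (h0 : s00 * o 0 = 0) (h1 : s00 * o 1 + 2 * s01 * o 0 = 0) (h2 : 2 * s01 * o 1 + s11 * o 0 = 0)
    (h3 : s11 * o 1 = 0) : s00 = 0 ∧ s01 = 0 ∧ s11 = 0 := by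
  by_cases h : o 0 = 0
  · have h' := ho.resolve_left (not_not.2 h)
    simp only [h, mul_zero, add_zero, mul_eq_zero, h', or_false] at h1 h2 h3
    exact ⟨h1, h2.resolve_left two_ne_zero, h3⟩
  · have e0 := (mul_eq_zero.1 h0).resolve_right h
    simp only [e0, zero_mul, zero_add, mul_eq_zero, h, or_false] at h1
    have e1 := h1.resolve_left two_ne_zero
    simp only [e1, mul_zero, zero_mul, zero_add, mul_eq_zero, h, or_false] at h2
    exact ⟨e0, e1, h2⟩

/-- The anti-self-dual part of the integrability condition of the equation
`∇_{AX} α_B = z p_{AX} α_B - ½ f_{AX} α_B + f_{BX} α_A`. -/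
theorem asd_closure (hq : IsQuaternionicKahler g E U lam) (hE : IsOrthonormalFrame g E U)
    (hU : IsOpen U) (hx : x ∈ U) (hα : ∀ A, SmoothFn (α A) U) (hp : SmoothSpinor p U)
    (hf : SmoothSpinor f U) (h0 : α 0 x ≠ 0 ∨ α 1 x ≠ 0)
    (h : ∀ y ∈ U, ∀ A B X, nabla g E (ofPair α) ![A, B] ![X] y = z * p ![A] ![X] y * α B y
      - (1 / 2) * f ![A] ![X] y * α B y + f ![B] ![X] y * α A y) (A B : Fin 2) :
    z * ((nabla g E p ![A, B] ![0, 1] x - nabla g E p ![A, B] ![1, 0] x)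
      + (nabla g E p ![B, A] ![0, 1] x - nabla g E p ![B, A] ![1, 0] x))
    + (1 / 2) * ((nabla g E f ![A, B] ![0, 1] x - nabla g E f ![A, B] ![1, 0] x)
      + (nabla g E f ![B, A] ![0, 1] x - nabla g E f ![B, A] ![1, 0] x)) = 0 := by
  have tp := smooth_tensMul hα hp
  have tf := smooth_tensMul hα hf
  have hN : ∀ A B C X Y, nabla g E (nabla g E (ofPair α)) ![A, B, C] ![X, Y] x
      = z * (nabla g E (ofPair α) ![A, C] ![X] x * p ![B] ![Y] x
          + α C x * nabla g E p ![A, B] ![X, Y] x)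
        - (1 / 2) * (nabla g E (ofPair α) ![A, C] ![X] x * f ![B] ![Y] x
          + α C x * nabla g E f ![A, B] ![X, Y] x)
        + (nabla g E (ofPair α) ![A, B] ![X] x * f ![C] ![Y] x
          + α B x * nabla g E f ![A, C] ![X, Y] x) := by
    intro A B C X Y
    have e : ∀ y ∈ U, ∀ I Z, nabla g E (ofPair α) I Z y
        = z * tensMul α p (I ∘ Equiv.swap 0 1) Z y
          + ((-1 / 2) * tensMul α f (I ∘ Equiv.swap 0 1) Z y + tensMul α f I Z y) := by
      intro y hy I Z
      have hI : I = ![I 0, I 1] := by funext j; fin_cases j <;> rfl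
      have hZ : Z = ![Z 0] := by funext j; fin_cases j; rfl
      have hI' : I ∘ Equiv.swap 0 1 = ![I 1, I 0] := by funext j; fin_cases j <;> rfl
      have et : ∀ (φ : SpinorField M 1 1) (A B X : Fin 2), tensMul α φ ![A, B] ![X] y
        = α A y * φ ![B] ![X] y := fun _ _ _ _ => rfl
      rw [hI', hZ, hI, h y hy, et, et, et]
      simp only [Matrix.cons_val_zero, Matrix.cons_val_one]
      ring
    have s1 : SmoothSpinor (fun I Z y => tensMul α p (I ∘ Equiv.swap 0 1) Z y) U :=
      fun I Z => tp _ _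
    have s2 : SmoothSpinor (fun I Z y => tensMul α f (I ∘ Equiv.swap 0 1) Z y) U :=
      fun I Z => tf _ _
    have s3 : SmoothSpinor (fun I Z y => (-1 / 2 : ℂ) * tensMul α f (I ∘ Equiv.swap 0 1) Z y) U :=
      fun I Z => (SmoothFn.const _).mul (s2 _ _)
    rw [nabla_congr hU hx e, nabla_add hU hx
      (φ := fun I Z y => z * tensMul α p (I ∘ Equiv.swap 0 1) Z y)
      (fun I Z => (SmoothFn.const _).mul (s1 _ _)) (fun I Z => (s3 _ _).add (tf _ _)),
      nabla_add hU hx s3 tf, nabla_const_mul hU hx s1, nabla_const_mul hU hx s2,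
      nabla_tensMul hU hx hα hf]
    have e1 : ![B, C] ∘ Equiv.swap (0 : Fin 2) 1 = ![C, B] := by funext j; fin_cases j <;> rfl
    have n1 := nabla_perm (g := g) (E := E) (x := x) (tensMul α p) (Equiv.swap 0 1) 1 A X ![B, C] ![Y]
    have n2 := nabla_perm (g := g) (E := E) (x := x) (tensMul α f) (Equiv.swap 0 1) 1 A X ![B, C] ![Y]
    simp only [Equiv.Perm.coe_one, Function.comp_id, e1] at n1 n2
    rw [n1, n2, nabla_tensMul hU hx hα hp, nabla_tensMul hU hx hα hf]
    ring
  have hc := fun A B C X Y => hE.nabla_comm hU hx (smooth_ofPair hα) A B X Y ![C] ![]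
  simp only [act_one, act_nil, hq.curvS_eq hE hU hx, hN, h x hx] at hc
  have eo : ∀ A, ofPair α ![A] ![] x = α A x := fun _ => rfl
  simp only [eo, Fin.sum_univ_two] at hc
  clear hN h
  set a : Fin 2 → ℂ := fun A => α A x with ha
  have key := fun A B C => congrArg₂ (· - ·) (hc A B C 0 1) (hc A B C 1 0)
  clear hc
  simp only [eps_zero_zero, eps_zero_one, eps_one_zero, eps_one_one] at key
  set s00 : ℂ := z * (2 * (nabla g E p ![0, 0] ![0, 1] x - nabla g E p ![0, 0] ![1, 0] x))
      + (nabla g E f ![0, 0] ![0, 1] x - nabla g E f ![0, 0] ![1, 0] x) with h00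
  set s01 : ℂ := z * ((nabla g E p ![0, 1] ![0, 1] x - nabla g E p ![0, 1] ![1, 0] x)
      + (nabla g E p ![1, 0] ![0, 1] x - nabla g E p ![1, 0] ![1, 0] x))
      + (1 / 2) * ((nabla g E f ![0, 1] ![0, 1] x - nabla g E f ![0, 1] ![1, 0] x)
      + (nabla g E f ![1, 0] ![0, 1] x - nabla g E f ![1, 0] ![1, 0] x)) with h01
  set s11 : ℂ := z * (2 * (nabla g E p ![1, 1] ![0, 1] x - nabla g E p ![1, 1] ![1, 0] x))
      + (nabla g E f ![1, 1] ![0, 1] x - nabla g E f ![1, 1] ![1, 0] x) with h11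
  have e0 : s00 * a 0 = 0 := by
    have k := key 0 0 0
    simp [eps_zero_zero] at k
    linear_combination k
  -- The Ricci identity for `α_C` is symmetrised over `A, B, C`. The curvature terms carry an `ε`
  -- and drop out, leaving `α_{(A} s_{BC)} = 0`, with `s` the anti-self-dual part of the curl of `z
  -- p + ½ f`.
  have e1 : s00 * a 1 + 2 * s01 * a 0 = 0 := by
    have k := key 0 0 1
    have k2 := key 0 1 0
    have k3 := key 1 0 0
    simp [eps_zero_zero, eps_zero_one, eps_one_zero, eps_one_one] at k k2 k3
    linear_combination k + k2 + k3
  have e2 : 2 * s01 * a 1 + s11 * a 0 = 0 := by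
    have k := key 0 1 1
    have k2 := key 1 0 1
    have k3 := key 1 1 0
    simp [eps_zero_zero, eps_zero_one, eps_one_zero, eps_one_one] at k k2 k3
    linear_combination k + k2 + k3
  have e3 : s11 * a 1 = 0 := by
    have k := key 1 1 1
    simp [eps_one_one] at k
    linear_combination k
  obtain ⟨r0, r1, r2⟩ := eq_zero_of_symm_mul h0 e0 e1 e2 e3
  revert A B
  simp only [Fin.forall_fin_two]
  refine ⟨⟨?_, ?_⟩, ?_, ?_⟩
  · linear_combination r0
  · linear_combination r1
  · linear_combination r1
  · linear_combination r2

/-- The integrability conditions of `o` and `ι` contain `P` with opposite signs and `f` with the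
same sign; their difference and sum separate the two. -/
theorem IsPrincipalPair.closed (h : IsPrincipalPair g E U J o ι 1)
    (hq : IsQuaternionicKahler g E U lam) (hE : IsOrthonormalFrame g E U) (hU : IsOpen U)
    (hx : x ∈ U) (A B : Fin 2) :
    (nabla g E (pSpinor g E J o ι) ![A, B] ![0, 1] x
      - nabla g E (pSpinor g E J o ι) ![A, B] ![1, 0] x)
    + (nabla g E (pSpinor g E J o ι) ![B, A] ![0, 1] x
      - nabla g E (pSpinor g E J o ι) ![B, A] ![1, 0] x) = 0 ∧
    (nabla g E (leeSpinor g E J) ![A, B] ![0, 1] x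
      - nabla g E (leeSpinor g E J) ![A, B] ![1, 0] x)
    + (nabla g E (leeSpinor g E J) ![B, A] ![0, 1] x
      - nabla g E (leeSpinor g E J) ![B, A] ![1, 0] x) = 0 := by
  have hn := h.normalised x hx
  have ho : o 0 x ≠ 0 ∨ o 1 x ≠ 0 := by
    by_contra hc
    push Not at hc
    simp [hc.1, hc.2] at hn
  have hi : ι 0 x ≠ 0 ∨ ι 1 x ≠ 0 := by
    by_contra hc
    push Not at hc
    simp [hc.1, hc.2] at hn
  have k1 := asd_closure (z := -1) hq hE hU hx h.smooth_left (h.smooth_pSpinor hE hU)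
    (h.smooth_leeSpinor hE hU) ho (fun y hy A B X => by
      rw [(h.nabla_spinors hE hU hy A B X).1]; ring) A B
  have k2 := asd_closure (z := 1) hq hE hU hx h.smooth_right (h.smooth_pSpinor hE hU)
    (h.smooth_leeSpinor hE hU) hi (fun y hy A B X => by
      rw [(h.nabla_spinors hE hU hy A B X).2]; ring) A B
  constructor
  · linear_combination (1 / 2) * (k2 - k1)
  · linear_combination k1 + k2

end Closure

/-! ### The fields `S^i` as weighted spinors -/

section WeightedSpinors

variable {M : Type*} [TopologicalSpace M] [ChartedSpace R4 M] [IsManifold (𝓡 4) ∞ M]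
  {U : Set M} {x : M} {g : Metric M} {E : Frame M} {J : EndField M} {o ι α : Fin 2 → M → ℂ}
  {p f : SpinorField M 1 1} {z k : ℂ} {n : ℕ}

/-- A spinor field with `n` indices and `∇_{AX} φ_{B …} = (k p_{AX} - ½ n f_{AX}) φ_{B …} +
f_{BX} φ_{A …} + …`. -/
structure HasWeight (g : Metric M) (E : Frame M) (U : Set M) (p f : SpinorField M 1 1)
    (φ : SpinorField M n 0) (k : ℂ) : Prop where
  smooth : SmoothSpinor φ U
  nabla_eq : ∀ x ∈ U, ∀ A I X, nabla g E φ (Matrix.vecCons A I) ![X] x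
    = (k * p ![A] ![X] x - (n / 2 : ℂ) * f ![A] ![X] x) * φ I ![] x
      + act (fun C D => f ![C] ![X] x * if D = A then 1 else 0) (fun K => φ K ![] x) I

/-- By the Leibniz rule the weights add, and each further index contributes `-½ f`, which is why the
coefficient of `f` is tied to the number of indices. -/
theorem HasWeight.tensMul {φ : SpinorField M n 0} (hα : HasWeight g E U p f (ofPair α) k)
    (hφ : HasWeight g E U p f φ z) (hU : IsOpen U) :
    HasWeight g E U p f (tensMul α φ) (k + z) where
  smooth := smooth_tensMul (α := α) (fun A => hα.smooth ![A] ![]) hφ.smooth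
  nabla_eq x hx A I X := by
    obtain ⟨B, I, rfl⟩ : ∃ i J, I = (Matrix.vecCons i J : Fin (n + 1) → Fin 2) :=
      ⟨I 0, Fin.tail I, (Fin.cons_self_tail I).symm⟩
    rw [nabla_tensMul hU hx (α := α) (fun A => hα.smooth ![A] ![]) hφ.smooth, hα.nabla_eq x hx A ![B] X,
      hφ.nabla_eq x hx A I X, act_one, act_vecCons]
    have e : ∀ B (K : Fin n → Fin 2), QK.tensMul α φ (Matrix.vecCons B K) ![] x
      = α B x * φ K ![] x := fun _ _ => rfl
    have e' : ∀ B, ofPair α ![B] ![] x = α B x := fun _ => rfl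
    simp only [e, e', act_mul_left, Fin.sum_univ_two]
    push_cast
    ring

theorem HasWeight.perm {φ : SpinorField M n 0} (hφ : HasWeight g E U p f φ z)
    (q : Equiv.Perm (Fin n)) : HasWeight g E U p f (fun I X => φ (I ∘ q) X) z where
  smooth I X := hφ.smooth _ X
  nabla_eq x hx A I X := by
    have h := nabla_perm (g := g) (E := E) (x := x) φ q 1 A X I ![]
    simp only [Equiv.Perm.coe_one, Function.comp_id] at h
    rw [h, hφ.nabla_eq x hx, ← act_perm _ (fun J => φ J ![] x) I q]

theorem HasWeight.sum {τ : Type*} {s : Finset τ} {φ : τ → SpinorField M n 0}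
    (hφ : ∀ t, HasWeight g E U p f (φ t) z) (hU : IsOpen U) :
    HasWeight g E U p f (fun I X x => ∑ t ∈ s, φ t I X x) z where
  smooth I X := SmoothFn.sum fun t => (hφ t).smooth I X
  nabla_eq x hx A I X := by
    rw [nabla_sum s hU hx fun t => (hφ t).smooth, act_sum, Finset.mul_sum,
      ← Finset.sum_add_distrib]
    exact Finset.sum_congr rfl fun t _ => (hφ t).nabla_eq x hx A I X

theorem HasWeight.const_mul {φ : SpinorField M n 0} (hφ : HasWeight g E U p f φ z) (hU : IsOpen U)
    (c : ℂ) : HasWeight g E U p f (fun I X x => c * φ I X x) z where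
  smooth I X := (SmoothFn.const c).mul (hφ.smooth I X)
  nabla_eq x hx A I X := by
    rw [nabla_const_mul hU hx hφ.smooth, hφ.nabla_eq x hx, act_mul_left]
    ring

theorem HasWeight.prod (hU : IsOpen U) {β : Fin n → Fin 2 → M → ℂ} {k : Fin n → ℂ}
    (hβ : ∀ j, HasWeight g E U p f (ofPair (β j)) (k j)) :
    HasWeight g E U p f (fun I _ x => ∏ j, β j (I j) x) (∑ j, k j) := by
  induction n with
  | zero =>
    refine ⟨fun I X => ?_, fun x hx A I X => ?_⟩
    · simp only [Finset.univ_eq_empty, Finset.prod_empty]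
      exact SmoothFn.const 1
    · simp only [Finset.univ_eq_empty, Finset.prod_empty, Finset.sum_empty]
      rw [nabla_cons]
      simp only [covS_eq, act_nil, D_const]
      simp
  | succ n ih =>
    have h := (hβ 0).tensMul (ih fun j => hβ j.succ) hU
    rw [Fin.sum_univ_succ]
    have e : (fun I _ x => ∏ j, β j (I j) x : SpinorField M (n + 1) 0)
        = QK.tensMul (β 0) (fun I _ x => ∏ j : Fin n, β j.succ (I j) x) := by
      funext I X x
      rw [Fin.prod_univ_succ]
      rfl
    rw [e]
    exact h

/-- The spinor field `S^i_{ABCD}`. -/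
noncomputable def fieldS (o ι : Fin 2 → M → ℂ) (i : Fin 5) : SpinorField M 4 0 :=
  fun I _ x => spinS o ι i I x

theorem IsPrincipalPair.hasWeight_fieldS (h : IsPrincipalPair g E U J o ι 1)
    (hE : IsOrthonormalFrame g E U) (hU : IsOpen U) (i : Fin 5) :
    HasWeight g E U (pSpinor g E J o ι) (leeSpinor g E J) (fieldS o ι i) (2 * (i : ℕ) - 4) := by
  have h1 : ∀ {α : Fin 2 → M → ℂ} {z : ℂ}, (∀ A, SmoothFn (α A) U) → (∀ y ∈ U, ∀ A B X,
      nabla g E (ofPair α) ![A, B] ![X] y = z * pSpinor g E J o ι ![A] ![X] y * α B y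
        - (1 / 2) * leeSpinor g E J ![A] ![X] y * α B y + leeSpinor g E J ![B] ![X] y * α A y) →
      HasWeight g E U (pSpinor g E J o ι) (leeSpinor g E J) (ofPair α) z := by
    intro α z hs hn
    refine ⟨smooth_ofPair hs, fun y hy A I X => ?_⟩
    have hI : I = ![I 0] := by funext j; fin_cases j; rfl
    have e' : ∀ B, ofPair α ![B] ![] y = α B y := fun _ => rfl
    rw [hI, hn y hy, act_one]
    simp only [e', mul_ite, ite_mul, mul_one, mul_zero, zero_mul, Finset.sum_ite_eq',
      Finset.mem_univ, if_true]
    push_cast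
    ring
  have ho := h1 (z := -1) h.smooth_left fun y hy A B X => by
    rw [(h.nabla_spinors hE hU hy A B X).1]; ring
  have hi := h1 (z := 1) h.smooth_right fun y hy A B X => by
    rw [(h.nabla_spinors hE hU hy A B X).2]; ring
  have hp := HasWeight.prod hU (β := fun j : Fin 4 => if (j : ℕ) < 4 - (i : ℕ) then o else ι)
    (k := fun j : Fin 4 => if (j : ℕ) < 4 - (i : ℕ) then -1 else 1) (g := g) (E := E)
    (p := pSpinor g E J o ι) (f := leeSpinor g E J) (fun j => by
      split_ifs
      · exact ho
      · exact hi)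
  -- The `4 - i` factors `o` have weight `-1` and the `i` factors `ι` weight `+1`; the total `2i -
  -- 4` is the weight `p` in the theorem.
  have hk : (∑ j : Fin 4, (if (j : ℕ) < 4 - (i : ℕ) then (-1 : ℂ) else 1)) = 2 * (i : ℕ) - 4 := by
    fin_cases i <;> simp [Fin.sum_univ_four] <;> norm_num
  rw [hk] at hp
  have hS := (HasWeight.sum (s := Finset.univ) (fun q => hp.perm q) hU).const_mul hU
    ((Nat.factorial 4 : ℂ)⁻¹)
  have e : fieldS o ι i = fun I X x => ((Nat.factorial 4 : ℂ)⁻¹) *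
      ∑ q : Equiv.Perm (Fin 4), ∏ j : Fin 4, (if (j : ℕ) < 4 - (i : ℕ) then o else ι) ((I ∘ q) j) x := by
    funext I X x
    simp only [fieldS, spinS, symm, apply_ite (fun (γ : Fin 2 → M → ℂ) => γ _ x)]
    congr 1
    refine Finset.sum_congr rfl fun q _ => Finset.prod_congr rfl fun j _ => ?_
    split_ifs <;> rfl
  rw [e]
  exact hS

theorem fieldS_perm (i : Fin 5) (q : Equiv.Perm (Fin 4)) (I : Fin 4 → Fin 2) (X : Fin 0 → Fin 2)
    (x : M) : fieldS o ι i (I ∘ q) X x = fieldS o ι i I X x := by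
  simp only [fieldS, spinS]
  exact symm_comp_right (fun K => ∏ k : Fin 4, if (k : ℕ) < 4 - (i : ℕ) then o (K k) x
    else ι (K k) x) q I

end WeightedSpinors

/-! ### The potential equation as the Teukolsky equation -/

section WeightedPotential

variable {M : Type*} [TopologicalSpace M] [ChartedSpace R4 M] [IsManifold (𝓡 4) ∞ M]
  {U : Set M} {x : M} {g : Metric M} {E : Frame M} {J : EndField M} {o ι : Fin 2 → M → ℂ}
  {lam : ℝ} {p f v : SpinorField M 1 1} {k : ℂ} {n : ℕ}

/-- The product `v_{AA'} ψ_{B …}` with a covector `v`. -/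
def covecMul (v : SpinorField M 1 1) (ψ : SpinorField M n 0) : SpinorField M (n + 1) 1 :=
  fun I X x => v ![I 0] X x * ψ (Fin.tail I) ![] x

theorem smooth_covecMul (hv : SmoothSpinor v U) {ψ : SpinorField M n 0} (hψ : SmoothSpinor ψ U) :
    SmoothSpinor (covecMul v ψ) U := fun _ _ => (hv _ _).mul (hψ _ _)

theorem covS_covecMul (hU : IsOpen U) (hx : x ∈ U) (hv : SmoothSpinor v U)
    {ψ : SpinorField M n 0} (hψ : SmoothSpinor ψ U) (a : Fin 4) (A X : Fin 2)
    (I : Fin n → Fin 2) : covS g E a (covecMul v ψ) (Matrix.vecCons A I) ![X] x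
      = covS g E a v ![A] ![X] x * ψ I ![] x + v ![A] ![X] x * covS g E a ψ I ![] x := by
  have hD : D E a (covecMul v ψ (Matrix.vecCons A I) ![X]) x
      = v ![A] ![X] x * D E a (ψ I ![]) x + D E a (v ![A] ![X]) x * ψ I ![] x :=
    D_mul hU hx a (hv _ _) (hψ _ _)
  rw [covS_eq, covS_eq, covS_eq, hD, act_vecCons, act_one, act_one, act_one, act_nil]
  have e : ∀ B (K : Fin n → Fin 2) Y,
    covecMul v ψ (Matrix.vecCons B K) ![Y] x = v ![B] ![Y] x * ψ K ![] x := fun _ _ _ => rfl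
  simp only [e, act_mul_left, Fin.sum_univ_two]
  ring

theorem nabla_covecMul (hU : IsOpen U) (hx : x ∈ U) (hv : SmoothSpinor v U)
    {ψ : SpinorField M n 0} (hψ : SmoothSpinor ψ U) (P A V X : Fin 2) (I : Fin n → Fin 2) :
    nabla g E (covecMul v ψ) (Matrix.vecCons P (Matrix.vecCons A I)) ![V, X] x
      = nabla g E v ![P, A] ![V, X] x * ψ I ![] x
        + v ![A] ![X] x * nabla g E ψ (Matrix.vecCons P I) ![V] x := by
  have h1 := nabla_cons g E (covecMul v ψ) P V (Matrix.vecCons A I) ![X] x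
  have h2 := nabla_cons g E v P V ![A] ![X] x
  have h3 := nabla_cons g E ψ P V I ![] x
  rw [h1, h2, h3]
  simp only [covS_covecMul hU hx hv hψ, Fin.sum_univ_four]
  ring

theorem exists_weight_of_symmetric {S : (Fin 4 → Fin 2) → ℂ}
    (h : ∀ I (q : Equiv.Perm (Fin 4)), S (I ∘ q) = S I) :
    ∃ s : ℕ → ℂ, ∀ A B C D : Fin 2, S ![A, B, C, D] = s (A + B + C + D) := by
  have h1 : ∀ A B C D, S ![B, A, C, D] = S ![A, B, C, D] := fun A B C D => by
    rw [← h ![A, B, C, D] (Equiv.swap 0 1)]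
    congr 1; funext j; fin_cases j <;> rfl
  have h2 : ∀ A B C D, S ![A, C, B, D] = S ![A, B, C, D] := fun A B C D => by
    rw [← h ![A, B, C, D] (Equiv.swap 1 2)]
    congr 1; funext j; fin_cases j <;> rfl
  have h3 : ∀ A B C D, S ![A, B, D, C] = S ![A, B, C, D] := fun A B C D => by
    rw [← h ![A, B, C, D] (Equiv.swap 2 3)]
    congr 1; funext j; fin_cases j <;> rfl
  -- A symmetric spinor is determined by the number of its indices equal to `1`; the witness uses
  -- the sorted index list with the ones last.
  refine ⟨fun k => S ![if 3 < k then 1 else 0, if 2 < k then 1 else 0, if 1 < k then 1 else 0,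
    if 0 < k then 1 else 0], fun A B C D => ?_⟩
  fin_cases A <;> fin_cases B <;> fin_cases C <;> fin_cases D <;> simp <;> grind

/-- Split the weighted derivative of `v = 𝒞Φ`, contracted over primed indices, into a part symmetric
in the unprimed indices and an `ε` part. The former is the anti-self-dual part of a curl, zero by
`hs`; the latter is the Teukolsky operator, zero by `hb`. The terms in `f` from differentiating `S`
are exactly those completing these two. -/
theorem weighted_potential_algebra {s : ℕ → ℂ} {N : Fin 2 → Fin 2 → Fin 2 → Fin 2 → ℂ}
    {v θ f : Fin 2 → Fin 2 → ℂ}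
    (hs : ∀ A B, (N A B 0 1 - N A B 1 0) + (N B A 0 1 - N B A 1 0)
      = θ B 1 * v A 0 - θ B 0 * v A 1 + (θ A 1 * v B 0 - θ A 0 * v B 1))
    (hb : ∑ A, ∑ B, ∑ X, ∑ Y, eps A B * eps X Y *
      (N A B X Y + θ A X * v B Y + 2 * f A X * v B Y) = 0) (A B C D : Fin 2)
    {F : Fin 2 → Fin 2 → Fin 2 → Fin 2 → ℂ}
    (hF : ∀ P B C D : Fin 2, F P B C D = ∑ X, ∑ Y, eps X Y * ∑ G, ∑ H, eps G H *
      (N P H Y X * s (G + B + C + D) + v H X * ((θ P Y - 3 * f P Y) * s (G + B + C + D)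
        + f G Y * s (P + B + C + D) + f B Y * s (G + P + C + D) + f C Y * s (G + B + P + D)
        + f D Y * s (G + B + C + P)))) :
    F A B C D + F B A C D + F C B A D + F D B C A = 0 := by
  simp only [hF]
  have h0 := hs 0 0
  have h1 := hs 0 1
  have h2 := hs 1 1
  simp only [Fin.sum_univ_two, eps_zero_zero, eps_zero_one, eps_one_zero, eps_one_one] at hb ⊢
  fin_cases A <;> fin_cases B <;> fin_cases C <;> fin_cases D <;> 
   simp only [Fin.zero_eta, Fin.mk_one, Fin.val_zero, Fin.val_one, Nat.add_zero, Nat.zero_add, Nat.reduceAdd, Fin.isValue] 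
  -- If `j` of the four indices equal `1`, the trace enters with `s j` and the two brackets of curl
  -- components with `(4 - j)/2` and `j/2`, since each index serves once as the derivative index.
  · linear_combination (-2 * s 0) * hb - 2 * (s 0 * h1 - s 1 * h0)
  · linear_combination (-2 * s 1) * hb - (3 / 2) * (s 1 * h1 - s 2 * h0)
      - (1 / 2) * (s 0 * h2 - s 1 * h1)
  · linear_combination (-2 * s 1) * hb - (3 / 2) * (s 1 * h1 - s 2 * h0)
      - (1 / 2) * (s 0 * h2 - s 1 * h1)
  · linear_combination (-2 * s 2) * hb - (s 2 * h1 - s 3 * h0) - (s 1 * h2 - s 2 * h1)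
  · linear_combination (-2 * s 1) * hb - (3 / 2) * (s 1 * h1 - s 2 * h0)
      - (1 / 2) * (s 0 * h2 - s 1 * h1)
  · linear_combination (-2 * s 2) * hb - (s 2 * h1 - s 3 * h0) - (s 1 * h2 - s 2 * h1)
  · linear_combination (-2 * s 2) * hb - (s 2 * h1 - s 3 * h0) - (s 1 * h2 - s 2 * h1)
  · linear_combination (-2 * s 3) * hb - (1 / 2) * (s 3 * h1 - s 4 * h0)
      - (3 / 2) * (s 2 * h2 - s 3 * h1)
  · linear_combination (-2 * s 1) * hb - (3 / 2) * (s 1 * h1 - s 2 * h0)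
      - (1 / 2) * (s 0 * h2 - s 1 * h1)
  · linear_combination (-2 * s 2) * hb - (s 2 * h1 - s 3 * h0) - (s 1 * h2 - s 2 * h1)
  · linear_combination (-2 * s 2) * hb - (s 2 * h1 - s 3 * h0) - (s 1 * h2 - s 2 * h1)
  · linear_combination (-2 * s 3) * hb - (1 / 2) * (s 3 * h1 - s 4 * h0)
      - (3 / 2) * (s 2 * h2 - s 3 * h1)
  · linear_combination (-2 * s 2) * hb - (s 2 * h1 - s 3 * h0) - (s 1 * h2 - s 2 * h1)
  · linear_combination (-2 * s 3) * hb - (1 / 2) * (s 3 * h1 - s 4 * h0)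
      - (3 / 2) * (s 2 * h2 - s 3 * h1)
  · linear_combination (-2 * s 3) * hb - (1 / 2) * (s 3 * h1 - s 4 * h0)
      - (3 / 2) * (s 2 * h2 - s 3 * h1)
  · linear_combination (-2 * s 4) * hb - 2 * (s 3 * h2 - s 4 * h1)


/-- The covector `𝒞_{AA'} Φ` of a scalar of weights `(1, k)`. -/
noncomputable def weightedSpinor (g : Metric M) (E : Frame M) (J : EndField M)
    (o ι : Fin 2 → M → ℂ) (k : ℂ) (Φ : M → ℂ) : SpinorField M 1 1 :=
  spinorOf (weightedD g E J o ι 1 k Φ)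

variable {Φ : M → ℂ}

theorem IsPrincipalPair.smooth_weightedD (h : IsPrincipalPair g E U J o ι 1)
    (hE : IsOrthonormalFrame g E U) (hU : IsOpen U) (hΦ : SmoothFn Φ U) (I : Fin 1 → Fin 4) :
    SmoothFn (weightedD g E J o ι 1 k Φ I) U := by
  have h1 := h.smooth_leeForm hE hU
  have h2 := h.smooth_pForm hE hU
  have h3 := fun a => hE.smooth_D hU a hΦ
  unfold weightedD
  fun_prop

theorem weightedSpinor_eq (A X : Fin 2) : weightedSpinor g E J o ι k Φ ![A] ![X] x
    = nabla g E (fun (_ : Fin 0 → Fin 2) (_ : Fin 0 → Fin 2) => Φ) ![A] ![X] x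
      + (leeSpinor g E J ![A] ![X] x + k * pSpinor g E J o ι ![A] ![X] x) * Φ x := by
  simp only [weightedSpinor, leeSpinor, pSpinor, spinorOf, toSpinor_one, nabla_cons, covS_eq,
    act_nil, weightedD, Fin.sum_univ_four]
  simp
  ring

/-- Here `v = dΦ + θ Φ` with `θ = f + k P`. Second derivatives of `Φ` commute and `dθ` has no
anti-self-dual part, so only the product of `θ` with `dΦ` remains; replacing `dΦ` by `v` changes
nothing, as `θ ∧ θ = 0`. -/
theorem IsPrincipalPair.nabla_weightedSpinor_sub (h : IsPrincipalPair g E U J o ι 1)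
    (hq : IsQuaternionicKahler g E U lam)
    (hE : IsOrthonormalFrame g E U) (hU : IsOpen U) (hΦ : SmoothFn Φ U) (hx : x ∈ U)
    {v θ : SpinorField M 1 1} (hv : v = weightedSpinor g E J o ι k Φ)
    (hθ : θ = fun I X x => leeSpinor g E J I X x + k * pSpinor g E J o ι I X x) (A B : Fin 2) :
    (nabla g E v ![A, B] ![0, 1] x - nabla g E v ![A, B] ![1, 0] x)
        + (nabla g E v ![B, A] ![0, 1] x - nabla g E v ![B, A] ![1, 0] x)
      = θ ![B] ![1] x * v ![A] ![0] x - θ ![B] ![0] x * v ![A] ![1] x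
        + (θ ![A] ![1] x * v ![B] ![0] x - θ ![A] ![0] x * v ![B] ![1] x) := by
  subst hv hθ
  have sΦ : SmoothSpinor (fun (_ : Fin 0 → Fin 2) (_ : Fin 0 → Fin 2) => Φ) U := fun _ _ => hΦ
  have sf := h.smooth_leeSpinor hE hU
  have sp := h.smooth_pSpinor hE hU
  have sθ : SmoothSpinor (fun I X x => leeSpinor g E J I X x
      + k * pSpinor g E J o ι I X x : SpinorField M 1 1) U :=
    fun I X => (sf I X).add ((SmoothFn.const k).mul (sp I X))
  have hn : ∀ A B X Y, nabla g E (weightedSpinor g E J o ι k Φ) ![A, B] ![X, Y] x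
      = nabla g E (nabla g E (fun (_ : Fin 0 → Fin 2) (_ : Fin 0 → Fin 2) => Φ)) ![A, B] ![X, Y] x
        + ((nabla g E (leeSpinor g E J) ![A, B] ![X, Y] x
            + k * nabla g E (pSpinor g E J o ι) ![A, B] ![X, Y] x) * Φ x
          + (leeSpinor g E J ![B] ![Y] x + k * pSpinor g E J o ι ![B] ![Y] x)
            * nabla g E (fun (_ : Fin 0 → Fin 2) (_ : Fin 0 → Fin 2) => Φ) ![A] ![X] x) := by
    intro A B X Y
    have e : weightedSpinor g E J o ι k Φ = fun I X x =>
        nabla g E (fun (_ : Fin 0 → Fin 2) (_ : Fin 0 → Fin 2) => Φ) I X x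
        + covecMul (fun I X x => leeSpinor g E J I X x + k * pSpinor g E J o ι I X x)
          (fun (_ : Fin 0 → Fin 2) (_ : Fin 0 → Fin 2) => Φ) I X x := by
      funext I X x
      obtain ⟨B, rfl⟩ : ∃ B, I = ![B] := ⟨I 0, by funext j; fin_cases j; rfl⟩
      obtain ⟨Y, rfl⟩ : ∃ Y, X = ![Y] := ⟨X 0, by funext j; fin_cases j; rfl⟩
      exact weightedSpinor_eq _ _
    rw [e, nabla_add hU hx (sΦ.nabla hE hU) (smooth_covecMul sθ sΦ),
      nabla_covecMul hU hx sθ sΦ, nabla_add hU hx sf fun I X => (SmoothFn.const k).mul (sp I X),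
      nabla_const_mul hU hx sp]
  have hc := fun A B V Y => hE.nabla_comm hU hx sΦ A B V Y ![] ![]
  simp only [act_nil, neg_zero, sub_zero] at hc
  obtain ⟨h1, h2⟩ := h.closed hq hE hU hx A B
  rw [hn, hn, hn, hn, weightedSpinor_eq, weightedSpinor_eq, weightedSpinor_eq, weightedSpinor_eq]
  linear_combination hc A B 0 1 - hc A B 1 0 + Φ x * h2 + k * Φ x * h1

theorem IsPrincipalPair.teukolsky_eq (h : IsPrincipalPair g E U J o ι 1)
    (hE : IsOrthonormalFrame g E U) (hU : IsOpen U) (hΦ : SmoothFn Φ U) (hx : x ∈ U)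
    {v f p : SpinorField M 1 1} (hv : v = weightedSpinor g E J o ι k Φ)
    (hf : f = leeSpinor g E J) (hp : p = pSpinor g E J o ι) :
    teukolsky g E J o ι 1 k Φ x = ∑ A, ∑ B, ∑ X, ∑ Y, eps A B * eps X Y *
      (nabla g E v ![A, B] ![X, Y] x + (f ![A] ![X] x + k * p ![A] ![X] x) * v ![B] ![Y] x
        + 2 * f ![A] ![X] x * v ![B] ![Y] x) := by
  -- In the trace, the correction terms of `𝒞` on covectors contribute `-(2 - 4) f = 2 f`, raising
  -- the weight `1` of `f` to `3`.
  have h1 : teukolsky g E J o ι 1 k Φ x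
      = ∑ a, nablaT g E (weightedD g E J o ι 1 k Φ) ![a, a] x
        + ∑ a, (3 * leeForm g E J a x + k * pForm g E J o ι a x)
          * weightedD g E J o ι 1 k Φ ![a] x := by
    simp only [teukolsky, weightedDCov, Fin.sum_univ_four]
    simp
    ring
  have h2 := toSpinor_trace (fun K => nablaT g E (weightedD g E J o ι 1 k Φ) K x) ![] ![]
  have h3 : ∀ A B X Y, toSpinor (fun K => nablaT g E (weightedD g E J o ι 1 k Φ) K x)
      ![A, B] ![X, Y] = nabla g E v ![A, B] ![X, Y] x := fun A B X Y => by
    rw [hv]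
    exact (nabla_spinorOf hU hx (h.smooth_weightedD hE hU hΦ) _ _).symm
  have h4 : toSpinor (fun K => ∑ c, nablaT g E (weightedD g E J o ι 1 k Φ)
      (Matrix.vecCons c (Matrix.vecCons c K)) x) ![] ![]
      = ∑ a, nablaT g E (weightedD g E J o ι 1 k Φ) ![a, a] x := by
    simp [toSpinor]
    rfl
  rw [h1, ← h4, h2, sum_mul_eq]
  have h5 : ∀ A X, ∑ a, sigmaLow a A X * (3 * leeForm g E J a x + k * pForm g E J o ι a x)
      = 3 * f ![A] ![X] x + k * p ![A] ![X] x := fun A X => by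
    simp only [hf, hp, leeSpinor, pSpinor, spinorOf, toSpinor_one, Fin.sum_univ_four]
    simp
    ring
  have h6 : ∀ A X, ∑ a, sigmaLow a A X * weightedD g E J o ι 1 k Φ ![a] x = v ![A] ![X] x :=
    fun A X => by rw [hv, weightedSpinor, spinorOf, toSpinor_one]
  simp only [h3, h5, h6, ← Finset.sum_add_distrib, ← mul_add]
  refine Finset.sum_congr rfl fun A _ => Finset.sum_congr rfl fun B _ =>
    Finset.sum_congr rfl fun X _ => Finset.sum_congr rfl fun Y _ => ?_
  ring

end WeightedPotential

/-! ### The potential attached to a Teukolsky solution -/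

section PotentialOf

variable {M : Type*} [TopologicalSpace M] [ChartedSpace R4 M] [IsManifold (𝓡 4) ∞ M]
  {U : Set M} {x : M} {g : Metric M} {E : Frame M} {J : EndField M} {o ι : Fin 2 → M → ℂ}
  {lam : ℝ} {p f v : SpinorField M 1 1} {k : ℂ} {n : ℕ} {Φ : M → ℂ}

/-- The potential `Π_{A'BCD} = S^i_{BCD}{}^A 𝒞_{AA'} Φ`. -/
noncomputable def potentialOf (g : Metric M) (E : Frame M) (J : EndField M) (o ι : Fin 2 → M → ℂ)
    (i : Fin 5) (Φ : M → ℂ) : SpinorField M 3 1 :=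
  contr (covecMul (weightedSpinor g E J o ι (2 * (i : ℕ) - 4) Φ) (fieldS o ι i))

/-- The total symmetry of `S` is inherited by the three free unprimed indices, so the symmetrisation
is a sum of four terms; each is expanded by the Leibniz rule and the weight of `S`. -/
theorem IsPrincipalPair.isPotential_potentialOf (h : IsPrincipalPair g E U J o ι 1)
    (hq : IsQuaternionicKahler g E U lam) (hE : IsOrthonormalFrame g E U) (hU : IsOpen U)
    (hΦ : SmoothFn Φ U) (i : Fin 5)
    (ht : ∀ x ∈ U, teukolsky g E J o ι 1 (2 * (i : ℕ) - 4) Φ x = 0) :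
    IsPotential g E U (potentialOf g E J o ι i Φ) := by
  have hS := h.hasWeight_fieldS hE hU i
  have sv : SmoothSpinor (weightedSpinor g E J o ι (2 * (i : ℕ) - 4) Φ) U :=
    smoothSpinor_spinorOf (h.smooth_weightedD hE hU hΦ)
  have sT := smooth_covecMul sv hS.smooth
  have hsym : ∀ x, ∀ (q : Equiv.Perm (Fin 3)) I X,
      potentialOf g E J o ι i Φ (I ∘ q) X x = potentialOf g E J o ι i Φ I X x := by
    intro x q I X
    simp only [potentialOf, contr, covecMul]
    refine Finset.sum_congr rfl fun A _ => Finset.sum_congr rfl fun B _ => ?_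
    have e : Fin.tail (Matrix.vecCons B (Matrix.vecCons A (I ∘ q)))
        = Matrix.vecCons A I ∘ Equiv.Perm.decomposeFin.symm (0, q) := by
      funext j
      refine Fin.cases ?_ (fun j => ?_) j
      · simp [Fin.tail]
      · simp [Fin.tail]
    rw [e, fieldS_perm]
    rfl
  refine ⟨sT.contr, fun x _ => hsym x, fun x hx K => ?_⟩
  obtain ⟨s, hs⟩ := exists_weight_of_symmetric (S := fun K => fieldS o ι i K ![] x)
    fun K q => fieldS_perm i q K _ x
  rw [potentialEq, symm_of_symmetric_tail, vec_four K,
    sum_swap_vec (F := fun K => ∑ X, ∑ Y, eps X Y *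
      nabla g E (potentialOf g E J o ι i Φ) K ![Y, X] x)]
  · refine mul_eq_zero_of_right _ (weighted_potential_algebra (s := s)
      (N := fun A B X Y => nabla g E (weightedSpinor g E J o ι (2 * (i : ℕ) - 4) Φ)
        ![A, B] ![X, Y] x)
      (v := fun A X => weightedSpinor g E J o ι (2 * (i : ℕ) - 4) Φ ![A] ![X] x)
      (θ := fun A X => leeSpinor g E J ![A] ![X] x
        + (2 * (i : ℕ) - 4) * pSpinor g E J o ι ![A] ![X] x)
      (f := fun A X => leeSpinor g E J ![A] ![X] x)
      (h.nabla_weightedSpinor_sub hq hE hU hΦ hx rfl rfl)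
      ((h.teukolsky_eq hE hU hΦ hx rfl rfl rfl).symm.trans (ht x hx)) _ _ _ _
      (F := fun P B C D => ∑ X, ∑ Y, eps X Y *
        nabla g E (potentialOf g E J o ι i Φ) ![P, B, C, D] ![Y, X] x) ?_)
    intro P B C D
    refine Finset.sum_congr rfl fun X _ => Finset.sum_congr rfl fun Y _ => ?_
    congr 1
    refine (nabla_contr hU hx sT P Y ![B, C, D] ![X]).trans ?_
    refine Finset.sum_congr rfl fun G _ => Finset.sum_congr rfl fun H _ => ?_
    congr 1
    rw [nabla_covecMul hU hx sv hS.smooth, hS.nabla_eq x hx]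
    simp only [act_vecCons, act_nil, hs, mul_ite, ite_mul, mul_one, mul_zero, zero_mul,
      Finset.sum_ite_eq', Finset.mem_univ, if_true]
    push_cast
    ring
  · intro a I q
    refine Finset.sum_congr rfl fun X _ => Finset.sum_congr rfl fun Y _ => ?_
    rw [nabla_perm_of_invariant hU hx q fun y _ => hsym y q]

end PotentialOf

/-! ### The inner divergence: from `S Φ` to the potential -/

section MetricPerturbation

variable {M : Type*} [TopologicalSpace M] [ChartedSpace R4 M] [IsManifold (𝓡 4) ∞ M]
  {U : Set M} {x : M} {g : Metric M} {E : Frame M} {J : EndField M} {o ι : Fin 2 → M → ℂ}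
  {lam : ℝ} {k : ℂ} {n : ℕ} {Φ : M → ℂ}

theorem toSpinor_sum_sigma (G : (Fin n → Fin 2) → (Fin n → Fin 2) → ℂ) (I X : Fin n → Fin 2) :
    toSpinor (fun J => ∑ A : Fin n → Fin 2, ∑ Y : Fin n → Fin 2,
      G A Y * ∏ j, sigma (J j) (A j) (Y j)) I X = G I X := by
  simp only [toSpinor_sum, toSpinor_mul]
  have h : ∀ A Y : Fin n → Fin 2, toSpinor (fun J => ∏ j, sigma (J j) (A j) (Y j)) I X
      = if A = I then (if Y = X then 1 else 0) else 0 := by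
    intro A Y
    simp only [toSpinor, ← Finset.prod_mul_distrib]
    rw [← Fintype.piFinset_univ, ← Finset.prod_univ_sum (fun _ => Finset.univ)
      (fun j a => sigmaLow a (I j) (X j) * sigma a (A j) (Y j))]
    simp only [sum_sigmaLow_mul_sigma]
    by_cases hA : A = I
    · by_cases hY : Y = X
      · simp [hA, hY]
      · obtain ⟨j, hj⟩ := Function.ne_iff.mp hY
        rw [if_pos hA, if_neg hY]
        exact Finset.prod_eq_zero (Finset.mem_univ j) (by simp [Ne.symm hj])
    · obtain ⟨j, hj⟩ := Function.ne_iff.mp hA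
      rw [if_neg hA]
      exact Finset.prod_eq_zero (Finset.mem_univ j) (by simp [Ne.symm hj])
  simp only [h]
  simp

/-- The spinor field `S^i_{ABCD} Φ`. -/
noncomputable def scaledS (o ι : Fin 2 → M → ℂ) (i : Fin 5) (Φ : M → ℂ) : SpinorField M 4 0 :=
  fun I X x => Φ x * fieldS o ι i I X x

theorem spinorOf_tensorW (i : Fin 5) (I X : Fin 4 → Fin 2) :
    spinorOf (tensorW o ι i) I X x = spinS o ι i I x * eps (X 0) (X 1) * eps (X 2) (X 3) := by
  rw [spinorOf, ← toSpinor_sum_sigma (fun I X => spinS o ι i I x * eps (X 0) (X 1) * eps (X 2) (X 3))]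
  simp only [tensorW, Fin.prod_univ_four]

theorem spinorOf_symW (i : Fin 5) (I X : Fin 4 → Fin 2) :
    spinorOf (symW o ι i Φ) I X x = (1 / 2) * (epsMul (epsMul (scaledS o ι i Φ)) I X x
      + epsMul (epsMul (scaledS o ι i Φ)) I (X ∘ Equiv.swap 1 2) x) := by
  have e : ∀ K : Fin 4 → Fin 4, symW o ι i Φ K x
      = (1 / 2 * Φ x) * (tensorW o ι i K x + tensorW o ι i (K ∘ Equiv.swap 1 2) x) := by
    intro K
    have h1 : K = ![K 0, K 1, K 2, K 3] := by funext j; fin_cases j <;> rfl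
    have h2 : K ∘ Equiv.swap 1 2 = ![K 0, K 2, K 1, K 3] := by funext j; fin_cases j <;> rfl
    rw [h2, symW, ← h1]
    ring
  have h := spinorOf_tensorW (o := o) (ι := ι) (x := x) i
  have hS := fieldS_perm (o := o) (ι := ι) i (Equiv.swap 1 2) I ![] x
  simp only [fieldS] at hS
  simp only [spinorOf] at h ⊢
  simp only [e, toSpinor_mul, toSpinor_add]
  rw [toSpinor_comp_perm (fun K => tensorW o ι i K x), h, h, hS]
  simp only [epsMul, scaledS, fieldS, Fin.tail]
  simp
  ring

/-- The divergence of `S` contributes `-2 f` from its four indices and `-f` from the derivative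
index moved into the contracted slot. With the extra `4 f` this leaves weight `1`, so that precisely
`𝒞Φ` appears. The sign comes from the order of contraction. -/
theorem IsPrincipalPair.nabla_scaledS (h : IsPrincipalPair g E U J o ι 1)
    (hE : IsOrthonormalFrame g E U) (hU : IsOpen U) (hΦ : SmoothFn Φ U) (hx : x ∈ U) (i : Fin 5)
    (V : Fin 2) (I : Fin 3 → Fin 2) :
    ∑ A, ∑ B, eps A B * (nabla g E (scaledS o ι i Φ) (Matrix.vecCons A (Matrix.vecCons B I)) ![V] x
      + 4 * leeSpinor g E J ![A] ![V] x * scaledS o ι i Φ (Matrix.vecCons B I) ![] x)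
      = -potentialOf g E J o ι i Φ I ![V] x := by
  have hS := h.hasWeight_fieldS hE hU i
  have hn : ∀ A K, nabla g E (scaledS o ι i Φ) (Matrix.vecCons A K) ![V] x
      = nabla g E (fun (_ : Fin 0 → Fin 2) (_ : Fin 0 → Fin 2) => Φ) ![A] ![V] x
        * fieldS o ι i K ![] x + Φ x * nabla g E (fieldS o ι i) (Matrix.vecCons A K) ![V] x := by
    intro A K
    have h1 := nabla_cons g E (scaledS o ι i Φ) A V K ![] x
    have h2 := nabla_cons g E (fun (_ : Fin 0 → Fin 2) (_ : Fin 0 → Fin 2) => Φ) A V ![] ![] x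
    have h3 := nabla_cons g E (fieldS o ι i) A V K ![] x
    have h4 : ∀ a, covS g E a (scaledS o ι i Φ) K ![] x = _ :=
      fun a => covS_mul hU hx hΦ hS.smooth a K ![]
    rw [h1, h2, h3]
    simp only [h4, covS_eq, act_nil, Fin.sum_univ_four]
    ring
  obtain ⟨B, C, D, rfl⟩ : ∃ B C D, I = ![B, C, D] := ⟨_, _, _, vec_three I⟩
  obtain ⟨s, hs⟩ := exists_weight_of_symmetric (S := fun K => fieldS o ι i K ![] x)
    fun K q => fieldS_perm i q K _ x
  have hp : potentialOf g E J o ι i Φ ![B, C, D] ![V] x = ∑ A, ∑ G, eps A G *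
      (weightedSpinor g E J o ι (2 * (i : ℕ) - 4) Φ ![G] ![V] x
        * fieldS o ι i ![A, B, C, D] ![] x) := rfl
  have e : ∀ K, scaledS o ι i Φ K ![] x = Φ x * fieldS o ι i K ![] x := fun _ => rfl
  rw [hp]
  simp only [hn, hS.nabla_eq x hx, e, weightedSpinor_eq]
  simp only [act_vecCons, act_nil, hs, mul_ite, ite_mul, mul_one, mul_zero, zero_mul,
    Finset.sum_ite_eq', Finset.mem_univ, if_true]
  simp only [Fin.sum_univ_two, eps_zero_zero, eps_zero_one, eps_one_zero, eps_one_one,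
    Fin.val_zero, Fin.val_one]
  -- By symmetry of `S` the derivative index and the contracted one may be exchanged; hence the `f`
  -- terms in the three free slots cancel under the contraction with `ε`.
  have c1 : s (0 + 1 + (C : ℕ) + D) = s (1 + 0 + (C : ℕ) + D) := by congr 1
  have c2 : s (0 + (B : ℕ) + 1 + D) = s (1 + (B : ℕ) + 0 + D) := by congr 1; omega
  have c3 : s (0 + (B : ℕ) + C + 1) = s (1 + (B : ℕ) + C + 0) := by congr 1; omega
  rw [c1, c2, c3]
  push_cast
  ring

end MetricPerturbation

/-! ### Spinor components of the inner divergence -/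

section MetricPerturbation

variable {M : Type*} [TopologicalSpace M] [ChartedSpace R4 M] [IsManifold (𝓡 4) ∞ M]
  {U : Set M} {x : M} {g : Metric M} {E : Frame M} {J : EndField M} {o ι : Fin 2 → M → ℂ}
  {lam : ℝ} {Φ : M → ℂ}

theorem IsPrincipalPair.smooth_symW (h : IsPrincipalPair g E U J o ι 1) (hΦ : SmoothFn Φ U)
    (i : Fin 5) (I : Fin 4 → Fin 4) : SmoothFn (symW o ι i Φ I) U := by
  have h1 : ∀ K, SmoothFn (spinS o ι i K) U := by
    intro K
    unfold spinS symm
    refine (SmoothFn.const _).mul (SmoothFn.sum fun q => SmoothFn.prod fun j => ?_)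
    split_ifs
    · exact h.smooth_left _
    · exact h.smooth_right _
  unfold symW tensorW
  fun_prop

theorem IsPrincipalPair.smooth_divW (h : IsPrincipalPair g E U J o ι 1)
    (hE : IsOrthonormalFrame g E U) (hU : IsOpen U) (hΦ : SmoothFn Φ U)
    (i : Fin 5) (I : Fin 3 → Fin 4) : SmoothFn (divW g E J o ι i Φ I) U := by
  have h1 := h.smooth_symW hΦ i
  have h2 := smooth_nablaT (g := g) hE hU h1
  have h3 := h.smooth_leeForm hE hU
  unfold divW
  fun_prop

theorem IsPrincipalPair.smooth_metricPert (h : IsPrincipalPair g E U J o ι 1)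
    (hE : IsOrthonormalFrame g E U) (hU : IsOpen U) (hΦ : SmoothFn Φ U)
    (i : Fin 5) (a b : Fin 4) : SmoothFn (fun y => metricPert g E J o ι i Φ y a b) U := by
  have h1 := smooth_nablaT (g := g) hE hU (h.smooth_divW hE hU hΦ i)
  unfold metricPert
  fun_prop

theorem IsPrincipalPair.smooth_scaledS (h : IsPrincipalPair g E U J o ι 1)
    (hE : IsOrthonormalFrame g E U) (hU : IsOpen U) (hΦ : SmoothFn Φ U) (i : Fin 5) :
    SmoothSpinor (scaledS o ι i Φ) U :=
  fun I X => hΦ.mul ((h.hasWeight_fieldS hE hU i).smooth I X)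

theorem IsPrincipalPair.nabla_spinorOf_symW (h : IsPrincipalPair g E U J o ι 1)
    (hE : IsOrthonormalFrame g E U) (hU : IsOpen U) (hΦ : SmoothFn Φ U) (hx : x ∈ U) (i : Fin 5)
    (A V : Fin 2) (I X : Fin 4 → Fin 2) :
    nabla g E (spinorOf (symW o ι i Φ)) (Matrix.vecCons A I) (Matrix.vecCons V X) x
      = (1 / 2) * (eps (X 0) (X 1) * eps (X 2) (X 3) + eps (X 0) (X 2) * eps (X 1) (X 3))
        * nabla g E (scaledS o ι i Φ) (Matrix.vecCons A I) ![V] x := by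
  have s0 := h.smooth_scaledS hE hU hΦ i
  have s1 := smooth_epsMul s0
  have s2 := smooth_epsMul s1
  have e : spinorOf (symW o ι i Φ) = fun I X x => (1 / 2) *
      (epsMul (epsMul (scaledS o ι i Φ)) I X x
      + epsMul (epsMul (scaledS o ι i Φ)) I (X ∘ Equiv.swap 1 2) x) := by
    funext I X x
    exact spinorOf_symW i I X
  have hp := nabla_perm (g := g) (E := E) (x := x) (epsMul (epsMul (scaledS o ι i Φ))) 1
    (Equiv.swap 1 2) A V I X
  have hn : ∀ X : Fin 4 → Fin 2, nabla g E (epsMul (epsMul (scaledS o ι i Φ)))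
      (Matrix.vecCons A I) (Matrix.vecCons V X) x = eps (X 0) (X 1) * (eps (X 2) (X 3)
        * nabla g E (scaledS o ι i Φ) (Matrix.vecCons A I) ![V] x) := by
    intro X
    have hX : X = ![X 0, X 1, X 2, X 3] := vec_four X
    conv_lhs => rw [hX]
    rw [nabla_epsMul hU hx s1, nabla_epsMul hU hx s0]
  simp only [Equiv.Perm.coe_one, Function.comp_id] at hp
  rw [e, nabla_const_mul hU hx fun I X => (s2 I X).add (s2 I _),
    nabla_add hU hx s2 fun I X => s2 I _, hp, hn, hn]
  have c1 : (X ∘ Equiv.swap 1 2) 0 = X 0 := rfl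
  have c2 : (X ∘ Equiv.swap 1 2) 1 = X 2 := rfl
  have c3 : (X ∘ Equiv.swap 1 2) 2 = X 1 := rfl
  have c4 : (X ∘ Equiv.swap 1 2) 3 = X 3 := rfl
  rw [c1, c2, c3, c4]
  ring

/-- The primed factors `ε` are parallel, so the divergence acts on `S Φ` only. The symmetrisation of
`a, b` in `W` becomes a symmetrisation of the first two primed indices, because `S` is symmetric. -/
theorem IsPrincipalPair.spinorOf_divW (h : IsPrincipalPair g E U J o ι 1)
    (hE : IsOrthonormalFrame g E U) (hU : IsOpen U) (hΦ : SmoothFn Φ U) (hx : x ∈ U) (i : Fin 5)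
    (I X : Fin 3 → Fin 2) : spinorOf (divW g E J o ι i Φ) I X x
      = (1 / 2) * (epsMul (potentialOf g E J o ι i Φ) I (X ∘ finRotate 3) x
        + epsMul (potentialOf g E J o ι i Φ) I (X ∘ Equiv.swap 1 2) x) := by
  have e : ∀ K : Fin 3 → Fin 4, divW g E J o ι i Φ K x = ∑ c,
      (fun K : Fin 5 → Fin 4 => nablaT g E (symW o ι i Φ) K x + 4 *
        (leeForm g E J (K 0) x * symW o ι i Φ (Fin.tail K) x))
        (Matrix.vecCons c (Matrix.vecCons c K)) := by
    intro K
    obtain ⟨a, b, d, rfl⟩ : ∃ a b d, K = ![a, b, d] :=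
      ⟨K 0, K 1, K 2, by funext j; fin_cases j <;> rfl⟩
    simp only [divW]
    refine Finset.sum_congr rfl fun c _ => ?_
    have e1 : Fin.tail (Matrix.vecCons c (Matrix.vecCons c ![a, b, d])) = ![c, a, b, d] := rfl
    rw [e1, ← mul_assoc]
    rfl
  have hl : ∀ A V (I X : Fin 4 → Fin 2), toSpinor (fun K : Fin 5 → Fin 4 =>
      leeForm g E J (K 0) x * symW o ι i Φ (Fin.tail K) x) (Matrix.vecCons A I)
        (Matrix.vecCons V X) = leeSpinor g E J ![A] ![V] x * spinorOf (symW o ι i Φ) I X x := by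
    intro A V I X
    rw [toSpinor_vecCons, leeSpinor, spinorOf, toSpinor_one, Finset.sum_mul]
    refine Finset.sum_congr rfl fun a _ => ?_
    change sigmaLow a A V * toSpinor (fun K => leeForm g E J a x * symW o ι i Φ K x) I X
      = sigmaLow a A V * leeForm g E J a x * toSpinor (fun K => symW o ι i Φ K x) I X
    rw [toSpinor_mul, mul_assoc]
  have hn : ∀ A V (I X : Fin 4 → Fin 2), toSpinor (fun K => nablaT g E (symW o ι i Φ) K x)
      (Matrix.vecCons A I) (Matrix.vecCons V X) = _ := fun A V I X =>
    (nabla_spinorOf hU hx (h.smooth_symW hΦ i) _ _).symm.trans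
      (h.nabla_spinorOf_symW hE hU hΦ hx i A V I X)
  obtain ⟨Y, Z, W, rfl⟩ : ∃ B C D, X = ![B, C, D] := ⟨_, _, _, vec_three X⟩
  have hp := fun V => h.nabla_scaledS hE hU hΦ hx i V I
  have d1 : ∀ (K : Fin 4 → Fin 2) V, epsMul (epsMul (scaledS o ι i Φ)) K ![V, Y, Z, W] x
      = eps V Y * (eps Z W * scaledS o ι i Φ K ![] x) := fun _ _ => rfl
  have d2 : ∀ (K : Fin 4 → Fin 2) V, epsMul (epsMul (scaledS o ι i Φ)) K
      (![V, Y, Z, W] ∘ Equiv.swap 1 2) x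
      = eps V Z * (eps Y W * scaledS o ι i Φ K ![] x) := by
    intro K V
    have c1 : ![V, Y, Z, W] ∘ Equiv.swap (1 : Fin 4) 2 = ![V, Z, Y, W] := by
      funext j; fin_cases j <;> rfl
    rw [c1]
    rfl
  have d3 : epsMul (potentialOf g E J o ι i Φ) I (![Y, Z, W] ∘ finRotate 3) x
      = eps Z W * potentialOf g E J o ι i Φ I ![Y] x := by
    have c1 : ![Y, Z, W] ∘ finRotate 3 = ![Z, W, Y] := by
      funext j; fin_cases j <;> rfl
    rw [c1]
    rfl
  have d4 : epsMul (potentialOf g E J o ι i Φ) I (![Y, Z, W] ∘ Equiv.swap 1 2) x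
      = eps Y W * potentialOf g E J o ι i Φ I ![Z] x := by
    have c1 : ![Y, Z, W] ∘ Equiv.swap (1 : Fin 3) 2 = ![Y, W, Z] := by
      funext j; fin_cases j <;> rfl
    rw [c1]
    rfl
  refine (congrArg (fun T => toSpinor T I ![Y, Z, W]) (funext e)).trans ?_
  refine (toSpinor_trace (fun K : Fin 5 → Fin 4 => nablaT g E (symW o ι i Φ) K x + 4 *
    (leeForm g E J (K 0) x * symW o ι i Φ (Fin.tail K) x)) I ![Y, Z, W]).trans ?_
  simp only [toSpinor_add, toSpinor_mul, hl, hn, spinorOf_symW, d1, d2, d3, d4]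
  have p0 := hp 0
  have p1 := hp 1
  simp only [Matrix.cons_val_zero, Matrix.cons_val_one, Matrix.cons_val]
  clear hp d1 d2 d3 d4 hn hl e
  simp only [Fin.sum_univ_two, eps_zero_zero, eps_zero_one, eps_one_zero, eps_one_one]
    at p0 p1 ⊢
  revert Y Z
  simp only [Fin.forall_fin_two, eps_zero_zero, eps_zero_one, eps_one_zero, eps_one_one]
  refine ⟨⟨?_, ?_⟩, ?_, ?_⟩
  · linear_combination -eps 0 W * p0
  · linear_combination (-1 / 2) * (eps 1 W * p0 + eps 0 W * p1)
  · linear_combination (-1 / 2) * (eps 1 W * p0 + eps 0 W * p1)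
  · linear_combination -eps 1 W * p1

end MetricPerturbation

/-! ### The metric perturbation is the field `γ` of the potential -/

section MetricPerturbation

variable {M : Type*} [TopologicalSpace M] [ChartedSpace R4 M] [IsManifold (𝓡 4) ∞ M]
  {U : Set M} {x : M} {g : Metric M} {E : Frame M} {J : EndField M} {o ι : Fin 2 → M → ℂ}
  {lam : ℝ} {k : ℂ} {Φ : M → ℂ} {h : M → Matrix (Fin 4) (Fin 4) ℂ} {Pot : SpinorField M 3 1}

theorem nabla_epsMul_potential (hU : IsOpen U) (hx : x ∈ U) (hP : SmoothSpinor Pot U)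
    {T : TensorField M 3} (hT : ∀ y ∈ U, ∀ I X, spinorOf T I X y
      = (1 / 2) * (epsMul Pot I (X ∘ finRotate 3) y + epsMul Pot I (X ∘ Equiv.swap 1 2) y))
    (P A B C V Y Z W : Fin 2) : nabla g E (spinorOf T) ![P, A, B, C] ![V, Y, Z, W] x
      = (1 / 2) * (eps Z W * nabla g E Pot ![P, A, B, C] ![V, Y] x
        + eps Y W * nabla g E Pot ![P, A, B, C] ![V, Z] x) := by
  have s1 := smooth_epsMul hP
  rw [nabla_congr hU hx hT,
    nabla_const_mul hU hx fun I X => (s1 I _).add (s1 I _),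
    nabla_add hU hx (fun I X => s1 I _) fun I X => s1 I _]
  have h1 := nabla_perm (g := g) (E := E) (x := x) (epsMul Pot) 1 (finRotate 3) P V ![A, B, C]
    ![Y, Z, W]
  have h2 := nabla_perm (g := g) (E := E) (x := x) (epsMul Pot) 1 (Equiv.swap 1 2) P V ![A, B, C]
    ![Y, Z, W]
  simp only [Equiv.Perm.coe_one, Function.comp_id] at h1 h2
  have c1 : ![Y, Z, W] ∘ finRotate 3 = ![Z, W, Y] := by
    funext j; fin_cases j <;> rfl
  have c2 : ![Y, Z, W] ∘ Equiv.swap (1 : Fin 3) 2 = ![Y, W, Z] := by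
    funext j; fin_cases j <;> rfl
  rw [h1, h2, c1, c2, nabla_epsMul hU hx hP, nabla_epsMul hU hx hP]

/-- The outer divergence contracts the last primed index, carried by an `ε`, with the derivative.
What is left is the unprimed contraction of `∇Π`, symmetrised in its primed indices. -/
theorem IsPotential.spinorOf_neg_trace (hP : IsPotential g E U Pot) (hU : IsOpen U) (hx : x ∈ U)
    {T : TensorField M 3} (sT : ∀ K, SmoothFn (T K) U) (hT : ∀ y ∈ U, ∀ I X, spinorOf T I X y
      = (1 / 2) * (epsMul Pot I (X ∘ finRotate 3) y + epsMul Pot I (X ∘ Equiv.swap 1 2) y))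
    (hh : ∀ a b, h x a b = -∑ d, nablaT g E T ![d, a, b, d] x) (I X : Fin 2 → Fin 2) :
    spinorOf (tensorOf h) I X x = gammaOf g E Pot I X x := by
  obtain ⟨A, B, rfl⟩ : ∃ A B, I = ![A, B] := ⟨I 0, I 1, by funext j; fin_cases j <;> rfl⟩
  obtain ⟨Y, Z, rfl⟩ : ∃ A B, X = ![A, B] := ⟨X 0, X 1, by funext j; fin_cases j <;> rfl⟩
  -- The permutation brings the traced pair, the derivative index and the last index of `T`, to the
  -- first two slots.
  obtain ⟨q, hq⟩ : ∃ q : Equiv.Perm (Fin 4), ∀ (τ : Type) (a b c d : τ),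
      ![a, b, c, d] ∘ q = ![a, c, d, b] := by
    refine ⟨Equiv.swap 1 2 * Equiv.swap 2 3, fun τ a b c d => ?_⟩
    funext j; fin_cases j <;> rfl
  have e : ∀ K : Fin 2 → Fin 4, tensorOf h K x = (-1) * ∑ c,
      (fun K : Fin 4 → Fin 4 => nablaT g E T (K ∘ q) x)
        (Matrix.vecCons c (Matrix.vecCons c K)) := by
    intro K
    obtain ⟨a, b, rfl⟩ : ∃ a b, K = ![a, b] := ⟨K 0, K 1, by funext j; fin_cases j <;> rfl⟩
    simp only [hq, tensorOf, Matrix.cons_val_zero, Matrix.cons_val_one, hh]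
    ring
  have ht := toSpinor_trace (fun K : Fin 4 → Fin 4 => nablaT g E T (K ∘ q) x) ![A, B] ![Y, Z]
  refine (congrArg (fun T => toSpinor T ![A, B] ![Y, Z]) (funext e)).trans ?_
  refine (toSpinor_mul _ _ _ _).trans ?_
  rw [ht]
  have hn : ∀ (I X : Fin 4 → Fin 2), toSpinor (fun K => nablaT g E T K x) I X
      = nabla g E (spinorOf T) I X x := fun I X => (nabla_spinorOf hU hx sT I X).symm
  simp only [toSpinor_comp_perm (fun K => nablaT g E T K x), hq, hn,
    nabla_epsMul_potential hU hx hP.smooth hT]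
  have hs : ∀ P C X, nabla g E Pot ![P, A, B, C] X x = nabla g E Pot ![P, C, A, B] X x := by
    intro P C X
    have h2 := hP.nabla_perm hU hx (finRotate 3) P ![C, A, B] X
    have c1 : ![C, A, B] ∘ finRotate 3 = ![A, B, C] := by
      funext j; fin_cases j <;> rfl
    rw [c1] at h2
    exact h2
  clear ht hn e
  simp only [hs]
  simp only [gammaOf, Fin.sum_univ_two, eps_zero_zero, eps_zero_one, eps_one_zero, eps_one_one,
    Matrix.cons_val_zero, Matrix.cons_val_one]
  revert Y Z
  simp only [Fin.forall_fin_two, eps_zero_zero, eps_zero_one, eps_one_zero, eps_one_one]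
  refine ⟨⟨?_, ?_⟩, ?_, ?_⟩ <;> ring

theorem IsPotential.gammaOf_swap (hP : IsPotential g E U Pot) (hU : IsOpen U) (hx : x ∈ U)
    (A B V Y : Fin 2) : gammaOf g E Pot ![B, A] ![Y, V] x = gammaOf g E Pot ![A, B] ![V, Y] x := by
  have h1 : ∀ P C X, nabla g E Pot ![P, C, B, A] X x = nabla g E Pot ![P, C, A, B] X x := by
    intro P C X
    have h2 := hP.nabla_perm hU hx (Equiv.swap 1 2) P ![C, A, B] X
    have c1 : ![C, A, B] ∘ Equiv.swap (1 : Fin 3) 2 = ![C, B, A] := by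
      funext j; fin_cases j <;> rfl
    rw [c1] at h2
    exact h2
  simp only [gammaOf, Matrix.cons_val_zero, Matrix.cons_val_one, h1, Fin.sum_univ_two]
  ring

theorem IsPotential.isSymm_of_spinorOf (hP : IsPotential g E U Pot) (hU : IsOpen U) (hx : x ∈ U)
    (hγ : ∀ I X, spinorOf (tensorOf h) I X x = gammaOf g E Pot I X x) : (h x).IsSymm := by
  refine Matrix.IsSymm.ext fun a b => sub_eq_zero.mp ?_
  refine eq_zero_of_sum_sigmaLow (u := fun a => h x b a - h x a b) (fun A V => ?_) a
  refine eq_zero_of_sum_sigmaLow (u := fun b => ∑ a, sigmaLow a A V * (h x b a - h x a b))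
    (fun B Y => ?_) b
  have h1 := hP.gammaOf_swap hU hx A B V Y
  rw [← hγ, ← hγ, spinorOf, spinorOf, toSpinor_two, toSpinor_two] at h1
  simp only [tensorOf, Matrix.cons_val_zero, Matrix.cons_val_one] at h1
  rw [Finset.sum_comm (f := fun a b => sigmaLow a A V * sigmaLow b B Y * h x a b)] at h1
  rw [← sub_eq_zero, ← Finset.sum_sub_distrib] at h1
  rw [← h1]
  refine Finset.sum_congr rfl fun b _ => ?_
  rw [Finset.mul_sum, ← Finset.sum_sub_distrib]
  exact Finset.sum_congr rfl fun a _ => by ring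

/-- Part 2 assembled: the Teukolsky solution gives a potential, its `γ` has the spinor components of
`h`, and the deformation theorem for potentials applies with factor `1`. -/
theorem IsIntegrableComplexStructure.isQuaternionicDeformation
    (hJ : IsIntegrableComplexStructure g E U J o ι) (hq : IsQuaternionicKahler g E U lam)
    (hE : IsOrthonormalFrame g E U) (hU : IsOpen U) (hΦ : SmoothFn Φ U) (i : Fin 5)
    (ht : ∀ x ∈ U, teukolsky g E J o ι 1 (2 * (i : ℕ) - 4) Φ x = 0) :
    IsQuaternionicDeformation g E U lam (metricPert g E J o ι i Φ) := by
  have h := hJ.isPrincipalPair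
  have hP := h.isPotential_potentialOf hq hE hU hΦ i ht
  have hγ : ∀ y ∈ U, ∀ I X, spinorOf (tensorOf (metricPert g E J o ι i Φ)) I X y
      = gammaOf g E (potentialOf g E J o ι i Φ) I X y := fun y hy I X =>
    hP.spinorOf_neg_trace hU hy (h.smooth_divW hE hU hΦ i)
      (fun z hz => h.spinorOf_divW hE hU hΦ hz i) (fun _ _ => rfl) I X
  exact hP.isQuaternionicDeformation hq hE hU (h.smooth_metricPert hE hU hΦ i)
    (fun y hy => hP.isSymm_of_spinorOf hU hy (hγ y hy))
    (k := 1) fun y hy I X => by rw [hγ y hy, one_mul]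

end MetricPerturbation

end QK

theorem mainTheorem8 {M : Type*} [TopologicalSpace M] [ChartedSpace QK.R4 M]
    [IsManifold (𝓡 4) ∞ M] (g : QK.Metric M) (U : Set M) (hU : IsOpen U) (E : QK.Frame M)
    (hE : QK.IsOrthonormalFrame g E U) (lam : ℝ) (hqK : QK.IsQuaternionicKahler g E U lam) :
    (∀ Pot : QK.SpinorField M 3 1, QK.SmoothSpinor Pot U →
      (∀ x ∈ U, ∀ (p : Equiv.Perm (Fin 3)) I X, Pot (I ∘ p) X x = Pot I X x) →
      (∀ x ∈ U, ∀ I, QK.potentialEq g E Pot I x = 0) →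
      ∀ x ∈ U, ∀ I, QK.secondOrderOp g E (QK.gammaOf g E Pot) I x = 0) ∧
    (∀ (J : QK.EndField M) (o ι : Fin 2 → M → ℂ),
      QK.IsIntegrableComplexStructure g E U J o ι →
      ∀ (i : Fin 5) (Φ : M → ℂ), QK.SmoothFn Φ U →
      (∀ x ∈ U, QK.teukolsky g E J o ι 1 (2 * (i : ℕ) - 4) Φ x = 0) →
      QK.LinearisedASDWeylVanishes g E U (QK.metricPert g E J o ι i Φ) ∧
      QK.IsQuaternionicDeformation g E U lam (QK.metricPert g E J o ι i Φ)) := by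
  refine ⟨fun Pot hs hp he x hx I => ?_, fun J o ι hJ i Φ hΦ ht => ?_⟩
  · exact QK.IsPotential.secondOrderOp_gammaOf ⟨hs, hp, he⟩ hqK hE hU hx I
  · have h := hJ.isQuaternionicDeformation hqK hE hU hΦ i ht
    exact ⟨h.weyl, h⟩
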